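/- **Setting.** Let $\mathbb T^2=\mathbb R^2/\mathbb Z^2$, $K=2\pi\mathbb Z^2\setminus\{(0,0)\}$, $e_k(x)=e^{i\langle k,x\rangle}$, and let $V$ be the Hilbert space of complex mean-zero functions in $L^2(\mathbb T^2)$, with orthonormal basis $(e_k)_{k\in K}$. Let $H\in(0,1)$, $\nu>0$, and let $(\lambda_k)_{k\in K}\subset[0,\infty)$, $(\alpha_k)_{k\in K}\subset[c_0,\infty)$ for some $c_0>0$, with $\lambda_k=\lambda_{-k}$, $\alpha_k=\alpha_{-k}$ and $\alpha_k\to\infty$ as $|k|\to\infty$ (for example $\alpha_k=|k|^2$). Put $Ae_k=-\alpha_ke_k$, $Q^{1/2}e_k=\sqrt{\lambda_k}\,e_k$, and let $S(t)e_k=e^{-t\nu\alpha_k}e_k$ be the semigroup generated by $\nu A$. On a probability space $(\Omega,\mathcal F,\mathbb P)$ let $B^H(t)=\sum_{k\in K}\beta_k(t)e_k$, $t\in\mathbb R$, where $\sqrt2\,\mathrm{Re}\,\beta_k$ and $\sqrt2\,\mathrm{Im}\,\beta_k$ are independent real normalized two-sided fractional Brownian motions with Hurst parameter $H$, $\beta_{-k}=\overline{\beta_k}$,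 and the $\beta_k$ are otherwise independent. Consider $$d\psi_t=\nu A\psi_t\,dt+\nu^HQ^{1/2}\,dB^H_t .\tag{M3}$$ A jointly measurable $V$-valued process is a *mild solution* on $[0,T]$ if for every $t\in[0,T]$, a.s., $$\psi(t)=S(t)\psi(0)+\sum_{k\in K}\sqrt{\lambda_k}\,\nu^H\int_0^te^{-(t-s)\nu\alpha_k}\,d\beta_k(s)\,e_k ,$$ the series converging in $L^2(\Omega,V)$. A strictly stationary mild solution $(\psi(t))_{t\ge0}$ is one that is a mild solution on $[0,T]$ for every $T>0$ and whose finite-dimensional laws are invariant under time shifts $r\ge0$. It is *unique* if every strictly stationary mild solution adapted to the natural filtration of $(\beta_k)$ (up to null sets) has the same law, and *ergodic* if for every measurable $\rho:V\to\mathbb R$ with $\mathbb E|\rho(\psi(0))|<\infty$ one has $\frac1T\int_0^T\rho(\psi(t))\,dt\to\mathbb E\rho(\psi(0))$ a.s. as $T\to\infty$. **Proposition.** Suppose that $\sum_{k\in K}\lambda_k|k|^{2m+\varepsilon}<\infty$ for some integer $m\ge1$ and some $\varepsilon>0$. Then: 1. (M3) has a unique ergodic (strictly stationary, adapted) mild solution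 $\psi$; it is given, also for negative times, by $\psi(t)=\sum_{k\in K}\sqrt{\lambda_k}\,\nu^H\int_{-\infty}^te^{-(t-u)\nu\alpha_k}\,d\beta_k(u)\,e_k$, $t\in\mathbb R$. 2. $\psi$ has a real-valued version, again denoted by $\psi$, such that a.s. $\psi\in C(\mathbb R,C^m(\mathbb T^2))$ and $v=\nabla^\perp\psi=(\partial_{x_2}\psi,-\partial_{x_1}\psi)\in C(\mathbb R,C^{m-1}(\mathbb T^2,\mathbb R^2))$; moreover $v(x,t)\in L^2(\Omega)$ for all $x,t$. 3. For all $t,s\in\mathbb R$ and $x\in\mathbb T^2$, $\ \mathbb E|v(x,t)-v(x,s)|^2\le C|t-s|^{2H}$. 4. If the $\lambda_k$ are not all zero, then for every $T>0$, all $t,s\in[-T,T]$ and $x\in\mathbb T^2$, $\ c_T|t-s|^{2H}\le\mathbb E|v(x,t)-v(x,s)|^2$. Here $C>0$ depends only on $H,\nu,(\lambda_k),(\alpha_k)$, and $c_T>0$ only on these and on $T$; neither depends on $m$, $\varepsilon$, the probability space, the noise, $t$, $s$ or $x$. -/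

import Mathlib

open MeasureTheory ProbabilityTheory Filter Topology Set
open scoped ENNReal

noncomputable section

/-! ### The torus, the Hilbert space `V` and its Fourier basis -/

/-- The two-dimensional torus `ℝ² / ℤ²`. -/
abbrev Torus2 : Type := UnitAddTorus (Fin 2)

/-- The plane `ℝ²` with its Euclidean norm. -/
abbrev Plane : Type := EuclideanSpace ℝ (Fin 2)

/-- The Lebesgue (normalized Haar) measure on the torus. -/
def torusMeasure : Measure Torus2 :=
  Measure.pi fun _ : Fin 2 => (AddCircle.haarAddCircle : Measure UnitAddCircle)

instance : IsProbabilityMeasure torusMeasure := by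
  unfold torusMeasure; infer_instance

/-- The subspace of mean-zero functions of the complex space `L²(𝕋²)`. -/
def meanZeroL2 : Submodule ℂ (Lp ℂ 2 torusMeasure) where
  carrier := {f | ∫ x, f x ∂torusMeasure = 0}
  zero_mem' := by
    have h := Lp.coeFn_zero ℂ 2 torusMeasure
    simp only [Set.mem_ofPred_eq]
    rw [integral_congr_ae h]
    simp
  add_mem' := by
    intro f g hf hg
    simp only [Set.mem_ofPred_eq] at *
    rw [integral_congr_ae (Lp.coeFn_add f g)]
    simp only [Pi.add_apply]
    rw [integral_add ((Lp.memLp f).integrable (by norm_num))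
      ((Lp.memLp g).integrable (by norm_num)), hf, hg, add_zero]
  smul_mem' := by
    intro c f hf
    simp only [Set.mem_ofPred_eq] at *
    rw [integral_congr_ae (Lp.coeFn_smul c f)]
    simp only [Pi.smul_apply]
    rw [integral_smul, hf, smul_zero]

/-- The Hilbert space `V` of mean-zero complex `L²` functions on the torus. -/
abbrev VSpace : Type := meanZeroL2

instance : MeasurableSpace VSpace := borel VSpace

instance : BorelSpace VSpace := ⟨rfl⟩

/-- The index set of the Fourier modes: `n ∈ ℤ² \ {0}` stands for the wave vector `k = 2πn`. -/
abbrev Mode : Type := {n : Fin 2 → ℤ // n ≠ 0}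

instance : Neg Mode := ⟨fun n => ⟨-n.1, neg_ne_zero.mpr n.2⟩⟩

/-- The wave vector `k = 2πn ∈ 2πℤ² \ {0}`. -/
def waveVec (n : Mode) : Plane := WithLp.toLp 2 fun i => 2 * Real.pi * (n.1 i : ℝ)

/-- The basis function `e_k(x) = exp(i⟨k, x⟩)`, `k = 2πn`, on the torus. -/
def modeFun (n : Mode) : C(Torus2, ℂ) := UnitAddTorus.mFourier n.1

theorem integral_modeFun (n : Mode) : ∫ x, modeFun n x ∂torusMeasure = 0 := by
  obtain ⟨i, hi⟩ := Function.ne_iff.mp n.2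
  have h : ∀ x : Torus2, modeFun n x = ∏ j : Fin 2, fourier (n.1 j) (x j) := fun x => rfl
  simp_rw [h, torusMeasure]
  rw [integral_fintype_prod_eq_prod (fun j (y : UnitAddCircle) => (fourier (n.1 j) y : ℂ))]
  apply Finset.prod_eq_zero (Finset.mem_univ i)
  have h2 := orthonormal_iff_ite.mp (orthonormal_fourier (T := (1 : ℝ))) 0 (n.1 i)
  rw [if_neg (fun h => hi h.symm)] at h2
  simpa [ContinuousMap.inner_toLp] using! h2

/-- `e_k` as an element of `V`. -/
def basisV (n : Mode) : VSpace :=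
  ⟨ContinuousMap.toLp (E := ℂ) 2 torusMeasure ℂ (modeFun n), by
    change ∫ x, _ ∂torusMeasure = 0
    rw [integral_congr_ae (ContinuousMap.coeFn_toLp torusMeasure (modeFun n))]
    exact integral_modeFun n⟩

/-- The semigroup on `V` generated by `νA`, where `A e_k = -α_k e_k`:
`S(t) f = ∑ₖ exp(-t ν α_k) ⟨f, e_k⟩ e_k`. -/
def semigroupV (ν : ℝ) (α : Mode → ℝ) (t : ℝ) (f : VSpace) : VSpace :=
  ∑' k : Mode, ((Real.exp (-(t * (ν * α k))) : ℂ) * inner ℂ (basisV k) f) • basisV k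

/-! ### Differentiability on the torus -/

/-- The point of the torus represented by a point of the plane. -/
def toTorus (x : Plane) : Torus2 := fun i => ((x i : ℝ) : UnitAddCircle)

/-- The partial derivative `∂f/∂x_i` of a function on the torus. -/
def torusPartial (i : Fin 2) (f : Torus2 → ℝ) (x : Torus2) : ℝ :=
  deriv (fun h : ℝ => f (x + Pi.single i (h : UnitAddCircle))) 0

/-- `∇^⊥ f = (∂f/∂x₂, -∂f/∂x₁)`. -/
def perpGrad (f : Torus2 → ℝ) (x : Torus2) : Plane :=
  !₂[torusPartial 1 f x, -torusPartial 0 f x]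

/-- `u ∈ C(ℝ, C^m(𝕋²; F))`: every `u t` is an `m` times continuously differentiable function on
the torus, and `t ↦ u t` is continuous for the norm of `C^m`, that is, all derivatives of order at
most `m` depend continuously on `t`, uniformly in space. -/
def IsContinuousIntoCm {F : Type*} [NormedAddCommGroup F] [NormedSpace ℝ F] (m : ℕ)
    (u : ℝ → Torus2 → F) : Prop :=
  (∀ t, ContDiff ℝ m fun x : Plane => u t (toTorus x)) ∧
    ∀ t, ∀ j ≤ m, TendstoUniformly
      (fun s => iteratedFDeriv ℝ j fun x : Plane => u s (toTorus x))
      (iteratedFDeriv ℝ j fun x : Plane => u t (toTorus x)) (𝓝 t)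

/-! ### The noise -/

section Noise

variable {Ω : Type*} [MeasurableSpace Ω]

/-- A real normalized two-sided fractional Brownian motion with Hurst parameter `H`. -/
structure IsFractionalBM (P : Measure Ω) (H : ℝ) (b : ℝ → Ω → ℝ) : Prop where
  gaussian : IsGaussianProcess b P
  zero : ∀ᵐ ω ∂P, b 0 ω = 0
  mean : ∀ t, ∫ ω, b t ω ∂P = 0
  cov : ∀ t s, ∫ ω, b t ω * b s ω ∂P =
    (1 / 2) * (|t| ^ (2 * H) + |s| ^ (2 * H) - |t - s| ^ (2 * H))
  continuous : ∀ᵐ ω ∂P, Continuous fun t => b t ω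

/-- The complex fractional Brownian motions `β_k` driving the infinite-dimensional fractional
Brownian motion `∑ₖ β_k e_k`: `√2 Re β_k` and `√2 Im β_k` are independent real normalized
fractional Brownian motions, `β_{-k} = β_k^*`, and otherwise the `β_k` are independent, that is,
they are so along any set of indices that does not contain both `k` and `-k`. -/
structure IsFractionalNoise (P : Measure Ω) (H : ℝ) (β : Mode → ℝ → Ω → ℂ) : Prop where
  measurable : ∀ k t, Measurable (β k t)
  re : ∀ k, IsFractionalBM P H fun t ω => √2 * (β k t ω).re
  im : ∀ k, IsFractionalBM P H fun t ω => √2 * (β k t ω).im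
  indep_re_im : ∀ k, IndepFun (fun ω (t : ℝ) => (β k t ω).re) (fun ω (t : ℝ) => (β k t ω).im) P
  conj : ∀ k t, ∀ᵐ ω ∂P, β (-k) t ω = starRingEnd ℂ (β k t ω)
  indep : ∀ S : Set Mode, (∀ k ∈ S, -k ∉ S) →
    iIndepFun (fun (k : S) (ω : Ω) (t : ℝ) => β k t ω) P

/-- The natural filtration of the two-sided noise at time `t`. -/
@[reducible]
def noiseSigma (β : Mode → ℝ → Ω → ℂ) (t : ℝ) : MeasurableSpace Ω :=
  ⨆ (k : Mode) (u : Set.Iic t), MeasurableSpace.comap (β k u) inferInstance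

/-- `I = ∫_a^b f(u) dβ(u)` (for `a ≤ b`) as the limit in `L²(P)` of the Riemann–Stieltjes sums
`∑ᵢ f(ξᵢ) (β(xᵢ₊₁) - β(xᵢ))` as the mesh of the tagged partition tends to `0`. -/
def IsWienerIntegral (P : Measure Ω) (f : ℝ → ℝ) (β : ℝ → Ω → ℂ) (a b : ℝ) (I : Ω → ℂ) : Prop :=
  MemLp I 2 P ∧ ∀ ε > (0 : ℝ), ∃ δ > (0 : ℝ), ∀ (N : ℕ) (x ξ : ℕ → ℝ), x 0 = a → x N = b →
    (∀ i < N, x i ≤ ξ i ∧ ξ i ≤ x (i + 1) ∧ x (i + 1) - x i ≤ δ) →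
    eLpNorm (fun ω => ∑ i ∈ Finset.range N, (f (ξ i) : ℂ) * (β (x (i + 1)) ω - β (x i) ω) - I ω)
      2 P ≤ ENNReal.ofReal ε

/-- `I = ∫_{-∞}^b f(u) dβ(u)` as the limit in `L²(P)` of `∫_a^b f(u) dβ(u)` as `a → -∞`. -/
def IsWienerIntegralIic (P : Measure Ω) (f : ℝ → ℝ) (β : ℝ → Ω → ℂ) (b : ℝ) (I : Ω → ℂ) : Prop :=
  MemLp I 2 P ∧ ∃ J : ℝ → Ω → ℂ, (∀ a ≤ b, IsWienerIntegral P f β a b (J a)) ∧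
    Tendsto (fun a => eLpNorm (fun ω => J a ω - I ω) 2 P) atBot (𝓝 0)

/-- `X = ∑ₖ c_k e_k` with convergence in `L²(Ω, V)`. -/
def IsModeSum (P : Measure Ω) (c : Mode → Ω → ℂ) (X : Ω → VSpace) : Prop :=
  (∀ k, MemLp (c k) 2 P) ∧ MemLp X 2 P ∧
    Tendsto (fun F : Finset Mode => eLpNorm (fun ω => ∑ k ∈ F, c k ω • basisV k - X ω) 2 P)
      atTop (𝓝 0)

/-! ### Mild solutions of `dψ = νAψ dt + ν^H Q^{1/2} dB^H` -/

/-- `Z = ∫_0^t S(t-s) Q^{1/2} ν^H dB^H(s) = ∑ₖ √λ_k ν^H ∫_0^t exp(-(t-s)να_k) dβ_k(s) e_k`. -/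
def IsStochasticConvolution (P : Measure Ω) (H ν : ℝ) (lam α : Mode → ℝ)
    (β : Mode → ℝ → Ω → ℂ) (t : ℝ) (Z : Ω → VSpace) : Prop :=
  ∃ I : Mode → Ω → ℂ,
    (∀ k, IsWienerIntegral P (fun s => Real.exp (-((t - s) * (ν * α k)))) (β k) 0 t (I k)) ∧
    IsModeSum P (fun k ω => ((√(lam k) * ν ^ H : ℝ) : ℂ) * I k ω) Z

/-- A mild solution on `[0, T]`. -/
def IsMildSolution (P : Measure Ω) (H ν : ℝ) (lam α : Mode → ℝ) (β : Mode → ℝ → Ω → ℂ)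
    (T : ℝ) (ψ : ℝ → Ω → VSpace) : Prop :=
  Measurable (fun p : Set.Icc (0 : ℝ) T × Ω => ψ p.1 p.2) ∧
    ∀ t ∈ Set.Icc (0 : ℝ) T, ∃ Z : Ω → VSpace, IsStochasticConvolution P H ν lam α β t Z ∧
      ∀ᵐ ω ∂P, ψ t ω = semigroupV ν α t (ψ 0 ω) + Z ω

/-- Strict stationarity of `(ψ(t))_{t ≥ 0}`. -/
def IsStrictlyStationary (P : Measure Ω) (ψ : ℝ → Ω → VSpace) : Prop :=
  ∀ (N : ℕ) (t : Fin N → ℝ), (∀ i, 0 ≤ t i) → ∀ r : ℝ, 0 ≤ r →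
    P.map (fun ω i => ψ (t i + r) ω) = P.map (fun ω i => ψ (t i) ω)

/-- A strictly stationary mild solution on `[0, ∞)`. -/
def IsStationaryMildSolution (P : Measure Ω) (H ν : ℝ) (lam α : Mode → ℝ)
    (β : Mode → ℝ → Ω → ℂ) (ψ : ℝ → Ω → VSpace) : Prop :=
  (∀ T > 0, IsMildSolution P H ν lam α β T ψ) ∧ IsStrictlyStationary P ψ

/-- Adaptedness of `(ψ(t))_{t ≥ 0}` to the natural filtration of the noise, up to null sets. -/
def IsAdaptedToNoise (P : Measure Ω) (β : Mode → ℝ → Ω → ℂ) (ψ : ℝ → Ω → VSpace) : Prop :=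
  ∀ t ≥ 0, AEStronglyMeasurable[noiseSigma β t] (ψ t) P

/-- Ergodicity: time averages of integrable observables converge to their expectation. -/
def IsErgodicProcess (P : Measure Ω) (ψ : ℝ → Ω → VSpace) : Prop :=
  ∀ ρ : VSpace → ℝ, Measurable ρ → Integrable (fun ω => ρ (ψ 0 ω)) P →
    ∀ᵐ ω ∂P, (∀ T > 0, IntervalIntegrable (fun t => ρ (ψ t ω)) volume 0 T) ∧
      Tendsto (fun T : ℝ => (1 / T) * ∫ t in (0 : ℝ)..T, ρ (ψ t ω)) atTop
        (𝓝 (∫ ω', ρ (ψ 0 ω') ∂P))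

/-- `ψ` is the unique ergodic mild solution: it is a strictly stationary and ergodic mild solution
adapted to the noise, and every strictly stationary mild solution adapted to the noise has the same
law, as a process on `[0, ∞)`, as `ψ`. -/
structure IsUniqueErgodicMildSolution (P : Measure Ω) (H ν : ℝ) (lam α : Mode → ℝ)
    (β : Mode → ℝ → Ω → ℂ) (ψ : ℝ → Ω → VSpace) : Prop where
  stationary : IsStationaryMildSolution P H ν lam α β ψ
  adapted : IsAdaptedToNoise P β ψ
  ergodic : IsErgodicProcess P ψ
  unique : ∀ φ : ℝ → Ω → VSpace, IsStationaryMildSolution P H ν lam α β φ →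
    IsAdaptedToNoise P β φ →
    P.map (fun ω (t : Set.Ici (0 : ℝ)) => φ t ω) = P.map (fun ω (t : Set.Ici (0 : ℝ)) => ψ t ω)

/-- The process on the whole time axis
`ψ(t) = ∑ₖ √λ_k ν^H ∫_{-∞}^t exp(-(t-u)να_k) dβ_k(u) e_k`, `t ∈ ℝ`. -/
def IsFourierOUProcess (P : Measure Ω) (H ν : ℝ) (lam α : Mode → ℝ)
    (β : Mode → ℝ → Ω → ℂ) (ψ : ℝ → Ω → VSpace) : Prop :=
  ∀ t : ℝ, ∃ I : Mode → Ω → ℂ,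
    (∀ k, IsWienerIntegralIic P (fun u => Real.exp (-((t - u) * (ν * α k)))) (β k) t (I k)) ∧
    IsModeSum P (fun k ω => ((√(lam k) * ν ^ H : ℝ) : ℂ) * I k ω) (ψ t)

/-- `Ψ` is a version of `ψ` given by real functions on the torus. -/
def IsFieldVersion (P : Measure Ω) (ψ : ℝ → Ω → VSpace) (Ψ : ℝ → Ω → Torus2 → ℝ) : Prop :=
  ∀ t : ℝ, ∀ᵐ ω ∂P, ((ψ t ω : Lp ℂ 2 torusMeasure) : Torus2 → ℂ) =ᵐ[torusMeasure]
    fun x => ((Ψ t ω x : ℝ) : ℂ)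

end Noise

end

set_option linter.unusedSectionVars false

noncomputable section

/-! ### Riemann–Stieltjes sums of Hölder curves -/

section Curves

variable {E : Type*} [NormedAddCommGroup E] [NormedSpace ℝ E]

/-! The noise is read as a family of curves `t ↦ β_k(t)` in the Hilbert space `L²(P)`. There the
probability becomes geometry: `‖β_k(t) - β_k(s)‖ = |t - s|^H`; curves of distinct modes are
orthogonal, also for `k` and `-k`, because `E β_k(t) β_k(s) = 0`; and all curves lie in one closed
subspace whose elements have centred Gaussian real parts, so that laws are determined by norms.

The stationary solution of `dX = -aX dt + db` is the average of `b(t) - b(t - r)` over an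
exponential law of rate `a` in `r` (`ouTransform`). From this form one reads off `‖X(t)‖ ≤ 1 + 1/a`
and `‖X(t) - X(s)‖ ≤ 2|t - s|^H`, the latter with a constant free of `a`. The covariance of `X`
depends on the time difference alone and tends to zero, being an average of second differences of
`|τ|^(2H)`, which are `O(τ^(2H-2))` (`tendsto_incCov`, `HasFBMCov.tendsto_ouCov`). Integration by
parts identifies increments of the transform with the Wiener integrals of the equation
(`norm_riemannStieltjes_sub_le`, `ouTransform_eq_add`), and Fubini's theorem provides versions with
continuous paths (`coeFn_integral_toLp`).

Regularity: moments of Gaussian variables are controlled by their `L²` norms, so chaining on a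
time-space cube bounds the expected supremum of a trigonometric polynomial in the modes by a
weighted `ℓ²` norm of its coefficients (`exists_lintegral_trigPoly_bound`). The modes are cut into
finite symmetric blocks whose weights decay geometrically; the surplus `ε` in the hypothesis pays
for the Hölder exponent that chaining consumes. Hence all derivatives of order at most `m` of the
block series converge uniformly, almost surely.

Stationarity holds because all covariances depend on time differences. For ergodicity, the decay of
the covariance makes characters `exp(i L(ψ))` mix; characters span a dense subspace of `L²`, which
gives the mean ergodic theorem for bounded observables, and the maximal inequality upgrades it to
almost sure convergence for integrable ones (`IsOUModes.exists_mixing_rate`,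
`ae_tendsto_timeAverage`). Uniqueness: two mild solutions driven by the same noise differ by `S(t)`
applied to the initial difference, which decays exponentially, while by stationarity the laws do not
move (`map_eq_of_isStrictlyStationary`).

Orthogonality gives the exact formula `E|v(x,t) - v(x,s)|² = ∑ w_k² |k|² ouIncVar(t - s)`. The upper
bound follows termwise. For the lower bound a single mode with `λ_k ≠ 0` suffices
(`HasFBMCov.exists_le_ouIncVar`). -/

/-- The Wiener integral `∫_c^d f db` of a smooth function, by integration by parts. -/
def partsIntegral (f f' : ℝ → ℝ) (b : ℝ → E) (c d : ℝ) : E :=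
  f d • b d - f c • b c - ∫ u in c..d, f' u • b u

/-- Integration by parts on `[x, ξ]` and on `[ξ, y]` writes the error as `∫ f' (b - b x)` plus `∫ f'
(b - b y)`, in which only increments of `b` over distances at most `δ` occur. Smoothness of `f`
makes every exponent `H > 0` admissible. -/
theorem norm_parts_sub_le [CompleteSpace E] {H : ℝ} (hH : 0 < H) {b : ℝ → E} (hb : Continuous b)
    (hbH : ∀ u v, ‖b u - b v‖ ≤ |u - v| ^ H) {f f' : ℝ → ℝ} (hf : ∀ u, HasDerivAt f (f' u) u)
    (hf' : Continuous f') {x ξ y δ : ℝ} (hx : x ≤ ξ) (hy : ξ ≤ y) (hδ : y - x ≤ δ) :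
    ‖f ξ • (b y - b x) - partsIntegral f f' b x y‖ ≤ δ ^ H * ∫ u in x..y, |f' u| := by
  have hi : ∀ p q : ℝ, IntervalIntegrable (fun u => f' u • b u) volume p q :=
    fun p q => (hf'.smul hb).intervalIntegrable _ _
  have hi' : ∀ (p q : ℝ) (e : E), IntervalIntegrable (fun u => f' u • e) volume p q :=
    fun p q e => (hf'.smul continuous_const).intervalIntegrable _ _
  have hint : ∀ p q : ℝ, ∫ u in p..q, f' u = f q - f p := fun p q =>
    intervalIntegral.integral_eq_sub_of_hasDerivAt (fun u _ => hf u) (hf'.intervalIntegrable _ _)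
  have hkey : f ξ • (b y - b x) - partsIntegral f f' b x y =
      (∫ u in x..ξ, f' u • (b u - b x)) + ∫ u in ξ..y, f' u • (b u - b y) := by
    simp only [smul_sub]
    rw [intervalIntegral.integral_sub (hi _ _) (hi' _ _ _),
      intervalIntegral.integral_sub (hi _ _) (hi' _ _ _),
      intervalIntegral.integral_smul_const, intervalIntegral.integral_smul_const, hint, hint,
      partsIntegral, ← intervalIntegral.integral_add_adjacent_intervals (hi x ξ) (hi ξ y)]
    simp only [sub_smul]
    abel
  have hd : ∀ p q : ℝ, x ≤ p → q ≤ y → ∀ z ∈ Set.Icc x y, p ≤ q →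
      ‖∫ u in p..q, f' u • (b u - b z)‖ ≤ δ ^ H * ∫ u in p..q, |f' u| := by
    intro p q hp hq z hz hpq
    rw [← intervalIntegral.integral_const_mul]
    refine (intervalIntegral.norm_integral_le_integral_norm hpq).trans ?_
    refine intervalIntegral.integral_mono_on hpq
      ((hf'.smul (hb.sub continuous_const)).norm.intervalIntegrable _ _)
      ((continuous_const.mul hf'.abs).intervalIntegrable _ _) ?_
    intro u hu
    rw [norm_smul, Real.norm_eq_abs, mul_comm]
    refine mul_le_mul_of_nonneg_right ((hbH u z).trans ?_) (abs_nonneg _)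
    refine Real.rpow_le_rpow (abs_nonneg _) ?_ hH.le
    rw [abs_le]
    constructor <;> linarith [hu.1, hu.2, hz.1, hz.2]
  rw [hkey, ← intervalIntegral.integral_add_adjacent_intervals (hf'.abs.intervalIntegrable x ξ)
    (hf'.abs.intervalIntegrable ξ y), mul_add]
  exact (norm_add_le _ _).trans (add_le_add
    (hd x ξ le_rfl hy x ⟨le_rfl, hx.trans hy⟩ hx) (hd ξ y hx le_rfl y ⟨hx.trans hy, le_rfl⟩ hy))

/-- `partsIntegral` and `∫ |f'|` are both additive over adjacent intervals, so the errors of the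
single cells add up to `δ^H` times the total variation of `f`. -/
theorem norm_riemannStieltjes_sub_le [CompleteSpace E] {H : ℝ} (hH : 0 < H) {b : ℝ → E} (hb : Continuous b)
    (hbH : ∀ u v, ‖b u - b v‖ ≤ |u - v| ^ H) {f f' : ℝ → ℝ} (hf : ∀ u, HasDerivAt f (f' u) u)
    (hf' : Continuous f') {δ : ℝ} (N : ℕ) (x ξ : ℕ → ℝ)
    (h : ∀ i < N, x i ≤ ξ i ∧ ξ i ≤ x (i + 1) ∧ x (i + 1) - x i ≤ δ) :
    ‖∑ i ∈ Finset.range N, f (ξ i) • (b (x (i + 1)) - b (x i)) -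
      partsIntegral f f' b (x 0) (x N)‖ ≤ δ ^ H * ∫ u in x 0..x N, |f' u| := by
  induction N with
  | zero => simp [partsIntegral]
  | succ n ih =>
    have h1 := ih fun i hi => h i (by omega)
    obtain ⟨ha, hb', hc⟩ := h n (by omega)
    have h2 := norm_parts_sub_le hH hb hbH hf hf' ha hb' hc
    have h3 : partsIntegral f f' b (x 0) (x (n + 1)) =
        partsIntegral f f' b (x 0) (x n) + partsIntegral f f' b (x n) (x (n + 1)) := by
      simp only [partsIntegral]
      have hi : ∀ p q : ℝ, IntervalIntegrable (fun u => f' u • b u) volume p q :=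
        fun p q => (hf'.smul hb).intervalIntegrable _ _
      rw [← intervalIntegral.integral_add_adjacent_intervals (hi (x 0) (x n))
        (hi (x n) (x (n + 1)))]
      abel
    rw [Finset.sum_range_succ, h3, ← intervalIntegral.integral_add_adjacent_intervals
      (hf'.abs.intervalIntegrable (x 0) (x n)) (hf'.abs.intervalIntegrable (x n) (x (n + 1))),
      mul_add, add_sub_add_comm]
    exact (norm_add_le _ _).trans (add_le_add h1 h2)

/-! ### Exponential averages -/

/-- The exponential law is the kernel of the stationary solution. Averaging against a probability
measure turns bounds on increments of a curve into the same bounds for its transform. -/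
theorem integral_expMeasure {a : ℝ} (ha : 0 < a) (g : ℝ → E) :
    ∫ r, g r ∂(expMeasure a) = ∫ r in Ioi 0, (a * Real.exp (-(a * r))) • g r := by
  have hm : Measurable (exponentialPDF a) := by
    unfold exponentialPDF
    exact (measurable_exponentialPDFReal a).ennreal_ofReal
  have h0 : expMeasure a = volume.withDensity (exponentialPDF a) := rfl
  rw [h0, integral_withDensity_eq_integral_toReal_smul hm
    (ae_of_all _ fun x => by simp [exponentialPDF])]
  rw [← integral_Ici_eq_integral_Ioi, ← integral_indicator measurableSet_Ici]
  congr 1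
  ext x
  by_cases hx : 0 ≤ x
  · rw [indicator_of_mem (by exact hx), exponentialPDF_of_nonneg hx, ENNReal.toReal_ofReal]
    positivity
  · rw [indicator_of_notMem (by exact hx), exponentialPDF_of_neg (not_le.mp hx)]
    simp

theorem integrable_expMeasure_iff {a : ℝ} (ha : 0 < a) (g : ℝ → E) :
    Integrable g (expMeasure a) ↔
      IntegrableOn (fun r => (a * Real.exp (-(a * r))) • g r) (Ioi 0) := by
  have hm : Measurable (exponentialPDF a) := by
    unfold exponentialPDF
    exact (measurable_exponentialPDFReal a).ennreal_ofReal
  have h0 : expMeasure a = volume.withDensity (exponentialPDF a) := rfl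
  rw [h0, integrable_withDensity_iff_integrable_smul' hm
    (ae_of_all _ fun x => by simp [exponentialPDF]), ← integrableOn_Ici_iff_integrableOn_Ioi,
    ← integrable_indicator_iff measurableSet_Ici]
  congr! 1
  ext x
  by_cases hx : 0 ≤ x
  · rw [indicator_of_mem (by exact hx), exponentialPDF_of_nonneg hx, ENNReal.toReal_ofReal]
    positivity
  · rw [indicator_of_notMem (by exact hx), exponentialPDF_of_neg (not_le.mp hx)]
    simp

theorem ae_expMeasure_nonneg (a : ℝ) : ∀ᵐ r ∂(expMeasure a), 0 ≤ r := by
  have h0 : expMeasure a = volume.withDensity (exponentialPDF a) := rfl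
  rw [h0, ae_iff, withDensity_apply _ (by measurability)]
  simp only [not_le]
  exact lintegral_exponentialPDF_of_nonpos le_rfl

theorem integrable_id_expMeasure {a : ℝ} (ha : 0 < a) : Integrable (fun r => r) (expMeasure a) := by
  rw [integrable_expMeasure_iff ha]
  have h : IntegrableOn _ _ _ := (integrableOn_rpow_mul_exp_neg_mul_rpow (s := 1) (p := 1) (b := a)
    (by norm_num) one_pos ha).const_mul a
  refine h.congr_fun (fun x hx => ?_) measurableSet_Ioi
  simp only [Real.rpow_one, smul_eq_mul]
  rw [neg_mul]
  ring

theorem integral_id_expMeasure {a : ℝ} (ha : 0 < a) : ∫ r, r ∂(expMeasure a) = 1 / a := by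
  rw [integral_expMeasure ha]
  have h := Real.integral_rpow_mul_exp_neg_mul_Ioi (a := 2) (r := a) (by norm_num) ha
  have h2 : ∫ r in Ioi (0 : ℝ), (a * Real.exp (-(a * r))) • r =
      a * ∫ r in Ioi (0 : ℝ), r ^ ((2 : ℝ) - 1) * Real.exp (-(a * r)) := by
    rw [← integral_const_mul]
    refine setIntegral_congr_fun measurableSet_Ioi fun x hx => ?_
    simp only [smul_eq_mul]
    norm_num
    ring
  rw [h2, h]
  have : Real.Gamma 2 = 1 := by
    have := Real.Gamma_nat_eq_factorial 1
    rwa [Nat.factorial_one, Nat.cast_one, one_add_one_eq_two] at this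
  rw [this, Real.rpow_two]
  field_simp

theorem rpow_le_one_add {r H : ℝ} (hr : 0 ≤ r) (hH : 0 < H ∧ H < 1) : r ^ H ≤ 1 + r := by
  rcases le_total r 1 with h | h
  · exact (Real.rpow_le_one hr h hH.1.le).trans (by linarith)
  · have := Real.rpow_le_rpow_of_exponent_le h hH.2.le
    rw [Real.rpow_one] at this
    linarith

theorem integrable_rpow_expMeasure {a H : ℝ} (ha : 0 < a) (hH : 0 < H ∧ H < 1) :
    Integrable (fun r => |r| ^ H) (expMeasure a) := by
  have := isProbabilityMeasure_expMeasure ha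
  refine ((integrable_const (1 : ℝ)).add (integrable_id_expMeasure ha).abs).mono'
    ((Real.continuous_rpow_const hH.1.le).comp continuous_abs).aestronglyMeasurable
    (ae_of_all _ fun r => ?_)
  rw [Real.norm_of_nonneg (by positivity)]
  exact rpow_le_one_add (abs_nonneg r) hH

/-- The bound is non-increasing in the rate, so one constant serves all rates above a common
positive lower bound. -/
theorem integral_rpow_expMeasure_le {a H : ℝ} (ha : 0 < a) (hH : 0 < H ∧ H < 1) :
    ∫ r, |r| ^ H ∂(expMeasure a) ≤ 1 + 1 / a := by
  have := isProbabilityMeasure_expMeasure ha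
  have h2 : ∫ r, (1 + r) ∂(expMeasure a) = 1 + 1 / a := by
    rw [integral_add (integrable_const _) (integrable_id_expMeasure ha),
      integral_id_expMeasure ha]
    simp
  rw [← h2]
  refine integral_mono_ae (integrable_rpow_expMeasure ha hH)
    ((integrable_const (1 : ℝ)).add (integrable_id_expMeasure ha)) ?_
  filter_upwards [ae_expMeasure_nonneg a] with r hr
  rw [abs_of_nonneg hr]
  exact rpow_le_one_add hr hH

/-- The stationary Ornstein–Uhlenbeck transform
`∫_{-∞}^t exp(-a(t-u)) db(u) = ∫_0^∞ a exp(-ar) (b(t) - b(t-r)) dr`. -/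
def ouTransform (a : ℝ) (b : ℝ → E) (t : ℝ) : E := ∫ r, (b t - b (t - r)) ∂(expMeasure a)

/-- Substitution `u = t - r`. On the right side `t` enters only through the domain, so the condition
can be transported from one time to another. -/
theorem integrable_comp_sub_expMeasure_iff {a : ℝ} (ha : 0 < a) {b : ℝ → E} {t : ℝ} :
    Integrable (fun r => b (t - r)) (expMeasure a) ↔
      IntegrableOn (fun u => Real.exp (a * u) • b u) (Iic t) := by
  have hpre : (fun r : ℝ => t - r) ⁻¹' (Iic t) = Ici 0 := by
    ext r; simp
  have e1 : ∀ r, (a * Real.exp (-(a * r))) • b (t - r) =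
      (a * Real.exp (-(a * t))) • (Real.exp (a * (t - r)) • b (t - r)) := by
    intro r
    rw [smul_smul, mul_assoc, ← Real.exp_add]
    ring_nf
  have hc : a * Real.exp (-(a * t)) ≠ 0 := by positivity
  have h2 := (integrable_indicator_iff (μ := volume) (f := fun r => Real.exp (a * (t - r)) •
      b (t - r)) (measurableSet_Ici (a := (0 : ℝ))))
  rw [integrable_expMeasure_iff ha, ← integrableOn_Ici_iff_integrableOn_Ioi]
  simp_rw [e1]
  rw [IntegrableOn, integrable_fun_smul_iff hc, ← IntegrableOn, ← h2,
    ← integrable_indicator_iff measurableSet_Iic, ← hpre]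
  exact integrable_comp_sub_left
    ((Iic t).indicator (fun u => Real.exp (a * u) • b u)) t

/-- The dependence on `t` is isolated in an explicit factor and the endpoint of an integral; both
the restart identity and the continuity of paths come from this form. -/
theorem ouTransform_eq [CompleteSpace E] {a : ℝ} (ha : 0 < a) {b : ℝ → E} {t : ℝ}
    (hbt : IntegrableOn (fun u => Real.exp (a * u) • b u) (Iic t)) :
    ouTransform a b t = b t - (a * Real.exp (-(a * t))) • ∫ u in Iic t, Real.exp (a * u) • b u := by
  have := isProbabilityMeasure_expMeasure ha
  have hpre : (fun r : ℝ => t - r) ⁻¹' (Iic t) = Ici 0 := by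
    ext r; simp
  have e1 : ∀ r, (a * Real.exp (-(a * r))) • b (t - r) =
      (a * Real.exp (-(a * t))) • (Real.exp (a * (t - r)) • b (t - r)) := by
    intro r
    rw [smul_smul, mul_assoc, ← Real.exp_add]
    ring_nf
  have hi := (integrable_comp_sub_expMeasure_iff ha).mpr hbt
  rw [ouTransform, integral_sub (integrable_const _) hi, integral_const, probReal_univ, one_smul,
    integral_expMeasure ha]
  simp_rw [e1]
  rw [integral_smul, ← integral_Ici_eq_integral_Ioi, ← integral_indicator measurableSet_Ici,
    ← integral_indicator measurableSet_Iic, ← hpre]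
  congr 2
  exact (integral_sub_left_eq_self
    (fun u => (Iic t).indicator (fun u => Real.exp (a * u) • b u) u) volume t)

/-- The transform solves `dX = -aX dt + db`. -/
theorem ouTransform_eq_add [CompleteSpace E] {a : ℝ} (ha : 0 < a) {b : ℝ → E}
    {s t : ℝ} (hst : s ≤ t) (hbt : IntegrableOn (fun u => Real.exp (a * u) • b u) (Iic t)) :
    ouTransform a b t = Real.exp (-((t - s) * a)) • ouTransform a b s +
      partsIntegral (fun u => Real.exp (-((t - u) * a)))
        (fun u => a * Real.exp (-((t - u) * a))) b s t := by
  have hbs := hbt.mono_set (Iic_subset_Iic.mpr hst)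
  have h0 := intervalIntegral.integral_Iic_sub_Iic hbs hbt
  rw [ouTransform_eq ha hbt, ouTransform_eq ha hbs, partsIntegral]
  have h1 : ∫ u in s..t, (a * Real.exp (-((t - u) * a))) • b u =
      (a * Real.exp (-(a * t))) • ∫ u in s..t, Real.exp (a * u) • b u := by
    rw [← intervalIntegral.integral_smul]
    congr 1; ext u
    rw [smul_smul, mul_assoc, ← Real.exp_add]
    ring_nf
  rw [h1, ← h0, smul_sub, smul_smul, smul_sub]
  have h2 : Real.exp (-((t - s) * a)) * (a * Real.exp (-(a * s))) = a * Real.exp (-(a * t)) := by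
    rw [mul_left_comm, ← Real.exp_add]
    ring_nf
  rw [h2]
  simp only [sub_self, zero_mul, neg_zero, Real.exp_zero, one_smul]
  abel

/-- A curve with the increments of a fractional Brownian motion, up to constants. -/
structure IsHolderCurve (H : ℝ) (b : ℝ → E) : Prop where
  hurst : 0 < H ∧ H < 1
  holder : ∀ u v, ‖b u - b v‖ ≤ |u - v| ^ H

namespace IsHolderCurve

variable {H : ℝ} {b : ℝ → E}

theorem continuous (hb : IsHolderCurve H b) : Continuous b := by
  rw [continuous_iff_continuousAt]
  intro u
  rw [ContinuousAt, tendsto_iff_norm_sub_tendsto_zero]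
  refine squeeze_zero (fun _ => norm_nonneg _) (fun v => hb.holder v u) ?_
  have h : Continuous fun v : ℝ => |v - u| ^ H :=
    (Real.continuous_rpow_const hb.hurst.1.le).comp (by fun_prop)
  have := h.tendsto u
  simpa [Real.zero_rpow hb.hurst.1.ne'] using this

theorem integrable_sub (hb : IsHolderCurve H b) {a : ℝ} (ha : 0 < a) (t : ℝ) :
    Integrable (fun r => b t - b (t - r)) (expMeasure a) := by
  refine (integrable_rpow_expMeasure ha hb.hurst).mono' ?_ (ae_of_all _ fun r => ?_)
  · exact (continuous_const.sub (hb.continuous.comp (by fun_prop))).aestronglyMeasurable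
  · simpa using hb.holder t (t - r)

theorem integrableOn_exp_smul (hb : IsHolderCurve H b) {a : ℝ} (ha : 0 < a) (t : ℝ) :
    IntegrableOn (fun u => Real.exp (a * u) • b u) (Iic t) := by
  have := isProbabilityMeasure_expMeasure ha
  rw [← integrable_comp_sub_expMeasure_iff ha]
  refine ((integrable_const (b t)).sub (hb.integrable_sub ha t)).congr (ae_of_all _ fun r => ?_)
  simp

/-- The increment is the average of `(b t - b s) - (b (t - r) - b (s - r))`, two increments over the
same time lag. This explains the factor 2 and its independence of the rate. -/
theorem norm_ouTransform_sub_le (hb : IsHolderCurve H b) {a : ℝ} (ha : 0 < a) (t s : ℝ) :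
    ‖ouTransform a b t - ouTransform a b s‖ ≤ 2 * |t - s| ^ H := by
  have := isProbabilityMeasure_expMeasure ha
  rw [ouTransform, ouTransform, ← integral_sub (hb.integrable_sub ha t) (hb.integrable_sub ha s)]
  have h := norm_integral_le_of_norm_le_const (μ := expMeasure a)
    (f := fun r => b t - b (t - r) - (b s - b (s - r))) (C := 2 * |t - s| ^ H)
    (ae_of_all _ fun r => ?_)
  · simpa using h
  · have h1 := hb.holder t s
    have h2 := hb.holder (t - r) (s - r)
    rw [sub_sub_sub_cancel_right] at h2
    calc ‖b t - b (t - r) - (b s - b (s - r))‖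
        = ‖(b t - b s) - (b (t - r) - b (s - r))‖ := by congr 1; abel
      _ ≤ _ := (norm_sub_le _ _).trans (by linarith)

theorem norm_ouTransform_le (hb : IsHolderCurve H b) {a : ℝ} (ha : 0 < a) (t : ℝ) :
    ‖ouTransform a b t‖ ≤ 1 + 1 / a := by
  refine le_trans ?_ (integral_rpow_expMeasure_le ha hb.hurst)
  refine norm_integral_le_of_norm_le (integrable_rpow_expMeasure ha hb.hurst)
    (ae_of_all _ fun r => ?_)
  simpa using hb.holder t (t - r)

/-- `∫_s^t exp(-a(t-u)) db(u)` is close to `b(t) - b(s)`. -/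
theorem norm_ouTransform_sub_ge [CompleteSpace E] (hb : IsHolderCurve H b) {a : ℝ} (ha : 0 < a)
    {s t : ℝ} (hst : s ≤ t) (hbst : ‖b t - b s‖ = (t - s) ^ H) :
    (t - s) ^ H - a * (t - s) * ((t - s) ^ H + (1 + 1 / a)) ≤
      ‖ouTransform a b t - ouTransform a b s‖ := by
  have hf : ∀ u, HasDerivAt (fun u => Real.exp (-((t - u) * a)))
      (a * Real.exp (-((t - u) * a))) u := by
    intro u
    have h := ((((hasDerivAt_id u).const_sub t).mul_const a).neg).exp
    simpa [mul_comm] using h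
  have hc : Continuous fun u => a * Real.exp (-((t - u) * a)) := by fun_prop
  have h1 := norm_parts_sub_le hb.hurst.1 hb.continuous hb.holder hf hc hst le_rfl le_rfl
  have h2 : ∫ u in s..t, |a * Real.exp (-((t - u) * a))| = 1 - Real.exp (-((t - s) * a)) := by
    have h3 : ∀ u : ℝ, |a * Real.exp (-((t - u) * a))| = a * Real.exp (-((t - u) * a)) :=
      fun u => abs_of_pos (by positivity)
    simp_rw [h3]
    rw [intervalIntegral.integral_eq_sub_of_hasDerivAt (fun u _ => hf u)
      (hc.intervalIntegrable _ _)]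
    simp
  rw [h2] at h1
  have h4 : 1 - Real.exp (-((t - s) * a)) ≤ a * (t - s) := by
    have := Real.one_sub_le_exp_neg ((t - s) * a)
    linarith
  have h5 : Real.exp (-((t - s) * a)) ≤ 1 :=
    Real.exp_le_one_iff.mpr (neg_nonpos.mpr (mul_nonneg (by linarith) ha.le))
  simp only [sub_self, zero_mul, neg_zero, Real.exp_zero, one_smul] at h1
  rw [ouTransform_eq_add ha hst (hb.integrableOn_exp_smul ha t)]
  set Q := partsIntegral (fun u => Real.exp (-((t - u) * a)))
    (fun u => a * Real.exp (-((t - u) * a))) b s t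
  set e := Real.exp (-((t - s) * a))
  set X := ouTransform a b s
  -- The increment of `b` is that of the transform, plus the error in replacing the kernel by 1,
  -- plus the decay `(1 - e) X` of the past. The first error is of order `(t - s)^(1+H)` and the
  -- last term of order `t - s`; both are negligible against `(t - s)^H` as `H < 1`.
  have h6 : b t - b s = (e • X + Q - X) + ((b t - b s - Q) + (1 - e) • X) := by
    rw [sub_smul, one_smul]; abel
  have h7 : ‖(1 - e) • X‖ ≤ a * (t - s) * (1 + 1 / a) := by
    rw [norm_smul, Real.norm_of_nonneg (by linarith)]
    exact mul_le_mul h4 (hb.norm_ouTransform_le ha s) (norm_nonneg _)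
      (mul_nonneg ha.le (by linarith))
  have h8 : ‖b t - b s - Q‖ ≤ a * (t - s) * (t - s) ^ H := by
    refine h1.trans ?_
    rw [mul_comm]
    exact mul_le_mul_of_nonneg_right h4 (Real.rpow_nonneg (by linarith) _)
  have h9 := norm_add_le (e • X + Q - X) ((b t - b s - Q) + (1 - e) • X)
  rw [← h6, hbst] at h9
  have h10 := norm_add_le (b t - b s - Q) ((1 - e) • X)
  linarith

end IsHolderCurve

end Curves

end

noncomputable section

/-! ### Covariances -/

/-- The covariance of a normalized fractional Brownian motion. -/
def fbmCov (H t s : ℝ) : ℝ := (1 / 2) * (|t| ^ (2 * H) + |s| ^ (2 * H) - |t - s| ^ (2 * H))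

/-- The covariance of the increments over `[τ - r, τ]` and `[-q, 0]`. -/
def incCov (H τ r q : ℝ) : ℝ :=
  (1 / 2) * (|τ + q| ^ (2 * H) + |τ - r| ^ (2 * H) - |τ| ^ (2 * H) - |τ - r + q| ^ (2 * H))

/-- The covariance function of fractional Ornstein–Uhlenbeck processes with rates `a` and `a'`. -/
def ouCov (H a a' τ : ℝ) : ℝ := ∫ r, ∫ q, incCov H τ r q ∂(expMeasure a') ∂(expMeasure a)

/-- The variance of the increments of a fractional Ornstein–Uhlenbeck process. -/
def ouIncVar (H a τ : ℝ) : ℝ := 2 * (ouCov H a a 0 - ouCov H a a τ)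

/-- The terms `|t|^(2H)` and `|s|^(2H)` cancel: increments are stationary. Stationarity of the whole
solution rests on this identity. -/
theorem fbmCov_increments (H t r s q : ℝ) :
    fbmCov H t s - fbmCov H t (s - q) - fbmCov H (t - r) s + fbmCov H (t - r) (s - q) =
      incCov H (t - s) r q := by
  simp only [fbmCov, incCov]
  rw [show t - (s - q) = t - s + q by ring, show t - r - s = t - s - r by ring,
    show t - r - (s - q) = t - s - r + q by ring]
  ring

section Hilbert

variable {E : Type*} [NormedAddCommGroup E] [InnerProductSpace ℂ E]

theorem inner_self_eq_ofReal_norm_sq (x : E) : inner ℂ x x = ((‖x‖ ^ 2 : ℝ) : ℂ) := by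
  rw [inner_self_eq_norm_sq_to_K]
  push_cast
  rfl

theorem integral_inner_left [CompleteSpace E] [NormedSpace ℝ E] {μ : Measure ℝ} {f : ℝ → E}
    (hf : Integrable f μ) (c : E) : ∫ x, inner ℂ (f x) c ∂μ = inner ℂ (∫ x, f x ∂μ) c := by
  rw [← inner_conj_symm, ← integral_inner hf, ← integral_conj]
  simp only [inner_conj_symm]

/-- The curves `B` and `B'` are fractional Brownian motions with covariance `κ` times the standard
one. -/
def HasFBMCov (H : ℝ) (κ : ℂ) (B B' : ℝ → E) : Prop :=
  ∀ t s, inner ℂ (B t) (B' s) = κ * (fbmCov H t s : ℂ)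

variable {H : ℝ} {B B' : ℝ → E}

theorem HasFBMCov.norm_sub (h : HasFBMCov H 1 B B) (hH : 0 < H) (t s : ℝ) :
    ‖B t - B s‖ = |t - s| ^ H := by
  have h1 : ((‖B t - B s‖ ^ 2 : ℝ) : ℂ) = ((|t - s| ^ (2 * H) : ℝ) : ℂ) := by
    rw [← inner_self_eq_ofReal_norm_sq]
    simp only [inner_sub_left, inner_sub_right, h _ _, one_mul]
    norm_cast
    have h0 : |(0 : ℝ)| ^ (2 * H) = 0 := by
      rw [abs_zero, Real.zero_rpow (by positivity)]
    simp only [fbmCov, sub_self, h0]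
    rw [abs_sub_comm s t]
    ring
  have h2 : ‖B t - B s‖ ^ 2 = (|t - s| ^ H) ^ 2 := by
    rw [← Real.rpow_mul_natCast (abs_nonneg _)]
    rw [mul_comm H]
    exact_mod_cast h1
  exact (pow_left_inj₀ (norm_nonneg _) (by positivity) two_ne_zero).mp h2

theorem HasFBMCov.isHolderCurve (h : HasFBMCov H 1 B B) (hH : 0 < H ∧ H < 1) :
    IsHolderCurve H B where
  hurst := hH
  holder t s := (h.norm_sub hH.1 t s).le

theorem HasFBMCov.inner_increments {κ : ℂ} (h : HasFBMCov H κ B B') (t r s q : ℝ) :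
    inner ℂ (B t - B (t - r)) (B' s - B' (s - q)) = κ * (incCov H (t - s) r q : ℂ) := by
  simp only [inner_sub_left, inner_sub_right, h _ _, ← fbmCov_increments]
  push_cast
  ring

variable [CompleteSpace E] [NormedSpace ℝ E]

theorem HasFBMCov.inner_increment_ouTransform {κ : ℂ} (h : HasFBMCov H κ B B')
    (hB' : IsHolderCurve H B') {a' : ℝ} (ha' : 0 < a') (t r s : ℝ) :
    inner ℂ (B t - B (t - r)) (ouTransform a' B' s) =
      κ * ((∫ q, incCov H (t - s) r q ∂(expMeasure a') : ℝ) : ℂ) := by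
  rw [ouTransform, ← integral_inner (hB'.integrable_sub ha' s)]
  simp_rw [h.inner_increments]
  rw [integral_const_mul, integral_complex_ofReal]

/-- The inner product passes through both Bochner integrals. Keeping `κ` general covers the
autocovariance of a mode (`κ = 1`) and the orthogonality of distinct modes (`κ = 0`) at once. -/
theorem HasFBMCov.inner_ouTransform {κ : ℂ} (h : HasFBMCov H κ B B')
    (hB : IsHolderCurve H B) (hB' : IsHolderCurve H B') {a a' : ℝ} (ha : 0 < a) (ha' : 0 < a')
    (t s : ℝ) :
    inner ℂ (ouTransform a B t) (ouTransform a' B' s) = κ * (ouCov H a a' (t - s) : ℂ) := by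
  rw [ouTransform, ← integral_inner_left (hB.integrable_sub ha t)]
  simp_rw [h.inner_increment_ouTransform hB' ha']
  rw [integral_const_mul, integral_complex_ofReal, ouCov]

/-- Twice `incCov` is a mixed second difference, with steps `r` and `q`, of `x^(2H)` at large `x`.
Two mean value estimates bound it by a multiple of `(τ - r)^(2H-2)`, and the exponent is negative
since `H < 1`. -/
theorem tendsto_incCov (hH : 0 < H ∧ H < 1) {r q : ℝ} (hr : 0 ≤ r) (hq : 0 ≤ q) :
    Tendsto (fun τ => incCov H τ r q) atTop (𝓝 0) := by
  obtain ⟨p, hp⟩ : ∃ p, p = 2 * H := ⟨_, rfl⟩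
  have hp0 : 0 < p := by linarith [hH.1]
  have hbound : ∀ᶠ τ in atTop, |incCov H τ r q| ≤
      (1 / 2 * (r * q * (p * |p - 1|))) * (τ - r) ^ (p - 2) := by
    filter_upwards [eventually_gt_atTop r] with τ hτ
    -- first mean value theorem
    let h : ℝ → ℝ := fun x => (x + q) ^ p - x ^ p
    let h' : ℝ → ℝ := fun x => p * (x + q) ^ (p - 1) - p * x ^ (p - 1)
    have hd : ∀ x, 0 < x → HasDerivAt h (h' x) x := by
      intro x hx
      have h1 := ((hasDerivAt_id x).add_const q).rpow_const (p := p)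
        (Or.inl (by simp only [id]; positivity))
      have h2 := Real.hasDerivAt_rpow_const (p := p) (Or.inl hx.ne')
      have := h1.sub h2
      simp only [one_mul, id] at this
      exact this
    have hd2 : ∀ x, 0 < x → HasDerivAt (fun x : ℝ => p * x ^ (p - 1))
        (p * ((p - 1) * x ^ (p - 2))) x := by
      intro x hx
      have := (Real.hasDerivAt_rpow_const (p := p - 1) (Or.inl hx.ne')).const_mul p
      rw [show p - 1 - 1 = p - 2 by ring] at this
      exact this
    have hτr : 0 < τ - r := by linarith
    have hb2 : ∀ x ∈ Set.Icc (τ - r) τ, ‖h' x‖ ≤ p * (|p - 1| * (τ - r) ^ (p - 2)) * q := by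
      intro x hx
      have := (convex_Icc x (x + q)).norm_image_sub_le_of_norm_hasDerivWithin_le
        (f := fun x : ℝ => p * x ^ (p - 1)) (f' := fun x => p * ((p - 1) * x ^ (p - 2)))
        (C := p * (|p - 1| * (τ - r) ^ (p - 2)))
        (fun y hy => (hd2 y (by linarith [hy.1, hx.1])).hasDerivWithinAt)
        (fun y hy => ?_) (left_mem_Icc.mpr (by linarith)) (right_mem_Icc.mpr (by linarith))
      · simpa [h', abs_of_nonneg hq] using this
      · have hy0 : 0 < y := by linarith [hy.1, hx.1]
        rw [norm_mul, norm_mul, Real.norm_of_nonneg hp0.le, Real.norm_eq_abs,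
          Real.norm_of_nonneg (by positivity)]
        have hle : y ^ (p - 2) ≤ (τ - r) ^ (p - 2) :=
          Real.rpow_le_rpow_of_nonpos hτr (by linarith [hy.1, hx.1]) (by linarith [hH.2])
        exact mul_le_mul_of_nonneg_left (mul_le_mul_of_nonneg_left hle (abs_nonneg _)) hp0.le
    have hb1 := (convex_Icc (τ - r) τ).norm_image_sub_le_of_norm_hasDerivWithin_le
      (f := h) (f' := h') (fun y hy => (hd y (by linarith [hy.1])).hasDerivWithinAt) hb2
      (left_mem_Icc.mpr (by linarith)) (right_mem_Icc.mpr (by linarith))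
    have he : incCov H τ r q = (1 / 2) * (h τ - h (τ - r)) := by
      simp only [incCov, h, ← hp]
      rw [abs_of_nonneg (by linarith : 0 ≤ τ + q), abs_of_nonneg hτr.le,
        abs_of_nonneg (by linarith : 0 ≤ τ), abs_of_nonneg (by linarith : 0 ≤ τ - r + q)]
      ring
    rw [he, abs_mul, abs_of_pos (by norm_num : (0 : ℝ) < 1 / 2)]
    rw [Real.norm_eq_abs, Real.norm_eq_abs, sub_sub_cancel, abs_of_nonneg hr] at hb1
    nlinarith
  refine squeeze_zero_norm' hbound ?_
  have h1 : Tendsto (fun τ : ℝ => (τ - r) ^ (p - 2)) atTop (𝓝 0) := by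
    have := (tendsto_rpow_neg_atTop (show 0 < 2 - p by linarith [hH.2])).comp
      (tendsto_atTop_add_const_right _ (-r) tendsto_id)
    refine this.congr fun τ => ?_
    simp [sub_eq_add_neg]
  simpa using h1.const_mul (1 / 2 * (r * q * (p * |p - 1|)))

/-- Dominated convergence in each of the two averages. The dominating function `|r|^H |q|^H` is the
Cauchy–Schwarz bound for increments of the curve `B`. -/
theorem HasFBMCov.tendsto_ouCov (h : HasFBMCov H 1 B B) (hH : 0 < H ∧ H < 1) {a a' : ℝ}
    (ha : 0 < a) (ha' : 0 < a') : Tendsto (fun τ => ouCov H a a' τ) atTop (𝓝 0) := by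
  have := isProbabilityMeasure_expMeasure ha
  have := isProbabilityMeasure_expMeasure ha'
  have hB := h.isHolderCurve hH
  have hbd : ∀ τ r q, |incCov H τ r q| ≤ |r| ^ H * |q| ^ H := by
    intro τ r q
    have h1 := h.inner_increments τ r 0 q
    rw [one_mul, sub_zero] at h1
    have h2 := norm_inner_le_norm (𝕜 := ℂ) (B τ - B (τ - r)) (B 0 - B (0 - q))
    rw [h1, h.norm_sub hH.1, h.norm_sub hH.1, Complex.norm_real] at h2
    simpa using h2
  have hcont : ∀ τ, Continuous (Function.uncurry fun r q => incCov H τ r q) := by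
    intro τ
    have hH2 : 0 ≤ 2 * H := by linarith [hH.1]
    have hc : Continuous fun x : ℝ => |x| ^ (2 * H) :=
      (Real.continuous_rpow_const hH2).comp continuous_abs
    have e : (Function.uncurry fun r q => incCov H τ r q) = fun p : ℝ × ℝ =>
      (1 / 2) * ((fun x : ℝ => |x| ^ (2 * H)) (τ + p.2) + (fun x : ℝ => |x| ^ (2 * H)) (τ - p.1)
        - |τ| ^ (2 * H) - (fun x : ℝ => |x| ^ (2 * H)) (τ - p.1 + p.2)) := rfl
    rw [e]
    exact continuous_const.mul ((((hc.comp (by fun_prop)).add (hc.comp (by fun_prop))).sub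
      continuous_const).sub (hc.comp (by fun_prop)))
  have hi : ∀ r, Integrable (fun q => |r| ^ H * |q| ^ H) (expMeasure a') := fun r =>
    (integrable_rpow_expMeasure ha' hH).const_mul _
  have hin : ∀ r, 0 ≤ r → Tendsto (fun τ => ∫ q, incCov H τ r q ∂(expMeasure a')) atTop (𝓝 0) := by
    intro r hr
    rw [← integral_zero (α := ℝ) (G := ℝ) (μ := expMeasure a')]
    refine tendsto_integral_filter_of_dominated_convergence (fun q => |r| ^ H * |q| ^ H)
      (Eventually.of_forall fun τ => ?_) (Eventually.of_forall fun τ => ae_of_all _ fun q => ?_)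
      (hi r) ?_
    · exact ((hcont τ).comp (by fun_prop : Continuous fun q : ℝ => (r, q))).aestronglyMeasurable
    · exact hbd τ r q
    · filter_upwards [ae_expMeasure_nonneg a'] with q hq
      exact tendsto_incCov hH hr hq
  rw [← integral_zero (α := ℝ) (G := ℝ) (μ := expMeasure a)]
  refine tendsto_integral_filter_of_dominated_convergence
    (fun r => |r| ^ H * ∫ q, |q| ^ H ∂(expMeasure a'))
    (Eventually.of_forall fun τ => ?_) (Eventually.of_forall fun τ => ae_of_all _ fun r => ?_)
    ((integrable_rpow_expMeasure ha hH).mul_const _) ?_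
  · exact ((hcont τ).stronglyMeasurable.integral_prod_right).aestronglyMeasurable
  · rw [← integral_const_mul]
    exact norm_integral_le_of_norm_le (hi r) (ae_of_all _ fun q => hbd τ r q)
  · filter_upwards [ae_expMeasure_nonneg a] with r hr
    exact hin r hr

theorem HasFBMCov.norm_sub_sq_ouTransform (h : HasFBMCov H 1 B B) (hH : 0 < H ∧ H < 1) {a : ℝ}
    (ha : 0 < a) (t s : ℝ) :
    ‖ouTransform a B t - ouTransform a B s‖ ^ 2 = ouIncVar H a (t - s) := by
  have hB := h.isHolderCurve hH
  have hin := fun x y => h.inner_ouTransform hB hB ha ha x y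
  have hsymm : ouCov H a a (s - t) = ouCov H a a (t - s) := by
    have h1 := inner_conj_symm (𝕜 := ℂ) (ouTransform a B s) (ouTransform a B t)
    rw [hin, hin, one_mul, one_mul, Complex.conj_ofReal] at h1
    exact_mod_cast h1.symm
  have h1 : ((‖ouTransform a B t - ouTransform a B s‖ ^ 2 : ℝ) : ℂ) =
      (ouIncVar H a (t - s) : ℂ) := by
    rw [← inner_self_eq_ofReal_norm_sq]
    simp only [inner_sub_left, inner_sub_right, hin, one_mul, sub_self, hsymm, ouIncVar]
    push_cast
    ring
  exact_mod_cast h1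

theorem HasFBMCov.norm_sq_ouTransform (h : HasFBMCov H 1 B B) (hH : 0 < H ∧ H < 1) {a : ℝ}
    (ha : 0 < a) (t : ℝ) : ‖ouTransform a B t‖ ^ 2 = ouCov H a a 0 := by
  have hB := h.isHolderCurve hH
  have h1 := h.inner_ouTransform hB hB ha ha t t
  rw [inner_self_eq_ofReal_norm_sq, sub_self, one_mul] at h1
  exact_mod_cast h1

/-- The 4 is the square of the factor 2 in `norm_ouTransform_sub_le`, hence the same for all rates.
-/
theorem HasFBMCov.ouIncVar_le (h : HasFBMCov H 1 B B) (hH : 0 < H ∧ H < 1) {a : ℝ}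
    (ha : 0 < a) (τ : ℝ) : ouIncVar H a τ ≤ 4 * |τ| ^ (2 * H) := by
  have h1 := h.norm_sub_sq_ouTransform hH ha τ 0
  rw [sub_zero] at h1
  have h2 := (h.isHolderCurve hH).norm_ouTransform_sub_le ha τ 0
  rw [sub_zero] at h2
  rw [← h1, mul_comm 2 H, Real.rpow_mul (abs_nonneg _), Real.rpow_two]
  nlinarith [norm_nonneg (ouTransform a B τ - ouTransform a B 0)]

/-- Near zero, increments of the transform agree with those of `B` to leading order. At a positive
time lag the increment cannot vanish, as the process would then be constant along multiples of that
lag while its covariance decays. On the compact remainder continuity gives a positive minimum. -/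
theorem HasFBMCov.exists_le_ouIncVar (h : HasFBMCov H 1 B B) (hH : 0 < H ∧ H < 1) {a : ℝ}
    (ha : 0 < a) (T : ℝ) :
    ∃ c > 0, ∀ τ, |τ| ≤ T → c * |τ| ^ (2 * H) ≤ ouIncVar H a τ := by
  have hB := h.isHolderCurve hH
  set X := ouTransform a B with hX
  have hv : ∀ τ, ouIncVar H a τ = ‖X τ - X 0‖ ^ 2 := fun τ => by
    rw [hX, h.norm_sub_sq_ouTransform hH ha, sub_zero]
  have heven : ∀ τ, ouIncVar H a |τ| = ouIncVar H a τ := by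
    intro τ
    rcases abs_choice τ with h1 | h1
    · rw [h1]
    · rw [h1, ← zero_sub, ← h.norm_sub_sq_ouTransform hH ha, norm_sub_rev, hv]
  -- small times
  obtain ⟨τ₀, hτ₀, hsmall⟩ : ∃ τ₀ > 0, ∀ τ, 0 ≤ τ → τ ≤ τ₀ → τ ^ H / 2 ≤ ‖X τ - X 0‖ := by
    -- This is the error of `norm_ouTransform_sub_ge` divided by `τ^H`; once it is below `1/2`, half
    -- of the main term survives.
    have hlim : Tendsto (fun τ : ℝ => a * τ + (a + 1) * τ ^ (1 - H)) (𝓝 0) (𝓝 0) := by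
      have hc : Continuous fun τ : ℝ => a * τ + (a + 1) * τ ^ (1 - H) :=
        (continuous_const.mul continuous_id).add
          (continuous_const.mul (Real.continuous_rpow_const (by linarith [hH.2])))
      have := hc.tendsto 0
      simpa [Real.zero_rpow (show 1 - H ≠ 0 by linarith [hH.2])] using this
    obtain ⟨δ, hδ, hδ'⟩ := Metric.eventually_nhds_iff.mp
      (hlim.eventually (gt_mem_nhds (show (0 : ℝ) < 1 / 2 by norm_num)))
    refine ⟨δ / 2, by positivity, fun τ h0 h1 => ?_⟩
    have h2 := hδ' (y := τ) (by rw [Real.dist_eq, sub_zero, abs_of_nonneg h0]; linarith)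
    have h3 := hB.norm_ouTransform_sub_ge ha h0 (by
      rw [h.norm_sub hH.1, sub_zero, abs_of_nonneg h0])
    rw [sub_zero] at h3
    refine le_trans ?_ h3
    have h4 : τ = τ ^ H * τ ^ (1 - H) := by
      rcases h0.eq_or_lt with h5 | h5
      · rw [← h5, Real.zero_rpow hH.1.ne', zero_mul]
      · rw [← Real.rpow_add h5]; simp
    have h6 : a * τ * (τ ^ H + (1 + 1 / a)) =
        τ ^ H * (a * τ + (a + 1) * τ ^ (1 - H)) := by
      have : a * τ * (1 + 1 / a) = (a + 1) * τ := by field_simp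
      rw [mul_add, this]
      nth_rewrite 3 [h4]
      ring
    rw [h6]
    have h7 : 0 ≤ τ ^ H := Real.rpow_nonneg h0 _
    nlinarith
  -- positivity
  have hpos : ∀ τ, 0 < τ → 0 < ‖X τ - X 0‖ := by
    intro τ hτ
    by_contra hcon
    have hz : ‖X τ - X 0‖ = 0 := le_antisymm (not_lt.mp hcon) (norm_nonneg _)
    have hstep : ∀ n : ℕ, X (n * τ) = X 0 := by
      intro n
      induction n with
      | zero => simp
      | succ n ih =>
        have h1 := h.norm_sub_sq_ouTransform hH ha ((n + 1 : ℕ) * τ) (n * τ)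
        rw [show ((n + 1 : ℕ) : ℝ) * τ - n * τ = τ by push_cast; ring, hv, hz] at h1
        have h2 : ouTransform a B ((n + 1 : ℕ) * τ) - ouTransform a B (n * τ) = 0 := by
          simpa using h1
        rw [← ih]
        exact sub_eq_zero.mp h2
    -- Along multiples of `τ` the covariance is both constant and convergent to zero, so the
    -- variance is zero and the process vanishes, against the small-time bound.
    have hlim : Tendsto (fun n : ℕ => ouCov H a a (n * τ)) atTop (𝓝 0) :=
      (h.tendsto_ouCov hH ha ha).comp
        ((tendsto_natCast_atTop_atTop (R := ℝ)).atTop_mul_const hτ)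
    have hconst : ∀ n : ℕ, ouCov H a a (n * τ) = ouCov H a a 0 := by
      intro n
      have h1 := h.inner_ouTransform hB hB ha ha (n * τ) 0
      rw [show ouTransform a B (n * τ) = ouTransform a B 0 from hstep n,
        h.inner_ouTransform hB hB ha ha, one_mul, one_mul, sub_zero, sub_zero] at h1
      exact_mod_cast h1.symm
    simp_rw [hconst] at hlim
    have h0 : ouCov H a a 0 = 0 := tendsto_nhds_unique tendsto_const_nhds hlim
    have hX0 : ∀ t, X t = 0 := fun t => by
      have := h.norm_sq_ouTransform hH ha t
      rw [h0] at this
      simpa using this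
    have h1 := hsmall τ₀ hτ₀.le le_rfl
    rw [hX0, hX0, sub_zero, norm_zero] at h1
    have : 0 < τ₀ ^ H := Real.rpow_pos_of_pos hτ₀ _
    linarith
  have hXc : Continuous X := by
    rw [continuous_iff_continuousAt]
    intro u
    rw [ContinuousAt, tendsto_iff_norm_sub_tendsto_zero]
    refine squeeze_zero (fun _ => norm_nonneg _) (fun v => hB.norm_ouTransform_sub_le ha v u) ?_
    have hc : Continuous fun v : ℝ => 2 * |v - u| ^ H :=
      continuous_const.mul ((Real.continuous_rpow_const hH.1.le).comp (by fun_prop))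
    have := hc.tendsto u
    simpa [Real.zero_rpow hH.1.ne'] using this
  -- The maximum with `τ₀` keeps the interval nonempty for every `T`, including `T < τ₀`.
  obtain ⟨m, hm, hmin⟩ : ∃ m > 0, ∀ τ ∈ Set.Icc τ₀ (max T τ₀), m ≤ ‖X τ - X 0‖ ^ 2 := by
    obtain ⟨x, hx, hx'⟩ := (isCompact_Icc (a := τ₀) (b := max T τ₀)).exists_isMinOn
      ⟨τ₀, le_rfl, le_max_right _ _⟩
      (((hXc.sub continuous_const).norm.pow 2).continuousOn (f := fun τ => ‖X τ - X 0‖ ^ 2))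
    exact ⟨_, pow_pos (hpos x (hτ₀.trans_le hx.1)) 2, fun τ hτ => hx' hτ⟩
  have hM : 0 < (max T τ₀) ^ (2 * H) :=
    Real.rpow_pos_of_pos (hτ₀.trans_le (le_max_right _ _)) _
  -- `1/4` is the square of the `1/2` valid for small times; the other constant turns the minimum
  -- `m` into a multiple of `|τ|^(2H)` on the bounded remainder.
  refine ⟨min (1 / 4) (m / (max T τ₀) ^ (2 * H)), lt_min (by norm_num) (by positivity), ?_⟩
  intro τ hτ
  rw [← heven, hv]
  rcases le_total |τ| τ₀ with h1 | h1
  · have h2 := hsmall |τ| (abs_nonneg _) h1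
    have h3 : |τ| ^ (2 * H) = (|τ| ^ H) ^ 2 := by
      rw [mul_comm 2 H, Real.rpow_mul (abs_nonneg _), Real.rpow_two]
    have h4 : 0 ≤ |τ| ^ H := Real.rpow_nonneg (abs_nonneg _) _
    calc _ ≤ 1 / 4 * |τ| ^ (2 * H) :=
          mul_le_mul_of_nonneg_right (min_le_left _ _) (Real.rpow_nonneg (abs_nonneg _) _)
      _ ≤ _ := by rw [h3]; nlinarith
  · have h2 := hmin |τ| ⟨h1, hτ.trans (le_max_left _ _)⟩
    refine le_trans ?_ h2
    calc _ ≤ m / (max T τ₀) ^ (2 * H) * (max T τ₀) ^ (2 * H) :=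
          mul_le_mul (min_le_right _ _) (Real.rpow_le_rpow (abs_nonneg _)
            (hτ.trans (le_max_left _ _)) (by linarith [hH.1]))
            (Real.rpow_nonneg (abs_nonneg _) _) (by positivity)
      _ = m := by field_simp

end Hilbert

end

noncomputable section

/-! ### Chaining -/

section Chaining

universe u

/-- The dyadic point `u / 2^n`. -/
def dyadicPoint {d : ℕ} (n : ℕ) (u : Fin d → ℕ) : Fin d → ℝ := fun i => (u i : ℝ) / 2 ^ n

/-- The indices of the dyadic points of level `n` in the unit cube. -/
def dyadicIndex (d n : ℕ) : Finset (Fin d → ℕ) := Fintype.piFinset fun _ => Finset.range (2 ^ n)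

theorem dyadicPoint_mem {d n : ℕ} {u : Fin d → ℕ} (hu : u ∈ dyadicIndex d n) :
    dyadicPoint n u ∈ Set.Icc (0 : Fin d → ℝ) 1 := by
  simp only [dyadicIndex, Fintype.mem_piFinset, Finset.mem_range] at hu
  constructor
  · intro i
    simp only [dyadicPoint, Pi.zero_apply]
    positivity
  · intro i
    simp only [dyadicPoint, Pi.one_apply]
    rw [div_le_one (by positivity)]
    exact_mod_cast (hu i).le

theorem half_mem_dyadicIndex {d n : ℕ} {u : Fin d → ℕ} (hu : u ∈ dyadicIndex d (n + 1)) :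
    (fun i => u i / 2) ∈ dyadicIndex d n := by
  simp only [dyadicIndex, Fintype.mem_piFinset, Finset.mem_range] at hu ⊢
  intro i
  have := hu i
  rw [pow_succ] at this
  omega

theorem dist_dyadicPoint_half {d n : ℕ} (u : Fin d → ℕ) :
    dist (dyadicPoint (n + 1) u) (dyadicPoint n fun i => u i / 2) ≤ (1 / 2) ^ n := by
  rw [dist_pi_le_iff (by positivity)]
  intro i
  have h1 : (u i : ℝ) = 2 * (u i / 2 : ℕ) + (u i % 2 : ℕ) := by
    exact_mod_cast (Nat.div_add_mod (u i) 2).symm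
  have h2 : ((u i % 2 : ℕ) : ℝ) ≤ 1 := by
    exact_mod_cast Nat.lt_succ_iff.mp (Nat.mod_lt _ two_pos)
  have h3 : (0 : ℝ) ≤ ((u i % 2 : ℕ) : ℝ) := by positivity
  simp only [dyadicPoint]
  rw [Real.dist_eq, h1, pow_succ]
  have h4 : (2 * ((u i / 2 : ℕ) : ℝ) + ((u i % 2 : ℕ) : ℝ)) / (2 ^ n * 2) -
      ((u i / 2 : ℕ) : ℝ) / 2 ^ n = ((u i % 2 : ℕ) : ℝ) / 2 * (1 / 2) ^ n := by
    rw [one_div, inv_pow]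
    field_simp
    ring
  rw [h4, abs_of_nonneg (by positivity)]
  have : (0 : ℝ) < (1 / 2) ^ n := by positivity
  nlinarith

theorem lintegral_le_rpow_lintegral_rpow {Ω : Type*} [MeasurableSpace Ω] {P : Measure Ω}
    [IsProbabilityMeasure P] {g : Ω → ℝ≥0∞} (hg : Measurable g) {k : ℝ} (hk : 1 ≤ k) :
    ∫⁻ ω, g ω ∂P ≤ (∫⁻ ω, g ω ^ k ∂P) ^ (1 / k) := by
  have h := eLpNorm'_le_eLpNorm'_of_exponent_le (p := 1) (q := k) one_pos hk P
    hg.aestronglyMeasurable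
  simpa [eLpNorm'] using h

/-- Level `n + 1` has `2^((n+1)d)` points and mesh of order `2^(-n)`. The terms are geometric of
ratio `2^(d/k - γ)`, and `d < kγ` says exactly that this is below 1. -/
theorem tsum_chaining_ne_top {d : ℕ} {k γ : ℝ} (hk : 1 ≤ k) (hdk : d < k * γ) :
    ∑' n : ℕ, ENNReal.ofReal ((((2 : ℝ) ^ (n + 1)) ^ d) ^ (1 / k) * ((1 / 2) ^ n) ^ γ) ≠ ∞ := by
  have hk0 : 0 < k := by linarith
  have hterm : ∀ n : ℕ, (((2 : ℝ) ^ (n + 1)) ^ d) ^ (1 / k) * ((1 / 2) ^ n) ^ γ =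
      (2 : ℝ) ^ ((d : ℝ) / k) * ((2 : ℝ) ^ ((d : ℝ) / k - γ)) ^ n := by
    intro n
    rw [one_div 2, inv_pow, ← Real.rpow_natCast 2 n, ← Real.rpow_natCast 2 (n + 1),
      ← Real.rpow_mul_natCast (by norm_num), ← Real.rpow_mul (by norm_num),
      ← Real.rpow_neg (by norm_num), ← Real.rpow_mul (by norm_num),
      ← Real.rpow_mul_natCast (by norm_num), ← Real.rpow_add (by norm_num),
      ← Real.rpow_add (by norm_num)]
    congr 1
    push_cast
    field_simp
    ring
  simp_rw [hterm]
  rw [← ENNReal.ofReal_tsum_of_nonneg (fun n => by positivity)]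
  · exact ENNReal.ofReal_ne_top
  · refine (summable_geometric_of_lt_one (by positivity) ?_).mul_left _
    refine Real.rpow_lt_one_of_one_lt_of_neg (by norm_num) ?_
    rw [sub_neg, div_lt_iff₀ hk0]
    linarith [mul_comm k γ]

/-- A bound for the expected supremum of a continuous random field on the unit cube. -/
theorem exists_lintegral_sup_bound (d : ℕ) {k γ : ℝ} (hk : 1 ≤ k) (hγ : 0 < γ)
    (hdk : d < k * γ) :
    ∃ C : ℝ≥0∞, C ≠ ∞ ∧ ∀ {Ω : Type u} [MeasurableSpace Ω] (P : Measure Ω)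
      [IsProbabilityMeasure P] (f : (Fin d → ℝ) → Ω → ℂ) (M : ℝ≥0∞),
      (∀ ω, Continuous fun p => f p ω) → (∀ p, Measurable (f p)) →
      ∫⁻ ω, ‖f 0 ω‖ₑ ∂P ≤ M →
      (∀ p ∈ Set.Icc (0 : Fin d → ℝ) 1, ∀ q ∈ Set.Icc (0 : Fin d → ℝ) 1,
        ∫⁻ ω, ‖f p ω - f q ω‖ₑ ^ k ∂P ≤ (M * ENNReal.ofReal (dist p q) ^ γ) ^ k) →
      ∃ K : Ω → ℝ≥0∞, Measurable K ∧
        (∀ ω p, (∀ i, 0 ≤ p i ∧ p i < 1) → ‖f p ω‖ₑ ≤ K ω) ∧ ∫⁻ ω, K ω ∂P ≤ C * M := by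
  have hk0 : 0 < k := by linarith
  refine ⟨1 + ∑' n : ℕ, ENNReal.ofReal ((((2 : ℝ) ^ (n + 1)) ^ d) ^ (1 / k) * ((1 / 2) ^ n) ^ γ),
    ENNReal.add_ne_top.mpr ⟨ENNReal.one_ne_top, tsum_chaining_ne_top hk hdk⟩, ?_⟩
  intro Ω _ P _ f M hcont hmeas h0 hinc
  -- Increment between a dyadic point and its parent at the next coarser level, obtained by halving
  -- the indices.
  set Δ : ℕ → (Fin d → ℕ) → Ω → ℂ := fun n u ω =>
    f (dyadicPoint (n + 1) u) ω - f (dyadicPoint n fun i => u i / 2) ω with hΔ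
  have hΔm : ∀ n u, Measurable (Δ n u) := fun n u => (hmeas _).sub (hmeas _)
  -- The `ℓ^k` norm replaces the maximum over a level: it dominates it, and its `k`-th moment is a
  -- plain sum of moments of increments.
  set Kn : ℕ → Ω → ℝ≥0∞ := fun n ω =>
    (∑ u ∈ dyadicIndex d (n + 1), ‖Δ n u ω‖ₑ ^ k) ^ (1 / k) with hKn
  have hKm : ∀ n, Measurable (Kn n) := fun n =>
    (Finset.measurable_sum _ fun u _ => ((hΔm n u).enorm).pow_const k).pow_const _
  have hKle : ∀ n, ∀ u ∈ dyadicIndex d (n + 1), ∀ ω, ‖Δ n u ω‖ₑ ≤ Kn n ω := by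
    intro n u hu ω
    calc ‖Δ n u ω‖ₑ = (‖Δ n u ω‖ₑ ^ k) ^ (1 / k) := by
          rw [one_div, ENNReal.rpow_rpow_inv hk0.ne']
      _ ≤ _ := ENNReal.rpow_le_rpow
          (Finset.single_le_sum (f := fun u => ‖Δ n u ω‖ₑ ^ k) (fun _ _ => zero_le) hu)
          (by positivity)
  have hKint : ∀ n, ∫⁻ ω, Kn n ω ∂P ≤
      ENNReal.ofReal ((((2 : ℝ) ^ (n + 1)) ^ d) ^ (1 / k) * ((1 / 2) ^ n) ^ γ) * M := by
    intro n
    refine (lintegral_le_rpow_lintegral_rpow (hKm n) hk).trans ?_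
    have h1 : ∀ ω, Kn n ω ^ k = ∑ u ∈ dyadicIndex d (n + 1), ‖Δ n u ω‖ₑ ^ k := by
      intro ω
      rw [hKn]
      simp only
      rw [one_div, ENNReal.rpow_inv_rpow hk0.ne']
    simp_rw [h1]
    rw [lintegral_finsetSum _ fun u _ => ((hΔm n u).enorm).pow_const k]
    have h2 : ∑ u ∈ dyadicIndex d (n + 1), ∫⁻ ω, ‖Δ n u ω‖ₑ ^ k ∂P ≤
        ∑ u ∈ dyadicIndex d (n + 1), (M * ENNReal.ofReal ((1 / 2) ^ n) ^ γ) ^ k := by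
      refine Finset.sum_le_sum fun u hu => ?_
      refine (hinc _ (dyadicPoint_mem hu) _ (dyadicPoint_mem (half_mem_dyadicIndex hu))).trans ?_
      have := dist_dyadicPoint_half (n := n) u
      gcongr
    have h3 : (dyadicIndex d (n + 1)).card = (2 ^ (n + 1)) ^ d := by
      simp [dyadicIndex]
    rw [Finset.sum_const, h3, nsmul_eq_mul] at h2
    refine (ENNReal.rpow_le_rpow h2 (by positivity)).trans ?_
    rw [ENNReal.mul_rpow_of_nonneg _ _ (by positivity), one_div, ENNReal.rpow_rpow_inv hk0.ne',
      mul_comm M, ← mul_assoc]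
    refine mul_le_mul_left (le_of_eq ?_) _
    rw [ENNReal.ofReal_mul (by positivity),
      ← ENNReal.ofReal_rpow_of_nonneg (by positivity) (by positivity),
      ← ENNReal.ofReal_rpow_of_nonneg (by positivity) (by positivity)]
    congr 2
    rw [← ENNReal.ofReal_natCast]
    push_cast
    rfl
  refine ⟨fun ω => ‖f 0 ω‖ₑ + ∑' n, Kn n ω,
    (hmeas 0).enorm.add (Measurable.tsum hKm), ?_, ?_⟩
  · intro ω p hp
    -- Floors of `2^n p` are nested under halving, so the values of `f` along them telescope into
    -- increments from child to parent. `p < 1` puts the indices in range and makes the level-zero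
    -- point the origin.
    set v : ℕ → Fin d → ℕ := fun n i => ⌊2 ^ n * p i⌋₊ with hv
    have hvmem : ∀ n, v n ∈ dyadicIndex d n := by
      intro n
      simp only [dyadicIndex, Fintype.mem_piFinset, Finset.mem_range]
      intro i
      rw [hv]
      simp only
      rw [Nat.floor_lt (by have := (hp i).1; positivity)]
      push_cast
      have := (hp i).2
      have h2 : (0 : ℝ) < 2 ^ n := by positivity
      nlinarith
    have hhalf : ∀ n, (fun i => v (n + 1) i / 2) = v n := by
      intro n
      ext i
      rw [hv]
      simp only
      rw [← Nat.floor_div_natCast]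
      congr 1
      push_cast
      rw [pow_succ]
      ring
    have hlim : Tendsto (fun n => dyadicPoint n (v n)) atTop (𝓝 p) := by
      rw [tendsto_pi_nhds]
      intro i
      have h := tendsto_nat_floor_mul_div_atTop (R := ℝ) (hp i).1
      have h2 := h.comp (tendsto_pow_atTop_atTop_of_one_lt (one_lt_two : (1 : ℝ) < 2))
      refine h2.congr fun n => ?_
      simp [dyadicPoint, hv, mul_comm]
    have hN : ∀ N, ‖f (dyadicPoint N (v N)) ω‖ₑ ≤ ‖f 0 ω‖ₑ + ∑ n ∈ Finset.range N, Kn n ω := by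
      intro N
      induction N with
      | zero =>
        have : dyadicPoint 0 (v 0) = 0 := by
          ext i
          simp [dyadicPoint, hv, Nat.floor_eq_zero.mpr (hp i).2]
        simp [this]
      | succ n ih =>
        have h1 : f (dyadicPoint (n + 1) (v (n + 1))) ω =
            f (dyadicPoint n (v n)) ω + Δ n (v (n + 1)) ω := by
          rw [hΔ]
          simp only [hhalf]
          ring
        rw [h1, Finset.sum_range_succ, ← add_assoc]
        exact (enorm_add_le _ _).trans (add_le_add ih (hKle n _ (hvmem _) ω))
    have hl := ((hcont ω).tendsto p).comp hlim
    refine le_of_tendsto' ((continuous_enorm.tendsto _).comp hl) fun N => (hN N).trans ?_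
    exact add_le_add_right (ENNReal.sum_le_tsum _) _
  · rw [lintegral_add_left (hmeas 0).enorm, lintegral_tsum fun n => (hKm n).aemeasurable,
      add_mul, one_mul, ← ENNReal.tsum_mul_right]
    exact add_le_add h0 (ENNReal.tsum_le_tsum hKint)

end Chaining

end

noncomputable section

/-! ### The maximal ergodic inequality and almost sure convergence of Birkhoff averages -/

section Birkhoff

variable {X : Type*} [MeasurableSpace X] {μ : Measure X} {θ : X → X}

/-- The maximum of the Birkhoff sums of order at most `n`. -/
def birkhoffMax (θ : X → X) (g : X → ℝ) : ℕ → X → ℝ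
  | 0, _ => 0
  | n + 1, x => max 0 (g x + birkhoffMax θ g n (θ x))

theorem birkhoffMax_nonneg (g : X → ℝ) (n : ℕ) (x : X) : 0 ≤ birkhoffMax θ g n x := by
  cases n with
  | zero => exact le_rfl
  | succ n => exact le_max_left _ _

theorem birkhoffMax_le_succ (g : X → ℝ) (n : ℕ) (x : X) :
    birkhoffMax θ g n x ≤ birkhoffMax θ g (n + 1) x := by
  induction n generalizing x with
  | zero => exact birkhoffMax_nonneg g 1 x
  | succ n ih => exact max_le_max le_rfl (add_le_add le_rfl (ih (θ x)))

theorem birkhoffSum_le_birkhoffMax (g : X → ℝ) (n : ℕ) (x : X) :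
    birkhoffSum θ g n x ≤ birkhoffMax θ g n x := by
  induction n generalizing x with
  | zero => simp [birkhoffMax]
  | succ n ih =>
    rw [birkhoffSum_succ']
    exact (add_le_add le_rfl (ih (θ x))).trans (le_max_right _ _)

theorem measurable_birkhoffMax (hθ : Measurable θ) {g : X → ℝ} (hg : Measurable g) (n : ℕ) :
    Measurable (birkhoffMax θ g n) := by
  induction n with
  | zero => exact measurable_const
  | succ n ih => exact measurable_const.max (hg.add (ih.comp hθ))

theorem integrable_birkhoffMax (hθ : MeasurePreserving θ μ μ) {g : X → ℝ} (hg : Integrable g μ)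
    (n : ℕ) : Integrable (birkhoffMax θ g n) μ := by
  induction n with
  | zero => exact integrable_zero X ℝ μ
  | succ n ih =>
    exact (integrable_zero X ℝ μ).sup (hg.add (hθ.integrable_comp_of_integrable ih))

/-- Garsia's argument. Where the maximum `M` is positive, its recursion and monotonicity in `n` give
`M ≤ g + M ∘ θ`. Since `M ≥ 0` vanishes elsewhere and `θ` preserves the measure, integrating leaves
`0 ≤ ∫ g` over that set. -/
theorem setIntegral_birkhoffMax_nonneg (hθ : MeasurePreserving θ μ μ) {g : X → ℝ}
    (hgm : Measurable g) (hg : Integrable g μ) (n : ℕ) :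
    0 ≤ ∫ x in {x | 0 < birkhoffMax θ g n x}, g x ∂μ := by
  set M := birkhoffMax θ g n with hM
  have hMi : Integrable M μ := integrable_birkhoffMax hθ hg n
  have hMm : Measurable M := measurable_birkhoffMax hθ.measurable hgm n
  have hA : MeasurableSet {x | 0 < M x} := measurableSet_lt measurable_const hMm
  have hMθ : Integrable (fun x => M (θ x)) μ := hθ.integrable_comp_of_integrable hMi
  have h1 : ∫ x in {x | 0 < M x}, (M x - M (θ x)) ∂μ ≤ ∫ x in {x | 0 < M x}, g x ∂μ := by
    refine setIntegral_mono_on (hMi.sub hMθ).integrableOn hg.integrableOn hA fun x hx => ?_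
    have hx' : 0 < M x := hx
    cases n with
    | zero => exact absurd hx' (lt_irrefl _)
    | succ n =>
      have h2 : M x = g x + birkhoffMax θ g n (θ x) := by
        rcases max_choice 0 (g x + birkhoffMax θ g n (θ x)) with h3 | h3
        · exact absurd (show M x = 0 from h3) hx'.ne'
        · exact h3
      have h3 := birkhoffMax_le_succ (θ := θ) g n (θ x)
      rw [h2]
      linarith
  have h2 : ∫ x in {x | 0 < M x}, M x ∂μ = ∫ x, M x ∂μ := by
    refine setIntegral_eq_integral_of_forall_compl_eq_zero fun x hx => ?_
    exact le_antisymm (not_lt.mp hx) (birkhoffMax_nonneg g n x)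
  have h3 : ∫ x in {x | 0 < M x}, M (θ x) ∂μ ≤ ∫ x, M (θ x) ∂μ :=
    setIntegral_le_integral hMθ (ae_of_all _ fun x => birkhoffMax_nonneg g n (θ x))
  have h4 : ∫ x, M (θ x) ∂μ = ∫ x, M x ∂μ := by
    have := integral_map (μ := μ) hθ.measurable.aemeasurable (f := M)
      (by rw [hθ.map_eq]; exact hMi.aestronglyMeasurable)
    rw [← this, hθ.map_eq]
  rw [integral_sub hMi.integrableOn hMθ.integrableOn] at h1
  linarith

/-- The weak-type bound: the maximal inequality for `h - l`, whose Birkhoff sums are positive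
exactly where those of `h` exceed `l n`, followed by an increasing union over the horizon. -/
theorem measure_birkhoffSum_gt_le [IsProbabilityMeasure μ] (hθ : MeasurePreserving θ μ μ)
    {h : X → ℝ} (hm : Measurable h) (hi : Integrable h μ) (h0 : ∀ x, 0 ≤ h x) {l : ℝ}
    (hl : 0 < l) :
    μ {x | ∃ n : ℕ, l * n < birkhoffSum θ h n x} ≤ ENNReal.ofReal ((∫ x, h x ∂μ) / l) := by
  set g : X → ℝ := fun x => h x - l with hg
  have hgi : Integrable g μ := hi.sub (integrable_const l)
  have hgm : Measurable g := hm.sub_const l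
  have hsum : ∀ n x, birkhoffSum θ g n x = birkhoffSum θ h n x - l * n := by
    intro n x
    simp [birkhoffSum, hg, Finset.sum_sub_distrib, mul_comm]
  have hbound : ∀ n, μ {x | 0 < birkhoffMax θ g n x} ≤ ENNReal.ofReal ((∫ x, h x ∂μ) / l) := by
    intro n
    have hA : MeasurableSet {x | 0 < birkhoffMax θ g n x} :=
      measurableSet_lt measurable_const (measurable_birkhoffMax hθ.measurable hgm n)
    have h1 := setIntegral_birkhoffMax_nonneg hθ hgm hgi n
    rw [hg, integral_sub hi.integrableOn (integrable_const l).integrableOn, ← hg] at h1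
    rw [setIntegral_const] at h1
    have h2 : ∫ x in {x | 0 < birkhoffMax θ g n x}, h x ∂μ ≤ ∫ x, h x ∂μ :=
      setIntegral_le_integral hi (ae_of_all _ h0)
    rw [ENNReal.le_ofReal_iff_toReal_le (measure_ne_top _ _)
      (div_nonneg (integral_nonneg h0) hl.le), le_div_iff₀ hl]
    simp only [smul_eq_mul] at h1
    change μ.real _ * l ≤ _
    linarith
  have hsub : {x | ∃ n : ℕ, l * n < birkhoffSum θ h n x} ⊆
      ⋃ n, {x | 0 < birkhoffMax θ g n x} := by
    rintro x ⟨n, hn⟩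
    refine mem_iUnion.mpr ⟨n, ?_⟩
    have := birkhoffSum_le_birkhoffMax (θ := θ) g n x
    rw [hsum] at this
    have h1 : 0 < birkhoffMax θ g n x := by linarith
    exact h1
  refine (measure_mono hsub).trans ?_
  have hmono : Monotone fun n => {x | 0 < birkhoffMax θ g n x} := by
    refine monotone_nat_of_le_succ fun n x hx => ?_
    exact lt_of_lt_of_le hx (birkhoffMax_le_succ g n x)
  rw [hmono.measure_iUnion]
  exact iSup_le hbound

/-- Banach's principle: if the centred averages of `f` are asymptotically those of functions of
arbitrarily small `L¹` norm, the maximal inequality makes the set of bad points null. -/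
theorem ae_tendsto_birkhoffAverage_of_approx [IsProbabilityMeasure μ]
    (hθ : MeasurePreserving θ μ μ) {f : X → ℝ} {e : ℝ}
    (H : ∀ ε > 0, ∃ h : X → ℝ, Measurable h ∧ Integrable h μ ∧ ∫ x, |h x| ∂μ ≤ ε ∧
      ∀ᵐ x ∂μ, Tendsto (fun n => birkhoffAverage ℝ θ f n x - e - birkhoffAverage ℝ θ h n x)
        atTop (𝓝 0)) :
    ∀ᵐ x ∂μ, Tendsto (fun n => birkhoffAverage ℝ θ f n x) atTop (𝓝 e) := by
  have key : ∀ l > 0, ∀ᵐ x ∂μ, ∀ᶠ n in atTop, |birkhoffAverage ℝ θ f n x - e| ≤ 2 * l := by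
    intro l hl
    rw [ae_iff]
    refine le_antisymm (ENNReal.le_of_forall_pos_le_add fun ε hε _ => ?_) zero_le
    rw [zero_add]
    -- The factor `l` compensates the division by `l` in the weak-type bound.
    obtain ⟨h, hm, hi, hle, hae⟩ := H (ε * l) (by positivity)
    have h1 := measure_birkhoffSum_gt_le hθ hm.abs hi.abs (fun x => abs_nonneg (h x)) hl
    have h2 : ENNReal.ofReal ((∫ x, |h x| ∂μ) / l) ≤ ε := by
      rw [← ENNReal.ofReal_coe_nnreal]
      refine ENNReal.ofReal_le_ofReal ?_
      rw [div_le_iff₀ hl]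
      exact hle
    refine le_trans (measure_mono_ae ?_) (h1.trans h2)
    filter_upwards [hae] with x hx hcon
    change ∃ n : ℕ, _
    by_contra hno
    push Not at hno
    apply hcon
    filter_upwards [(tendsto_order.mp hx.abs).2 l (by simpa using hl), eventually_gt_atTop 0]
      with n hn hn0
    have hn0' : (0 : ℝ) < n := by exact_mod_cast hn0
    have h3 : |birkhoffAverage ℝ θ h n x| ≤ l := by
      rw [birkhoffAverage, smul_eq_mul, abs_mul, abs_of_pos (by positivity), inv_mul_le_iff₀ hn0',
        mul_comm]
      refine le_trans ?_ (hno n)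
      exact Finset.abs_sum_le_sum_abs _ _
    have h4 := abs_add_le (birkhoffAverage ℝ θ f n x - e - birkhoffAverage ℝ θ h n x)
      (birkhoffAverage ℝ θ h n x)
    rw [sub_add_cancel] at h4
    linarith
  have h5 : ∀ᵐ x ∂μ, ∀ j : ℕ, ∀ᶠ n in atTop,
      |birkhoffAverage ℝ θ f n x - e| ≤ 2 * (1 / ((j : ℝ) + 1)) :=
    ae_all_iff.mpr fun j => key _ (by positivity)
  filter_upwards [h5] with x hx
  rw [Metric.tendsto_nhds]
  intro ε hε
  obtain ⟨j, hj⟩ := exists_nat_one_div_lt (show 0 < ε / 2 by positivity)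
  filter_upwards [hx j] with n hn
  rw [Real.dist_eq]
  linarith

theorem birkhoffAverage_birkhoffAverage (f : X → ℝ) (N n : ℕ) (x : X) :
    birkhoffAverage ℝ θ (birkhoffAverage ℝ θ f N) n x =
      (N : ℝ)⁻¹ * ∑ k ∈ Finset.range N, birkhoffAverage ℝ θ f n (θ^[k] x) := by
  simp only [birkhoffAverage, birkhoffSum, smul_eq_mul, Finset.mul_sum]
  rw [Finset.sum_comm]
  refine Finset.sum_congr rfl fun k _ => Finset.sum_congr rfl fun j _ => ?_
  rw [← Function.iterate_add_apply, ← Function.iterate_add_apply, add_comm k j]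
  ring

theorem measurable_birkhoffAverage (hθ : Measurable θ) {f : X → ℝ} (hf : Measurable f) (n : ℕ) :
    Measurable (birkhoffAverage ℝ θ f n) := by
  have h : Measurable fun x => ∑ k ∈ Finset.range n, f (θ^[k] x) :=
    Finset.measurable_sum _ fun k _ => hf.comp (hθ.iterate k)
  exact h.const_smul (n : ℝ)⁻¹

/-- The approximant is the centred average of `f` of order `N`, small in `L¹` by mean convergence.
Averaging it again reproduces the averages of `f` up to finitely many time shifts, which are
negligible because `f` is bounded. -/
theorem ae_tendsto_birkhoffAverage_of_bounded [IsProbabilityMeasure μ]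
    (hθ : MeasurePreserving θ μ μ) {f : X → ℝ} (hf : Measurable f) {K : ℝ} (hK : ∀ x, |f x| ≤ K)
    {e : ℝ} (hmean : Tendsto (fun n => ∫ x, |birkhoffAverage ℝ θ f n x - e| ∂μ) atTop (𝓝 0)) :
    ∀ᵐ x ∂μ, Tendsto (fun n => birkhoffAverage ℝ θ f n x) atTop (𝓝 e) := by
  refine ae_tendsto_birkhoffAverage_of_approx hθ fun ε hε => ?_
  obtain ⟨N, hN, hN0⟩ := (((tendsto_order.mp hmean).2 ε hε).and (eventually_gt_atTop 0)).exists
  have hm : Measurable fun x => birkhoffAverage ℝ θ f N x - e :=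
    (measurable_birkhoffAverage hθ.measurable hf N).sub_const e
  have hN0' : (N : ℝ) ≠ 0 := by exact_mod_cast hN0.ne'
  refine ⟨fun x => birkhoffAverage ℝ θ f N x - e, hm, ?_, hN.le, ae_of_all _ fun x => ?_⟩
  · refine Integrable.of_bound hm.aestronglyMeasurable (K + |e|) (ae_of_all _ fun x => ?_)
    refine (norm_sub_le _ _).trans (add_le_add ?_ le_rfl)
    rw [birkhoffAverage, norm_smul, norm_inv, Real.norm_natCast,
      inv_mul_le_iff₀ (by positivity)]
    refine (norm_sum_le _ _).trans ((Finset.sum_le_sum fun k _ => hK _).trans ?_)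
    simp
  · have hb : Bornology.IsBounded (range f) := by
      rw [isBounded_iff_forall_norm_le]
      exact ⟨K, by rintro _ ⟨y, rfl⟩; exact hK y⟩
    have h1 : ∀ k, Tendsto (fun n => birkhoffAverage ℝ θ f n x -
        birkhoffAverage ℝ θ f n (θ^[k] x)) atTop (𝓝 0) := by
      intro k
      induction k with
      | zero => simp
      | succ k ih =>
        have h2 := tendsto_birkhoffAverage_apply_sub_birkhoffAverage' ℝ hb θ (θ^[k] x)
        have h3 := ih.sub h2
        rw [sub_zero] at h3
        refine h3.congr fun n => ?_
        rw [Function.iterate_succ_apply']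
        ring
    have h4 : Tendsto (fun n => (N : ℝ)⁻¹ * ∑ k ∈ Finset.range N,
        (birkhoffAverage ℝ θ f n x - birkhoffAverage ℝ θ f n (θ^[k] x))) atTop (𝓝 0) := by
      have := (tendsto_finsetSum (Finset.range N) fun k _ => h1 k).const_mul (N : ℝ)⁻¹
      simpa using this
    refine h4.congr' ?_
    filter_upwards [eventually_gt_atTop 0] with n hn
    have hn' : (n : ℝ) ≠ 0 := by exact_mod_cast hn.ne'
    have h5 : birkhoffAverage ℝ θ (fun x => birkhoffAverage ℝ θ f N x - e) n x =
        birkhoffAverage ℝ θ (birkhoffAverage ℝ θ f N) n x - e := by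
      simp only [birkhoffAverage, birkhoffSum, Finset.sum_sub_distrib, smul_eq_mul, mul_sub]
      simp [hn']
    rw [h5, birkhoffAverage_birkhoffAverage, Finset.sum_sub_distrib, mul_sub]
    simp [hN0']

end Birkhoff

end

noncomputable section

/-! ### Characters are dense in `L²` -/

section Characters

variable {V : Type*} [NormedAddCommGroup V] [NormedSpace ℝ V] [CompleteSpace V]
  [SecondCountableTopology V] [MeasurableSpace V] [BorelSpace V]
  {ν : Measure V} [IsProbabilityMeasure ν]

theorem norm_exp_dual (L : StrongDual ℝ V) (v : V) : ‖Complex.exp (L v * Complex.I)‖ = 1 :=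
  Complex.norm_exp_ofReal_mul_I _

theorem measurable_exp_dual (L : StrongDual ℝ V) :
    Measurable fun v => Complex.exp (L v * Complex.I) :=
  (by fun_prop : Continuous fun v => Complex.exp (L v * Complex.I)).measurable

theorem memLp_exp_dual (L : StrongDual ℝ V) :
    MemLp (fun v => Complex.exp (L v * Complex.I)) 2 ν :=
  MemLp.of_bound (measurable_exp_dual L).aestronglyMeasurable 1
    (ae_of_all _ fun v => (norm_exp_dual L v).le)

/-- The character `exp(i L)` in `L²`. -/
def charLp (ν : Measure V) [IsProbabilityMeasure ν] (L : StrongDual ℝ V) : Lp ℂ 2 ν :=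
  (memLp_exp_dual L).toLp

/-- The positive and negative parts of `r` are densities of two finite measures with the same
characteristic function, hence of the same measure. -/
theorem ae_eq_zero_of_integral_exp_dual {r : V → ℝ} (hr : Integrable r ν)
    (h : ∀ L : StrongDual ℝ V, ∫ v, Complex.exp (L v * Complex.I) * r v ∂ν = 0) : r =ᵐ[ν] 0 := by
  have hm : ∀ s : V → ℝ, Integrable s ν →
      AEMeasurable (fun v => ENNReal.ofReal (s v)) ν := fun s hs =>
    hs.aestronglyMeasurable.aemeasurable.ennreal_ofReal
  have hfin : ∀ s : V → ℝ, Integrable s ν →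
      IsFiniteMeasure (ν.withDensity fun v => ENNReal.ofReal (s v)) := fun s hs =>
    isFiniteMeasure_withDensity_ofReal hs.2
  have hrn : Integrable (fun v => -r v) ν := hr.neg
  have := hfin r hr
  have := hfin (fun v => -r v) hrn
  have hchar : ∀ (s : V → ℝ), Integrable s ν → ∀ L : StrongDual ℝ V,
      charFunDual (ν.withDensity fun v => ENNReal.ofReal (s v)) L =
        ∫ v, Complex.exp (L v * Complex.I) * (max (s v) 0 : ℝ) ∂ν := by
    intro s hs L
    rw [charFunDual_apply, integral_withDensity_eq_integral_toReal_smul₀ (hm s hs)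
      (ae_of_all _ fun v => ENNReal.ofReal_lt_top)]
    refine integral_congr_ae (ae_of_all _ fun v => ?_)
    simp only [ENNReal.toReal_ofReal', Complex.real_smul]
    rw [mul_comm]
  have hi : ∀ (s : V → ℝ), Integrable s ν → ∀ L : StrongDual ℝ V,
      Integrable (fun v => Complex.exp (L v * Complex.I) * (s v : ℂ)) ν := by
    intro s hs L
    refine (hs.ofReal (𝕜 := ℂ)).bdd_mul (c := 1) (measurable_exp_dual L).aestronglyMeasurable
      (ae_of_all _ fun v => (norm_exp_dual L v).le)
  have heq : ν.withDensity (fun v => ENNReal.ofReal (r v)) =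
      ν.withDensity fun v => ENNReal.ofReal (-r v) := by
    refine Measure.ext_of_charFunDual (funext fun L => ?_)
    rw [hchar r hr, hchar _ hrn, ← sub_eq_zero,
      ← integral_sub (hi _ hr.pos_part L) (hi _ hr.neg_part L), ← h L]
    refine integral_congr_ae (ae_of_all _ fun v => ?_)
    simp only
    rw [← mul_sub, ← Complex.ofReal_sub]
    congr 2
    rcases le_total 0 (r v) with h1 | h1
    · rw [max_eq_left h1, max_eq_right (by linarith)]; ring
    · rw [max_eq_right h1, max_eq_left (by linarith)]; ring
  have h2 := (withDensity_eq_iff (hm r hr) (hm _ hrn) (by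
    have := measure_ne_top (ν.withDensity fun v => ENNReal.ofReal (r v)) univ
    rwa [withDensity_apply _ MeasurableSet.univ, setLIntegral_univ] at this)).mp heq
  filter_upwards [h2] with v hv
  rcases lt_trichotomy (r v) 0 with h3 | h3 | h3
  · rw [ENNReal.ofReal_of_nonpos h3.le, eq_comm, ENNReal.ofReal_eq_zero] at hv
    exact absurd hv (by linarith)
  · exact h3
  · rw [ENNReal.ofReal_of_nonpos (by linarith : -r v ≤ 0), ENNReal.ofReal_eq_zero] at hv
    exact absurd hv (by linarith)

theorem inner_charLp (L : StrongDual ℝ V) (g : Lp ℂ 2 ν) :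
    inner ℂ (charLp ν L) g = ∫ v, Complex.exp (((-L) v : ℝ) * Complex.I) * g v ∂ν := by
  rw [L2.inner_def]
  refine integral_congr_ae ?_
  filter_upwards [(memLp_exp_dual (ν := ν) L).coeFn_toLp] with v hv
  rw [charLp, hv, RCLike.inner_apply, ← Complex.exp_conj, mul_comm]
  simp

/-- A function orthogonal to all characters has vanishing Fourier transform. Since `-L` ranges over
the functionals along with `L`, the conjugate function does too, so the real and imaginary parts can
be treated separately. -/
theorem closure_span_charLp :
    (Submodule.span ℂ (range (charLp ν))).topologicalClosure = ⊤ := by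
  rw [Submodule.topologicalClosure_eq_top_iff, Submodule.eq_bot_iff]
  intro g hg
  have h0 : ∀ L : StrongDual ℝ V, ∫ v, Complex.exp (L v * Complex.I) * g v ∂ν = 0 := by
    intro L
    have h1 := (Submodule.mem_orthogonal _ g).mp hg (charLp ν (-L))
      (Submodule.subset_span ⟨_, rfl⟩)
    rwa [inner_charLp, neg_neg] at h1
  have hgi : Integrable g ν := (Lp.memLp g).integrable (by norm_num)
  have hgi' : ∀ L : StrongDual ℝ V, Integrable (fun v => Complex.exp (L v * Complex.I) * g v) ν :=
    fun L => hgi.bdd_mul (c := 1) (measurable_exp_dual L).aestronglyMeasurable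
      (ae_of_all _ fun v => (norm_exp_dual L v).le)
  have h1 : ∀ L : StrongDual ℝ V,
      ∫ v, Complex.exp (L v * Complex.I) * (starRingEnd ℂ) (g v) ∂ν = 0 := by
    intro L
    have h2 := congrArg (starRingEnd ℂ) (h0 (-L))
    rw [← integral_conj, map_zero] at h2
    rw [← h2]
    refine integral_congr_ae (ae_of_all _ fun v => ?_)
    simp [← Complex.exp_conj]
  have hgc : Integrable (fun v => (starRingEnd ℂ) (g v)) ν :=
    Complex.conjCLE.toContinuousLinearMap.integrable_comp hgi
  have hgc' : ∀ L : StrongDual ℝ V,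
      Integrable (fun v => Complex.exp (L v * Complex.I) * (starRingEnd ℂ) (g v)) ν :=
    fun L => hgc.bdd_mul (c := 1) (measurable_exp_dual L).aestronglyMeasurable
      (ae_of_all _ fun v => (norm_exp_dual L v).le)
  have hre := ae_eq_zero_of_integral_exp_dual (ν := ν) (r := fun v => (g v).re) hgi.re (by
    intro L
    have : ∀ v, Complex.exp (L v * Complex.I) * ((g v).re : ℂ) =
        (1 / 2) * (Complex.exp (L v * Complex.I) * g v +
          Complex.exp (L v * Complex.I) * (starRingEnd ℂ) (g v)) := by
      intro v
      rw [Complex.re_eq_add_conj]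
      ring
    simp_rw [this]
    rw [integral_const_mul, integral_add (hgi' L) (hgc' L), h0, h1]
    simp)
  have him := ae_eq_zero_of_integral_exp_dual (ν := ν) (r := fun v => (g v).im) hgi.im (by
    intro L
    have : ∀ v, Complex.exp (L v * Complex.I) * ((g v).im : ℂ) =
        (1 / (2 * Complex.I)) * (Complex.exp (L v * Complex.I) * g v -
          Complex.exp (L v * Complex.I) * (starRingEnd ℂ) (g v)) := by
      intro v
      rw [Complex.im_eq_sub_conj]
      ring
    simp_rw [this]
    rw [integral_const_mul, integral_sub (hgi' L) (hgc' L), h0, h1]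
    simp)
  rw [Lp.eq_zero_iff_ae_eq_zero]
  filter_upwards [hre, him] with v h3 h4
  exact Complex.ext h3 h4

end Characters

/-! ### Mean convergence of averages of mixing sequences -/

section Mean

/-- When the square is expanded, each lag `j < N` occurs in at most `2N` ordered pairs. -/
theorem norm_sq_sum_le {E : Type*} [NormedAddCommGroup E] [InnerProductSpace ℂ E] {x : ℕ → E}
    {c : ℕ → ℝ} (hc0 : ∀ j, 0 ≤ c j) (hc : ∀ n j, ‖inner ℂ (x n) (x (n + j))‖ ≤ c j) (N : ℕ) :
    ‖∑ n ∈ Finset.range N, x n‖ ^ 2 ≤ 2 * N * ∑ j ∈ Finset.range N, c j := by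
  induction N with
  | zero => simp
  | succ N ih =>
    rw [Finset.sum_range_succ, @norm_add_sq ℂ]
    have h1 : RCLike.re (inner ℂ (∑ n ∈ Finset.range N, x n) (x N)) ≤
        ∑ j ∈ Finset.range N, c (j + 1) := by
      refine (RCLike.re_le_norm _).trans ?_
      rw [sum_inner]
      refine (norm_sum_le _ _).trans ?_
      rw [← Finset.sum_range_reflect]
      refine Finset.sum_le_sum fun j hj => ?_
      have hj' := Finset.mem_range.mp hj
      have h2 := hc (N - 1 - j) (j + 1)
      rwa [show N - 1 - j + (j + 1) = N by omega] at h2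
    have h2 : ‖x N‖ ^ 2 ≤ c 0 := by
      have := hc N 0
      rw [add_zero, inner_self_eq_norm_sq_to_K, norm_pow] at this
      simpa using this
    have h3 : ∑ j ∈ Finset.range (N + 1), c j = (∑ j ∈ Finset.range N, c (j + 1)) + c 0 :=
      Finset.sum_range_succ' c N
    have h4 : ∑ j ∈ Finset.range (N + 1), c j = (∑ j ∈ Finset.range N, c j) + c N :=
      Finset.sum_range_succ c N
    have h5 : 0 ≤ ∑ j ∈ Finset.range (N + 1), c j := Finset.sum_nonneg fun j _ => hc0 j
    have h6 : (2 * N : ℝ) * ∑ j ∈ Finset.range N, c j ≤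
        2 * N * ∑ j ∈ Finset.range (N + 1), c j := by
      rw [h4]
      have := hc0 N
      have : (0 : ℝ) ≤ 2 * N := by positivity
      nlinarith
    have h7 := hc0 0
    push_cast
    nlinarith

theorem tendsto_average_of_tendsto_inner {E : Type*} [NormedAddCommGroup E]
    [InnerProductSpace ℂ E] {x : ℕ → E} {c : ℕ → ℝ} (hc0 : ∀ j, 0 ≤ c j)
    (hc : ∀ n j, ‖inner ℂ (x n) (x (n + j))‖ ≤ c j) (hlim : Tendsto c atTop (𝓝 0)) :
    Tendsto (fun N : ℕ => (N : ℂ)⁻¹ • ∑ n ∈ Finset.range N, x n) atTop (𝓝 0) := by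
  rw [tendsto_zero_iff_norm_tendsto_zero]
  have h1 : Tendsto (fun N : ℕ => √(2 * ((N : ℝ)⁻¹ * ∑ j ∈ Finset.range N, c j))) atTop
      (𝓝 0) := by
    have := (hlim.cesaro.const_mul 2).sqrt
    simpa using this
  refine squeeze_zero' (Eventually.of_forall fun _ => norm_nonneg _) ?_ h1
  filter_upwards [eventually_gt_atTop 0] with N hN
  have hN' : (0 : ℝ) < N := by exact_mod_cast hN
  refine Real.le_sqrt_of_sq_le ?_
  rw [norm_smul, mul_pow, norm_inv, Complex.norm_natCast]
  refine (mul_le_mul_of_nonneg_left (norm_sq_sum_le hc0 hc N) (by positivity)).trans (le_of_eq ?_)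
  field_simp

variable {V : Type*} [NormedAddCommGroup V] [NormedSpace ℝ V] [CompleteSpace V]
  [SecondCountableTopology V] [MeasurableSpace V] [BorelSpace V]
  {ν : Measure V} [IsProbabilityMeasure ν] {Ω : Type*} [MeasurableSpace Ω] {P : Measure Ω}
  [IsProbabilityMeasure P]

/-- For a centred character, the inner product at times `n` and `n + j` is exactly the quantity
bounded in `hmix`, so its averages tend to zero in `L²`. Density of characters carries this to every
`g`. -/
theorem tendsto_average_lp {ψ : ℕ → Ω → V} (hψ : ∀ n, MeasurePreserving (ψ n) P ν)
    (hmix : ∀ L : StrongDual ℝ V, ∃ c : ℕ → ℝ, Tendsto c atTop (𝓝 0) ∧ ∀ n j,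
      ‖∫ ω, Complex.exp ((L (ψ (n + j) ω) - L (ψ n ω) : ℝ) * Complex.I) ∂P -
        (‖∫ v, Complex.exp (L v * Complex.I) ∂ν‖ : ℂ) ^ 2‖ ≤ c j) (g : Lp ℂ 2 ν) :
    Tendsto (fun N : ℕ => (N : ℂ)⁻¹ • ∑ n ∈ Finset.range N,
      (Lp.compMeasurePreservingₗᵢ ℂ (ψ n) (hψ n) g -
        (∫ v, g v ∂ν) • (Lp.const 2 P (1 : ℂ) : Lp ℂ 2 P))) atTop (𝓝 0) := by
  set one : Lp ℂ 2 P := Lp.const 2 P (1 : ℂ) with hone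
  have hone_norm : ‖one‖ ≤ 1 := by
    refine (Lp.norm_const_le 2 P (1 : ℂ)).trans ?_
    simp
  have hint : ∀ g : Lp ℂ 2 ν, inner ℂ (charLp ν 0) g = ∫ v, g v ∂ν := by
    intro g
    rw [inner_charLp]
    simp
  have hchar0 : ‖charLp ν (0 : StrongDual ℝ V)‖ ≤ 1 := by
    have h1 := Lp.norm_le_of_ae_bound (f := charLp ν (0 : StrongDual ℝ V)) (C := 1) zero_le_one
      (by
        filter_upwards [(memLp_exp_dual (ν := ν) (0 : StrongDual ℝ V)).coeFn_toLp] with v hv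
        rw [charLp, hv]
        exact (norm_exp_dual _ _).le)
    simpa [measureUnivNNReal] using h1
  -- Composition with `ψ n` minus the projection onto constants, since `charLp ν 0` is the constant
  -- function 1.
  set J : ℕ → Lp ℂ 2 ν →L[ℂ] Lp ℂ 2 P := fun n =>
    (Lp.compMeasurePreservingₗᵢ ℂ (ψ n) (hψ n)).toContinuousLinearMap -
      (innerSL ℂ (charLp ν 0)).smulRight one with hJ
  have hJg : ∀ n g, J n g = Lp.compMeasurePreservingₗᵢ ℂ (ψ n) (hψ n) g -
      (∫ v, g v ∂ν) • one := by
    intro n g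
    rw [hJ, ← hint]
    rfl
  have hJn : ∀ n g, ‖J n g‖ ≤ 2 * ‖g‖ := by
    intro n g
    rw [hJg]
    refine (norm_sub_le _ _).trans ?_
    rw [LinearIsometry.norm_map, norm_smul, ← hint]
    have h1 := norm_inner_le_norm (𝕜 := ℂ) (charLp ν 0) g
    have h2 : ‖charLp ν (0 : StrongDual ℝ V)‖ * ‖g‖ ≤ 1 * ‖g‖ :=
      mul_le_mul_of_nonneg_right hchar0 (norm_nonneg _)
    have h3 : ‖(inner ℂ (charLp ν 0) g : ℂ)‖ * ‖one‖ ≤ ‖g‖ * 1 :=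
      mul_le_mul (by linarith) hone_norm (norm_nonneg _) (norm_nonneg _)
    linarith
  set D : ℕ → Lp ℂ 2 ν →L[ℂ] Lp ℂ 2 P := fun N =>
    (N : ℂ)⁻¹ • ∑ n ∈ Finset.range N, J n with hD
  have hDg : ∀ N g, D N g = (N : ℂ)⁻¹ • ∑ n ∈ Finset.range N, J n g := by
    intro N g
    simp [hD]
  have hDn : ∀ N g, ‖D N g‖ ≤ 2 * ‖g‖ := by
    intro N g
    rw [hDg, norm_smul, norm_inv, Complex.norm_natCast]
    rcases Nat.eq_zero_or_pos N with h | h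
    · simp [h]
    · have hN' : (0 : ℝ) < N := by exact_mod_cast h
      rw [inv_mul_le_iff₀ hN']
      refine (norm_sum_le _ _).trans ((Finset.sum_le_sum fun n _ => hJn n g).trans ?_)
      simp
  -- The averaging operators have norm at most 2 uniformly in `N`, so the functions with vanishing
  -- limit form a closed subspace.
  let W : Submodule ℂ (Lp ℂ 2 ν) :=
    { carrier := {g | Tendsto (fun N => D N g) atTop (𝓝 0)}
      zero_mem' := by
        change Tendsto _ _ _
        simp
      add_mem' := by
        intro a b ha hb
        change Tendsto _ _ _
        have h : Tendsto (fun N => D N a + D N b) atTop (𝓝 (0 + 0)) := Tendsto.add ha hb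
        simpa [map_add] using h
      smul_mem' := by
        intro z a ha
        change Tendsto _ _ _
        have h : Tendsto (fun N => z • D N a) atTop (𝓝 (z • 0)) := Tendsto.const_smul ha z
        simpa [map_smul] using h }
  have hWc : IsClosed (W : Set (Lp ℂ 2 ν)) := by
    rw [← isSeqClosed_iff_isClosed]
    intro x y hx hxy
    change Tendsto (fun N => D N y) atTop (𝓝 0)
    rw [Metric.tendsto_nhds]
    intro ε hε
    obtain ⟨i, hi⟩ := ((Metric.tendsto_nhds.mp hxy) (ε / 4) (by positivity)).exists
    have hxi : Tendsto (fun N => D N (x i)) atTop (𝓝 0) := hx i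
    filter_upwards [(Metric.tendsto_nhds.mp hxi) (ε / 2) (by positivity)] with N hN
    rw [dist_zero_right] at hN ⊢
    rw [dist_comm, dist_eq_norm] at hi
    have h1 : D N y = D N (x i) + D N (y - x i) := by rw [map_sub]; abel
    have h2 := hDn N (y - x i)
    rw [h1]
    exact (norm_add_le _ _).trans_lt (by linarith)
  have hWchar : ∀ L, charLp ν L ∈ W := by
    intro L
    change Tendsto (fun N => D N (charLp ν L)) atTop (𝓝 0)
    simp_rw [hDg]
    obtain ⟨c, hc, hcb⟩ := hmix L
    have hc0 : ∀ j, 0 ≤ c j := fun j => (norm_nonneg _).trans (hcb 0 j)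
    refine tendsto_average_of_tendsto_inner hc0 (fun n j => ?_) hc
    refine le_trans (le_of_eq ?_) (hcb n j)
    set m : ℂ := ∫ v, Complex.exp (L v * Complex.I) ∂ν with hm
    have hcomp : ∀ n, (Lp.compMeasurePreservingₗᵢ ℂ (ψ n) (hψ n) (charLp ν L) : Lp ℂ 2 P) =ᵐ[P]
        fun ω => Complex.exp (L (ψ n ω) * Complex.I) := by
      intro n
      have h1 := Lp.coeFn_compMeasurePreserving (charLp ν L) (hψ n)
      have h2 := (hψ n).quasiMeasurePreserving.ae_eq_comp
        (memLp_exp_dual (ν := ν) L).coeFn_toLp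
      exact h1.trans h2
    have hJc : ∀ n, J n (charLp ν L) =ᵐ[P] fun ω => Complex.exp (L (ψ n ω) * Complex.I) - m := by
      intro n
      rw [hJg]
      have h3 : ∫ v, (charLp ν L) v ∂ν = m :=
        integral_congr_ae (memLp_exp_dual (ν := ν) L).coeFn_toLp
      rw [h3]
      filter_upwards [Lp.coeFn_sub (Lp.compMeasurePreservingₗᵢ ℂ (ψ n) (hψ n) (charLp ν L))
        (m • one), hcomp n, Lp.coeFn_smul m one, Lp.coeFn_const 2 P (1 : ℂ)] with ω h4 h5 h6 h7
      rw [h4, Pi.sub_apply, h5, h6, Pi.smul_apply, h7]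
      simp
    have hexp : ∀ n, ∫ ω, Complex.exp (L (ψ n ω) * Complex.I) ∂P = m := by
      intro n
      rw [hm, ← (hψ n).map_eq, integral_map (hψ n).measurable.aemeasurable
        (measurable_exp_dual L).aestronglyMeasurable]
    have hmeas : ∀ n, Measurable fun ω => Complex.exp (L (ψ n ω) * Complex.I) := fun n =>
      (measurable_exp_dual L).comp (hψ n).measurable
    have hei : ∀ n, Integrable (fun ω => Complex.exp (L (ψ n ω) * Complex.I)) P := fun n =>
      Integrable.of_bound (hmeas n).aestronglyMeasurable 1
        (ae_of_all _ fun ω => (norm_exp_dual L _).le)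
    rw [L2.inner_def]
    have h8 : ∫ ω, inner ℂ (J n (charLp ν L) ω) (J (n + j) (charLp ν L) ω) ∂P =
        ∫ ω, (Complex.exp ((L (ψ (n + j) ω) - L (ψ n ω) : ℝ) * Complex.I) -
          (starRingEnd ℂ m) * Complex.exp (L (ψ (n + j) ω) * Complex.I) -
          m * (starRingEnd ℂ) (Complex.exp (L (ψ n ω) * Complex.I)) +
          m * starRingEnd ℂ m) ∂P := by
      refine integral_congr_ae ?_
      filter_upwards [hJc n, hJc (n + j)] with ω h9 h10
      rw [h9, h10, RCLike.inner_apply]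
      have h11 : Complex.exp ((L (ψ (n + j) ω) - L (ψ n ω) : ℝ) * Complex.I) =
          Complex.exp (L (ψ (n + j) ω) * Complex.I) *
            (starRingEnd ℂ) (Complex.exp (L (ψ n ω) * Complex.I)) := by
        rw [← Complex.exp_conj, ← Complex.exp_add]
        congr 1
        simp
        ring
      rw [h11, map_sub]
      ring
    have hi1 : Integrable (fun ω =>
        Complex.exp ((L (ψ (n + j) ω) - L (ψ n ω) : ℝ) * Complex.I)) P := by
      refine Integrable.of_bound (Measurable.aestronglyMeasurable ?_) 1
        (ae_of_all _ fun ω => (Complex.norm_exp_ofReal_mul_I _).le)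
      have := (L.measurable.comp (hψ (n + j)).measurable).sub
        (L.measurable.comp (hψ n).measurable)
      exact (by fun_prop : Measurable fun x : ℝ => Complex.exp (x * Complex.I)).comp this
    have hi2 := (hei (n + j)).const_mul (starRingEnd ℂ m)
    have hconj : Integrable (fun ω => (starRingEnd ℂ) (Complex.exp (L (ψ n ω) * Complex.I))) P :=
      Complex.conjCLE.toContinuousLinearMap.integrable_comp (hei n)
    have hi3 := hconj.const_mul m
    have hi12 : Integrable (fun ω =>
        Complex.exp ((L (ψ (n + j) ω) - L (ψ n ω) : ℝ) * Complex.I) -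
        (starRingEnd ℂ m) * Complex.exp (L (ψ (n + j) ω) * Complex.I)) P := hi1.sub hi2
    have hi123 : Integrable (fun ω =>
        Complex.exp ((L (ψ (n + j) ω) - L (ψ n ω) : ℝ) * Complex.I) -
        (starRingEnd ℂ m) * Complex.exp (L (ψ (n + j) ω) * Complex.I) -
          m * (starRingEnd ℂ) (Complex.exp (L (ψ n ω) * Complex.I))) P := hi12.sub hi3
    rw [h8, integral_add hi123 (integrable_const _),
      integral_sub hi12 hi3, integral_sub hi1 hi2, integral_const_mul, hexp,
      integral_const_mul, integral_conj, hexp, integral_const, probReal_univ, one_smul,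
      ← Complex.conj_mul' m]
    congr 1
    ring
  have htop : W = ⊤ := by
    rw [eq_top_iff, ← closure_span_charLp (ν := ν)]
    refine Submodule.topologicalClosure_minimal _ (Submodule.span_le.mpr ?_) hWc
    rintro _ ⟨L, rfl⟩
    exact hWchar L
  have hg : g ∈ W := htop ▸ Submodule.mem_top
  have hg' : Tendsto (fun N => D N g) atTop (𝓝 0) := hg
  simp_rw [hDg, hJg] at hg'
  exact hg'

/-- Mean ergodic theorem for bounded observables of a mixing sequence. -/
theorem tendsto_integral_abs_average {ψ : ℕ → Ω → V} (hψ : ∀ n, MeasurePreserving (ψ n) P ν)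
    (hmix : ∀ L : StrongDual ℝ V, ∃ c : ℕ → ℝ, Tendsto c atTop (𝓝 0) ∧ ∀ n j,
      ‖∫ ω, Complex.exp ((L (ψ (n + j) ω) - L (ψ n ω) : ℝ) * Complex.I) ∂P -
        (‖∫ v, Complex.exp (L v * Complex.I) ∂ν‖ : ℂ) ^ 2‖ ≤ c j) {ρ : V → ℝ}
    (hρ : Measurable ρ) {K : ℝ} (hK : ∀ v, |ρ v| ≤ K) :
    Tendsto (fun N : ℕ => ∫ ω, |(N : ℝ)⁻¹ * ∑ n ∈ Finset.range N, ρ (ψ n ω) -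
      ∫ v, ρ v ∂ν| ∂P) atTop (𝓝 0) := by
  have hmem : MemLp (fun v => (ρ v : ℂ)) 2 ν :=
    MemLp.of_bound (Complex.measurable_ofReal.comp hρ).aestronglyMeasurable K
      (ae_of_all _ fun v => by rw [Complex.norm_real]; exact hK v)
  set gρ : Lp ℂ 2 ν := hmem.toLp (fun v => (ρ v : ℂ)) with hgρ
  have h1 := tendsto_average_lp hψ hmix gρ
  rw [tendsto_zero_iff_norm_tendsto_zero] at h1
  refine squeeze_zero' (Eventually.of_forall fun _ => integral_nonneg fun _ => abs_nonneg _) ?_ h1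
  filter_upwards [eventually_gt_atTop 0] with N hN
  have hN' : (N : ℂ) ≠ 0 := by exact_mod_cast hN.ne'
  set G : Lp ℂ 2 P := (N : ℂ)⁻¹ • ∑ n ∈ Finset.range N,
      (Lp.compMeasurePreservingₗᵢ ℂ (ψ n) (hψ n) gρ -
        (∫ v, gρ v ∂ν) • (Lp.const 2 P (1 : ℂ) : Lp ℂ 2 P)) with hG
  have hE : ∫ v, gρ v ∂ν = ((∫ v, ρ v ∂ν : ℝ) : ℂ) := by
    rw [integral_congr_ae hmem.coeFn_toLp, integral_complex_ofReal]
  have hcomp : ∀ n, (Lp.compMeasurePreservingₗᵢ ℂ (ψ n) (hψ n) gρ : Lp ℂ 2 P) =ᵐ[P]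
      fun ω => (ρ (ψ n ω) : ℂ) := by
    intro n
    have h1 := Lp.coeFn_compMeasurePreserving gρ (hψ n)
    have h2 := (hψ n).quasiMeasurePreserving.ae_eq_comp hmem.coeFn_toLp
    exact h1.trans h2
  have hGe : G =ᵐ[P] fun ω => (((N : ℝ)⁻¹ * ∑ n ∈ Finset.range N, ρ (ψ n ω) -
      ∫ v, ρ v ∂ν : ℝ) : ℂ) := by
    have h2 : ∀ᵐ ω ∂P, ∀ n, (Lp.compMeasurePreservingₗᵢ ℂ (ψ n) (hψ n) gρ -
        (∫ v, gρ v ∂ν) • (Lp.const 2 P (1 : ℂ) : Lp ℂ 2 P) : Lp ℂ 2 P) ω =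
        (ρ (ψ n ω) : ℂ) - ((∫ v, ρ v ∂ν : ℝ) : ℂ) := by
      rw [ae_all_iff]
      intro n
      filter_upwards [Lp.coeFn_sub (Lp.compMeasurePreservingₗᵢ ℂ (ψ n) (hψ n) gρ)
        ((∫ v, gρ v ∂ν) • (Lp.const 2 P (1 : ℂ) : Lp ℂ 2 P)), hcomp n,
        Lp.coeFn_smul (∫ v, gρ v ∂ν) (Lp.const 2 P (1 : ℂ) : Lp ℂ 2 P),
        Lp.coeFn_const 2 P (1 : ℂ)] with ω h4 h5 h6 h7
      rw [h4, Pi.sub_apply, h5, h6, Pi.smul_apply, h7, hE]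
      simp
    filter_upwards [Lp.coeFn_smul (N : ℂ)⁻¹ (∑ n ∈ Finset.range N,
      (Lp.compMeasurePreservingₗᵢ ℂ (ψ n) (hψ n) gρ -
        (∫ v, gρ v ∂ν) • (Lp.const 2 P (1 : ℂ) : Lp ℂ 2 P))),
      Lp.coeFn_finsetSum (Finset.range N) (fun n =>
      (Lp.compMeasurePreservingₗᵢ ℂ (ψ n) (hψ n) gρ -
        (∫ v, gρ v ∂ν) • (Lp.const 2 P (1 : ℂ) : Lp ℂ 2 P))), h2] with ω h3 h4 h5
    rw [hG, h3, Pi.smul_apply, h4, Finset.sum_apply]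
    simp_rw [h5]
    rw [Finset.sum_sub_distrib, Finset.sum_const, Finset.card_range, smul_eq_mul, mul_sub,
      nsmul_eq_mul, inv_mul_cancel_left₀ hN']
    push_cast
    ring
  have h3 : ∫ ω, |(N : ℝ)⁻¹ * ∑ n ∈ Finset.range N, ρ (ψ n ω) - ∫ v, ρ v ∂ν| ∂P =
      ∫ ω, ‖G ω‖ ∂P := by
    refine integral_congr_ae ?_
    filter_upwards [hGe] with ω h
    rw [h, Complex.norm_real, Real.norm_eq_abs]
  rw [h3, integral_norm_eq_lintegral_enorm (Lp.aestronglyMeasurable G), Lp.norm_def,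
    ← eLpNorm_one_eq_lintegral_enorm]
  exact ENNReal.toReal_mono (Lp.eLpNorm_ne_top G)
    (eLpNorm_le_eLpNorm_of_exponent_le (by norm_num) (Lp.aestronglyMeasurable G))

end Mean

end

noncomputable section

/-! ### Time averages of stationary mixing processes with continuous paths -/

/-- Between integer times the error is at most `∫ |g|` over one unit interval. Divided by `N` it is
a difference of consecutive averages of `|g|`, up to a factor tending to 1; this is why averages of
`|g|` must converge as well. -/
theorem tendsto_timeAverage_of_nat {g : ℝ → ℝ} {e e' : ℝ}
    (hg : ∀ n : ℕ, IntervalIntegrable g volume 0 n)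
    (h1 : Tendsto (fun N : ℕ => (N : ℝ)⁻¹ * ∫ t in (0 : ℝ)..N, g t) atTop (𝓝 e))
    (h2 : Tendsto (fun N : ℕ => (N : ℝ)⁻¹ * ∫ t in (0 : ℝ)..N, |g t|) atTop (𝓝 e')) :
    (∀ T > 0, IntervalIntegrable g volume 0 T) ∧
      Tendsto (fun T : ℝ => (1 / T) * ∫ t in (0 : ℝ)..T, g t) atTop (𝓝 e) := by
  have hgi : ∀ T, 0 ≤ T → IntervalIntegrable g volume 0 T := by
    intro T hT
    refine (hg ⌈T⌉₊).mono_set ?_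
    rw [uIcc_of_le hT, uIcc_of_le (by positivity)]
    exact Icc_subset_Icc le_rfl (Nat.le_ceil T)
  refine ⟨fun T hT => hgi T hT.le, ?_⟩
  have h3 : Tendsto (fun N : ℕ => (N : ℝ)⁻¹ * ∫ t in (N : ℝ)..(N + 1 : ℕ), |g t|) atTop (𝓝 0) := by
    have h4 := (tendsto_add_atTop_iff_nat 1).mpr h2
    have h5 : Tendsto (fun N : ℕ => ((N + 1 : ℕ) : ℝ) / N) atTop (𝓝 1) := by
      have := (tendsto_natCast_div_add_atTop (1 : ℝ)).inv₀ one_ne_zero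
      simpa using this
    have h6 := (h4.mul h5).sub h2
    rw [mul_one, sub_self] at h6
    refine h6.congr' ?_
    filter_upwards [eventually_gt_atTop 0] with N hN
    have hN' : (N : ℝ) ≠ 0 := by exact_mod_cast hN.ne'
    have hN1 : ((N + 1 : ℕ) : ℝ) ≠ 0 := by positivity
    rw [← intervalIntegral.integral_add_adjacent_intervals (hg N).abs
      ((hg N).symm.trans (hg (N + 1))).abs]
    field_simp
    ring
  have h7 : Tendsto (fun T : ℝ => ⌊T⌋₊ / T * ((⌊T⌋₊ : ℝ)⁻¹ * ∫ t in (0 : ℝ)..⌊T⌋₊, g t))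
      atTop (𝓝 (1 * e)) :=
    (tendsto_nat_floor_div_atTop (R := ℝ)).mul (h1.comp tendsto_nat_floor_atTop)
  have h8 : Tendsto (fun T : ℝ => (1 / T) * ∫ t in (⌊T⌋₊ : ℝ)..T, g t) atTop (𝓝 0) := by
    refine squeeze_zero_norm' ?_ (h3.comp (tendsto_nat_floor_atTop (α := ℝ)))
    filter_upwards [eventually_ge_atTop 1] with T hT
    have hT0 : 0 < T := by linarith
    have hfl : (⌊T⌋₊ : ℝ) ≤ T := Nat.floor_le hT0.le
    have hfl1 : T ≤ (⌊T⌋₊ + 1 : ℕ) := by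
      push_cast
      exact (Nat.lt_floor_add_one T).le
    have hfl0 : (0 : ℝ) < ⌊T⌋₊ := by exact_mod_cast Nat.floor_pos.mpr hT
    have hii : IntervalIntegrable (fun t => |g t|) volume (⌊T⌋₊ : ℝ) (⌊T⌋₊ + 1 : ℕ) :=
      ((hg _).symm.trans (hg _)).abs
    rw [norm_mul, Real.norm_of_nonneg (by positivity), one_div]
    refine mul_le_mul (inv_anti₀ hfl0 hfl) ?_ (norm_nonneg _) (by positivity)
    refine (intervalIntegral.norm_integral_le_integral_norm hfl).trans ?_
    refine intervalIntegral.integral_mono_interval le_rfl hfl hfl1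
      (ae_of_all _ fun t => abs_nonneg _) hii
  have h9 := h7.add h8
  rw [one_mul, add_zero] at h9
  refine h9.congr' ?_
  filter_upwards [eventually_ge_atTop 1] with T hT
  have hT0 : 0 < T := by linarith
  have hfl0 : (0 : ℝ) < ⌊T⌋₊ := by exact_mod_cast Nat.floor_pos.mpr hT
  rw [← intervalIntegral.integral_add_adjacent_intervals (hg ⌊T⌋₊)
    ((hg _).symm.trans (hgi T hT0.le))]
  field_simp

section Paths

variable {V : Type*} [NormedAddCommGroup V] [NormedSpace ℝ V] [CompleteSpace V]
  [SecondCountableTopology V] [MeasurableSpace V] [BorelSpace V]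

/-- Continuous paths, with the `σ`-algebra generated by the evaluations. -/
abbrev ContPath (V : Type*) [TopologicalSpace V] : Type _ := {f : ℝ → V // Continuous f}

/-- The time shift. -/
def pathShift (f : ContPath V) : ContPath V := ⟨fun t => f.1 (t + 1), f.2.comp (by fun_prop)⟩

theorem measurable_pathShift : Measurable (pathShift (V := V)) := by
  refine Measurable.subtype_mk (measurable_pi_lambda _ fun t => ?_)
  exact (measurable_pi_apply (t + 1)).comp measurable_subtype_coe

theorem pathShift_iterate (n : ℕ) (f : ContPath V) (t : ℝ) :
    ((pathShift^[n]) f).1 t = f.1 (t + n) := by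
  induction n generalizing f t with
  | zero => simp
  | succ n ih =>
    rw [Function.iterate_succ_apply, ih]
    simp only [pathShift]
    rw [show t + n + 1 = t + ((n + 1 : ℕ) : ℝ) by push_cast; ring]

theorem measurable_path_eval : Measurable fun p : ContPath V × ℝ => p.1.1 p.2 := by
  have h := measurable_uncurry_of_continuous_of_measurable (α := ContPath V) (β := V) (ι := ℝ)
    (u := fun t f => f.1 t) (fun f => f.2)
    (fun t => (measurable_pi_apply t).comp measurable_subtype_coe)
  exact h.comp measurable_swap

/-- The average of an observable over the unit time interval. -/
def unitAverage (ρ : V → ℝ) (f : ContPath V) : ℝ := ∫ u in (0 : ℝ)..1, ρ (f.1 u)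

theorem measurable_unitAverage {ρ : V → ℝ} (hρ : Measurable ρ) : Measurable (unitAverage ρ) := by
  have h : unitAverage ρ = fun f => ∫ u, ρ (f.1 u) ∂(volume.restrict (Ioc (0 : ℝ) 1)) := by
    ext f
    rw [unitAverage, intervalIntegral.integral_of_le zero_le_one]
  rw [h]
  exact ((hρ.comp measurable_path_eval).stronglyMeasurable.integral_prod_right').measurable

theorem unitAverage_iterate (ρ : V → ℝ) (n : ℕ) (f : ContPath V) :
    unitAverage ρ ((pathShift^[n]) f) = ∫ u in (n : ℝ)..(n + 1 : ℕ), ρ (f.1 u) := by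
  simp only [unitAverage, pathShift_iterate]
  rw [intervalIntegral.integral_comp_add_right (fun u => ρ (f.1 u)), zero_add]
  push_cast
  rw [add_comm]

variable {μ : Measure (ContPath V)} [IsProbabilityMeasure μ] {ν : Measure V}
  [IsProbabilityMeasure ν]

/-- All one-dimensional marginals equal `ν`, so the integral of `|ρ|` over paths does not depend on
time and Fubini's theorem applies. It also yields local integrability along almost every path. -/
theorem integrable_path_eval (hν : ∀ t : ℝ, μ.map (fun f => f.1 t) = ν) {ρ : V → ℝ}
    (hρ : Measurable ρ) (hi : Integrable ρ ν) (a b : ℝ) :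
    Integrable (fun p : ContPath V × ℝ => ρ (p.1.1 p.2)) (μ.prod (volume.restrict (Ioc a b))) := by
  have hev : ∀ t : ℝ, Measurable fun f : ContPath V => f.1 t := fun t =>
    (measurable_pi_apply t).comp measurable_subtype_coe
  have hm : AEStronglyMeasurable (fun p : ContPath V × ℝ => ρ (p.1.1 p.2))
      (μ.prod (volume.restrict (Ioc a b))) := (hρ.comp measurable_path_eval).aestronglyMeasurable
  rw [integrable_prod_iff' hm]
  constructor
  · refine ae_of_all _ fun t => ?_
    have h := hi
    rw [← hν t, integrable_map_measure hρ.aestronglyMeasurable (hev t).aemeasurable] at h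
    exact h
  · have : ∀ t : ℝ, ∫ f : ContPath V, ‖ρ (f.1 t)‖ ∂μ = ∫ v, ‖ρ v‖ ∂ν := by
      intro t
      rw [← hν t, integral_map (hev t).aemeasurable hρ.norm.aestronglyMeasurable]
    simp_rw [this]
    exact integrable_const _

theorem integrable_unitAverage (hν : ∀ t : ℝ, μ.map (fun f => f.1 t) = ν) {ρ : V → ℝ}
    (hρ : Measurable ρ) (hi : Integrable ρ ν) :
    Integrable (unitAverage ρ) μ ∧ ∫ f, unitAverage ρ f ∂μ = ∫ v, ρ v ∂ν := by
  have hev : ∀ t : ℝ, Measurable fun f : ContPath V => f.1 t := fun t =>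
    (measurable_pi_apply t).comp measurable_subtype_coe
  have h : unitAverage ρ = fun f => ∫ u, ρ (f.1 u) ∂(volume.restrict (Ioc (0 : ℝ) 1)) := by
    ext f
    rw [unitAverage, intervalIntegral.integral_of_le zero_le_one]
  have h0 := integrable_path_eval hν hρ hi 0 1
  rw [h]
  refine ⟨h0.integral_prod_left, ?_⟩
  rw [integral_integral_swap h0]
  have : ∀ t : ℝ, ∫ f : ContPath V, ρ (f.1 t) ∂μ = ∫ v, ρ v ∂ν := by
    intro t
    rw [← hν t, integral_map (hev t).aemeasurable hρ.aestronglyMeasurable]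
  simp [this]

theorem measurePreserving_eval (hν : ∀ t : ℝ, μ.map (fun f => f.1 t) = ν) (t : ℝ) :
    MeasurePreserving (fun f : ContPath V => f.1 t) μ ν :=
  ⟨(measurable_pi_apply t).comp measurable_subtype_coe, hν t⟩

/-- For each phase `u` in the unit interval the samples at times `u + n` mix, so their averages
converge in mean. Integration over `u` gives mean convergence of the Birkhoff averages of
`unitAverage ρ`, the input of the bounded theorem. -/
theorem ae_tendsto_birkhoffAverage_unitAverage_of_bounded
    (hθ : MeasurePreserving pathShift μ μ) (hν : ∀ t : ℝ, μ.map (fun f => f.1 t) = ν)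
    (hmix : ∀ L : StrongDual ℝ V, ∃ c : ℕ → ℝ, Tendsto c atTop (𝓝 0) ∧ ∀ (t : ℝ) (j : ℕ),
      ‖∫ f : ContPath V, Complex.exp ((L (f.1 (t + j)) - L (f.1 t) : ℝ) * Complex.I) ∂μ -
        (‖∫ v, Complex.exp (L v * Complex.I) ∂ν‖ : ℂ) ^ 2‖ ≤ c j)
    {ρ : V → ℝ} (hρ : Measurable ρ) {K : ℝ} (hK : ∀ v, |ρ v| ≤ K) :
    ∀ᵐ f ∂μ, Tendsto (fun n => birkhoffAverage ℝ pathShift (unitAverage ρ) n f) atTop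
      (𝓝 (∫ v, ρ v ∂ν)) := by
  have hK0 : 0 ≤ K := (abs_nonneg _).trans (hK 0)
  have hFb : ∀ f, |unitAverage ρ f| ≤ K := by
    intro f
    have := intervalIntegral.norm_integral_le_of_norm_le_const (a := 0) (b := 1)
      (f := fun u => ρ (f.1 u)) (C := K) (fun u _ => hK _)
    simpa [unitAverage] using this
  refine ae_tendsto_birkhoffAverage_of_bounded hθ (measurable_unitAverage hρ) hFb ?_
  set e := ∫ v, ρ v ∂ν with he
  set φ : ℕ → ℝ → ℝ := fun N u =>
    ∫ f : ContPath V, |(N : ℝ)⁻¹ * ∑ n ∈ Finset.range N, ρ (f.1 (u + n)) - e| ∂μ with hφ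
  have hjm : ∀ N : ℕ, Measurable fun p : ContPath V × ℝ =>
      |(N : ℝ)⁻¹ * ∑ n ∈ Finset.range N, ρ (p.1.1 (p.2 + n)) - e| := by
    intro N
    have h1 : ∀ n : ℕ, Measurable fun p : ContPath V × ℝ => ρ (p.1.1 (p.2 + n)) := fun n =>
      hρ.comp (measurable_path_eval.comp
        (measurable_fst.prodMk (measurable_snd.add_const (n : ℝ))))
    have h2 : Measurable fun p : ContPath V × ℝ => ∑ n ∈ Finset.range N, ρ (p.1.1 (p.2 + n)) :=
      Finset.measurable_sum _ fun n _ => h1 n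
    exact ((h2.const_mul _).sub_const _).abs
  have hjb : ∀ (N : ℕ) (p : ContPath V × ℝ),
      |(N : ℝ)⁻¹ * ∑ n ∈ Finset.range N, ρ (p.1.1 (p.2 + n)) - e| ≤ K + |e| := by
    intro N p
    refine (abs_sub _ _).trans (add_le_add ?_ le_rfl)
    rw [abs_mul, abs_inv, Nat.abs_cast]
    rcases Nat.eq_zero_or_pos N with h | h
    · simp [h, hK0]
    · have hN' : (0 : ℝ) < N := by exact_mod_cast h
      rw [inv_mul_le_iff₀ hN']
      refine (Finset.abs_sum_le_sum_abs _ _).trans ((Finset.sum_le_sum fun n _ => hK _).trans ?_)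
      simp
  have hφ0 : ∀ u, Tendsto (fun N => φ N u) atTop (𝓝 0) := by
    intro u
    refine tendsto_integral_abs_average (ν := ν) (P := μ)
      (ψ := fun n f => f.1 (u + n)) (fun n => measurePreserving_eval hν _) (fun L => ?_) hρ hK
    obtain ⟨c, hc, hcb⟩ := hmix L
    refine ⟨c, hc, fun n j => ?_⟩
    have := hcb (u + n) j
    push_cast
    rw [← add_assoc]
    exact_mod_cast this
  have hφi : Tendsto (fun N => ∫ u in Ioc (0 : ℝ) 1, φ N u) atTop (𝓝 0) := by
    have := tendsto_integral_of_dominated_convergence (μ := volume.restrict (Ioc (0 : ℝ) 1))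
      (F := φ) (f := fun _ => 0) (fun _ => K + |e|) (fun N => ?_) (integrable_const _)
      (fun N => ae_of_all _ fun u => ?_) (ae_of_all _ hφ0)
    · simpa using this
    · exact ((hjm N).comp measurable_swap).stronglyMeasurable.integral_prod_right'.aestronglyMeasurable
    · refine (norm_integral_le_of_norm_le_const (C := K + |e|) (ae_of_all _ fun f => ?_)).trans ?_
      · rw [Real.norm_eq_abs, abs_abs]
        exact hjb N (f, u)
      · simp
  refine squeeze_zero' (Eventually.of_forall fun _ => integral_nonneg fun _ => abs_nonneg _) ?_ hφi
  filter_upwards [eventually_gt_atTop 0] with N hN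
  have hN' : (N : ℝ) ≠ 0 := by exact_mod_cast hN.ne'
  have hpi : Integrable (fun p : ContPath V × ℝ =>
      |(N : ℝ)⁻¹ * ∑ n ∈ Finset.range N, ρ (p.1.1 (p.2 + n)) - e|)
      (μ.prod (volume.restrict (Ioc (0 : ℝ) 1))) :=
    Integrable.of_bound (hjm N).aestronglyMeasurable (K + |e|)
      (ae_of_all _ fun p => by rw [Real.norm_eq_abs, abs_abs]; exact hjb N p)
  have hswap : ∫ u in Ioc (0 : ℝ) 1, φ N u = ∫ f : ContPath V, (∫ u : ℝ in Ioc (0 : ℝ) 1,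
      |(N : ℝ)⁻¹ * ∑ n ∈ Finset.range N, ρ (f.1 (u + n)) - e|) ∂μ :=
    (integral_integral_swap hpi).symm
  rw [hswap]
  refine integral_mono_of_nonneg (ae_of_all _ fun _ => abs_nonneg _) hpi.integral_prod_left
    (ae_of_all _ fun f => ?_)
  have hri : ∀ n : ℕ, Integrable (fun u => ρ (f.1 (u + n)))
      (volume.restrict (Ioc (0 : ℝ) 1)) := fun n =>
    Integrable.of_bound (hρ.comp (f.2.measurable.comp
      (measurable_id.add_const (n : ℝ)))).aestronglyMeasurable K
      (ae_of_all _ fun u => hK _)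
  have hF : birkhoffAverage ℝ pathShift (unitAverage ρ) N f - e =
      ∫ u in Ioc (0 : ℝ) 1, ((N : ℝ)⁻¹ * ∑ n ∈ Finset.range N, ρ (f.1 (u + n)) - e) := by
    rw [integral_sub ((integrable_finsetSum _ fun n _ => hri n).const_mul _) (integrable_const _),
      integral_const_mul, integral_finsetSum _ fun n _ => hri n]
    simp only [birkhoffAverage, birkhoffSum, unitAverage, pathShift_iterate, smul_eq_mul]
    simp [intervalIntegral.integral_of_le]
  simp only
  rw [hF]
  exact abs_integral_le_integral_abs

theorem exists_bounded_integral_abs_sub_le {ρ : V → ℝ} (hρ : Measurable ρ) (hi : Integrable ρ ν)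
    {ε : ℝ} (hε : 0 < ε) :
    ∃ (ρ' : V → ℝ) (K : ℝ), Measurable ρ' ∧ (∀ v, |ρ' v| ≤ K) ∧ ∫ v, |ρ v - ρ' v| ∂ν ≤ ε := by
  set r : ℕ → V → ℝ := fun n => {v | |ρ v| ≤ n}.indicator ρ with hr
  have hrm : ∀ n, Measurable (r n) := fun n =>
    hρ.indicator (measurableSet_le hρ.abs measurable_const)
  have hlim : Tendsto (fun n => ∫ v, |ρ v - r n v| ∂ν) atTop (𝓝 0) := by
    have := tendsto_integral_of_dominated_convergence (μ := ν) (F := fun n v => |ρ v - r n v|)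
      (f := fun _ => 0) (fun v => |ρ v|) (fun n => ((hρ.sub (hrm n)).abs).aestronglyMeasurable)
      hi.abs (fun n => ae_of_all _ fun v => ?_) (ae_of_all _ fun v => ?_)
    · simpa using this
    · rw [Real.norm_eq_abs, abs_abs]
      by_cases h : v ∈ {v | |ρ v| ≤ n}
      · simp only [hr, indicator_of_mem h, sub_self, abs_zero]
        exact abs_nonneg _
      · simp only [hr, indicator_of_notMem h, sub_zero, le_refl]
    · refine tendsto_const_nhds.congr' ?_
      filter_upwards [eventually_ge_atTop ⌈|ρ v|⌉₊] with n hn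
      have h : |ρ v| ≤ n := (Nat.le_ceil _).trans (Nat.cast_le.mpr hn)
      have h : v ∈ {v | |ρ v| ≤ n} := h
      simp [hr, indicator_of_mem h]
  obtain ⟨n, hn⟩ := ((tendsto_order.mp hlim).2 ε hε).exists
  refine ⟨r n, n, hrm n, fun v => ?_, hn.le⟩
  by_cases h : v ∈ {v | |ρ v| ≤ n}
  · simp only [hr, indicator_of_mem h]
    exact h
  · simp [hr, indicator_of_notMem h]

/-- Truncation reduces to a bounded observable; the centred remainder is the approximant of small
`L¹` norm required by `ae_tendsto_birkhoffAverage_of_approx`. -/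
theorem ae_tendsto_birkhoffAverage_unitAverage
    (hθ : MeasurePreserving pathShift μ μ) (hν : ∀ t : ℝ, μ.map (fun f => f.1 t) = ν)
    (hmix : ∀ L : StrongDual ℝ V, ∃ c : ℕ → ℝ, Tendsto c atTop (𝓝 0) ∧ ∀ (t : ℝ) (j : ℕ),
      ‖∫ f : ContPath V, Complex.exp ((L (f.1 (t + j)) - L (f.1 t) : ℝ) * Complex.I) ∂μ -
        (‖∫ v, Complex.exp (L v * Complex.I) ∂ν‖ : ℂ) ^ 2‖ ≤ c j)
    {ρ : V → ℝ} (hρ : Measurable ρ) (hi : Integrable ρ ν) :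
    ∀ᵐ f ∂μ, Tendsto (fun n => birkhoffAverage ℝ pathShift (unitAverage ρ) n f) atTop
      (𝓝 (∫ v, ρ v ∂ν)) := by
  refine ae_tendsto_birkhoffAverage_of_approx hθ fun ε hε => ?_
  -- Half of `ε` is spent on the remainder and half on its centring.
  obtain ⟨ρ', K, hρ', hK, hle⟩ := exists_bounded_integral_abs_sub_le hρ hi
    (show 0 < ε / 2 by positivity)
  have hi' : Integrable ρ' ν := Integrable.of_bound hρ'.aestronglyMeasurable K (ae_of_all _ hK)
  set e := ∫ v, ρ v ∂ν
  set e' := ∫ v, ρ' v ∂ν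
  have hF := integrable_unitAverage hν hρ hi
  have hF' := integrable_unitAverage hν hρ' hi'
  have hid : Integrable (fun v => |ρ v - ρ' v|) ν := (hi.sub hi').abs
  have hdm : Measurable fun v => |ρ v - ρ' v| := (hρ.sub hρ').abs
  have hFd := integrable_unitAverage hν hdm hid
  refine ⟨fun f => (unitAverage ρ f - unitAverage ρ' f) - (e - e'),
    ((measurable_unitAverage hρ).sub (measurable_unitAverage hρ')).sub_const _,
    (hF.1.sub hF'.1).sub (integrable_const _), ?_, ?_⟩
  · have hee : |e - e'| ≤ ∫ v, |ρ v - ρ' v| ∂ν := by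
      rw [← integral_sub hi hi']
      exact abs_integral_le_integral_abs
    have h1 : ∫ f, |(unitAverage ρ f - unitAverage ρ' f) - (e - e')| ∂μ ≤
        ∫ f, (unitAverage (fun v => |ρ v - ρ' v|) f + |e - e'|) ∂μ := by
      refine integral_mono_ae ((hF.1.sub hF'.1).sub (integrable_const _)).abs
        (hFd.1.add (integrable_const _)) ?_
      filter_upwards [(integrable_path_eval hν hρ hi 0 1).prod_right_ae,
        (integrable_path_eval hν hρ' hi' 0 1).prod_right_ae] with f h2 h3
      refine (abs_sub _ _).trans (add_le_add ?_ le_rfl)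
      simp only [unitAverage, intervalIntegral.integral_of_le zero_le_one]
      rw [← integral_sub h2 h3]
      exact abs_integral_le_integral_abs
    rw [integral_add hFd.1 (integrable_const _), hFd.2] at h1
    simp only [integral_const, probReal_univ, one_smul] at h1
    linarith
  · filter_upwards [ae_tendsto_birkhoffAverage_unitAverage_of_bounded hθ hν hmix hρ' hK] with f hf
    have h1 := hf.sub_const e'
    rw [sub_self] at h1
    refine h1.congr' ?_
    filter_upwards [eventually_gt_atTop 0] with n hn
    have hn' : (n : ℝ) ≠ 0 := by exact_mod_cast hn.ne'
    simp only [birkhoffAverage, birkhoffSum, Finset.sum_sub_distrib, smul_eq_mul, mul_sub]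
    simp only [Finset.sum_const, Finset.card_range, nsmul_eq_mul, inv_mul_cancel_left₀ hn']
    ring

variable {Ω : Type*} [MeasurableSpace Ω] {P : Measure Ω} [IsProbabilityMeasure P]

/-- Ergodic theorem for stationary mixing processes with continuous paths. -/
theorem ae_tendsto_timeAverage {ψ : ℝ → Ω → V} (hcont : ∀ ω, Continuous fun t => ψ t ω)
    (hmeas : ∀ t, Measurable (ψ t))
    (hstat : P.map (fun ω t => ψ (t + 1) ω) = P.map (fun ω t => ψ t ω))
    (hlaw : ∀ t, P.map (ψ t) = P.map (ψ 0))
    (hmix : ∀ L : StrongDual ℝ V, ∃ c : ℕ → ℝ, Tendsto c atTop (𝓝 0) ∧ ∀ (t : ℝ) (j : ℕ),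
      ‖∫ ω, Complex.exp ((L (ψ (t + j) ω) - L (ψ t ω) : ℝ) * Complex.I) ∂P -
        (‖∫ ω, Complex.exp (L (ψ 0 ω) * Complex.I) ∂P‖ : ℂ) ^ 2‖ ≤ c j)
    {ρ : V → ℝ} (hρ : Measurable ρ) (hi : Integrable (fun ω => ρ (ψ 0 ω)) P) :
    ∀ᵐ ω ∂P, (∀ T > 0, IntervalIntegrable (fun t => ρ (ψ t ω)) volume 0 T) ∧
      Tendsto (fun T : ℝ => (1 / T) * ∫ t in (0 : ℝ)..T, ρ (ψ t ω)) atTop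
        (𝓝 (∫ ω', ρ (ψ 0 ω') ∂P)) := by
  -- The probability space carries no time shift, so the problem is moved to path space, where the
  -- shift preserves the law by stationarity.
  let Φ : Ω → ContPath V := fun ω => ⟨fun t => ψ t ω, hcont ω⟩
  have hΦ : Measurable Φ := Measurable.subtype_mk (measurable_pi_lambda _ hmeas)
  set μ := P.map Φ with hμ
  have : IsProbabilityMeasure μ := Measure.isProbabilityMeasure_map hΦ.aemeasurable
  set ν := P.map (ψ 0) with hν'
  have : IsProbabilityMeasure ν := Measure.isProbabilityMeasure_map (hmeas 0).aemeasurable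
  have hev : ∀ t : ℝ, Measurable fun f : ContPath V => f.1 t := fun t =>
    (measurable_pi_apply t).comp measurable_subtype_coe
  have hν : ∀ t : ℝ, μ.map (fun f => f.1 t) = ν := by
    intro t
    rw [hμ, Measure.map_map (hev t) hΦ, ← hlaw t]
    rfl
  have hθ : MeasurePreserving pathShift μ μ := by
    refine ⟨measurable_pathShift, ?_⟩
    -- Measurable sets of continuous paths are traces of measurable sets of the full product, so it
    -- is enough to compare laws there.
    have hval : (μ.map pathShift).map Subtype.val = μ.map Subtype.val := by
      rw [hμ, Measure.map_map measurable_pathShift hΦ, Measure.map_map measurable_subtype_coe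
        (measurable_pathShift.comp hΦ), Measure.map_map measurable_subtype_coe hΦ]
      exact hstat
    ext A hA
    obtain ⟨B, hB, rfl⟩ := hA
    rw [← Measure.map_apply measurable_subtype_coe hB, hval,
      Measure.map_apply measurable_subtype_coe hB]
  have hmix' : ∀ L : StrongDual ℝ V, ∃ c : ℕ → ℝ, Tendsto c atTop (𝓝 0) ∧ ∀ (t : ℝ) (j : ℕ),
      ‖∫ f : ContPath V, Complex.exp ((L (f.1 (t + j)) - L (f.1 t) : ℝ) * Complex.I) ∂μ -
        (‖∫ v, Complex.exp (L v * Complex.I) ∂ν‖ : ℂ) ^ 2‖ ≤ c j := by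
    intro L
    obtain ⟨c, hc, hcb⟩ := hmix L
    refine ⟨c, hc, fun t j => ?_⟩
    rw [hμ, hν', integral_map hΦ.aemeasurable, integral_map (hmeas 0).aemeasurable]
    · exact hcb t j
    · exact (measurable_exp_dual L).aestronglyMeasurable
    · have h1 : Measurable fun f : ContPath V => L (f.1 (t + j)) - L (f.1 t) :=
        (L.measurable.comp (hev _)).sub (L.measurable.comp (hev _))
      exact ((by fun_prop : Measurable fun x : ℝ => Complex.exp (x * Complex.I)).comp
        h1).aestronglyMeasurable
  have hi' : Integrable ρ ν := by
    rw [hν', integrable_map_measure hρ.aestronglyMeasurable (hmeas 0).aemeasurable]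
    exact hi
  have he : ∫ ω', ρ (ψ 0 ω') ∂P = ∫ v, ρ v ∂ν := by
    rw [hν', integral_map (hmeas 0).aemeasurable hρ.aestronglyMeasurable]
  have hloc : ∀ᵐ f ∂μ, ∀ n : ℕ, Integrable (fun u => ρ (f.1 u))
      (volume.restrict (Ioc (0 : ℝ) n)) :=
    ae_all_iff.mpr fun n => (integrable_path_eval hν hρ hi' 0 n).prod_right_ae
  have h1 := ae_tendsto_birkhoffAverage_unitAverage hθ hν hmix' hρ hi'
  -- The same theorem for `|ρ|` supplies the control between integer times.
  have h2 := ae_tendsto_birkhoffAverage_unitAverage hθ hν hmix' hρ.abs hi'.abs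
  have hall : ∀ᵐ f ∂μ, (∀ T > 0, IntervalIntegrable (fun t => ρ (f.1 t)) volume 0 T) ∧
      Tendsto (fun T : ℝ => (1 / T) * ∫ t in (0 : ℝ)..T, ρ (f.1 t)) atTop (𝓝 (∫ v, ρ v ∂ν)) := by
    filter_upwards [hloc, h1, h2] with f h3 h4 h5
    have hii : ∀ n : ℕ, IntervalIntegrable (fun t => ρ (f.1 t)) volume 0 n := by
      intro n
      rw [intervalIntegrable_iff_integrableOn_Ioc_of_le (by positivity)]
      exact h3 n
    have hsum : ∀ (g : ℝ → ℝ), (∀ n : ℕ, IntervalIntegrable g volume 0 n) → ∀ N : ℕ,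
        ∑ n ∈ Finset.range N, ∫ u in (n : ℝ)..(n + 1 : ℕ), g u = ∫ u in (0 : ℝ)..N, g u := by
      intro g hg N
      have := intervalIntegral.sum_integral_adjacent_intervals (f := g) (μ := volume)
        (a := fun n : ℕ => (n : ℝ)) (n := N) (fun k _ => (hg k).symm.trans (hg (k + 1)))
      simpa using this
    refine tendsto_timeAverage_of_nat hii ?_ (e' := ∫ v, |ρ v| ∂ν) ?_
    · refine h4.congr fun N => ?_
      simp only [birkhoffAverage, birkhoffSum, unitAverage_iterate, smul_eq_mul]
      rw [hsum _ hii]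
    · refine h5.congr fun N => ?_
      simp only [birkhoffAverage, birkhoffSum, unitAverage_iterate, smul_eq_mul]
      rw [hsum _ fun n => (hii n).abs]
  rw [he]
  exact ae_of_ae_map hΦ.aemeasurable hall

end Paths

end

noncomputable section

section L2

variable {Ω : Type*} [MeasurableSpace Ω] {P : Measure Ω} [IsProbabilityMeasure P]

/-! ### Bochner integrals in `L²` are pathwise integrals -/

theorem ae_integrable_of_integrable_toLp {μ : Measure ℝ} [IsFiniteMeasure μ] {f : ℝ → Ω → ℂ}
    (hf : Measurable (Function.uncurry f)) (hF : ∀ r, MemLp (f r) 2 P)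
    (hi : Integrable (fun r => (hF r).toLp) μ) :
    Integrable (Function.uncurry f) (μ.prod P) := by
  rw [integrable_prod_iff hf.aestronglyMeasurable]
  refine ⟨ae_of_all _ fun r => (hF r).integrable (by norm_num), hi.norm.mono' ?_
    (ae_of_all _ fun r => ?_)⟩
  · exact (hf.norm.stronglyMeasurable.integral_prod_right').aestronglyMeasurable
  · rw [Real.norm_of_nonneg (integral_nonneg fun _ => norm_nonneg _)]
    rw [Lp.norm_toLp]
    have h1 : ∫ ω, ‖Function.uncurry f (r, ω)‖ ∂P = (eLpNorm (f r) 1 P).toReal := by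
      rw [eLpNorm_one_eq_lintegral_enorm,
        ← integral_norm_eq_lintegral_enorm (hF r).aestronglyMeasurable]
      rfl
    rw [h1]
    exact ENNReal.toReal_mono (hF r).eLpNorm_ne_top
      (eLpNorm_le_eLpNorm_of_exponent_le (by norm_num) (hF r).aestronglyMeasurable)

/-- Both sides have the same integral over every measurable set: pairing with an indicator commutes
with the Bochner integral, and Fubini's theorem swaps the pathwise one. This links the Hilbert-space
processes to their paths. -/
theorem coeFn_integral_toLp {μ : Measure ℝ} [IsFiniteMeasure μ] {f : ℝ → Ω → ℂ}
    (hf : Measurable (Function.uncurry f)) (hF : ∀ r, MemLp (f r) 2 P)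
    (hi : Integrable (fun r => (hF r).toLp) μ) :
    ((∫ r, (hF r).toLp ∂μ : Lp ℂ 2 P) : Ω → ℂ) =ᵐ[P] fun ω => ∫ r, f r ω ∂μ := by
  have hint := ae_integrable_of_integrable_toLp hf hF hi
  refine Integrable.ae_eq_of_forall_setIntegral_eq _ _
    ((Lp.memLp _).integrable (by norm_num)) hint.integral_prod_right fun A hA hAP => ?_
  rw [← L2.inner_indicatorConstLp_one hA hAP.ne, ← integral_inner hi]
  have hAi : Integrable (Function.uncurry f) (μ.prod (P.restrict A)) :=
    hint.mono_measure (Measure.prod_mono le_rfl Measure.restrict_le_self)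
  have hsw : ∫ ω in A, (∫ r, f r ω ∂μ) ∂P = ∫ r, (∫ ω in A, f r ω ∂P) ∂μ :=
    (integral_integral_swap hAi).symm
  rw [hsw]
  refine integral_congr_ae (ae_of_all _ fun r => ?_)
  simp only [L2.inner_indicatorConstLp_one]
  exact integral_congr_ae (ae_restrict_of_ae (hF r).coeFn_toLp)

/-! ### Gaussian elements of `L²` -/

/-- The real part of an element of `L²`. -/
def reL2 : Lp ℂ 2 P →L[ℝ] Lp ℝ 2 P := Complex.reCLM.compLpL 2 P

theorem coeFn_reL2 (Z : Lp ℂ 2 P) : (reL2 Z : Ω → ℝ) =ᵐ[P] fun ω => (Z ω).re :=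
  ContinuousLinearMap.coeFn_compLpL _ _

theorem norm_reL2_le (Z : Lp ℂ 2 P) : ‖reL2 Z‖ ≤ ‖Z‖ := by
  have h := ContinuousLinearMap.norm_compLp_le Complex.reCLM Z
  rw [Complex.reCLM_norm, one_mul] at h
  exact h

/-- The real part of `Z` is a centered Gaussian random variable. -/
def IsCenteredGaussianRe (Z : Lp ℂ 2 P) : Prop :=
  ∫ ω, Complex.exp (((Z ω).re : ℂ) * Complex.I) ∂P = Complex.exp (-(1 / 2 * ‖reL2 Z‖ ^ 2 : ℝ))

theorem measurable_re_Lp (Z : Lp ℂ 2 P) : AEMeasurable (fun ω => (Z ω).re) P :=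
  Complex.measurable_re.comp_aemeasurable (Lp.aestronglyMeasurable Z).aemeasurable

theorem integrable_exp_re (Z : Lp ℂ 2 P) :
    Integrable (fun ω => Complex.exp (((Z ω).re : ℂ) * Complex.I)) P := by
  refine Integrable.of_bound ?_ 1 (ae_of_all _ fun ω => (Complex.norm_exp_ofReal_mul_I _).le)
  exact ((by fun_prop : Measurable fun x : ℝ => Complex.exp (x * Complex.I)).comp_aemeasurable
    (measurable_re_Lp Z)).aestronglyMeasurable

theorem norm_exp_mul_I_sub_le (x y : ℝ) :
    ‖Complex.exp (x * Complex.I) - Complex.exp (y * Complex.I)‖ ≤ |x - y| := by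
  have h : Complex.exp (x * Complex.I) - Complex.exp (y * Complex.I) =
      Complex.exp (y * Complex.I) * (Complex.exp (Complex.I * (x - y : ℝ)) - 1) := by
    rw [mul_sub, ← Complex.exp_add]
    push_cast
    ring_nf
  rw [h, norm_mul, Complex.norm_exp_ofReal_mul_I, one_mul]
  exact Real.norm_exp_I_mul_ofReal_sub_one_le

theorem continuous_integral_exp_re :
    Continuous fun Z : Lp ℂ 2 P => ∫ ω, Complex.exp (((Z ω).re : ℂ) * Complex.I) ∂P := by
  refine (LipschitzWith.of_dist_le_mul (K := 1) fun Z W => ?_).continuous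
  rw [dist_eq_norm, dist_eq_norm, ← integral_sub (integrable_exp_re Z) (integrable_exp_re W),
    NNReal.coe_one, one_mul]
  have h1 : ∫ ω, ‖(Z - W) ω‖ ∂P ≤ ‖Z - W‖ := by
    rw [integral_norm_eq_lintegral_enorm (Lp.aestronglyMeasurable _),
      ← eLpNorm_one_eq_lintegral_enorm, Lp.norm_def]
    exact ENNReal.toReal_mono (Lp.eLpNorm_ne_top _)
      (eLpNorm_le_eLpNorm_of_exponent_le (by norm_num) (Lp.aestronglyMeasurable _))
  refine (norm_integral_le_integral_norm _).trans (le_trans ?_ h1)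
  refine integral_mono_ae ((integrable_exp_re Z).sub (integrable_exp_re W)).norm
    ((Lp.memLp (Z - W)).integrable (by norm_num)).norm ?_
  filter_upwards [Lp.coeFn_sub Z W] with ω hω
  refine (norm_exp_mul_I_sub_le _ _).trans ?_
  rw [hω, Pi.sub_apply, ← Complex.sub_re]
  exact Complex.abs_re_le_norm _

/-- Both sides of the defining identity are continuous in `Z`, so Gaussianity passes from the linear
span of the noise to its closure. -/
theorem isClosed_isCenteredGaussianRe : IsClosed {Z : Lp ℂ 2 P | IsCenteredGaussianRe Z} := by
  refine isClosed_eq continuous_integral_exp_re ?_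
  have : Continuous fun Z : Lp ℂ 2 P => (1 / 2 * ‖reL2 Z‖ ^ 2 : ℝ) := by fun_prop
  fun_prop

/-- `IsCenteredGaussianRe` records the characteristic function at 1 only; requiring it for all real
multiples recovers the whole function, hence the law. -/
theorem map_re_eq_gaussianReal {Z : Lp ℂ 2 P} (h : ∀ c : ℝ, IsCenteredGaussianRe (c • Z)) :
    P.map (fun ω => (Z ω).re) = gaussianReal 0 (‖reL2 Z‖₊ ^ 2) := by
  have : IsProbabilityMeasure (P.map fun ω => (Z ω).re) :=
    Measure.isProbabilityMeasure_map (measurable_re_Lp Z)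
  refine Measure.ext_of_charFun (funext fun t => ?_)
  rw [charFun_apply_real, charFun_gaussianReal, integral_map (measurable_re_Lp Z)
    (by fun_prop : Measurable fun x : ℝ => Complex.exp (t * x * Complex.I)).aestronglyMeasurable]
  have h1 := h t
  rw [IsCenteredGaussianRe, map_smul, norm_smul] at h1
  have h2 : ∫ ω, Complex.exp ((((t • Z : Lp ℂ 2 P) ω).re : ℂ) * Complex.I) ∂P =
      ∫ ω, Complex.exp (t * ((Z ω).re : ℂ) * Complex.I) ∂P := by
    refine integral_congr_ae ?_
    filter_upwards [Lp.coeFn_smul t Z] with ω hω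
    simp [hω]
  rw [← h2, h1]
  congr 1
  push_cast
  rw [mul_pow, Real.norm_eq_abs, ← Complex.ofReal_pow |t|, sq_abs]
  push_cast
  ring

/-- A centred Gaussian variable is in law a multiple of the standard one, so its `L^p` norm is its
`L²` norm times a constant depending only on `p`. -/
theorem eLpNorm_re_le {Z : Lp ℂ 2 P} (h : ∀ c : ℝ, IsCenteredGaussianRe (c • Z)) (p : ℝ≥0∞) :
    eLpNorm (fun ω => (Z ω).re) p P ≤ eLpNorm id p (gaussianReal 0 1) * ‖Z‖ₑ := by
  have h1 : eLpNorm (fun ω => (Z ω).re) p P = eLpNorm id p (P.map fun ω => (Z ω).re) := by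
    rw [eLpNorm_map_measure aestronglyMeasurable_id (measurable_re_Lp Z)]
    rfl
  have h2 : gaussianReal 0 (‖reL2 Z‖₊ ^ 2) =
      (gaussianReal 0 1).map (fun x => ‖reL2 Z‖ * x) := by
    rw [gaussianReal_map_const_mul, mul_zero, mul_one]
    congr 1
  rw [h1, map_re_eq_gaussianReal h, h2,
    eLpNorm_map_measure aestronglyMeasurable_id (by fun_prop)]
  have h3 : (id ∘ fun x => ‖reL2 Z‖ * x) = ‖reL2 Z‖ • (id : ℝ → ℝ) := rfl
  rw [h3, eLpNorm_const_smul, mul_comm]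
  gcongr
  rw [enorm_norm]
  exact enorm_le_iff_norm_le.mpr (norm_reL2_le Z)

theorem ofReal_smul_Lp (c : ℝ) (Z : Lp ℂ 2 P) : ((c : ℂ) • Z : Lp ℂ 2 P) = c • Z := by
  refine Lp.ext ?_
  filter_upwards [Lp.coeFn_smul (c : ℂ) Z, Lp.coeFn_smul c Z] with ω h1 h2
  rw [h1, h2]
  simp

/-- All moments of Gaussian elements are controlled by the norm of `L²`. -/
theorem eLpNorm_le_of_isCenteredGaussianRe {Z : Lp ℂ 2 P}
    (h : ∀ c : ℂ, IsCenteredGaussianRe (c • Z)) {p : ℝ≥0∞} (hp : 1 ≤ p) :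
    eLpNorm Z p P ≤ 2 * eLpNorm id p (gaussianReal 0 1) * ‖Z‖ₑ := by
  have h1 := eLpNorm_re_le (Z := Z) (fun c => ofReal_smul_Lp c Z ▸ h c) p
  -- The imaginary part of `Z` is the real part of `-iZ`.
  have h2 := eLpNorm_re_le (Z := (-Complex.I) • Z)
    (fun c => by rw [← ofReal_smul_Lp, smul_smul]; exact h _) p
  rw [enorm_smul, enorm_neg, show ‖Complex.I‖ₑ = 1 by simp [enorm_eq_nnnorm], one_mul] at h2
  have h3 : (Z : Ω → ℂ) =ᵐ[P]
      fun ω => ((Z ω).re : ℂ) + ((((-Complex.I) • Z : Lp ℂ 2 P) ω).re : ℂ) * Complex.I := by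
    filter_upwards [Lp.coeFn_smul (-Complex.I) Z] with ω hω
    rw [hω]
    simp [Complex.re_add_im]
  rw [eLpNorm_congr_ae h3]
  have hm : ∀ W : Lp ℂ 2 P, AEStronglyMeasurable (fun ω => ((W ω).re : ℂ)) P := fun W =>
    (Complex.measurable_ofReal.comp_aemeasurable (measurable_re_Lp W)).aestronglyMeasurable
  refine (eLpNorm_add_le (hm _) ((hm _).mul_const _) hp).trans ?_
  rw [two_mul, add_mul]
  refine add_le_add (le_trans (le_of_eq ?_) h1) (le_trans (le_of_eq ?_) h2)
  · exact eLpNorm_congr_norm_ae (ae_of_all _ fun ω => by simp)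
  · exact eLpNorm_congr_norm_ae (ae_of_all _ fun ω => by simp)

theorem lintegral_enorm_rpow_le_of_isCenteredGaussianRe {Z : Lp ℂ 2 P}
    (h : ∀ c : ℂ, IsCenteredGaussianRe (c • Z)) {k : ℝ} (hk : 1 ≤ k) :
    ∫⁻ ω, ‖Z ω‖ₑ ^ k ∂P ≤
      (2 * eLpNorm id (ENNReal.ofReal k) (gaussianReal 0 1) * ‖Z‖ₑ) ^ k := by
  have h0 : ENNReal.ofReal k ≠ 0 := by simpa using by linarith
  have h1 := eLpNorm_le_of_isCenteredGaussianRe h (p := ENNReal.ofReal k)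
    (by simpa using ENNReal.ofReal_le_ofReal hk)
  rw [eLpNorm_eq_lintegral_rpow_enorm_toReal h0 ENNReal.ofReal_ne_top,
    ENNReal.toReal_ofReal (by linarith)] at h1
  have h2 := ENNReal.rpow_le_rpow h1 (show 0 ≤ k by linarith)
  rwa [← ENNReal.rpow_mul, one_div_mul_cancel (by linarith), ENNReal.rpow_one] at h2

theorem eLpNorm_id_gaussianReal_ne_top (k : ℝ) :
    eLpNorm id (ENNReal.ofReal k) (gaussianReal 0 1) ≠ ∞ :=
  (memLp_id_gaussianReal' _ ENNReal.ofReal_ne_top).eLpNorm_ne_top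

theorem isCenteredGaussianRe_of_hasGaussianLaw {Z : Lp ℂ 2 P}
    (h : HasGaussianLaw (fun ω => (Z ω).re) P) (h0 : ∫ ω, (Z ω).re ∂P = 0) :
    IsCenteredGaussianRe Z := by
  have h1 := h.map_eq_gaussianReal
  have h2 := congrArg (fun μ => charFun μ 1) h1
  simp only [charFun_gaussianReal, h0] at h2
  rw [charFun_apply_real, integral_map (measurable_re_Lp Z)
    (by fun_prop : Measurable fun x : ℝ => Complex.exp ((1 : ℝ) * x * Complex.I)).aestronglyMeasurable]
    at h2
  simp only [Complex.ofReal_one, one_mul] at h2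
  rw [IsCenteredGaussianRe, h2]
  have h3 : ‖reL2 Z‖ ^ 2 = Var[fun ω => (Z ω).re; P] := by
    rw [variance_of_integral_eq_zero (measurable_re_Lp Z) h0, ← real_inner_self_eq_norm_sq,
      L2.inner_def]
    refine integral_congr_ae ?_
    filter_upwards [coeFn_reL2 Z] with ω hω
    rw [hω]
    simp [sq]
  congr 1
  rw [h3, Real.coe_toNNReal _ (variance_nonneg _ _)]
  push_cast
  ring

end L2

end

noncomputable section

section Noise

variable {Ω : Type*} [MeasurableSpace Ω] {P : Measure Ω} [IsProbabilityMeasure P] {H : ℝ}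
  {β : Mode → ℝ → Ω → ℂ}

/-! ### The noise as curves in `L²` -/

theorem Mode.neg_ne (k : Mode) : -k ≠ k := by
  intro h
  apply k.2
  have h1 : -k.1 = k.1 := congrArg Subtype.val h
  exact self_eq_neg.mp h1.symm

theorem Mode.neg_neg (k : Mode) : -(-k) = k := Subtype.ext (_root_.neg_neg k.1)

namespace IsFractionalNoise

theorem memLp_re (h : IsFractionalNoise P H β) (k : Mode) (t : ℝ) : MemLp (fun ω => (β k t ω).re) 2 P := by
  have h1 := ((h.re k).gaussian.hasGaussianLaw_eval t).memLp_two.const_mul (√2)⁻¹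
  refine (memLp_congr_ae (ae_of_all _ fun ω => ?_)).mp h1
  field_simp

theorem memLp_im (h : IsFractionalNoise P H β) (k : Mode) (t : ℝ) : MemLp (fun ω => (β k t ω).im) 2 P := by
  have h1 := ((h.im k).gaussian.hasGaussianLaw_eval t).memLp_two.const_mul (√2)⁻¹
  refine (memLp_congr_ae (ae_of_all _ fun ω => ?_)).mp h1
  field_simp

theorem memLp (h : IsFractionalNoise P H β) (k : Mode) (t : ℝ) : MemLp (β k t) 2 P := by
  have h1 := (h.memLp_re k t).ofReal (K := ℂ)
  have h2 := ((h.memLp_im k t).ofReal (K := ℂ)).mul_const Complex.I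
  refine (memLp_congr_ae (ae_of_all _ fun ω => ?_)).mp (h1.add h2)
  simp [Complex.re_add_im]

theorem integral_re (h : IsFractionalNoise P H β) (k : Mode) (t : ℝ) : ∫ ω, (β k t ω).re ∂P = 0 := by
  have h1 := (h.re k).mean t
  rw [integral_const_mul] at h1
  exact (mul_eq_zero.mp h1).resolve_left (by positivity)

theorem integral_im (h : IsFractionalNoise P H β) (k : Mode) (t : ℝ) : ∫ ω, (β k t ω).im ∂P = 0 := by
  have h1 := (h.im k).mean t
  rw [integral_const_mul] at h1
  exact (mul_eq_zero.mp h1).resolve_left (by positivity)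

theorem integral_re_mul_re (h : IsFractionalNoise P H β) (k : Mode) (t s : ℝ) :
    ∫ ω, (β k t ω).re * (β k s ω).re ∂P = 1 / 2 * fbmCov H t s := by
  have h1 := (h.re k).cov t s
  have h2 : ∀ ω, √2 * (β k t ω).re * (√2 * (β k s ω).re) =
      2 * ((β k t ω).re * (β k s ω).re) := by
    intro ω
    rw [mul_mul_mul_comm, Real.mul_self_sqrt (by norm_num)]
  simp_rw [h2] at h1
  rw [integral_const_mul] at h1
  rw [fbmCov]
  linarith

theorem integral_im_mul_im (h : IsFractionalNoise P H β) (k : Mode) (t s : ℝ) :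
    ∫ ω, (β k t ω).im * (β k s ω).im ∂P = 1 / 2 * fbmCov H t s := by
  have h1 := (h.im k).cov t s
  have h2 : ∀ ω, √2 * (β k t ω).im * (√2 * (β k s ω).im) =
      2 * ((β k t ω).im * (β k s ω).im) := by
    intro ω
    rw [mul_mul_mul_comm, Real.mul_self_sqrt (by norm_num)]
  simp_rw [h2] at h1
  rw [integral_const_mul] at h1
  rw [fbmCov]
  linarith

theorem integral_re_mul_im (h : IsFractionalNoise P H β) (k : Mode) (t s : ℝ) :
    ∫ ω, (β k t ω).re * (β k s ω).im ∂P = 0 := by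
  have h1 : IndepFun (fun ω => (β k t ω).re) (fun ω => (β k s ω).im) P :=
    (h.indep_re_im k).comp (φ := fun f : ℝ → ℝ => f t) (ψ := fun f : ℝ → ℝ => f s)
      (measurable_pi_apply t) (measurable_pi_apply s)
  have h2 := h1.integral_fun_mul_eq_mul_integral (h.memLp_re k t).aestronglyMeasurable
    (h.memLp_im k s).aestronglyMeasurable
  rw [h2, h.integral_re, zero_mul]

theorem integral_conj_mul_self (h : IsFractionalNoise P H β) (k : Mode) (t s : ℝ) :
    ∫ ω, starRingEnd ℂ (β k t ω) * β k s ω ∂P = (fbmCov H t s : ℂ) := by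
  have hi1 : Integrable (fun ω => (β k t ω).re * (β k s ω).re) P :=
    (h.memLp_re k t).integrable_mul (h.memLp_re k s)
  have hi2 : Integrable (fun ω => (β k t ω).im * (β k s ω).im) P :=
    (h.memLp_im k t).integrable_mul (h.memLp_im k s)
  have hi3 : Integrable (fun ω => (β k t ω).re * (β k s ω).im) P :=
    (h.memLp_re k t).integrable_mul (h.memLp_im k s)
  have hi4 : Integrable (fun ω => (β k t ω).im * (β k s ω).re) P :=
    (h.memLp_im k t).integrable_mul (h.memLp_re k s)
  have hA : Integrable (fun ω => (β k t ω).re * (β k s ω).re + (β k t ω).im * (β k s ω).im) P :=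
    hi1.add hi2
  have hB : Integrable (fun ω => (β k t ω).re * (β k s ω).im - (β k t ω).im * (β k s ω).re) P :=
    hi3.sub hi4
  have h1 : ∀ ω, starRingEnd ℂ (β k t ω) * β k s ω =
      (((β k t ω).re * (β k s ω).re + (β k t ω).im * (β k s ω).im : ℝ) : ℂ) +
      (((β k t ω).re * (β k s ω).im - (β k t ω).im * (β k s ω).re : ℝ) : ℂ) * Complex.I := by
    intro ω
    apply Complex.ext
    · simp
    · simp
      ring
  simp_rw [h1]
  rw [integral_add hA.ofReal (hB.ofReal.mul_const _), integral_mul_const, integral_complex_ofReal,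
    integral_complex_ofReal]
  have e1 : ∫ ω, ((β k t ω).re * (β k s ω).re + (β k t ω).im * (β k s ω).im) ∂P =
      fbmCov H t s := by
    have := integral_add hi1 hi2
    rw [h.integral_re_mul_re, h.integral_im_mul_im] at this
    rw [this]
    ring
  have e2 : ∫ ω, ((β k t ω).re * (β k s ω).im - (β k t ω).im * (β k s ω).re) ∂P = 0 := by
    have := integral_sub hi3 hi4
    rw [h.integral_re_mul_im] at this
    rw [this, zero_sub, neg_eq_zero, ← h.integral_re_mul_im k s t]
    exact integral_congr_ae (ae_of_all _ fun ω => mul_comm _ _)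
  rw [e1, e2]
  simp

/-- The real and imaginary parts have equal covariances and are uncorrelated, so the two
contributions cancel. As `β_{-k}` is the conjugate of `β_k`, this is the orthogonality of the modes
`k` and `-k`, which are not independent. -/
theorem integral_mul_self (h : IsFractionalNoise P H β) (k : Mode) (t s : ℝ) : ∫ ω, β k t ω * β k s ω ∂P = 0 := by
  have hi1 : Integrable (fun ω => (β k t ω).re * (β k s ω).re) P :=
    (h.memLp_re k t).integrable_mul (h.memLp_re k s)
  have hi2 : Integrable (fun ω => (β k t ω).im * (β k s ω).im) P :=
    (h.memLp_im k t).integrable_mul (h.memLp_im k s)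
  have hi3 : Integrable (fun ω => (β k t ω).re * (β k s ω).im) P :=
    (h.memLp_re k t).integrable_mul (h.memLp_im k s)
  have hi4 : Integrable (fun ω => (β k t ω).im * (β k s ω).re) P :=
    (h.memLp_im k t).integrable_mul (h.memLp_re k s)
  have hA : Integrable (fun ω => (β k t ω).re * (β k s ω).re - (β k t ω).im * (β k s ω).im) P :=
    hi1.sub hi2
  have hB : Integrable (fun ω => (β k t ω).re * (β k s ω).im + (β k t ω).im * (β k s ω).re) P :=
    hi3.add hi4
  have h1 : ∀ ω, β k t ω * β k s ω =
      (((β k t ω).re * (β k s ω).re - (β k t ω).im * (β k s ω).im : ℝ) : ℂ) +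
      (((β k t ω).re * (β k s ω).im + (β k t ω).im * (β k s ω).re : ℝ) : ℂ) * Complex.I := by
    intro ω
    apply Complex.ext <;> simp
  simp_rw [h1]
  rw [integral_add hA.ofReal (hB.ofReal.mul_const _), integral_mul_const, integral_complex_ofReal,
    integral_complex_ofReal]
  have e1 : ∫ ω, ((β k t ω).re * (β k s ω).re - (β k t ω).im * (β k s ω).im) ∂P = 0 := by
    have := integral_sub hi1 hi2
    rw [h.integral_re_mul_re, h.integral_im_mul_im] at this
    rw [this]
    ring
  have e2 : ∫ ω, ((β k t ω).re * (β k s ω).im + (β k t ω).im * (β k s ω).re) ∂P = 0 := by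
    have := integral_add hi3 hi4
    rw [h.integral_re_mul_im] at this
    rw [this, zero_add, ← h.integral_re_mul_im k s t]
    exact integral_congr_ae (ae_of_all _ fun ω => mul_comm _ _)
  rw [e1, e2]
  simp

theorem integral_eq_zero (h : IsFractionalNoise P H β) (k : Mode) (t : ℝ) : ∫ ω, β k t ω ∂P = 0 := by
  have h1 : ∀ ω, β k t ω = ((β k t ω).re : ℂ) + ((β k t ω).im : ℂ) * Complex.I := fun ω =>
    (Complex.re_add_im _).symm
  rw [integral_congr_ae (ae_of_all _ h1), integral_add
    ((h.memLp_re k t).integrable (by norm_num)).ofReal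
    (((h.memLp_im k t).integrable (by norm_num)).ofReal.mul_const _), integral_mul_const,
    integral_complex_ofReal, integral_complex_ofReal, h.integral_re, h.integral_im]
  simp

/-- For `l = -k` the claim is `integral_mul_self`; otherwise the set `{k, l}` contains no opposite
pair and the two motions are independent. -/
theorem integral_conj_mul_of_ne (h : IsFractionalNoise P H β) {k l : Mode} (hkl : k ≠ l) (t s : ℝ) :
    ∫ ω, starRingEnd ℂ (β k t ω) * β l s ω ∂P = 0 := by
  by_cases hl : l = -k
  · subst hl
    have h1 : ∫ ω, starRingEnd ℂ (β k t ω) * β (-k) s ω ∂P =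
        starRingEnd ℂ (∫ ω, β k t ω * β k s ω ∂P) := by
      rw [← integral_conj]
      refine integral_congr_ae ?_
      filter_upwards [h.conj k s] with ω hω
      rw [hω, map_mul]
    rw [h1, h.integral_mul_self, map_zero]
  · have hS : ∀ j ∈ ({k, l} : Set Mode), -j ∉ ({k, l} : Set Mode) := by
      rintro j (rfl | rfl) (h1 | h1)
      · exact Mode.neg_ne _ h1
      · exact hl h1.symm
      · exact hl (by rw [← h1, Mode.neg_neg])
      · exact Mode.neg_ne _ h1
    have h1 := (h.indep {k, l} hS).indepFun (i := ⟨k, Or.inl rfl⟩) (j := ⟨l, Or.inr rfl⟩)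
      (fun he => hkl (congrArg Subtype.val he))
    have h2 : IndepFun (fun ω => starRingEnd ℂ (β k t ω)) (fun ω => β l s ω) P :=
      h1.comp (φ := fun f : ℝ → ℂ => starRingEnd ℂ (f t)) (ψ := fun f : ℝ → ℂ => f s)
        ((by fun_prop : Measurable (starRingEnd ℂ)).comp (measurable_pi_apply t))
        (measurable_pi_apply s)
    rw [h2.integral_fun_mul_eq_mul_integral
      ((by fun_prop : Measurable (starRingEnd ℂ)).comp (h.measurable k t)).aestronglyMeasurable
      (h.measurable l s).aestronglyMeasurable, h.integral_eq_zero, mul_zero]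

/-- The noise as a family of curves in `L²`. -/
def curve (h : IsFractionalNoise P H β) (k : Mode) (t : ℝ) : Lp ℂ 2 P :=
  (h.memLp k t).toLp (β k t)

theorem inner_curve (h : IsFractionalNoise P H β) (k l : Mode) (t s : ℝ) :
    inner ℂ (h.curve k t) (h.curve l s) = ∫ ω, starRingEnd ℂ (β k t ω) * β l s ω ∂P := by
  rw [L2.inner_def]
  refine integral_congr_ae ?_
  filter_upwards [(h.memLp k t).coeFn_toLp, (h.memLp l s).coeFn_toLp] with ω h1 h2
  rw [curve, curve, h1, h2, RCLike.inner_apply, mul_comm]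

theorem hasFBMCov_self (h : IsFractionalNoise P H β) (k : Mode) : HasFBMCov H 1 (h.curve k) (h.curve k) := by
  intro t s
  rw [h.inner_curve, h.integral_conj_mul_self, one_mul]

theorem hasFBMCov_of_ne (h : IsFractionalNoise P H β) {k l : Mode} (hkl : k ≠ l) : HasFBMCov H 0 (h.curve k) (h.curve l) := by
  intro t s
  rw [h.inner_curve, h.integral_conj_mul_of_ne hkl, zero_mul]

/-! ### Joint Gaussianity -/

/-- Each real part splits into a multiple of `Re β` and one of `Im β`, which give two independent
Gaussian sums. The factors `(√2)⁻¹` undo the normalization of the noise. -/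
theorem hasGaussianLaw_sum_single (h : IsFractionalNoise P H β) (k : Mode) {ι : Type*} (s : Finset ι) (c : ι → ℂ) (t : ι → ℝ) :
    HasGaussianLaw (fun ω => ∑ i ∈ s, (c i * β k (t i) ω).re) P := by
  have h1 := (((h.re k).gaussian.comp_right t).smul
    fun i => (c i).re * (√2)⁻¹).hasGaussianLaw_fun_sum (I := s)
  have h2 := (((h.im k).gaussian.comp_right t).smul
    fun i => -(c i).im * (√2)⁻¹).hasGaussianLaw_fun_sum (I := s)
  have hind := (h.indep_re_im k).comp
    (φ := fun f : ℝ → ℝ => ∑ i ∈ s, ((c i).re * (√2)⁻¹) • (√2 * f (t i)))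
    (ψ := fun f : ℝ → ℝ => ∑ i ∈ s, (-(c i).im * (√2)⁻¹) • (√2 * f (t i)))
    (by fun_prop) (by fun_prop)
  have h3 := (IndepFun.hasGaussianLaw h1 h2 hind).fun_add
  refine h3.congr (ae_of_all _ fun ω => ?_)
  simp only [Function.comp_apply, smul_eq_mul]
  rw [← Finset.sum_add_distrib]
  refine Finset.sum_congr rfl fun i _ => ?_
  rw [Complex.mul_re]
  field_simp
  ring

/-- A lexicographic half-plane picks one mode from each pair `{k, -k}`; along it the noise is a
fully independent family. -/
theorem exists_half : ∃ S : Set Mode, (∀ k ∈ S, -k ∉ S) ∧ ∀ k, k ∈ S ∨ -k ∈ S := by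
  refine ⟨{k | 0 < k.1 0 ∨ (k.1 0 = 0 ∧ 0 < k.1 1)}, fun k hk hk' => ?_, fun k => ?_⟩
  · have h1 : 0 < k.1 0 ∨ (k.1 0 = 0 ∧ 0 < k.1 1) := hk
    have h2 : 0 < -k.1 0 ∨ (-k.1 0 = 0 ∧ 0 < -k.1 1) := hk'
    omega
  · have h0 : k.1 0 ≠ 0 ∨ k.1 1 ≠ 0 := by
      by_contra! hc
      refine k.2 (funext fun i => ?_)
      fin_cases i
      · exact hc.1
      · exact hc.2
    have : (0 < k.1 0 ∨ (k.1 0 = 0 ∧ 0 < k.1 1)) ∨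
        (0 < -k.1 0 ∨ (-k.1 0 = 0 ∧ 0 < -k.1 1)) := by omega
    exact this

theorem hasGaussianLaw_sum_coe {ι : Type*} (T : Finset ι) {X : ↥(T : Set ι) → Ω → ℝ}
    (h1 : ∀ k, HasGaussianLaw (X k) P) (h2 : iIndepFun X P) :
    HasGaussianLaw (fun ω => ∑ k : T, X k ω) P :=
  iIndepFun.hasGaussianLaw_fun_sum (ι := T) h1 h2

/-- Every mode is folded into the half-plane. Grouping by folded mode then gives a sum of
independent Gaussian variables. -/
theorem hasGaussianLaw_sum (h : IsFractionalNoise P H β) (s : Finset (Mode × ℝ)) (c : Mode × ℝ → ℂ) :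
    HasGaussianLaw (fun ω => ∑ p ∈ s, (c p * β p.1 p.2 ω).re) P := by
  classical
  obtain ⟨S, hS, hS'⟩ := exists_half
  -- `r` folds a mode into the half-plane; conjugating its coefficient at the same time leaves the
  -- real part of the product unchanged.
  obtain ⟨r, hr'⟩ : ∃ r : Mode → Mode, r = fun k => if k ∈ S then k else -k := ⟨_, rfl⟩
  have hr : ∀ k, r k ∈ S := by
    intro k
    by_cases hk : k ∈ S
    · simp [hr', hk]
    · simpa [hr', hk] using (hS' k).resolve_left hk
  obtain ⟨d, hd'⟩ : ∃ d : Mode × ℝ → ℂ,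
      d = fun p => if p.1 ∈ S then c p else starRingEnd ℂ (c p) := ⟨_, rfl⟩
  obtain ⟨T, hT'⟩ : ∃ T : Finset Mode, T = s.image fun p => r p.1 := ⟨_, rfl⟩
  have hT : ∀ k ∈ (T : Set Mode), -k ∉ (T : Set Mode) := by
    intro k hk hk'
    rw [hT'] at hk hk'
    obtain ⟨p, -, hp⟩ := Finset.mem_image.mp hk
    obtain ⟨q, -, hq⟩ := Finset.mem_image.mp hk'
    have h1 : k ∈ S := by rw [← hp]; exact hr _
    have h2 : -k ∈ S := by rw [← hq]; exact hr _
    exact hS k h1 h2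
  have hind := h.indep T hT
  have hX : iIndepFun (fun (k : (T : Set Mode)) ω =>
      ∑ p ∈ s with r p.1 = k.1, (d p * β k.1 p.2 ω).re) P :=
    hind.comp (fun k (f : ℝ → ℂ) => ∑ p ∈ s with r p.1 = k.1, (d p * f p.2).re)
      (fun k => Finset.measurable_sum _ fun p _ =>
        Complex.measurable_re.comp ((measurable_pi_apply p.2).const_mul _))
  have hXg : ∀ k : (T : Set Mode), HasGaussianLaw
      (fun ω => ∑ p ∈ s with r p.1 = k.1, (d p * β k.1 p.2 ω).re) P := fun k =>
    h.hasGaussianLaw_sum_single k.1 (s.filter fun p => r p.1 = k.1) d Prod.snd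
  have hg := hasGaussianLaw_sum_coe T hXg hX
  refine hg.congr ?_
  have hae : ∀ᵐ ω ∂P, ∀ p ∈ s, β (-p.1) p.2 ω = starRingEnd ℂ (β p.1 p.2 ω) :=
    (ae_ball_iff s.countable_toSet).mpr fun p _ => h.conj p.1 p.2
  filter_upwards [hae] with ω hω
  have h1 : ∑ p ∈ s, (c p * β p.1 p.2 ω).re = ∑ p ∈ s, (d p * β (r p.1) p.2 ω).re := by
    refine Finset.sum_congr rfl fun p hp => ?_
    by_cases hpS : p.1 ∈ S
    · simp [hd', hr', hpS]
    · simp only [hd', hr', hpS, if_false]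
      rw [hω p hp, ← map_mul, Complex.conj_re]
  have hmt : ∀ p ∈ s, r p.1 ∈ T := fun p hp => by
    rw [hT']
    exact Finset.mem_image_of_mem _ hp
  rw [h1, ← Finset.sum_fiberwise_of_maps_to hmt fun p => (d p * β (r p.1) p.2 ω).re]
  refine (Finset.sum_coe_sort T fun k => ∑ p ∈ s with r p.1 = k, (d p * β k p.2 ω).re).trans ?_
  refine Finset.sum_congr rfl fun k _ => Finset.sum_congr rfl fun p hp => ?_
  rw [(Finset.mem_filter.mp hp).2]

/-- The closed subspace of `L²` spanned by the noise. -/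
def gaussianSpace (h : IsFractionalNoise P H β) : Submodule ℂ (Lp ℂ 2 P) :=
  (Submodule.span ℂ (Set.range fun p : Mode × ℝ => h.curve p.1 p.2)).topologicalClosure

theorem isClosed_gaussianSpace (h : IsFractionalNoise P H β) : IsClosed (h.gaussianSpace : Set (Lp ℂ 2 P)) :=
  Submodule.isClosed_topologicalClosure _

theorem curve_mem (h : IsFractionalNoise P H β) (k : Mode) (t : ℝ) : h.curve k t ∈ h.gaussianSpace :=
  Submodule.le_topologicalClosure _ (Submodule.subset_span ⟨(k, t), rfl⟩)

theorem isCenteredGaussianRe_of_mem (h : IsFractionalNoise P H β) {Z : Lp ℂ 2 P} (hZ : Z ∈ h.gaussianSpace) :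
    IsCenteredGaussianRe Z := by
  refine closure_minimal (fun W hW => ?_) isClosed_isCenteredGaussianRe hZ
  obtain ⟨c, rfl⟩ := (Finsupp.mem_span_range_iff_exists_finsupp).mp hW
  have hae : ∀ᵐ ω ∂P, ((c.sum fun p a => a • h.curve p.1 p.2 : Lp ℂ 2 P) ω).re =
      ∑ p ∈ c.support, (c p * β p.1 p.2 ω).re := by
    have h1 := Lp.coeFn_finsetSum (p := 2) (μ := P) c.support fun p => c p • h.curve p.1 p.2
    have h2 : ∀ᵐ ω ∂P, ∀ p ∈ c.support,
        (c p • h.curve p.1 p.2 : Lp ℂ 2 P) ω = c p * β p.1 p.2 ω := by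
      refine (ae_ball_iff c.support.countable_toSet).mpr fun p _ => ?_
      filter_upwards [Lp.coeFn_smul (c p) (h.curve p.1 p.2),
        (h.memLp p.1 p.2).coeFn_toLp] with ω h3 h4
      rw [h3, Pi.smul_apply, curve, h4, smul_eq_mul]
    filter_upwards [h1, h2] with ω h3 h4
    rw [Finsupp.sum, h3, Finset.sum_apply, Complex.re_sum]
    exact Finset.sum_congr rfl fun p hp => by rw [h4 p hp]
  refine isCenteredGaussianRe_of_hasGaussianLaw ((h.hasGaussianLaw_sum c.support c).congr ?_) ?_
  · filter_upwards [hae] with ω hω using hω.symm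
  · have hi : ∀ p : Mode × ℝ, Integrable (fun ω => c p * β p.1 p.2 ω) P := fun p =>
      ((h.memLp p.1 p.2).integrable (by norm_num)).const_mul _
    have hi' : ∀ p : Mode × ℝ, Integrable (fun ω => (c p * β p.1 p.2 ω).re) P := fun p => (hi p).re
    rw [integral_congr_ae hae, integral_finsetSum _ fun p _ => hi' p]
    refine Finset.sum_eq_zero fun p _ => ?_
    have := _root_.integral_re (hi p)
    change ∫ ω, RCLike.re (c p * β p.1 p.2 ω) ∂P = 0
    rw [this, integral_const_mul, h.integral_eq_zero, mul_zero]
    simp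

theorem isCenteredGaussianRe_smul_of_mem (h : IsFractionalNoise P H β) {Z : Lp ℂ 2 P} (hZ : Z ∈ h.gaussianSpace) (c : ℂ) :
    IsCenteredGaussianRe (c • Z) :=
  h.isCenteredGaussianRe_of_mem (Submodule.smul_mem _ _ hZ)

/-- An average against a probability measure stays in a closed convex set that contains the
integrand. -/
theorem ouTransform_mem (h : IsFractionalNoise P H β) (hH : 0 < H ∧ H < 1) {a : ℝ} (ha : 0 < a) (k : Mode) (t : ℝ) :
    ouTransform a (h.curve k) t ∈ h.gaussianSpace := by
  have := isProbabilityMeasure_expMeasure ha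
  refine Convex.integral_mem (s := (h.gaussianSpace : Set (Lp ℂ 2 P)))
    (Submodule.convex (h.gaussianSpace.restrictScalars ℝ)) h.isClosed_gaussianSpace
    (ae_of_all _ fun r => ?_) (((h.hasFBMCov_self k).isHolderCurve hH).integrable_sub ha t)
  exact Submodule.sub_mem _ (h.curve_mem k t) (h.curve_mem k _)

end IsFractionalNoise

end Noise

end

noncomputable section

/-! ### Continuity of the pathwise Ornstein–Uhlenbeck transform -/

theorem integrableOn_exp_smul_Iic {a : ℝ} {b : ℝ → ℂ} (hb : Continuous b) {s : ℝ}
    (hs : IntegrableOn (fun u => Real.exp (a * u) • b u) (Iic s)) (t : ℝ) :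
    IntegrableOn (fun u => Real.exp (a * u) • b u) (Iic t) := by
  have hc : Continuous fun u => Real.exp (a * u) • b u := by fun_prop
  refine (hs.union (hc.integrableOn_Icc (a := s) (b := t))).mono_set fun u hu => ?_
  rcases le_total u s with h | h
  · exact Or.inl h
  · exact Or.inr ⟨h, hu⟩

theorem continuous_ouTransform {a : ℝ} (ha : 0 < a) {b : ℝ → ℂ} (hb : Continuous b)
    (hs : Integrable (fun r => b (0 - r)) (expMeasure a)) : Continuous (ouTransform a b) := by
  have h0 := (integrable_comp_sub_expMeasure_iff ha).mp hs
  have hall := integrableOn_exp_smul_Iic hb h0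
  have hc : Continuous fun u => Real.exp (a * u) • b u := by fun_prop
  have heq : ouTransform a b = fun t => b t - (a * Real.exp (-(a * t))) •
      ((∫ u in Iic 0, Real.exp (a * u) • b u) + ∫ u in (0 : ℝ)..t, Real.exp (a * u) • b u) := by
    ext t
    rw [ouTransform_eq ha (hall t), ← intervalIntegral.integral_Iic_sub_Iic (hall 0) (hall t)]
    congr 2
    ring
  have hp : Continuous fun t => ∫ u in (0 : ℝ)..t, Real.exp (a * u) • b u :=
    intervalIntegral.continuous_primitive (fun _ _ => hc.intervalIntegrable _ _) 0
  rw [heq]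
  fun_prop

/-! ### Continuous modifications of the noise, and Wiener integrals. -/

section Noise

variable {Ω : Type*} [MeasurableSpace Ω] {P : Measure Ω} [IsProbabilityMeasure P] {H : ℝ}
  {β : Mode → ℝ → Ω → ℂ}

instance : Countable Mode := by unfold Mode; infer_instance

/-- Processes are set to zero off such a set, which makes almost sure properties hold at every `ω`
without loss of measurability. -/
theorem exists_measurableSet_of_ae {p : Ω → Prop} (h : ∀ᵐ ω ∂P, p ω) :
    ∃ G : Set Ω, MeasurableSet G ∧ (∀ᵐ ω ∂P, ω ∈ G) ∧ ∀ ω ∈ G, p ω := by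
  refine ⟨(toMeasurable P {ω | ¬ p ω})ᶜ, (measurableSet_toMeasurable _ _).compl, ?_, ?_⟩
  · rw [ae_iff]
    simp only [mem_compl_iff, not_not]
    change P (toMeasurable P {ω | ¬ p ω}) = 0
    rw [measure_toMeasurable]
    exact ae_iff.mp h
  · intro ω hω
    by_contra hc
    exact hω (subset_toMeasurable P {ω | ¬ p ω} hc)

namespace IsFractionalNoise

theorem ae_continuous (h : IsFractionalNoise P H β) (k : Mode) :
    ∀ᵐ ω ∂P, Continuous fun t => β k t ω := by
  filter_upwards [(h.re k).continuous, (h.im k).continuous] with ω h1 h2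
  have h3 : (fun t => β k t ω) = fun t => (((√2)⁻¹ * (√2 * (β k t ω).re) : ℝ) : ℂ) +
      (((√2)⁻¹ * (√2 * (β k t ω).im) : ℝ) : ℂ) * Complex.I := by
    ext t
    rw [inv_mul_cancel_left₀ (by positivity), inv_mul_cancel_left₀ (by positivity),
      Complex.re_add_im]
  rw [h3]
  fun_prop

/-- The noise has a measurable modification with continuous paths and the symmetry of the modes. -/
theorem exists_modification (h : IsFractionalNoise P H β) (hH : 0 < H ∧ H < 1) {a : Mode → ℝ}
    (ha : ∀ k, 0 < a k) :
    ∃ b : Mode → ℝ → Ω → ℂ, (∀ k t, Measurable (b k t)) ∧ (∀ k t, b k t =ᵐ[P] β k t) ∧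
      (∀ k ω, Continuous fun t => b k t ω) ∧
      (∀ k ω, Integrable (fun r => b k (0 - r) ω) (expMeasure (a k))) ∧
      ∀ k t ω, b (-k) t ω = starRingEnd ℂ (b k t ω) := by
  have hE := fun k => isProbabilityMeasure_expMeasure (ha k)
  -- The conjugation symmetry is imposed at rational times only, which are countably many;
  -- continuity extends it to all times.
  obtain ⟨G, hG, hGae, hGp⟩ := exists_measurableSet_of_ae (P := P)
    (p := fun ω => (∀ k, Continuous fun t => β k t ω) ∧
      ∀ k (q : ℚ), β (-k) q ω = starRingEnd ℂ (β k q ω))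
    ((ae_all_iff.mpr h.ae_continuous).and
      (ae_all_iff.mpr fun k => ae_all_iff.mpr fun q : ℚ => h.conj k q))
  let b₁ : Mode → ℝ → Ω → ℂ := fun k t => G.indicator (β k t)
  have hm₁ : ∀ k t, Measurable (b₁ k t) := fun k t => (h.measurable k t).indicator hG
  have he₁ : ∀ k t, b₁ k t =ᵐ[P] β k t := by
    intro k t
    filter_upwards [hGae] with ω hω
    exact indicator_of_mem hω _
  have hc₁ : ∀ k ω, Continuous fun t => b₁ k t ω := by
    intro k ω
    by_cases hω : ω ∈ G
    · simpa [b₁, hω] using (hGp ω hω).1 k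
    · simpa [b₁, hω] using continuous_const
  have hconj : ∀ k t ω, b₁ (-k) t ω = starRingEnd ℂ (b₁ k t ω) := by
    intro k t ω
    by_cases hω : ω ∈ G
    · have h1 : (fun t => β (-k) t ω) = fun t => starRingEnd ℂ (β k t ω) :=
        Continuous.ext_on Rat.denseRange_cast ((hGp ω hω).1 (-k))
          (Complex.continuous_conj.comp ((hGp ω hω).1 k)) (by
            rintro _ ⟨q, rfl⟩
            exact (hGp ω hω).2 k q)
      simpa [b₁, hω] using congrFun h1 t
    · simp [b₁, hω]
  have hjm : ∀ k, Measurable (Function.uncurry fun r ω => b₁ k (0 - r) ω) := by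
    intro k
    exact (measurable_uncurry_of_continuous_of_measurable (u := fun t ω => b₁ k t ω)
      (hc₁ k) (hm₁ k)).comp ((measurable_fst.const_sub 0).prodMk measurable_snd)
  have hmem : ∀ k t, MemLp (b₁ k t) 2 P := fun k t => (memLp_congr_ae (he₁ k t)).mpr (h.memLp k t)
  -- Integrability of the `L²`-valued curve against the exponential law passes to almost every path
  -- by Fubini's theorem.
  have hint : ∀ k, ∀ᵐ ω ∂P, Integrable (fun r => b₁ k (0 - r) ω) (expMeasure (a k)) := by
    intro k
    have h1 : ∀ r, (hmem k (0 - r)).toLp (b₁ k (0 - r)) = h.curve k (0 - r) := fun r =>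
      MemLp.toLp_congr _ _ (he₁ k _)
    have hcv := (h.hasFBMCov_self k).isHolderCurve hH
    have h2 : Integrable (fun r => (hmem k (0 - r)).toLp (b₁ k (0 - r))) (expMeasure (a k)) := by
      simp_rw [h1]
      exact (integrable_comp_sub_expMeasure_iff (ha k)).mpr (hcv.integrableOn_exp_smul (ha k) 0)
    exact (ae_integrable_of_integrable_toLp (hjm k) (fun r => hmem k (0 - r)) h2).prod_left_ae
  obtain ⟨G', hG', hGae', hGp'⟩ := exists_measurableSet_of_ae (ae_all_iff.mpr hint)
  refine ⟨fun k t => G'.indicator (b₁ k t), fun k t => (hm₁ k t).indicator hG', fun k t => ?_,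
    fun k ω => ?_, fun k ω => ?_, fun k t ω => ?_⟩
  · filter_upwards [hGae', he₁ k t] with ω hω h1
    rw [indicator_of_mem hω, h1]
  · by_cases hω : ω ∈ G'
    · simpa [hω] using hc₁ k ω
    · simpa [hω] using continuous_const
  · by_cases hω : ω ∈ G'
    · simpa [hω] using hGp' ω hω k
    · simp [hω]
  · by_cases hω : ω ∈ G'
    · simpa [hω] using hconj k t ω
    · simp [hω]

/-- The fractional Ornstein–Uhlenbeck processes of the modes, with continuous paths. -/
theorem exists_ouModes (h : IsFractionalNoise P H β) (hH : 0 < H ∧ H < 1) {a : Mode → ℝ}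
    (ha : ∀ k, 0 < a k) (hsymm : ∀ k, a (-k) = a k) :
    ∃ X : Mode → ℝ → Ω → ℂ, (∀ k t, Measurable (X k t)) ∧ (∀ k ω, Continuous fun t => X k t ω) ∧
      (∀ k t ω, X (-k) t ω = starRingEnd ℂ (X k t ω)) ∧
      ∀ k t, X k t =ᵐ[P] (ouTransform (a k) (h.curve k) t : Lp ℂ 2 P) := by
  have hE := fun k => isProbabilityMeasure_expMeasure (ha k)
  obtain ⟨b, hbm, hbe, hbc, hbi, hbs⟩ := h.exists_modification hH ha
  have hjm : ∀ k t, Measurable (Function.uncurry fun r ω => b k t ω - b k (t - r) ω) := by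
    intro k t
    exact ((hbm k t).comp measurable_snd).sub
      ((measurable_uncurry_of_continuous_of_measurable (u := fun t ω => b k t ω)
      (hbc k) (hbm k)).comp ((measurable_fst.const_sub t).prodMk measurable_snd))
  have hmem : ∀ k t, MemLp (b k t) 2 P := fun k t => (memLp_congr_ae (hbe k t)).mpr (h.memLp k t)
  refine ⟨fun k t ω => ouTransform (a k) (fun u => b k u ω) t, fun k t => ?_, fun k ω => ?_,
    fun k t ω => ?_, fun k t => ?_⟩
  · exact ((hjm k t).comp measurable_swap).stronglyMeasurable.integral_prod_right'.measurable
  · exact continuous_ouTransform (ha k) (hbc k ω) (hbi k ω)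
  · simp only [ouTransform, hsymm, hbs, ← map_sub]
    exact integral_conj
  · have h1 : ∀ r, ((hmem k t).sub (hmem k (t - r))).toLp (b k t - b k (t - r)) =
        h.curve k t - h.curve k (t - r) := by
      intro r
      rw [MemLp.toLp_sub (hmem k t) (hmem k (t - r))]
      congr 1
      · exact MemLp.toLp_congr _ _ (hbe k _)
      · exact MemLp.toLp_congr _ _ (hbe k _)
    have hcv := (h.hasFBMCov_self k).isHolderCurve hH
    have h2 : Integrable (fun r => ((hmem k t).sub (hmem k (t - r))).toLp (b k t - b k (t - r)))
        (expMeasure (a k)) := by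
      simp_rw [h1]
      exact hcv.integrable_sub (ha k) t
    have h3 := coeFn_integral_toLp (f := fun r => b k t - b k (t - r)) (hjm k t)
      (fun r => (hmem k t).sub (hmem k (t - r))) h2
    simp_rw [h1] at h3
    exact h3.symm

/-! ### Wiener integrals -/

theorem isWienerIntegral_partsIntegral (h : IsFractionalNoise P H β) (hH : 0 < H ∧ H < 1)
    (k : Mode) {f f' : ℝ → ℝ} (hf : ∀ u, HasDerivAt f (f' u) u) (hf' : Continuous f') {c d : ℝ}
    (hcd : c ≤ d) {I : Ω → ℂ} (hI : I =ᵐ[P] (partsIntegral f f' (h.curve k) c d : Lp ℂ 2 P)) :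
    IsWienerIntegral P f (β k) c d I := by
  have hcv := (h.hasFBMCov_self k).isHolderCurve hH
  refine ⟨(memLp_congr_ae hI).mpr (Lp.memLp _), fun ε hε => ?_⟩
  set K := ∫ u in c..d, |f' u| with hK
  have hK0 : 0 ≤ K := intervalIntegral.integral_nonneg hcd fun u _ => abs_nonneg _
  -- The mesh solves `δ^H (K + 1) = ε`; the added 1 covers a constant integrand, for which `K = 0`.
  refine ⟨(ε / (K + 1)) ^ H⁻¹, by positivity, fun N x ξ h0 hN hx => ?_⟩
  have h1 := norm_riemannStieltjes_sub_le hH.1 hcv.continuous hcv.holder hf hf' N x ξ hx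
  rw [h0, hN, ← hK, ← Real.rpow_mul (by positivity), inv_mul_cancel₀ hH.1.ne', Real.rpow_one] at h1
  have h2 : ε / (K + 1) * K ≤ ε := by
    rw [div_mul_eq_mul_div, div_le_iff₀ (by positivity)]
    nlinarith
  have h3 : (fun ω => ∑ i ∈ Finset.range N, (f (ξ i) : ℂ) * (β k (x (i + 1)) ω - β k (x i) ω) - I ω)
      =ᵐ[P] ((∑ i ∈ Finset.range N, f (ξ i) • (h.curve k (x (i + 1)) - h.curve k (x i)) -
        partsIntegral f f' (h.curve k) c d : Lp ℂ 2 P) : Ω → ℂ) := by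
    have h4 : ∀ᵐ ω ∂P, ∀ i ∈ Finset.range N,
        (f (ξ i) • (h.curve k (x (i + 1)) - h.curve k (x i)) : Lp ℂ 2 P) ω =
          (f (ξ i) : ℂ) * (β k (x (i + 1)) ω - β k (x i) ω) := by
      refine (ae_ball_iff (Finset.range N).countable_toSet).mpr fun i _ => ?_
      filter_upwards [Lp.coeFn_smul (f (ξ i)) (h.curve k (x (i + 1)) - h.curve k (x i)),
        Lp.coeFn_sub (h.curve k (x (i + 1))) (h.curve k (x i)),
        (h.memLp k (x i)).coeFn_toLp, (h.memLp k (x (i + 1))).coeFn_toLp] with ω e1 e2 e3 e4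
      rw [e1, Pi.smul_apply, e2, Pi.sub_apply, curve, curve, e3, e4, Complex.real_smul]
    filter_upwards [h4, hI, Lp.coeFn_finsetSum (Finset.range N)
      fun i => f (ξ i) • (h.curve k (x (i + 1)) - h.curve k (x i)),
      Lp.coeFn_sub (∑ i ∈ Finset.range N, f (ξ i) • (h.curve k (x (i + 1)) - h.curve k (x i)))
        (partsIntegral f f' (h.curve k) c d)] with ω e1 e2 e3 e4
    rw [e4, Pi.sub_apply, e3, Finset.sum_apply, e2, Finset.sum_congr rfl e1]
  rw [eLpNorm_congr_ae h3, ← Lp.enorm_def, ← ofReal_norm]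
  exact ENNReal.ofReal_le_ofReal (h1.trans h2)

theorem isWienerIntegral_exp (h : IsFractionalNoise P H β) (hH : 0 < H ∧ H < 1) (k : Mode) {a : ℝ}
    (ha : 0 < a) {s t : ℝ} (hst : s ≤ t) {I : Ω → ℂ}
    (hI : I =ᵐ[P] (ouTransform a (h.curve k) t -
      Real.exp (-((t - s) * a)) • ouTransform a (h.curve k) s : Lp ℂ 2 P)) :
    IsWienerIntegral P (fun u => Real.exp (-((t - u) * a))) (β k) s t I := by
  have hcv := (h.hasFBMCov_self k).isHolderCurve hH
  refine h.isWienerIntegral_partsIntegral hH k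
    (f' := fun u => a * Real.exp (-((t - u) * a))) (fun u => ?_) (by fun_prop) hst ?_
  · have h1 : HasDerivAt (fun u : ℝ => -((t - u) * a)) a u := by
      have : HasDerivAt (fun u : ℝ => -((t - u) * a)) (-(-1 * a)) u :=
        (((hasDerivAt_id u).const_sub t).mul_const a).neg
      simpa using this
    have h2 := h1.exp
    rwa [mul_comm] at h2
  · rw [ouTransform_eq_add ha hst (hcv.integrableOn_exp_smul ha t), add_sub_cancel_left] at hI
    exact hI

/-- The integral from `s` differs from the transform by `exp(-(t - s)a)` times its value at `s`,
which is bounded in `L²`. -/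
theorem isWienerIntegralIic_exp (h : IsFractionalNoise P H β) (hH : 0 < H ∧ H < 1) (k : Mode)
    {a : ℝ} (ha : 0 < a) (t : ℝ) {I : Ω → ℂ}
    (hI : I =ᵐ[P] (ouTransform a (h.curve k) t : Lp ℂ 2 P)) :
    IsWienerIntegralIic P (fun u => Real.exp (-((t - u) * a))) (β k) t I := by
  have hcv := (h.hasFBMCov_self k).isHolderCurve hH
  refine ⟨(memLp_congr_ae hI).mpr (Lp.memLp _),
    fun s => ((ouTransform a (h.curve k) t -
      Real.exp (-((t - s) * a)) • ouTransform a (h.curve k) s : Lp ℂ 2 P) : Ω → ℂ),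
    fun s hs => h.isWienerIntegral_exp hH k ha hs EventuallyEq.rfl, ?_⟩
  have h1 : ∀ s, eLpNorm (fun ω => ((ouTransform a (h.curve k) t -
      Real.exp (-((t - s) * a)) • ouTransform a (h.curve k) s : Lp ℂ 2 P) : Ω → ℂ) ω - I ω) 2 P ≤
      ENNReal.ofReal (Real.exp (-((t - s) * a)) * (1 + 1 / a)) := by
    intro s
    have h2 : (fun ω => ((ouTransform a (h.curve k) t -
        Real.exp (-((t - s) * a)) • ouTransform a (h.curve k) s : Lp ℂ 2 P) : Ω → ℂ) ω - I ω)
        =ᵐ[P] ((-(Real.exp (-((t - s) * a)) • ouTransform a (h.curve k) s) : Lp ℂ 2 P) : Ω → ℂ) := by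
      filter_upwards [hI, Lp.coeFn_sub (ouTransform a (h.curve k) t)
        (Real.exp (-((t - s) * a)) • ouTransform a (h.curve k) s),
        Lp.coeFn_neg (Real.exp (-((t - s) * a)) • ouTransform a (h.curve k) s)] with ω e1 e2 e3
      rw [e1, e2, e3, Pi.sub_apply, Pi.neg_apply]
      ring
    rw [eLpNorm_congr_ae h2, ← Lp.enorm_def, ← ofReal_norm, norm_neg, norm_smul,
      Real.norm_of_nonneg (Real.exp_pos _).le]
    exact ENNReal.ofReal_le_ofReal
      (mul_le_mul_of_nonneg_left (hcv.norm_ouTransform_le ha s) (Real.exp_pos _).le)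
  refine tendsto_of_tendsto_of_tendsto_of_le_of_le tendsto_const_nhds ?_ (fun _ => zero_le) h1
  rw [← ENNReal.ofReal_zero]
  refine ENNReal.tendsto_ofReal ?_
  have h3 : Tendsto (fun s => Real.exp (-((t - s) * a))) atBot (𝓝 0) := by
    refine Real.tendsto_exp_neg_atTop_nhds_zero.comp ?_
    refine Tendsto.atTop_mul_const ha ?_
    exact tendsto_atTop_add_const_left _ t tendsto_neg_atBot_atTop
  simpa using h3.mul_const (1 + 1 / a)

end IsFractionalNoise

/-- Both integrals are `L²` limits of the same Riemann sums. The lemma is what makes two mild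
solutions share their stochastic convolution. -/
theorem IsWienerIntegral.ae_unique {f : ℝ → ℝ} {b : ℝ → Ω → ℂ} (hb : ∀ t, Measurable (b t))
    {c d : ℝ} (hcd : c ≤ d) {I J : Ω → ℂ} (hI : IsWienerIntegral P f b c d I)
    (hJ : IsWienerIntegral P f b c d J) : I =ᵐ[P] J := by
  have hle : ∀ ε > (0 : ℝ), eLpNorm (I - J) 2 P ≤ 2 * ENNReal.ofReal ε := by
    intro ε hε
    obtain ⟨δ, hδ, h1⟩ := hI.2 ε hε
    obtain ⟨δ', hδ', h2⟩ := hJ.2 ε hε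
    -- One equidistant partition fine enough for both tolerances.
    obtain ⟨N, hN⟩ := exists_nat_gt ((d - c) / min δ δ')
    have hN0 : (0 : ℝ) < N := lt_of_le_of_lt (div_nonneg (by linarith) (le_min hδ.le hδ'.le)) hN
    let x : ℕ → ℝ := fun i => c + i * ((d - c) / N)
    have hx0 : x 0 = c := by simp [x]
    have hxN : x N = d := by
      simp only [x]
      field_simp
      ring
    have hmesh : (d - c) / N ≤ min δ δ' := by
      rw [div_le_iff₀ hN0, mul_comm, ← div_le_iff₀ (lt_min hδ hδ')]
      exact hN.le
    have hstep : ∀ i, x (i + 1) - x i = (d - c) / N := by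
      intro i
      simp only [x]
      push_cast
      ring
    have hst0 : 0 ≤ (d - c) / N := div_nonneg (by linarith) hN0.le
    have e1 := h1 N x x hx0 hxN fun i _ => ⟨le_rfl, by linarith [hstep i],
      (hstep i).trans_le (hmesh.trans (min_le_left _ _))⟩
    have e2 := h2 N x x hx0 hxN fun i _ => ⟨le_rfl, by linarith [hstep i],
      (hstep i).trans_le (hmesh.trans (min_le_right _ _))⟩
    set R : Ω → ℂ := fun ω => ∑ i ∈ Finset.range N, (f (x i) : ℂ) * (b (x (i + 1)) ω - b (x i) ω)
    have hR : Measurable R :=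
      Finset.measurable_sum _ fun i _ => ((hb _).sub (hb _)).const_mul _
    have e3 : I - J = (fun ω => R ω - J ω) - fun ω => R ω - I ω := by
      ext ω
      simp
    rw [e3, two_mul]
    exact (eLpNorm_sub_le (hR.aestronglyMeasurable.sub hJ.1.aestronglyMeasurable)
      (hR.aestronglyMeasurable.sub hI.1.aestronglyMeasurable) (by norm_num)).trans (add_le_add e2 e1)
  have h0 : eLpNorm (I - J) 2 P = 0 := by
    refine le_antisymm (ge_of_tendsto (x := 𝓝[>] (0 : ℝ)) ?_
      (eventually_mem_nhdsWithin.mono fun ε hε => hle ε hε)) zero_le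
    have h1 : Tendsto (fun ε : ℝ => 2 * ENNReal.ofReal ε) (𝓝[>] 0) (𝓝 (2 * ENNReal.ofReal 0)) :=
      (ENNReal.Tendsto.const_mul (ENNReal.continuous_ofReal.tendsto 0)
        (Or.inr (by norm_num))).mono_left nhdsWithin_le_nhds
    simpa using h1
  rw [eLpNorm_eq_zero_iff (hI.1.sub hJ.1).aestronglyMeasurable (by norm_num)] at h0
  filter_upwards [h0] with ω hω
  exact sub_eq_zero.mp hω

end Noise

end

noncomputable section

/-! ### Sums of orthogonal families -/

section Orthogonal

variable {E : Type*} [NormedAddCommGroup E] [InnerProductSpace ℂ E] {ι : Type*}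

theorem norm_sq_sum_of_orthogonal {u : ι → E} (hu : Pairwise fun i j => inner ℂ (u i) (u j) = 0)
    (s : Finset ι) : ‖∑ i ∈ s, u i‖ ^ 2 = ∑ i ∈ s, ‖u i‖ ^ 2 := by
  classical
  have h : ((‖∑ i ∈ s, u i‖ ^ 2 : ℝ) : ℂ) = ((∑ i ∈ s, ‖u i‖ ^ 2 : ℝ) : ℂ) := by
    rw [← inner_self_eq_ofReal_norm_sq, sum_inner, Complex.ofReal_sum]
    refine Finset.sum_congr rfl fun i hi => ?_
    rw [inner_sum, Finset.sum_eq_single_of_mem i hi fun j _ hj => hu hj.symm,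
      inner_self_eq_ofReal_norm_sq]
  exact_mod_cast h

theorem summable_of_orthogonal [CompleteSpace E] {u : ι → E}
    (hu : Pairwise fun i j => inner ℂ (u i) (u j) = 0) (hs : Summable fun i => ‖u i‖ ^ 2) :
    Summable u := by
  rw [summable_iff_vanishing_norm]
  intro ε hε
  obtain ⟨s, hs'⟩ := summable_iff_vanishing_norm.mp hs (ε ^ 2) (by positivity)
  refine ⟨s, fun t ht => ?_⟩
  have h1 := hs' t ht
  rw [← norm_sq_sum_of_orthogonal hu, Real.norm_of_nonneg (by positivity)] at h1
  exact lt_of_pow_lt_pow_left₀ 2 hε.le h1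

end Orthogonal

/-! ### The Hilbert space of mean-zero functions -/

theorem orthonormal_basisV : Orthonormal ℂ basisV := by
  have h := UnitAddTorus.orthonormal_mFourier (d := Fin 2)
  rw [orthonormal_iff_ite] at h ⊢
  intro k l
  have h1 := h k.1 l.1
  simp only [Subtype.ext_iff]
  exact h1

theorem inner_basisV_self (k : Mode) : inner ℂ (basisV k) (basisV k) = 1 := by
  rw [orthonormal_iff_ite.mp orthonormal_basisV, if_pos rfl]

theorem inner_basisV_of_ne {k l : Mode} (h : k ≠ l) : inner ℂ (basisV k) (basisV l) = 0 := by
  rw [orthonormal_iff_ite.mp orthonormal_basisV, if_neg h]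

theorem isClosed_meanZeroL2 : IsClosed (meanZeroL2 : Set (Lp ℂ 2 torusMeasure)) := by
  have h : (meanZeroL2 : Set (Lp ℂ 2 torusMeasure)) =
      {f | inner ℂ (indicatorConstLp 2 MeasurableSet.univ (measure_ne_top torusMeasure univ)
        (1 : ℂ)) f = 0} := by
    ext f
    change ∫ x, f x ∂torusMeasure = 0 ↔ inner ℂ _ f = 0
    rw [L2.inner_indicatorConstLp_one, setIntegral_univ]
  rw [h]
  exact isClosed_eq (by fun_prop) continuous_const

instance : CompleteSpace VSpace := isClosed_meanZeroL2.completeSpace_coe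

instance : SecondCountableTopology VSpace := by
  have : Fact ((2 : ℝ≥0∞) ≠ ∞) := ⟨by norm_num⟩
  have : SecondCountableTopology (Lp ℂ 2 torusMeasure) := inferInstance
  exact TopologicalSpace.Subtype.secondCountableTopology _

theorem inner_smul_right_VSpace (f g : VSpace) (c : ℂ) : inner ℂ f (c • g) = c * inner ℂ f g :=
  inner_smul_right f g c

theorem inner_smul_left_VSpace (f g : VSpace) (c : ℂ) :
    inner ℂ (c • f) g = starRingEnd ℂ c * inner ℂ f g :=
  inner_smul_left f g c

theorem pairwise_orthogonal_smul_basisV (c : Mode → ℂ) :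
    Pairwise fun k l => inner ℂ (c k • basisV k) (c l • basisV l) = 0 := by
  intro i j hij
  simp only [inner_smul_left_VSpace, inner_smul_right_VSpace, inner_basisV_of_ne hij, mul_zero]

theorem norm_sq_sum_basisV (s : Finset Mode) (c : Mode → ℂ) :
    ‖∑ k ∈ s, c k • basisV k‖ ^ 2 = ∑ k ∈ s, ‖c k‖ ^ 2 := by
  rw [norm_sq_sum_of_orthogonal (pairwise_orthogonal_smul_basisV c)]
  simp [norm_smul, orthonormal_basisV.1]

theorem inner_basisV_sum (s : Finset Mode) (c : Mode → ℂ) {k : Mode} (hk : k ∈ s) :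
    inner ℂ (basisV k) (∑ l ∈ s, c l • basisV l) = c k := by
  rw [inner_sum, Finset.sum_eq_single_of_mem k hk, inner_smul_right_VSpace, inner_basisV_self, mul_one]
  intro l _ hl
  rw [inner_smul_right_VSpace, inner_basisV_of_ne hl.symm, mul_zero]

/-! ### The semigroup on Fourier coefficients. -/

section Semigroup

variable {ν c₀ : ℝ} {α : Mode → ℝ}

theorem norm_exp_coef_le (hν : 0 < ν) (hα : ∀ k, c₀ ≤ α k) {t : ℝ} (ht : 0 ≤ t) (k : Mode)
    (z : ℂ) : ‖(Real.exp (-(t * (ν * α k))) : ℂ) * z‖ ≤ Real.exp (-(t * (ν * c₀))) * ‖z‖ := by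
  rw [norm_mul, Complex.norm_real, Real.norm_of_nonneg (Real.exp_pos _).le]
  gcongr
  exact hα k

theorem summable_semigroupV (hν : 0 < ν) (hα : ∀ k, c₀ ≤ α k) {t : ℝ} (ht : 0 ≤ t) (f : VSpace) :
    Summable fun k : Mode => ((Real.exp (-(t * (ν * α k))) : ℂ) * inner ℂ (basisV k) f) •
      basisV k := by
  refine summable_of_orthogonal (pairwise_orthogonal_smul_basisV _) ?_
  refine Summable.of_nonneg_of_le (fun _ => by positivity) (fun k => ?_)
    ((orthonormal_basisV.inner_products_summable f).mul_left (Real.exp (-(t * (ν * c₀))) ^ 2))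
  rw [norm_smul, orthonormal_basisV.1, mul_one, ← mul_pow]
  exact pow_le_pow_left₀ (norm_nonneg _) (norm_exp_coef_le hν hα ht k _) 2

/-- Bessel's inequality with each coefficient damped at rate at least `ν c₀`. The spectral gap is
what makes solutions forget their initial value. -/
theorem norm_semigroupV_le (hν : 0 < ν) (hα : ∀ k, c₀ ≤ α k) {t : ℝ} (ht : 0 ≤ t) (f : VSpace) :
    ‖semigroupV ν α t f‖ ≤ Real.exp (-(t * (ν * c₀))) * ‖f‖ := by
  refine le_of_tendsto ((summable_semigroupV hν hα ht f).hasSum.norm)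
    (Eventually.of_forall fun s => ?_)
  refine (sq_le_sq₀ (norm_nonneg _) (by positivity)).mp ?_
  rw [norm_sq_sum_basisV, mul_pow]
  calc ∑ k ∈ s, ‖(Real.exp (-(t * (ν * α k))) : ℂ) * inner ℂ (basisV k) f‖ ^ 2
      ≤ ∑ k ∈ s, Real.exp (-(t * (ν * c₀))) ^ 2 * ‖inner ℂ (basisV k) f‖ ^ 2 := by
        refine Finset.sum_le_sum fun k _ => ?_
        rw [← mul_pow]
        exact pow_le_pow_left₀ (norm_nonneg _) (norm_exp_coef_le hν hα ht k _) 2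
    _ ≤ _ := by
        rw [← Finset.mul_sum]
        exact mul_le_mul_of_nonneg_left (orthonormal_basisV.sum_inner_products_le f)
          (by positivity)

theorem semigroupV_sub (hν : 0 < ν) (hα : ∀ k, c₀ ≤ α k) {t : ℝ} (ht : 0 ≤ t) (f g : VSpace) :
    semigroupV ν α t (f - g) = semigroupV ν α t f - semigroupV ν α t g := by
  rw [semigroupV, semigroupV, semigroupV,
    ← (summable_semigroupV hν hα ht f).tsum_sub (summable_semigroupV hν hα ht g)]
  refine tsum_congr fun k => ?_
  rw [inner_sub_right, mul_sub, sub_smul]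

theorem continuous_semigroupV (hν : 0 < ν) (hα : ∀ k, c₀ ≤ α k) {t : ℝ} (ht : 0 ≤ t) :
    Continuous (semigroupV ν α t) := by
  refine (LipschitzWith.of_dist_le_mul (K := ⟨Real.exp (-(t * (ν * c₀))), (Real.exp_pos _).le⟩)
    fun f g => ?_).continuous
  rw [dist_eq_norm, dist_eq_norm, ← semigroupV_sub hν hα ht]
  exact norm_semigroupV_le hν hα ht _

theorem semigroupV_sum (t : ℝ) (s : Finset Mode) (c : Mode → ℂ) :
    semigroupV ν α t (∑ k ∈ s, c k • basisV k) =
      ∑ k ∈ s, ((Real.exp (-(t * (ν * α k))) : ℂ) * c k) • basisV k := by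
  rw [semigroupV, tsum_eq_sum (s := s)]
  · exact Finset.sum_congr rfl fun k hk => by rw [inner_basisV_sum s c hk]
  · intro k hk
    rw [inner_sum, Finset.sum_eq_zero, mul_zero, zero_smul]
    intro l hl
    rw [inner_smul_right_VSpace, inner_basisV_of_ne (ne_of_mem_of_not_mem hl hk).symm, mul_zero]

end Semigroup

/-! ### Characters in the plane -/

/-- The linear form `x ↦ i⟨k, x⟩`. -/
def phaseCLM (k : Mode) : Plane →L[ℝ] ℂ :=
  (ContinuousLinearMap.toSpanSingleton ℝ Complex.I).comp (innerSL ℝ (waveVec k))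

theorem phaseCLM_apply (k : Mode) (x : Plane) :
    phaseCLM k x = (inner ℝ (waveVec k) x : ℂ) * Complex.I := by
  simp [phaseCLM]

theorem waveVec_apply (k : Mode) (i : Fin 2) : waveVec k i = 2 * Real.pi * (k.1 i : ℝ) := rfl

theorem modeFun_toTorus (k : Mode) (x : Plane) :
    modeFun k (toTorus x) = Complex.exp (phaseCLM k x) := by
  have h : modeFun k (toTorus x) = ∏ j : Fin 2, fourier (k.1 j) ((x j : ℝ) : UnitAddCircle) := rfl
  rw [h, phaseCLM_apply, Fin.prod_univ_two, fourier_coe_apply, fourier_coe_apply,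
    ← Complex.exp_add, PiLp.inner_apply, Fin.sum_univ_two]
  simp only [waveVec_apply, RCLike.inner_apply, conj_trivial]
  congr 1
  push_cast
  ring

theorem norm_modeFun (k : Mode) (x : Torus2) : ‖modeFun k x‖ = 1 := by
  have h : modeFun k x = ∏ j : Fin 2, fourier (k.1 j) (x j) := rfl
  rw [h, norm_prod]
  exact Finset.prod_eq_one fun i _ => Circle.norm_coe _

theorem modeFun_neg (k : Mode) (x : Torus2) : modeFun (-k) x = starRingEnd ℂ (modeFun k x) :=
  UnitAddTorus.mFourier_neg

theorem waveVec_neg (k : Mode) : waveVec (-k) = -waveVec k := by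
  ext i
  rw [PiLp.neg_apply, waveVec_apply, waveVec_apply]
  change 2 * Real.pi * ((-k.1 i : ℤ) : ℝ) = _
  push_cast
  ring

/-- Powers of `‖waveVec k‖` are therefore monotone in the exponent, so the assumed weighted sum
controls all sums of lower order. -/
theorem one_le_norm_waveVec (k : Mode) : 1 ≤ ‖waveVec k‖ := by
  obtain ⟨i, hi⟩ := Function.ne_iff.mp k.2
  refine le_trans ?_ (PiLp.norm_apply_le (waveVec k) i)
  rw [waveVec_apply, norm_mul, Real.norm_of_nonneg (by positivity), Real.norm_eq_abs]
  have h1 : (1 : ℝ) ≤ |(k.1 i : ℝ)| := by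
    have := Int.one_le_abs hi
    exact_mod_cast this
  nlinarith [Real.pi_gt_three]

theorem toTorus_add (x y : Plane) : toTorus (x + y) = toTorus x + toTorus y := by
  ext i
  simp [toTorus]

theorem exists_toTorus_eq (x : Torus2) : ∃ y : Plane, (∀ i, 0 ≤ y i ∧ y i < 1) ∧ toTorus y = x := by
  refine ⟨WithLp.toLp 2 fun i => (AddCircle.equivIco 1 0 (x i) : ℝ), fun i => ?_, ?_⟩
  · have := (AddCircle.equivIco (1 : ℝ) 0 (x i)).2
    exact ⟨this.1, by simpa using this.2⟩
  · ext i
    exact (AddCircle.equivIco (1 : ℝ) 0).symm_apply_apply (x i)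

/-- The symbol of the iterated directional derivative of multi-index `γ` at the mode `k`. -/
def derivSymbol {i : ℕ} (γ : Fin i → Fin 2) (k : Mode) : ℂ :=
  ∏ l, ((waveVec k (γ l) : ℝ) : ℂ) * Complex.I

theorem norm_derivSymbol_le {i : ℕ} (γ : Fin i → Fin 2) (k : Mode) :
    ‖derivSymbol γ k‖ ≤ ‖waveVec k‖ ^ i := by
  rw [derivSymbol, norm_prod]
  refine (Finset.prod_le_prod (fun _ _ => norm_nonneg _)
    fun l _ => (?_ : _ ≤ ‖waveVec k‖)).trans (by simp)
  rw [norm_mul, Complex.norm_I, mul_one, Complex.norm_real]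
  exact PiLp.norm_apply_le _ _

theorem contDiff_exp_phase (k : Mode) {n : WithTop ℕ∞} :
    ContDiff ℝ n fun x : Plane => Complex.exp (phaseCLM k x) :=
  Complex.contDiff_exp.comp (phaseCLM k).contDiff

theorem hasFDerivAt_exp_phase (k : Mode) (x : Plane) :
    HasFDerivAt (fun x : Plane => Complex.exp (phaseCLM k x))
      (Complex.exp (phaseCLM k x) • phaseCLM k) x :=
  (phaseCLM k).hasFDerivAt.cexp

theorem iteratedFDeriv_exp_phase (k : Mode) (i : ℕ) (x : Plane) (v : Fin i → Plane) :
    iteratedFDeriv ℝ i (fun x : Plane => Complex.exp (phaseCLM k x)) x v =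
      Complex.exp (phaseCLM k x) * ∏ l, phaseCLM k (v l) := by
  have key : ∀ i : ℕ, iteratedFDeriv ℝ i (fun x : Plane => Complex.exp (phaseCLM k x)) =
      fun x => Complex.exp (phaseCLM k x) •
        (ContinuousMultilinearMap.mkPiAlgebra ℝ (Fin i) ℂ).compContinuousLinearMap
          (fun _ => phaseCLM k) := by
    intro i
    induction i with
    | zero =>
      ext x v
      simp
    | succ i ih =>
      ext x v
      rw [iteratedFDeriv_succ_apply_left, ih,
        ((hasFDerivAt_exp_phase k x).smul_const _).fderiv]
      simp [Fin.prod_univ_succ, Fin.tail, mul_assoc]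
  rw [key]
  simp

theorem phaseCLM_eq_sum (k : Mode) (v : Plane) :
    phaseCLM k v = ∑ a : Fin 2, (v a : ℂ) * (((waveVec k a : ℝ) : ℂ) * Complex.I) := by
  rw [phaseCLM_apply, PiLp.inner_apply, Fin.sum_univ_two, Fin.sum_univ_two]
  simp only [RCLike.inner_apply, conj_trivial]
  push_cast
  ring

/-- Trigonometric polynomials on the torus. -/
def trigPoly (B : Finset Mode) (c : Mode → ℂ) (x : Torus2) : ℂ := ∑ k ∈ B, c k * modeFun k x

/-- Expanding the directions in coordinates turns each derivative into finitely many trigonometric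
polynomials with coefficients multiplied by a symbol. Supremum bounds for polynomials thus give
bounds for derivatives. -/
theorem iteratedFDeriv_trigPoly (B : Finset Mode) (c : Mode → ℂ) (i : ℕ) (x : Plane)
    (v : Fin i → Plane) :
    iteratedFDeriv ℝ i (fun x : Plane => trigPoly B c (toTorus x)) x v =
      ∑ γ : Fin i → Fin 2, ((∏ l, v l (γ l) : ℝ) : ℂ) *
        trigPoly B (fun k => derivSymbol γ k * c k) (toTorus x) := by
  have h1 : (fun x : Plane => trigPoly B c (toTorus x)) =
      fun x => ∑ k ∈ B, c k • Complex.exp (phaseCLM k x) := by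
    ext x
    simp only [trigPoly, modeFun_toTorus, smul_eq_mul]
  rw [h1, iteratedFDeriv_fun_sum_apply fun k _ =>
    ((contDiff_exp_phase k).const_smul (c k)).contDiffAt,
    sum_apply]
  have h2 : ∀ k, iteratedFDeriv ℝ i (fun x : Plane => c k • Complex.exp (phaseCLM k x)) x v =
      ∑ γ : Fin i → Fin 2, ((∏ l, v l (γ l) : ℝ) : ℂ) *
        (derivSymbol γ k * c k * modeFun k (toTorus x)) := by
    intro k
    rw [iteratedFDeriv_const_smul_apply' (contDiff_exp_phase k).contDiffAt,
      smul_apply, iteratedFDeriv_exp_phase]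
    simp_rw [phaseCLM_eq_sum]
    rw [Finset.prod_univ_sum, Fintype.piFinset_univ, Finset.mul_sum, Finset.smul_sum]
    refine Finset.sum_congr rfl fun γ _ => ?_
    rw [Finset.prod_mul_distrib, derivSymbol, modeFun_toTorus, phaseCLM_eq_sum, smul_eq_mul]
    push_cast
    ring
  simp_rw [h2, trigPoly, Finset.mul_sum]
  exact Finset.sum_comm

theorem contDiff_trigPoly (B : Finset Mode) (c : Mode → ℂ) {n : WithTop ℕ∞} :
    ContDiff ℝ n fun x : Plane => trigPoly B c (toTorus x) := by
  simp only [trigPoly, modeFun_toTorus]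
  exact ContDiff.sum fun k _ => contDiff_const.mul (contDiff_exp_phase k)

theorem norm_iteratedFDeriv_trigPoly_le (B : Finset Mode) (c : Mode → ℂ) (i : ℕ) (x : Plane) :
    ‖iteratedFDeriv ℝ i (fun x : Plane => trigPoly B c (toTorus x)) x‖ ≤
      ∑ γ : Fin i → Fin 2, ‖trigPoly B (fun k => derivSymbol γ k * c k) (toTorus x)‖ := by
  refine ContinuousMultilinearMap.opNorm_le_bound (by positivity) fun v => ?_
  rw [iteratedFDeriv_trigPoly, Finset.sum_mul]
  refine (norm_sum_le _ _).trans (Finset.sum_le_sum fun γ _ => ?_)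
  rw [norm_mul, mul_comm]
  gcongr
  rw [Complex.norm_real, norm_prod]
  exact Finset.prod_le_prod (fun _ _ => norm_nonneg _) fun l _ => PiLp.norm_apply_le _ _

theorem norm_iteratedFDeriv_re_le {f : Plane → ℂ} {i : ℕ} (hf : ContDiff ℝ i f) (x : Plane) :
    ‖iteratedFDeriv ℝ i (fun x => (f x).re) x‖ ≤ ‖iteratedFDeriv ℝ i f x‖ := by
  have h := Complex.reCLM.iteratedFDeriv_comp_left (i := i) hf.contDiffAt (x := x) le_rfl
  have h1 : (Complex.reCLM ∘ f) = fun x => (f x).re := rfl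
  rw [h1] at h
  rw [h]
  refine (ContinuousLinearMap.norm_compContinuousMultilinearMap_le _ _).trans ?_
  rw [Complex.reCLM_norm, one_mul]

end

noncomputable section

/-! ### Continuous curves of smooth functions on the torus -/

theorem isContinuousIntoCm_re_trigPoly (B : Finset Mode) {c : Mode → ℝ → ℂ}
    (hc : ∀ k, Continuous (c k)) (m : ℕ) :
    IsContinuousIntoCm m fun t x => (trigPoly B (fun k => c k t) x).re := by
  have hsm : ∀ t (n : WithTop ℕ∞),
      ContDiff ℝ n fun x : Plane => (trigPoly B (fun k => c k t) (toTorus x)).re := fun t n =>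
    Complex.reCLM.contDiff.comp (contDiff_trigPoly B _)
  refine ⟨fun t => hsm t _, fun t j _ => ?_⟩
  rw [Metric.tendstoUniformly_iff]
  intro ε hε
  have hlim : Tendsto (fun s => ∑ γ : Fin j → Fin 2, ∑ k ∈ B,
      ‖derivSymbol γ k‖ * ‖c k t - c k s‖) (𝓝 t) (𝓝 0) := by
    have : Continuous fun s => ∑ γ : Fin j → Fin 2, ∑ k ∈ B,
        ‖derivSymbol γ k‖ * ‖c k t - c k s‖ :=
      continuous_finsetSum _ fun γ _ => continuous_finsetSum _ fun k _ =>
        continuous_const.mul (continuous_const.sub (hc k)).norm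
    simpa using this.tendsto t
  filter_upwards [(tendsto_order.mp hlim).2 ε hε] with s hs x
  refine lt_of_le_of_lt ?_ hs
  have h1 : (fun x : Plane => (trigPoly B (fun k => c k t) (toTorus x)).re) -
      (fun x : Plane => (trigPoly B (fun k => c k s) (toTorus x)).re) =
      fun x : Plane => (trigPoly B (fun k => c k t - c k s) (toTorus x)).re := by
    ext x
    simp only [Pi.sub_apply, trigPoly, ← Complex.sub_re, ← Finset.sum_sub_distrib, sub_mul]
  rw [dist_eq_norm, ← iteratedFDeriv_sub_apply (hsm t j).contDiffAt (hsm s j).contDiffAt, h1]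
  refine (norm_iteratedFDeriv_re_le (contDiff_trigPoly B _) x).trans
    ((norm_iteratedFDeriv_trigPoly_le B _ j x).trans (Finset.sum_le_sum fun γ _ => ?_))
  refine (norm_sum_le _ _).trans (Finset.sum_le_sum fun k _ => ?_)
  rw [norm_mul, norm_modeFun, mul_one, norm_mul]

/-- Weierstrass' test for all derivatives up to order `m`. The majorants are uniform in space and
locally uniform in time, which gives termwise differentiation and continuity in time together. -/
theorem isContinuousIntoCm_tsum {m : ℕ} {f : ℕ → ℝ → Torus2 → ℝ}
    (hf : ∀ j, IsContinuousIntoCm m (f j))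
    (hb : ∀ N : ℕ, ∀ i ≤ m, ∃ K : ℕ → ℝ, Summable K ∧ ∀ (j : ℕ) (t : ℝ), |t| ≤ N → ∀ x,
      ‖iteratedFDeriv ℝ i (fun x => f j t (toTorus x)) x‖ ≤ K j) :
    IsContinuousIntoCm m (fun t x => ∑' j, f j t x) ∧
      ∀ t, ∀ i ≤ m, ∀ x, HasSum (fun j => iteratedFDeriv ℝ i (fun x => f j t (toTorus x)) x)
        (iteratedFDeriv ℝ i (fun x => ∑' j, f j t (toTorus x)) x) := by
  choose K hK hKb using hb
  -- Orders above `m` get the value 0, used by no estimate; it only makes the majorant defined for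
  -- every order.
  let v : ℕ → ℕ → ℕ → ℝ := fun N i => if h : i ≤ m then K N i h else 0
  have hv : ∀ N i, i ≤ m → Summable (v N i) := by
    intro N i hi
    simp only [v, hi, dif_pos]
    exact hK N i hi
  have hvb : ∀ (N i : ℕ), i ≤ m → ∀ (j : ℕ) (t : ℝ), |t| ≤ N → ∀ x,
      ‖iteratedFDeriv ℝ i (fun x => f j t (toTorus x)) x‖ ≤ v N i j := by
    intro N i hi
    simp only [v, hi, dif_pos]
    exact hKb N i hi
  have hcd : ∀ t, ContDiff ℝ m fun x : Plane => ∑' j, f j t (toTorus x) := by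
    intro t
    obtain ⟨N, hN⟩ := exists_nat_ge |t|
    exact contDiff_tsum (N := m) (v := v N) (fun j => (hf j).1 t)
      (fun i hi => hv N i (by exact_mod_cast hi))
      (fun i j x hi => hvb N i (by exact_mod_cast hi) j t hN x)
  have hit : ∀ t, ∀ i ≤ m, ∀ x : Plane,
      iteratedFDeriv ℝ i (fun x => ∑' j, f j t (toTorus x)) x =
        ∑' j, iteratedFDeriv ℝ i (fun x => f j t (toTorus x)) x := by
    intro t i hi x
    obtain ⟨N, hN⟩ := exists_nat_ge |t|
    exact iteratedFDeriv_tsum_apply (N := m) (v := v N) (fun j => (hf j).1 t)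
      (fun i hi => hv N i (by exact_mod_cast hi))
      (fun i j x hi => hvb N i (by exact_mod_cast hi) j t hN x) (by exact_mod_cast hi) x
  have hsum : ∀ t, ∀ i ≤ m, ∀ x : Plane,
      Summable fun j => iteratedFDeriv ℝ i (fun x => f j t (toTorus x)) x := by
    intro t i hi x
    obtain ⟨N, hN⟩ := exists_nat_ge |t|
    exact Summable.of_norm_bounded (hv N i hi) fun j => hvb N i hi j t hN x
  refine ⟨⟨hcd, fun t i hi => ?_⟩, fun t i hi x => ?_⟩
  · obtain ⟨N, hN⟩ := exists_nat_ge (|t| + 1)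
    have hnear : ∀ᶠ s : ℝ in 𝓝 t, |s| ≤ (N : ℝ) := by
      have h1 : ∀ᶠ s : ℝ in 𝓝 t, |s| < |t| + 1 :=
        (continuous_abs.tendsto t).eventually (gt_mem_nhds (by linarith))
      filter_upwards [h1] with s hs
      linarith
    have htN : |t| ≤ N := by linarith
    -- The trivial filter on the plane encodes uniformity in space, so dominated convergence of
    -- series yields uniform convergence directly.
    have hD : Tendsto (fun q : ℝ × Plane => ∑' j,
        (iteratedFDeriv ℝ i (fun x => f j q.1 (toTorus x)) q.2 -
          iteratedFDeriv ℝ i (fun x => f j t (toTorus x)) q.2)) (𝓝 t ×ˢ ⊤) (𝓝 0) := by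
      have h1 := tendsto_tsum_of_dominated_convergence (𝓕 := 𝓝 t ×ˢ (⊤ : Filter Plane))
        (f := fun (q : ℝ × Plane) j => iteratedFDeriv ℝ i (fun x => f j q.1 (toTorus x)) q.2 -
          iteratedFDeriv ℝ i (fun x => f j t (toTorus x)) q.2)
        (g := fun _ => 0) (bound := fun j => v N i j + v N i j) ((hv N i hi).add (hv N i hi))
        (fun j => ?_) ?_
      · simpa using h1
      · rw [tendsto_zero_iff_norm_tendsto_zero, Metric.tendsto_nhds]
        intro ε hε
        have h2 := Metric.tendstoUniformly_iff.mp ((hf j).2 t i hi) ε hε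
        filter_upwards [h2.prod_inl ⊤] with q hq
        simpa [← dist_eq_norm, dist_comm] using hq q.2
      · filter_upwards [hnear.prod_inl ⊤] with q hq j
        exact (norm_sub_le _ _).trans
          (add_le_add (hvb N i hi j q.1 hq q.2) (hvb N i hi j t htN q.2))
    rw [Metric.tendstoUniformly_iff]
    intro ε hε
    have h3 := Metric.tendstoUniformly_iff.mp (tendsto_prod_top_iff (F := fun s (x : Plane) =>
      ∑' j, (iteratedFDeriv ℝ i (fun x => f j s (toTorus x)) x -
        iteratedFDeriv ℝ i (fun x => f j t (toTorus x)) x)).mp hD) ε hε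
    filter_upwards [h3] with s hs x
    have h4 := hs x
    rw [dist_comm] at h4
    rw [dist_zero_right, (hsum s i hi x).tsum_sub (hsum t i hi x), ← hit s i hi x,
      ← hit t i hi x, ← dist_eq_norm, dist_comm] at h4
    exact h4
  · rw [hit t i hi x]
    exact (hsum t i hi x).hasSum

/-- `∇^⊥` as a linear function of the differential. -/
def perpCLM : (Plane →L[ℝ] ℝ) →L[ℝ] Plane :=
  (ContinuousLinearMap.toSpanSingleton ℝ (EuclideanSpace.single 0 1 : Plane)).comp
      (ContinuousLinearMap.apply ℝ ℝ (EuclideanSpace.single 1 1 : Plane)) -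
    (ContinuousLinearMap.toSpanSingleton ℝ (EuclideanSpace.single 1 1 : Plane)).comp
      (ContinuousLinearMap.apply ℝ ℝ (EuclideanSpace.single 0 1 : Plane))

theorem torusPartial_toTorus {f : Torus2 → ℝ} {x : Plane}
    (hf : DifferentiableAt ℝ (fun x : Plane => f (toTorus x)) x) (i : Fin 2) :
    torusPartial i f (toTorus x) =
      fderiv ℝ (fun x : Plane => f (toTorus x)) x (EuclideanSpace.single i 1) := by
  have h1 : (fun h : ℝ => f (toTorus x + Pi.single i (h : UnitAddCircle))) =
      fun h : ℝ => f (toTorus (x + h • (EuclideanSpace.single i 1 : Plane))) := by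
    ext h
    rw [toTorus_add]
    congr 2
    ext j
    by_cases hj : j = i
    · subst hj
      simp [toTorus]
    · simp [toTorus, hj]
  rw [torusPartial, h1]
  have h2 : HasDerivAt (fun h : ℝ => x + h • (EuclideanSpace.single i 1 : Plane))
      (EuclideanSpace.single i 1) 0 := by
    simpa using ((hasDerivAt_id (0 : ℝ)).smul_const
      (EuclideanSpace.single i 1 : Plane)).const_add x
  have h3 : HasFDerivAt (fun x : Plane => f (toTorus x))
      (fderiv ℝ (fun x : Plane => f (toTorus x)) x)
      (x + (0 : ℝ) • (EuclideanSpace.single i 1 : Plane)) := by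
    rw [zero_smul, add_zero]
    exact hf.hasFDerivAt
  exact (h3.comp_hasDerivAt (0 : ℝ) h2).deriv

theorem perpGrad_toTorus {f : Torus2 → ℝ} {x : Plane}
    (hf : DifferentiableAt ℝ (fun x : Plane => f (toTorus x)) x) :
    perpGrad f (toTorus x) = perpCLM (fderiv ℝ (fun x : Plane => f (toTorus x)) x) := by
  ext i
  rw [perpGrad, torusPartial_toTorus hf, torusPartial_toTorus hf]
  fin_cases i <;> simp [perpCLM]

/-- Derivatives of order `j` of `∇^⊥ u` are a fixed bounded linear image of derivatives of order `j
+ 1` of `u`. -/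
theorem IsContinuousIntoCm.perpGrad {m : ℕ} (hm : 1 ≤ m) {u : ℝ → Torus2 → ℝ}
    (hu : IsContinuousIntoCm m u) :
    IsContinuousIntoCm (m - 1) fun t => _root_.perpGrad (u t) := by
  obtain ⟨n, rfl⟩ : ∃ n, m = n + 1 := ⟨m - 1, by omega⟩
  rw [Nat.add_sub_cancel]
  have hd : ∀ t, Differentiable ℝ fun x : Plane => u t (toTorus x) := fun t =>
    (hu.1 t).differentiable (by simp)
  have hfd : ∀ t, ContDiff ℝ n (fderiv ℝ fun x : Plane => u t (toTorus x)) := fun t =>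
    (hu.1 t).fderiv_right (by simp)
  have heq : ∀ t, (fun x : Plane => _root_.perpGrad (u t) (toTorus x)) =
      perpCLM ∘ fderiv ℝ fun x : Plane => u t (toTorus x) := fun t =>
    funext fun x => perpGrad_toTorus (hd t x)
  refine ⟨fun t => ?_, fun t j hj => ?_⟩
  · rw [heq]
    exact perpCLM.contDiff.comp (hfd t)
  · have hnorm : ∀ s (x : Plane),
        dist (iteratedFDeriv ℝ j (fun x : Plane => _root_.perpGrad (u t) (toTorus x)) x)
          (iteratedFDeriv ℝ j (fun x : Plane => _root_.perpGrad (u s) (toTorus x)) x) ≤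
        ‖perpCLM‖ * dist (iteratedFDeriv ℝ (j + 1) (fun x : Plane => u t (toTorus x)) x)
          (iteratedFDeriv ℝ (j + 1) (fun x : Plane => u s (toTorus x)) x) := by
      intro s x
      rw [heq t, heq s,
        perpCLM.iteratedFDeriv_comp_left (hfd t).contDiffAt (by exact_mod_cast hj),
        perpCLM.iteratedFDeriv_comp_left (hfd s).contDiffAt (by exact_mod_cast hj),
        iteratedFDeriv_succ_eq_comp_right, iteratedFDeriv_succ_eq_comp_right, Function.comp_apply,
        Function.comp_apply, LinearIsometryEquiv.dist_map, dist_eq_norm, dist_eq_norm]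
      have : perpCLM.compContinuousMultilinearMap
            (iteratedFDeriv ℝ j (fderiv ℝ fun x : Plane => u t (toTorus x)) x) -
          perpCLM.compContinuousMultilinearMap
            (iteratedFDeriv ℝ j (fderiv ℝ fun x : Plane => u s (toTorus x)) x) =
          perpCLM.compContinuousMultilinearMap
            (iteratedFDeriv ℝ j (fderiv ℝ fun x : Plane => u t (toTorus x)) x -
              iteratedFDeriv ℝ j (fderiv ℝ fun x : Plane => u s (toTorus x)) x) := by
        ext v
        simp
      rw [this]
      exact ContinuousLinearMap.norm_compContinuousMultilinearMap_le _ _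
    rw [Metric.tendstoUniformly_iff]
    intro ε hε
    -- The added 1 avoids division by the norm itself.
    have h1 := Metric.tendstoUniformly_iff.mp (hu.2 t (j + 1) (by omega)) (ε / (‖perpCLM‖ + 1))
      (by positivity)
    filter_upwards [h1] with s hs x
    refine (hnorm s x).trans_lt ?_
    have h2 := hs x
    rw [lt_div_iff₀ (by positivity)] at h2
    nlinarith [dist_nonneg (x := iteratedFDeriv ℝ (j + 1) (fun x : Plane => u t (toTorus x)) x)
      (y := iteratedFDeriv ℝ (j + 1) (fun x : Plane => u s (toTorus x)) x)]

end

noncomputable section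

/-! ### Exhaustion of the modes by finite symmetric sets -/

theorem finite_box (R : ℕ) : {k : Mode | ∀ i, |k.1 i| ≤ R}.Finite := by
  refine Set.Finite.of_injOn (f := fun k : Mode => k.1)
    (t := Set.pi univ fun _ => Icc (-(R : ℤ)) R) (fun k hk i _ => ?_)
    (fun k _ l _ h => Subtype.ext h) (Set.Finite.pi fun _ => finite_Icc _ _)
  exact abs_le.mp (hk i)

/-- The modes in a box. -/
def boxModes (R : ℕ) : Finset Mode := (finite_box R).toFinset

theorem mem_boxModes {R : ℕ} {k : Mode} : k ∈ boxModes R ↔ ∀ i, |k.1 i| ≤ R :=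
  (finite_box R).mem_toFinset

theorem monotone_boxModes : Monotone boxModes := by
  intro R S h k hk
  rw [mem_boxModes] at hk ⊢
  exact fun i => (hk i).trans (by exact_mod_cast h)

theorem exists_mem_boxModes (k : Mode) : ∃ R, k ∈ boxModes R := by
  refine ⟨∑ i, (k.1 i).natAbs, mem_boxModes.mpr fun i => ?_⟩
  rw [Int.abs_eq_natAbs]
  exact_mod_cast Finset.single_le_sum (f := fun i => (k.1 i).natAbs) (fun _ _ => Nat.zero_le _)
    (Finset.mem_univ i)

theorem neg_mem_boxModes {R : ℕ} {k : Mode} (h : k ∈ boxModes R) : -k ∈ boxModes R := by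
  rw [mem_boxModes] at h ⊢
  intro i
  change |-k.1 i| ≤ _
  rw [abs_neg]
  exact h i

/-- Rate `1/4` for the tail weights makes their square roots, which govern the blocks in chaining,
summable. Closure under negation keeps the block sums real. -/
theorem exists_exhaustion {v : Mode → ℝ} (hv0 : ∀ k, 0 ≤ v k) (hv : Summable v) :
    ∃ F : ℕ → Finset Mode, Monotone F ∧ (∀ k, ∃ j, k ∈ F j) ∧ (∀ j, ∀ k ∈ F j, -k ∈ F j) ∧
      ∀ (j : ℕ) (G : Finset Mode), Disjoint G (F j) → ∑ k ∈ G, v k ≤ (1 / 4) ^ j := by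
  have ht := (tendsto_tsum_compl_atTop_zero v).comp
    (tendsto_atTop_finset_of_monotone monotone_boxModes exists_mem_boxModes)
  have hev : ∀ j : ℕ, ∀ᶠ R in atTop, ∑' a : {x // x ∉ boxModes R}, v a < (1 / 4) ^ j := fun j =>
    (tendsto_order.mp ht).2 _ (by positivity)
  obtain ⟨φ, hφ, h⟩ := extraction_forall_of_eventually hev
  refine ⟨fun j => boxModes (φ j), monotone_boxModes.comp hφ.monotone, fun k => ?_,
    fun j k hk => neg_mem_boxModes hk, fun j G hG => le_trans ?_ (h j).le⟩
  · obtain ⟨R, hR⟩ := exists_mem_boxModes k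
    exact ⟨R, monotone_boxModes (hφ.id_le R) hR⟩
  · have h1 : Summable fun a : {x // x ∉ boxModes (φ j)} => v a := hv.subtype _
    have hG' : ∀ k ∈ G, k ∉ boxModes (φ j) := fun k hk => Finset.disjoint_left.mp hG hk
    have h2 := h1.sum_le_tsum (G.subtype fun k => k ∉ boxModes (φ j)) fun k _ => hv0 _
    rwa [Finset.sum_subtype_of_mem _ hG'] at h2

/-- The blocks `F 0, F 1 \ F 0, F 2 \ F 1, …`. -/
def block (F : ℕ → Finset Mode) : ℕ → Finset Mode
  | 0 => F 0
  | j + 1 => F (j + 1) \ F j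

theorem sum_range_block {E : Type*} [AddCommMonoid E] {F : ℕ → Finset Mode} (hF : Monotone F)
    (f : Mode → E) (J : ℕ) :
    ∑ j ∈ Finset.range (J + 1), ∑ k ∈ block F j, f k = ∑ k ∈ F J, f k := by
  induction J with
  | zero => simp [block]
  | succ J ih =>
    rw [Finset.sum_range_succ, ih, block, add_comm]
    exact Finset.sum_sdiff (hF (Nat.le_succ J))

/-! ### The Ornstein–Uhlenbeck modes as orthogonal curves in `L²`. -/

section Noise

variable {Ω : Type u} [MeasurableSpace Ω] {P : Measure Ω} [IsProbabilityMeasure P] {H : ℝ}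
  {β : Mode → ℝ → Ω → ℂ}

/-- Continuous versions of the fractional Ornstein–Uhlenbeck processes with rates `a`. -/
structure IsOUModes (h : IsFractionalNoise P H β) (a : Mode → ℝ) (X : Mode → ℝ → Ω → ℂ) :
    Prop where
  measurable : ∀ k t, Measurable (X k t)
  continuous : ∀ k ω, Continuous fun t => X k t ω
  conj : ∀ k t ω, X (-k) t ω = starRingEnd ℂ (X k t ω)
  ae_eq : ∀ k t, X k t =ᵐ[P] (ouTransform (a k) (h.curve k) t : Lp ℂ 2 P)

namespace IsFractionalNoise

variable {a : Mode → ℝ}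

/-- The Ornstein–Uhlenbeck process of the mode `k` as a curve in `L²`. -/
def ouCurve (h : IsFractionalNoise P H β) (a : Mode → ℝ) (k : Mode) (t : ℝ) : Lp ℂ 2 P :=
  ouTransform (a k) (h.curve k) t

theorem inner_ouCurve_of_ne (h : IsFractionalNoise P H β) (hH : 0 < H ∧ H < 1)
    (ha : ∀ k, 0 < a k) {k l : Mode} (hkl : k ≠ l) (t s : ℝ) :
    inner ℂ (h.ouCurve a k t) (h.ouCurve a l s) = 0 := by
  have h1 := (h.hasFBMCov_of_ne hkl).inner_ouTransform ((h.hasFBMCov_self k).isHolderCurve hH)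
    ((h.hasFBMCov_self l).isHolderCurve hH) (ha k) (ha l) t s
  rw [zero_mul] at h1
  exact h1

/-- Two times are allowed at once because increments in time and in space both have coefficients of
the form `c • X(t) + d • X(s)`. -/
theorem pairwise_orthogonal (h : IsFractionalNoise P H β) (hH : 0 < H ∧ H < 1)
    (ha : ∀ k, 0 < a k) {c d : Mode → ℂ} {t s : ℝ} :
    Pairwise fun k l => inner ℂ (c k • h.ouCurve a k t + d k • h.ouCurve a k s)
      (c l • h.ouCurve a l t + d l • h.ouCurve a l s) = 0 := by
  intro k l hkl
  simp only [inner_add_left, inner_add_right, inner_smul_left, inner_smul_right,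
    h.inner_ouCurve_of_ne hH ha hkl, mul_zero, add_zero]

theorem norm_ouCurve_le (h : IsFractionalNoise P H β) (hH : 0 < H ∧ H < 1) {a₀ : ℝ} (ha₀ : 0 < a₀)
    (ha : ∀ k, a₀ ≤ a k) (k : Mode) (t : ℝ) : ‖h.ouCurve a k t‖ ≤ 1 + 1 / a₀ := by
  refine (((h.hasFBMCov_self k).isHolderCurve hH).norm_ouTransform_le
    (ha₀.trans_le (ha k)) t).trans ?_
  gcongr
  exact ha k

theorem norm_ouCurve_sub_le (h : IsFractionalNoise P H β) (hH : 0 < H ∧ H < 1)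
    (ha : ∀ k, 0 < a k) (k : Mode) (t s : ℝ) :
    ‖h.ouCurve a k t - h.ouCurve a k s‖ ≤ 2 * |t - s| ^ H :=
  ((h.hasFBMCov_self k).isHolderCurve hH).norm_ouTransform_sub_le (ha k) t s

/-- A finite linear combination of the modes as an element of `L²`. -/
def ouSum (h : IsFractionalNoise P H β) (a : Mode → ℝ) (B : Finset Mode) (c : Mode → ℂ) (t : ℝ) :
    Lp ℂ 2 P := ∑ k ∈ B, c k • h.ouCurve a k t

theorem ouSum_mem (h : IsFractionalNoise P H β) (hH : 0 < H ∧ H < 1) (ha : ∀ k, 0 < a k)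
    (B : Finset Mode) (c : Mode → ℂ) (t : ℝ) : h.ouSum a B c t ∈ h.gaussianSpace :=
  Submodule.sum_mem _ fun k _ => Submodule.smul_mem _ _ (h.ouTransform_mem hH (ha k) k t)

theorem coeFn_ouSum {h : IsFractionalNoise P H β} {X : Mode → ℝ → Ω → ℂ} (hX : IsOUModes h a X)
    (B : Finset Mode) (c : Mode → ℂ) (t : ℝ) :
    (h.ouSum a B c t : Ω → ℂ) =ᵐ[P] fun ω => ∑ k ∈ B, c k * X k t ω := by
  have h1 : ∀ᵐ ω ∂P, ∀ k ∈ B, (c k • h.ouCurve a k t : Lp ℂ 2 P) ω = c k * X k t ω := by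
    refine (ae_ball_iff B.countable_toSet).mpr fun k _ => ?_
    filter_upwards [Lp.coeFn_smul (c k) (h.ouCurve a k t), hX.ae_eq k t] with ω e1 e2
    rw [e1, Pi.smul_apply, smul_eq_mul, e2]
    rfl
  filter_upwards [h1, Lp.coeFn_finsetSum B fun k => c k • h.ouCurve a k t] with ω e1 e2
  rw [ouSum, e2, Finset.sum_apply]
  exact Finset.sum_congr rfl e1

theorem norm_sq_ouSum_add (h : IsFractionalNoise P H β) (hH : 0 < H ∧ H < 1) (ha : ∀ k, 0 < a k)
    (B : Finset Mode) (c d : Mode → ℂ) (t s : ℝ) :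
    ‖h.ouSum a B c t + h.ouSum a B d s‖ ^ 2 =
      ∑ k ∈ B, ‖c k • h.ouCurve a k t + d k • h.ouCurve a k s‖ ^ 2 := by
  rw [ouSum, ouSum, ← Finset.sum_add_distrib,
    norm_sq_sum_of_orthogonal (h.pairwise_orthogonal hH ha)]

theorem norm_sq_ouSum (h : IsFractionalNoise P H β) (hH : 0 < H ∧ H < 1) (ha : ∀ k, 0 < a k)
    (B : Finset Mode) (c : Mode → ℂ) (t : ℝ) :
    ‖h.ouSum a B c t‖ ^ 2 = ∑ k ∈ B, ‖c k‖ ^ 2 * ‖h.ouCurve a k t‖ ^ 2 := by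
  have h1 := h.norm_sq_ouSum_add hH ha B c 0 t t
  simp only [ouSum, Pi.zero_apply, zero_smul, Finset.sum_const_zero, add_zero, norm_smul,
    mul_pow] at h1
  exact h1

end IsFractionalNoise

/-! ### Uniform bounds for trigonometric polynomials of the modes -/

/-- Interpolation between the Lipschitz bound and the trivial bound 2; only `‖waveVec k‖^θ` is paid.
-/
theorem norm_exp_phase_sub_le (k : Mode) (x y : Plane) {θ : ℝ} (hθ : 0 < θ ∧ θ ≤ 1) :
    ‖Complex.exp (phaseCLM k x) - Complex.exp (phaseCLM k y)‖ ≤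
      2 * (‖waveVec k‖ * ‖x - y‖) ^ θ := by
  have h1 : ‖Complex.exp (phaseCLM k x) - Complex.exp (phaseCLM k y)‖ ≤ ‖waveVec k‖ * ‖x - y‖ := by
    rw [phaseCLM_apply, phaseCLM_apply]
    refine (norm_exp_mul_I_sub_le _ _).trans ?_
    rw [← inner_sub_right]
    exact abs_real_inner_le_norm _ _
  have h2 : ‖Complex.exp (phaseCLM k x) - Complex.exp (phaseCLM k y)‖ ≤ 2 := by
    refine (norm_sub_le _ _).trans ?_
    rw [phaseCLM_apply, phaseCLM_apply, Complex.norm_exp_ofReal_mul_I,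
      Complex.norm_exp_ofReal_mul_I]
    norm_num
  set z := ‖waveVec k‖ * ‖x - y‖ with hz
  have hz0 : 0 ≤ z := by positivity
  rcases le_total z 1 with h | h
  · have h3 : z ≤ z ^ θ := by
      have := Real.rpow_le_rpow_of_exponent_ge' hz0 h hθ.1.le hθ.2
      rwa [Real.rpow_one] at this
    have : 0 ≤ z ^ θ := by positivity
    linarith
  · have := Real.one_le_rpow h hθ.1.le
    linarith

/-- The point of the plane with the last two coordinates of `p`. -/
def planePoint (p : Fin 3 → ℝ) : Plane := WithLp.toLp 2 ![p 1, p 2]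

theorem norm_planePoint_sub_le (p q : Fin 3 → ℝ) : ‖planePoint p - planePoint q‖ ≤ 2 * dist p q := by
  have h1 : ‖planePoint p - planePoint q‖ ^ 2 = (p 1 - q 1) ^ 2 + (p 2 - q 2) ^ 2 := by
    rw [EuclideanSpace.norm_sq_eq, Fin.sum_univ_two]
    simp [planePoint]
  have h2 : ∀ i, |p i - q i| ≤ dist p q := fun i => by
    rw [← Real.dist_eq]
    exact dist_le_pi_dist p q i
  have h3 : ∀ i, (p i - q i) ^ 2 ≤ dist p q ^ 2 := fun i => by
    rw [← sq_abs]
    exact pow_le_pow_left₀ (abs_nonneg _) (h2 i) 2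
  refine (sq_le_sq₀ (norm_nonneg _) (by positivity)).mp ?_
  rw [h1]
  nlinarith [h3 1, h3 2, sq_nonneg (dist p q)]

theorem continuous_toTorus : Continuous toTorus :=
  continuous_pi fun i => (AddCircle.continuous_mk' 1).comp (by fun_prop)

theorem enorm_le_mul_ofReal_rpow {E : Type*} [NormedAddCommGroup E] {z : E} {x d γ : ℝ}
    (hx : 0 ≤ x) (hd : 0 ≤ d) (hγ : 0 ≤ γ)
    (h : ‖z‖ ≤ x * d ^ γ) : ‖z‖ₑ ≤ ENNReal.ofReal x * ENNReal.ofReal d ^ γ := by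
  rw [← ofReal_norm, ENNReal.ofReal_rpow_of_nonneg hd hγ, ← ENNReal.ofReal_mul hx]
  exact ENNReal.ofReal_le_ofReal h

/-- The polynomial is a Gaussian field on a cube with one time and two space coordinates, whose
increments are bounded in `L²` by orthogonality of the modes. Chaining then gives a constant
independent of the finite set, the coefficients and the time interval. -/
theorem exists_lintegral_trigPoly_bound {h : IsFractionalNoise P H β} (hH : 0 < H ∧ H < 1)
    {a : Mode → ℝ} {a₀ : ℝ} (ha₀ : 0 < a₀) (ha : ∀ k, a₀ ≤ a k) {X : Mode → ℝ → Ω → ℂ}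
    (hX : IsOUModes h a X) {θ : ℝ} (hθ : 0 < θ ∧ θ ≤ 1) :
    ∃ C : ℝ≥0∞, C ≠ ∞ ∧ ∀ (B : Finset Mode) (c : Mode → ℂ) (A : ℝ), 0 ≤ A →
      ∑ k ∈ B, ‖c k‖ ^ 2 * ‖waveVec k‖ ^ (2 * θ) ≤ A ^ 2 → ∀ n : ℤ, ∃ K : Ω → ℝ≥0∞,
        Measurable K ∧ (∀ ω (t : ℝ), (n : ℝ) ≤ t → t < n + 1 → ∀ x,
          ‖trigPoly B (fun k => c k * X k t ω) x‖ₑ ≤ K ω) ∧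
        ∫⁻ ω, K ω ∂P ≤ C * ENNReal.ofReal A := by
  have ha' : ∀ k, 0 < a k := fun k => ha₀.trans_le (ha k)
  set γ := min H θ with hγdef
  have hγ : 0 < γ := lt_min hH.1 hθ.1
  have hγ1 : γ ≤ 1 := (min_le_right _ _).trans hθ.2
  -- Moments of this order satisfy `κ γ = 4`, above the dimension 3 of the cube.
  set κ := 4 / γ with hκdef
  have hκ : 1 ≤ κ := by
    rw [hκdef, le_div_iff₀ hγ]
    linarith
  have hκγ : ((3 : ℕ) : ℝ) < κ * γ := by
    rw [hκdef, div_mul_cancel₀ _ hγ.ne']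
    norm_num
  obtain ⟨C, hC, hbound⟩ := exists_lintegral_sup_bound.{u} 3 hκ hγ hκγ
  set g := eLpNorm id (ENNReal.ofReal κ) (gaussianReal 0 1) with hg
  have hgt : g ≠ ∞ := eLpNorm_id_gaussianReal_ne_top κ
  set σ := 1 + 1 / a₀ with hσ
  have hσ0 : 0 < σ := by positivity
  -- `2 * g` comes from the Gaussian moments of the increments, the extra 1 from the value at the
  -- origin, for which the `L²` norm suffices. In `2 + 4 * σ` the 2 is for time increments and `4 *
  -- σ` for space increments.
  refine ⟨C * ((2 * g + 1) * ENNReal.ofReal (2 + 4 * σ)), ENNReal.mul_ne_top hC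
    (ENNReal.mul_ne_top (by finiteness) ENNReal.ofReal_ne_top), fun B c A hA hsum n => ?_⟩
  let f : (Fin 3 → ℝ) → Ω → ℂ := fun p ω =>
    trigPoly B (fun k => c k * X k (n + p 0) ω) (toTorus (planePoint p))
  let Z : (Fin 3 → ℝ) → Lp ℂ 2 P := fun p =>
    h.ouSum a B (fun k => c k * modeFun k (toTorus (planePoint p))) (n + p 0)
  have hfZ : ∀ p, f p =ᵐ[P] Z p := by
    intro p
    filter_upwards [IsFractionalNoise.coeFn_ouSum hX B
      (fun k => c k * modeFun k (toTorus (planePoint p))) (n + p 0)] with ω hω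
    rw [hω]
    exact Finset.sum_congr rfl fun k _ => by ring
  -- Pointwise bounds on the single modes are summed in `ℓ²`, where the weighted sum of the
  -- coefficients is at most `A²`.
  have hAnn : ∀ (b : Mode → ℝ) (y : ℝ), 0 ≤ y → (∀ k, 0 ≤ b k) →
      (∀ k, b k ≤ ‖c k‖ * (‖waveVec k‖ ^ θ * y)) → ∑ k ∈ B, b k ^ 2 ≤ (A * y) ^ 2 := by
    intro b y hy hb0 hb
    calc ∑ k ∈ B, b k ^ 2 ≤ ∑ k ∈ B, (‖c k‖ ^ 2 * ‖waveVec k‖ ^ (2 * θ)) * y ^ 2 := by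
          refine Finset.sum_le_sum fun k _ => (pow_le_pow_left₀ (hb0 k) (hb k) 2).trans
            (le_of_eq ?_)
          rw [mul_comm 2 θ, Real.rpow_mul (norm_nonneg _), Real.rpow_two]
          ring
      _ ≤ A ^ 2 * y ^ 2 := by
          rw [← Finset.sum_mul]
          exact mul_le_mul_of_nonneg_right hsum (sq_nonneg _)
      _ = (A * y) ^ 2 := by ring
  have hwθ : ∀ k, 1 ≤ ‖waveVec k‖ ^ θ := fun k =>
    Real.one_le_rpow (one_le_norm_waveVec k) hθ.1.le
  have hZ0 : ∀ p, ‖Z p‖ ≤ A * σ := by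
    intro p
    refine (sq_le_sq₀ (norm_nonneg _) (by positivity)).mp ?_
    rw [h.norm_sq_ouSum hH ha']
    simp_rw [← mul_pow]
    refine hAnn _ σ hσ0.le (fun k => by positivity) fun k => ?_
    rw [norm_mul, norm_modeFun, mul_one]
    refine mul_le_mul_of_nonneg_left ?_ (norm_nonneg _)
    calc ‖h.ouCurve a k (n + p 0)‖ ≤ 1 * σ := by
          rw [one_mul]
          exact h.norm_ouCurve_le hH ha₀ ha k _
      _ ≤ _ := mul_le_mul_of_nonneg_right (hwθ k) hσ0.le
  have hZd : ∀ p ∈ Icc (0 : Fin 3 → ℝ) 1, ∀ q ∈ Icc (0 : Fin 3 → ℝ) 1,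
      ‖Z p - Z q‖ ≤ A * (2 + 4 * σ) * dist p q ^ γ := by
    intro p hp q hq
    have hd1 : dist p q ≤ 1 := by
      refine (dist_pi_le_iff zero_le_one).mpr fun i => ?_
      rw [Real.dist_eq, abs_le]
      have h1 : (0 : ℝ) ≤ p i := hp.1 i
      have h2 : p i ≤ (1 : ℝ) := hp.2 i
      have h3 : (0 : ℝ) ≤ q i := hq.1 i
      have h4 : q i ≤ (1 : ℝ) := hq.2 i
      constructor <;> linarith
    have hdH : dist p q ^ H ≤ dist p q ^ γ :=
      Real.rpow_le_rpow_of_exponent_ge' dist_nonneg hd1 hγ.le (min_le_left _ _)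
    have hdθ : dist p q ^ θ ≤ dist p q ^ γ :=
      Real.rpow_le_rpow_of_exponent_ge' dist_nonneg hd1 hγ.le (min_le_right _ _)
    have hneg : Z p - Z q = Z p + h.ouSum a B
        (fun k => -(c k * modeFun k (toTorus (planePoint q)))) (n + q 0) := by
      simp only [Z, IsFractionalNoise.ouSum, neg_smul, Finset.sum_neg_distrib, sub_eq_add_neg]
    refine (sq_le_sq₀ (norm_nonneg _) (by positivity)).mp ?_
    rw [hneg, h.norm_sq_ouSum_add hH ha', mul_assoc]
    refine hAnn _ _ (by positivity) (fun k => norm_nonneg _) fun k => ?_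
    -- A time increment at a fixed point plus a space increment at a fixed time.
    have e1 : (c k * modeFun k (toTorus (planePoint p))) • h.ouCurve a k (n + p 0) +
        (-(c k * modeFun k (toTorus (planePoint q)))) • h.ouCurve a k (n + q 0) =
        c k • (modeFun k (toTorus (planePoint p)) •
          (h.ouCurve a k (n + p 0) - h.ouCurve a k (n + q 0)) +
          (modeFun k (toTorus (planePoint p)) - modeFun k (toTorus (planePoint q))) •
            h.ouCurve a k (n + q 0)) := by
      simp only [smul_add, smul_sub, sub_smul, neg_smul, mul_smul]
      abel
    rw [e1, norm_smul]
    refine mul_le_mul_of_nonneg_left ((norm_add_le _ _).trans ?_) (norm_nonneg _)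
    rw [norm_smul, norm_smul, norm_modeFun, one_mul, modeFun_toTorus, modeFun_toTorus]
    have e2 : ‖h.ouCurve a k (n + p 0) - h.ouCurve a k (n + q 0)‖ ≤ 2 * dist p q ^ γ := by
      refine (h.norm_ouCurve_sub_le hH ha' k _ _).trans ?_
      rw [add_sub_add_left_eq_sub]
      have h1 : |p 0 - q 0| ≤ dist p q := by
        rw [← Real.dist_eq]
        exact dist_le_pi_dist p q 0
      have h2 := Real.rpow_le_rpow (abs_nonneg _) h1 hH.1.le
      linarith
    have e3 : ‖Complex.exp (phaseCLM k (planePoint p)) - Complex.exp (phaseCLM k (planePoint q))‖ ≤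
        4 * (‖waveVec k‖ ^ θ * dist p q ^ γ) := by
      refine (norm_exp_phase_sub_le k _ _ hθ).trans ?_
      have h1 : (‖waveVec k‖ * ‖planePoint p - planePoint q‖) ^ θ ≤
          (‖waveVec k‖ * (2 * dist p q)) ^ θ :=
        Real.rpow_le_rpow (by positivity)
          (mul_le_mul_of_nonneg_left (norm_planePoint_sub_le p q) (norm_nonneg _)) hθ.1.le
      rw [Real.mul_rpow (norm_nonneg _) (by positivity : 0 ≤ 2 * dist p q),
        Real.mul_rpow (by norm_num : (0 : ℝ) ≤ 2) dist_nonneg] at h1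
      have h2 : (2 : ℝ) ^ θ ≤ 2 := by
        have := Real.rpow_le_rpow_of_exponent_le (one_le_two : (1 : ℝ) ≤ 2) hθ.2
        rwa [Real.rpow_one] at this
      have h3 : ‖waveVec k‖ ^ θ * (2 ^ θ * dist p q ^ θ) ≤
          ‖waveVec k‖ ^ θ * (2 * dist p q ^ γ) := by
        gcongr
      linarith
    have e4 := h.norm_ouCurve_le hH ha₀ ha k (n + q 0)
    calc _ ≤ 2 * dist p q ^ γ + 4 * (‖waveVec k‖ ^ θ * dist p q ^ γ) * σ :=
          add_le_add e2 (mul_le_mul e3 e4 (norm_nonneg _) (by positivity))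
      _ ≤ ‖waveVec k‖ ^ θ * (2 * dist p q ^ γ) + 4 * (‖waveVec k‖ ^ θ * dist p q ^ γ) * σ := by
          exact add_le_add (le_mul_of_one_le_left (by positivity) (hwθ k)) le_rfl
      _ = _ := by ring
  have hMofReal : ENNReal.ofReal (2 + 4 * σ) * ENNReal.ofReal A =
      ENNReal.ofReal (A * (2 + 4 * σ)) := by
    rw [mul_comm, ENNReal.ofReal_mul hA]
  have hcont : ∀ ω, Continuous fun p => f p ω := by
    intro ω
    refine continuous_finsetSum _ fun k _ => (continuous_const.mul
      ((hX.continuous k ω).comp (by fun_prop))).mul ((modeFun k).continuous.comp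
        (continuous_toTorus.comp ?_))
    exact (PiLp.continuous_toLp 2 _).comp (continuous_pi fun i => by fin_cases i <;> fun_prop)
  have hmeas : ∀ p, Measurable (f p) := by
    intro p
    exact Finset.measurable_sum _ fun k _ => ((hX.measurable k _).const_mul _).mul_const _
  have hzero : ∫⁻ ω, ‖f 0 ω‖ₑ ∂P ≤ (2 * g + 1) * ENNReal.ofReal (A * (2 + 4 * σ)) := by
    rw [lintegral_congr_ae (g := fun ω => ‖Z 0 ω‖ₑ) (by
      filter_upwards [hfZ 0] with ω hω
      rw [hω]), ← eLpNorm_one_eq_lintegral_enorm]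
    refine (eLpNorm_le_eLpNorm_of_exponent_le (q := 2) (by norm_num)
      (Lp.aestronglyMeasurable _)).trans ?_
    rw [← Lp.enorm_def, ← ofReal_norm]
    have h1 : ENNReal.ofReal ‖Z 0‖ ≤ ENNReal.ofReal (A * (2 + 4 * σ)) := by
      refine ENNReal.ofReal_le_ofReal ((hZ0 0).trans ?_)
      nlinarith
    calc _ ≤ 1 * ENNReal.ofReal (A * (2 + 4 * σ)) := by rwa [one_mul]
      _ ≤ _ := by
        gcongr
        exact le_add_self
  have hinc : ∀ p ∈ Icc (0 : Fin 3 → ℝ) 1, ∀ q ∈ Icc (0 : Fin 3 → ℝ) 1,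
      ∫⁻ ω, ‖f p ω - f q ω‖ₑ ^ κ ∂P ≤
        ((2 * g + 1) * ENNReal.ofReal (A * (2 + 4 * σ)) * ENNReal.ofReal (dist p q) ^ γ) ^ κ := by
    intro p hp q hq
    have h1 : (Z p - Z q) ∈ h.gaussianSpace :=
      Submodule.sub_mem _ (h.ouSum_mem hH ha' _ _ _) (h.ouSum_mem hH ha' _ _ _)
    have h2 := lintegral_enorm_rpow_le_of_isCenteredGaussianRe
      (h.isCenteredGaussianRe_smul_of_mem h1) hκ
    rw [lintegral_congr_ae (g := fun ω => ‖(Z p - Z q : Lp ℂ 2 P) ω‖ₑ ^ κ) (by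
      filter_upwards [hfZ p, hfZ q, Lp.coeFn_sub (Z p) (Z q)] with ω e1 e2 e3
      rw [e1, e2, e3, Pi.sub_apply])]
    refine h2.trans (ENNReal.rpow_le_rpow ?_ (by linarith))
    rw [mul_assoc (2 * g + 1)]
    refine mul_le_mul' le_self_add ?_
    exact enorm_le_mul_ofReal_rpow (by positivity) dist_nonneg hγ.le (hZd p hp q hq)
  obtain ⟨K, hK, hfK, hKi⟩ := hbound P f _ hcont hmeas hzero hinc
  refine ⟨K, hK, fun ω t ht1 ht2 x => ?_, ?_⟩
  · obtain ⟨y, hy, rfl⟩ := exists_toTorus_eq x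
    have h1 := hfK ω ![t - n, y 0, y 1] (fun i => by
      fin_cases i
      · exact ⟨by simpa using ht1, by simp; linarith⟩
      · exact hy 0
      · exact hy 1)
    have e1 : planePoint ![t - n, y 0, y 1] = y := by
      ext i
      fin_cases i <;> rfl
    simp only [f, e1] at h1
    simpa using h1
  · refine hKi.trans (le_of_eq ?_)
    rw [← hMofReal]
    ring

end Noise

end

/-! ### Almost sure regularity of the series of blocks. -/

noncomputable section

section Noise

variable {Ω : Type u} [MeasurableSpace Ω] {P : Measure Ω} [IsProbabilityMeasure P] {H : ℝ}
  {β : Mode → ℝ → Ω → ℂ}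

/-- All derivatives of order at most `m` of the blocks of the field with Fourier coefficients
`w k * X k` are summable, uniformly in space and locally uniformly in time. -/
def IsRegularAlong (w : Mode → ℝ) (F : ℕ → Finset Mode) (m : ℕ) (X : Mode → ℝ → Ω → ℂ) : Prop :=
  ∀ (ω : Ω) (N : ℕ), ∀ i ≤ m, ∀ γ : Fin i → Fin 2, ∃ K : ℕ → ℝ, Summable K ∧
    ∀ (j : ℕ) (t : ℝ), |t| ≤ N → ∀ x,
      ‖trigPoly (block F j) (fun k => derivSymbol γ k * ((w k : ℂ) * X k t ω)) x‖ ≤ K j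

/-- The expected suprema over a unit time interval are at most `C * A j`, which is summable, so the
suprema themselves are almost surely summable in `j`. -/
theorem exists_ae_summable_bound {h : IsFractionalNoise P H β} (hH : 0 < H ∧ H < 1)
    {a : Mode → ℝ} {a₀ : ℝ} (ha₀ : 0 < a₀) (ha : ∀ k, a₀ ≤ a k) {X : Mode → ℝ → Ω → ℂ}
    (hX : IsOUModes h a X) {θ : ℝ} (hθ : 0 < θ ∧ θ ≤ 1) (B : ℕ → Finset Mode) (c : Mode → ℂ)
    {A : ℕ → ℝ} (hA0 : ∀ j, 0 ≤ A j) (hA : Summable A)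
    (hcA : ∀ j, ∑ k ∈ B j, ‖c k‖ ^ 2 * ‖waveVec k‖ ^ (2 * θ) ≤ A j ^ 2) :
    ∀ᵐ ω ∂P, ∀ N : ℕ, ∃ K : ℕ → ℝ, Summable K ∧ ∀ (j : ℕ) (t : ℝ), |t| ≤ N → ∀ x,
      ‖trigPoly (B j) (fun k => c k * X k t ω) x‖ ≤ K j := by
  obtain ⟨C, hC, hb⟩ := exists_lintegral_trigPoly_bound hH ha₀ ha hX hθ
  choose K hKm hKb hKi using fun (j : ℕ) (n : ℤ) => hb (B j) c (A j) (hA0 j) (hcA j) n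
  have hfin : ∀ᵐ ω ∂P, ∀ n : ℤ, ∑' j, K j n ω < ∞ := by
    refine ae_all_iff.mpr fun n => ae_lt_top (Measurable.tsum fun j => hKm j n) ?_
    rw [lintegral_tsum fun j => (hKm j n).aemeasurable]
    refine ne_top_of_le_ne_top ?_ (ENNReal.tsum_le_tsum fun j => hKi j n)
    rw [ENNReal.tsum_mul_left]
    exact ENNReal.mul_ne_top hC hA.tsum_ofReal_ne_top
  filter_upwards [hfin] with ω hω N
  -- The unit intervals starting at `-N, …, N` cover `[-N, N]`.
  refine ⟨fun j => ∑ n ∈ Finset.Icc (-N : ℤ) N, (K j n ω).toReal,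
    summable_sum fun n _ => ENNReal.summable_toReal (hω n).ne, fun j t ht x => ?_⟩
  have h1 := abs_le.mp ht
  have hmem : ⌊t⌋ ∈ Finset.Icc (-N : ℤ) N := by
    rw [Finset.mem_Icc]
    constructor
    · exact Int.le_floor.mpr (by exact_mod_cast h1.1)
    · have : (⌊t⌋ : ℝ) ≤ N := (Int.floor_le t).trans h1.2
      exact_mod_cast this
  refine le_trans ?_ (Finset.single_le_sum (f := fun n => (K j n ω).toReal)
    (fun n _ => ENNReal.toReal_nonneg) hmem)
  have h2 := hKb j ⌊t⌋ ω t (Int.floor_le t) (Int.lt_floor_add_one t) x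
  have h3 := ENNReal.toReal_mono (ENNReal.ne_top_of_tsum_ne_top (hω ⌊t⌋).ne j) h2
  rwa [toReal_enorm] at h3

theorem IsOUModes.indicator {h : IsFractionalNoise P H β} {a : Mode → ℝ} {X : Mode → ℝ → Ω → ℂ}
    (hX : IsOUModes h a X) {G : Set Ω} (hG : MeasurableSet G) (hGae : ∀ᵐ ω ∂P, ω ∈ G) :
    IsOUModes h a fun k t => G.indicator (X k t) where
  measurable k t := (hX.measurable k t).indicator hG
  continuous k ω := by
    by_cases hω : ω ∈ G
    · simpa [hω] using hX.continuous k ω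
    · simpa [hω] using continuous_const
  conj k t ω := by
    by_cases hω : ω ∈ G
    · simpa [hω] using hX.conj k t ω
    · simp [hω]
  ae_eq k t := by
    filter_upwards [hGae, hX.ae_eq k t] with ω hω h1
    rw [indicator_of_mem hω, h1]

/-- The blocks are chosen from the weights before any path is seen. Almost sure summability is then
obtained for the finitely many derivative indices, and the modes are set to zero on the exceptional
set. -/
theorem IsFractionalNoise.exists_regular_ouModes (h : IsFractionalNoise P H β)
    (hH : 0 < H ∧ H < 1) {a : Mode → ℝ} {a₀ : ℝ} (ha₀ : 0 < a₀) (ha : ∀ k, a₀ ≤ a k)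
    (hsymm : ∀ k, a (-k) = a k) {w : Mode → ℝ} {m : ℕ} {ε : ℝ} (hε : 0 < ε)
    (hw : Summable fun k : Mode => w k ^ 2 * ‖waveVec k‖ ^ (2 * (m : ℝ) + ε)) :
    ∃ (F : ℕ → Finset Mode) (X : Mode → ℝ → Ω → ℂ), Monotone F ∧ (∀ k, ∃ j, k ∈ F j) ∧
      (∀ j, ∀ k ∈ F j, -k ∈ F j) ∧ IsOUModes h a X ∧ IsRegularAlong w F m X := by
  set v : Mode → ℝ := fun k => w k ^ 2 * ‖waveVec k‖ ^ (2 * (m : ℝ) + ε) with hv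
  have hv0 : ∀ k, 0 ≤ v k := fun k => by positivity
  obtain ⟨F, hF, hFc, hFs, hFt⟩ := exists_exhaustion hv0 hw
  obtain ⟨X, hXm, hXc, hXs, hXe⟩ := h.exists_ouModes hH (fun k => ha₀.trans_le (ha k)) hsymm
  have hX : IsOUModes h a X := ⟨hXm, hXc, hXs, hXe⟩
  -- For orders `i ≤ m` this gives `2 i + 2 θ ≤ 2 m + ε`, while `θ ≤ 1` is required by the
  -- interpolation of the characters.
  set θ := min 1 (ε / 2) with hθdef
  have hθ : 0 < θ ∧ θ ≤ 1 := ⟨lt_min one_pos (by positivity), min_le_left _ _⟩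
  -- The first block has no smallness and is measured by its own weight; later ones inherit the
  -- square root of `(1/4)^j`.
  let A : ℕ → ℝ := fun j => Nat.casesOn j (√(∑ k ∈ F 0, v k)) fun j => (1 / 2) ^ j
  have hA0 : ∀ j, 0 ≤ A j := by
    intro j
    cases j with
    | zero => exact Real.sqrt_nonneg _
    | succ j => exact pow_nonneg (by norm_num) j
  have hA : Summable A := by
    rw [← summable_nat_add_iff 1]
    exact summable_geometric_of_lt_one (by norm_num) (by norm_num)
  have hBA : ∀ j, ∑ k ∈ block F j, v k ≤ A j ^ 2 := by
    intro j
    cases j with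
    | zero => exact (Real.sq_sqrt (Finset.sum_nonneg fun k _ => hv0 k)).ge
    | succ j =>
      refine (hFt j _ Finset.sdiff_disjoint).trans (le_of_eq ?_)
      change _ = ((1 / 2 : ℝ) ^ j) ^ 2
      rw [← pow_mul, mul_comm, pow_mul]
      norm_num
  have hae : ∀ᵐ ω ∂P, ∀ (i : Fin (m + 1)) (γ : Fin i → Fin 2) (N : ℕ), ∃ K : ℕ → ℝ,
      Summable K ∧ ∀ (j : ℕ) (t : ℝ), |t| ≤ N → ∀ x,
        ‖trigPoly (block F j) (fun k => (derivSymbol γ k * (w k : ℂ)) * X k t ω) x‖ ≤ K j := by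
    refine ae_all_iff.mpr fun i => ae_all_iff.mpr fun γ =>
      exists_ae_summable_bound hH ha₀ ha hX hθ (block F) _ hA0 hA fun j =>
        (Finset.sum_le_sum fun k _ => ?_).trans (hBA j)
    have hk := one_le_norm_waveVec k
    have hk0 : 0 < ‖waveVec k‖ := by linarith
    have hi : ((i : ℕ) : ℝ) ≤ m := by
      have := i.2
      exact_mod_cast (by omega : (i : ℕ) ≤ m)
    rw [norm_mul, Complex.norm_real, mul_pow, Real.norm_eq_abs, sq_abs]
    have h1 : ‖derivSymbol γ k‖ ^ 2 ≤ ‖waveVec k‖ ^ (2 * ((i : ℕ) : ℝ)) := by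
      rw [mul_comm, Real.rpow_mul hk0.le, Real.rpow_natCast, Real.rpow_two]
      exact pow_le_pow_left₀ (norm_nonneg _) (norm_derivSymbol_le γ k) 2
    calc ‖derivSymbol γ k‖ ^ 2 * w k ^ 2 * ‖waveVec k‖ ^ (2 * θ)
        ≤ ‖waveVec k‖ ^ (2 * ((i : ℕ) : ℝ)) * w k ^ 2 * ‖waveVec k‖ ^ (2 * θ) := by gcongr
      _ = w k ^ 2 * ‖waveVec k‖ ^ (2 * ((i : ℕ) : ℝ) + 2 * θ) := by
          rw [Real.rpow_add hk0]
          ring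
      _ ≤ _ := by
          refine mul_le_mul_of_nonneg_left (Real.rpow_le_rpow_of_exponent_le hk ?_) (sq_nonneg _)
          have : θ ≤ ε / 2 := min_le_right _ _
          linarith
  obtain ⟨G, hG, hGae, hGp⟩ := exists_measurableSet_of_ae hae
  refine ⟨F, fun k t => G.indicator (X k t), hF, hFc, hFs, hX.indicator hG hGae,
    fun ω N i hi γ => ?_⟩
  by_cases hω : ω ∈ G
  · obtain ⟨K, hK, hKb⟩ := hGp ω hω ⟨i, by omega⟩ γ N
    refine ⟨K, hK, fun j t ht x => ?_⟩
    simp only [indicator_of_mem hω, ← mul_assoc]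
    exact hKb j t ht x
  · refine ⟨0, summable_zero, fun j t _ x => ?_⟩
    simp [indicator_of_notMem hω, trigPoly]

end Noise

/-! ### The field as a series of blocks -/

/-- Trigonometric polynomials as continuous functions. -/
def trigMap (B : Finset Mode) (c : Mode → ℂ) : C(Torus2, ℂ) := ∑ k ∈ B, c k • modeFun k

theorem trigMap_apply (B : Finset Mode) (c : Mode → ℂ) (x : Torus2) :
    trigMap B c x = trigPoly B c x := by
  simp [trigMap, trigPoly]

theorem coe_sum_basisV (B : Finset Mode) (c : Mode → ℂ) :
    ((∑ k ∈ B, c k • basisV k : VSpace) : Lp ℂ 2 torusMeasure) =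
      ContinuousMap.toLp (E := ℂ) 2 torusMeasure ℂ (trigMap B c) := by
  rw [trigMap, map_sum, Submodule.coe_sum]
  refine Finset.sum_congr rfl fun k _ => ?_
  rw [map_smul]
  rfl

theorem norm_toLp_le (f : C(Torus2, ℂ)) :
    ‖ContinuousMap.toLp (E := ℂ) 2 torusMeasure ℂ f‖ ≤ ‖f‖ := by
  refine ((ContinuousMap.toLp (E := ℂ) 2 torusMeasure ℂ).le_opNorm f).trans ?_
  have h1 := ContinuousMap.toLp_norm_le (E := ℂ) (p := 2) torusMeasure (𝕜 := ℂ)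
  have h2 : (measureUnivNNReal torusMeasure : ℝ) = 1 := by
    simp [measureUnivNNReal]
  rw [h2, Real.one_rpow] at h1
  exact mul_le_of_le_one_left (norm_nonneg _) h1

theorem norm_sum_basisV_le {B : Finset Mode} {c : Mode → ℂ} {K : ℝ}
    (hK : ∀ x, ‖trigPoly B c x‖ ≤ K) : ‖∑ k ∈ B, c k • basisV k‖ ≤ K := by
  have h0 : 0 ≤ K := (norm_nonneg _).trans (hK 0)
  change ‖((∑ k ∈ B, c k • basisV k : VSpace) : Lp ℂ 2 torusMeasure)‖ ≤ K
  rw [coe_sum_basisV]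
  refine (norm_toLp_le _).trans ((ContinuousMap.norm_le _ h0).mpr fun x => ?_)
  rw [trigMap_apply]
  exact hK x

theorem trigPoly_conj {B : Finset Mode} (hB : ∀ k ∈ B, -k ∈ B) {c : Mode → ℂ}
    (hc : ∀ k, c (-k) = starRingEnd ℂ (c k)) (x : Torus2) :
    starRingEnd ℂ (trigPoly B c x) = trigPoly B c x := by
  rw [trigPoly, map_sum]
  refine Finset.sum_nbij' (fun k => -k) (fun k => -k) hB hB (fun k _ => Mode.neg_neg k)
    (fun k _ => Mode.neg_neg k) fun k _ => ?_
  rw [map_mul, hc, modeFun_neg]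

theorem neg_mem_block {F : ℕ → Finset Mode} (hF : ∀ j, ∀ k ∈ F j, -k ∈ F j) (j : ℕ) :
    ∀ k ∈ block F j, -k ∈ block F j := by
  cases j with
  | zero => exact hF 0
  | succ j =>
    intro k hk
    rw [block, Finset.mem_sdiff] at hk ⊢
    refine ⟨hF _ k hk.1, fun h => hk.2 ?_⟩
    have := hF j _ h
    rwa [Mode.neg_neg] at this

section Field

variable {Ω : Type u} [MeasurableSpace Ω] {w : Mode → ℝ} {F : ℕ → Finset Mode} {m : ℕ}
  {X : Mode → ℝ → Ω → ℂ}

/-- The `V`-valued process with Fourier coefficients `w k * X k`. -/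
def seriesV (w : Mode → ℝ) (F : ℕ → Finset Mode) (X : Mode → ℝ → Ω → ℂ) (t : ℝ) (ω : Ω) : VSpace :=
  ∑' j, ∑ k ∈ block F j, ((w k : ℂ) * X k t ω) • basisV k

/-- The real field with Fourier coefficients `w k * X k`. -/
def seriesField (w : Mode → ℝ) (F : ℕ → Finset Mode) (X : Mode → ℝ → Ω → ℂ) (t : ℝ) (ω : Ω)
    (x : Torus2) : ℝ :=
  ∑' j, (trigPoly (block F j) (fun k => (w k : ℂ) * X k t ω) x).re

theorem IsRegularAlong.exists_bound (hR : IsRegularAlong w F m X) (ω : Ω) (N : ℕ) :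
    ∃ K : ℕ → ℝ, Summable K ∧ ∀ (j : ℕ) (t : ℝ), |t| ≤ N → ∀ x,
      ‖trigPoly (block F j) (fun k => (w k : ℂ) * X k t ω) x‖ ≤ K j := by
  -- Order zero: the multi-index is empty and its symbol is 1.
  obtain ⟨K, hK, hKb⟩ := hR ω N 0 (Nat.zero_le m) Fin.elim0
  refine ⟨K, hK, fun j t ht x => ?_⟩
  simpa [derivSymbol] using hKb j t ht x

theorem IsRegularAlong.summable_seriesV (hR : IsRegularAlong w F m X) (t : ℝ) (ω : Ω) :
    Summable fun j => ∑ k ∈ block F j, ((w k : ℂ) * X k t ω) • basisV k := by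
  obtain ⟨N, hN⟩ := exists_nat_ge |t|
  obtain ⟨K, hK, hKb⟩ := hR.exists_bound ω N
  exact Summable.of_norm_bounded hK fun j => norm_sum_basisV_le (hKb j t hN)

theorem IsRegularAlong.tendsto_seriesV (hR : IsRegularAlong w F m X) (hF : Monotone F) (t : ℝ)
    (ω : Ω) : Tendsto (fun J => ∑ k ∈ F J, ((w k : ℂ) * X k t ω) • basisV k) atTop
      (𝓝 (seriesV w F X t ω)) := by
  have h1 := (tendsto_add_atTop_iff_nat 1).mpr (hR.summable_seriesV t ω).hasSum.tendsto_sum_nat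
  refine h1.congr fun J => ?_
  exact sum_range_block hF _ J

theorem IsRegularAlong.measurable_seriesV (hR : IsRegularAlong w F m X) (hF : Monotone F)
    (hX : ∀ k t, Measurable (X k t)) (t : ℝ) : Measurable (seriesV w F X t) := by
  refine measurable_of_tendsto_metrizable (f := fun J ω =>
    ∑ k ∈ F J, ((w k : ℂ) * X k t ω) • basisV k) (fun J => ?_)
    (tendsto_pi_nhds.mpr fun ω => hR.tendsto_seriesV hF t ω)
  refine Finset.measurable_sum _ fun k _ => ?_
  exact (by fun_prop : Continuous fun z : ℂ => z • basisV k).measurable.comp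
    ((hX k t).const_mul _)

theorem IsRegularAlong.continuous_seriesV (hR : IsRegularAlong w F m X)
    (hX : ∀ k ω, Continuous fun t => X k t ω) (ω : Ω) :
    Continuous fun t => seriesV w F X t ω := by
  rw [continuous_iff_continuousAt]
  intro t
  obtain ⟨N, hN⟩ := exists_nat_gt |t|
  obtain ⟨K, hK, hKb⟩ := hR.exists_bound ω N
  have h1 : ContinuousOn (fun t => seriesV w F X t ω) {t | |t| < N} := by
    refine continuousOn_tsum (fun j => ?_) hK fun j s hs => norm_sum_basisV_le (hKb j s ?_)
    · exact (continuous_finsetSum _ fun k _ =>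
        ((continuous_const.mul (hX k ω)).smul continuous_const)).continuousOn
    · exact le_of_lt hs
  exact h1.continuousAt ((isOpen_lt continuous_abs continuous_const).mem_nhds hN)

/-- The block series converges uniformly, and the embedding of continuous functions into `L²` is
continuous, so both sums represent the same function. Symmetric blocks make it real. -/
theorem IsRegularAlong.coeFn_seriesV (hR : IsRegularAlong w F m X)
    (hF : ∀ j, ∀ k ∈ F j, -k ∈ F j) (hw : ∀ k, w (-k) = w k)
    (hX : ∀ k t ω, X (-k) t ω = starRingEnd ℂ (X k t ω)) (t : ℝ) (ω : Ω) :
    ((seriesV w F X t ω : Lp ℂ 2 torusMeasure) : Torus2 → ℂ) =ᵐ[torusMeasure]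
      fun x => ((seriesField w F X t ω x : ℝ) : ℂ) := by
  obtain ⟨N, hN⟩ := exists_nat_ge |t|
  obtain ⟨K, hK, hKb⟩ := hR.exists_bound ω N
  have h0 : ∀ j, 0 ≤ K j := fun j => (norm_nonneg _).trans (hKb j t hN 0)
  have hs : Summable fun j => trigMap (block F j) (fun k => (w k : ℂ) * X k t ω) :=
    Summable.of_norm_bounded hK fun j => (ContinuousMap.norm_le _ (h0 j)).mpr fun x => by
      rw [trigMap_apply]
      exact hKb j t hN x
  have h1 : (seriesV w F X t ω : Lp ℂ 2 torusMeasure) =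
      ContinuousMap.toLp (E := ℂ) 2 torusMeasure ℂ
        (∑' j, trigMap (block F j) (fun k => (w k : ℂ) * X k t ω)) := by
    rw [(ContinuousMap.toLp (E := ℂ) 2 torusMeasure ℂ).map_tsum hs]
    have h2 := (meanZeroL2.subtypeL).map_tsum (hR.summable_seriesV t ω)
    refine h2.trans (tsum_congr fun j => ?_)
    exact coe_sum_basisV _ _
  rw [h1]
  filter_upwards [ContinuousMap.coeFn_toLp (𝕜 := ℂ) (p := 2) torusMeasure
    (∑' j, trigMap (block F j) (fun k => (w k : ℂ) * X k t ω))] with x hx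
  rw [hx, ← ContinuousMap.tsum_apply hs, seriesField, Complex.ofReal_tsum]
  refine tsum_congr fun j => ?_
  rw [trigMap_apply]
  refine (Complex.conj_eq_iff_re.mp (trigPoly_conj (neg_mem_block hF j) (fun k => ?_) x)).symm
  rw [map_mul, Complex.conj_ofReal, hw, hX]

theorem IsRegularAlong.isContinuousIntoCm (hR : IsRegularAlong w F m X)
    (hX : ∀ k ω, Continuous fun t => X k t ω) (ω : Ω) :
    IsContinuousIntoCm m (fun t => seriesField w F X t ω) ∧
      ∀ t, ∀ i ≤ m, ∀ x, HasSum (fun j => iteratedFDeriv ℝ i (fun x : Plane =>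
          (trigPoly (block F j) (fun k => (w k : ℂ) * X k t ω) (toTorus x)).re) x)
        (iteratedFDeriv ℝ i (fun x => seriesField w F X t ω (toTorus x)) x) := by
  refine isContinuousIntoCm_tsum (fun j => isContinuousIntoCm_re_trigPoly (block F j)
    (c := fun k t => (w k : ℂ) * X k t ω) (fun k => continuous_const.mul (hX k ω)) m)
    fun N i hi => ?_
  choose K hK hKb using hR ω N i hi
  refine ⟨fun j => ∑ γ, K γ j, summable_sum fun γ _ => hK γ, fun j t ht x => ?_⟩
  exact (norm_iteratedFDeriv_re_le (contDiff_trigPoly _ _) x).trans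
    ((norm_iteratedFDeriv_trigPoly_le _ _ i x).trans
      (Finset.sum_le_sum fun γ _ => hKb γ j t ht _))

end Field

end

noncomputable section

/-! ### The stationary solution as a sum of modes -/

theorem eLpNorm_two_sq {Ω E : Type*} [MeasurableSpace Ω] [NormedAddCommGroup E] {P : Measure Ω}
    (f : Ω → E) : eLpNorm f 2 P ^ 2 = ∫⁻ ω, ‖f ω‖ₑ ^ 2 ∂P := by
  have h1 := eLpNorm_nnreal_pow_eq_lintegral (μ := P) (f := f) (p := 2) (by norm_num)
  norm_num at h1
  exact h1

theorem measurable_smul_basisV {Ω : Type*} [MeasurableSpace Ω] {z : Ω → ℂ} (hz : Measurable z)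
    (k : Mode) : Measurable fun ω => z ω • basisV k :=
  (by fun_prop : Continuous fun z : ℂ => z • basisV k).measurable.comp hz

section Solution

variable {Ω : Type u} [MeasurableSpace Ω] {P : Measure Ω} [IsProbabilityMeasure P] {H : ℝ}
  {β : Mode → ℝ → Ω → ℂ} {a : Mode → ℝ} {a₀ : ℝ} {w : Mode → ℝ} {F : ℕ → Finset Mode} {m : ℕ}
  {X : Mode → ℝ → Ω → ℂ} {h : IsFractionalNoise P H β}

theorem IsOUModes.memLp (hX : IsOUModes h a X) (k : Mode) (t : ℝ) : MemLp (X k t) 2 P :=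
  (memLp_congr_ae (hX.ae_eq k t)).mpr (Lp.memLp _)

theorem IsOUModes.eLpNorm_sum_basisV_le (hX : IsOUModes h a X) (hH : 0 < H ∧ H < 1) (ha₀ : 0 < a₀)
    (ha : ∀ k, a₀ ≤ a k) (B : Finset Mode) (w : Mode → ℝ) (t : ℝ) :
    eLpNorm (fun ω => ∑ k ∈ B, ((w k : ℂ) * X k t ω) • basisV k) 2 P ^ 2 ≤
      ENNReal.ofReal ((1 + 1 / a₀) ^ 2 * ∑ k ∈ B, w k ^ 2) := by
  have h1 : ∀ ω, ‖∑ k ∈ B, ((w k : ℂ) * X k t ω) • basisV k‖ₑ ^ 2 =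
      ∑ k ∈ B, ‖(w k : ℂ) * X k t ω‖ₑ ^ 2 := by
    intro ω
    simp_rw [← ofReal_norm]
    rw [← ENNReal.ofReal_pow (norm_nonneg _), norm_sq_sum_basisV,
      ENNReal.ofReal_sum_of_nonneg fun k _ => by positivity]
    exact Finset.sum_congr rfl fun k _ => ENNReal.ofReal_pow (norm_nonneg _) _
  have h2 : ∀ k, ∫⁻ ω, ‖(w k : ℂ) * X k t ω‖ₑ ^ 2 ∂P ≤
      ENNReal.ofReal ((1 + 1 / a₀) ^ 2 * w k ^ 2) := by
    intro k
    have e1 : ∀ ω, ‖(w k : ℂ) * X k t ω‖ₑ ^ 2 = ENNReal.ofReal (w k ^ 2) * ‖X k t ω‖ₑ ^ 2 := by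
      intro ω
      rw [enorm_mul, mul_pow, ← ofReal_norm, ← ENNReal.ofReal_pow (norm_nonneg _),
        Complex.norm_real, Real.norm_eq_abs, sq_abs]
    simp_rw [e1]
    rw [lintegral_const_mul _ ((hX.measurable k t).enorm.pow_const 2), ← eLpNorm_two_sq,
      eLpNorm_congr_ae (hX.ae_eq k t), ← Lp.enorm_def, ← ofReal_norm,
      ← ENNReal.ofReal_pow (norm_nonneg _), ← ENNReal.ofReal_mul (sq_nonneg _), mul_comm]
    refine ENNReal.ofReal_le_ofReal (mul_le_mul_of_nonneg_right ?_ (sq_nonneg _))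
    exact pow_le_pow_left₀ (norm_nonneg _) (h.norm_ouCurve_le hH ha₀ ha k t) 2
  rw [eLpNorm_two_sq]
  simp_rw [h1]
  rw [lintegral_finsetSum _ fun k _ => ((hX.measurable k t).const_mul _).enorm.pow_const 2,
    Finset.mul_sum, ENNReal.ofReal_sum_of_nonneg fun k _ => by positivity]
  exact Finset.sum_le_sum fun k _ => h2 k

/-- The process is a pointwise limit along the blocks, whereas the claim concerns arbitrary finite
sets of modes. Fatou's lemma bounds the distance to it by norms of finite sums, and Parseval's
identity bounds these by a tail of `∑ w_k²`. -/
theorem IsOUModes.tendsto_eLpNorm_seriesV (hX : IsOUModes h a X) (hH : 0 < H ∧ H < 1)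
    (ha₀ : 0 < a₀) (ha : ∀ k, a₀ ≤ a k) (hw : Summable fun k => w k ^ 2) (hF : Monotone F)
    (hFc : ∀ k, ∃ j, k ∈ F j) (hR : IsRegularAlong w F m X) (t : ℝ) :
    Tendsto (fun B : Finset Mode => eLpNorm
      (fun ω => ∑ k ∈ B, ((w k : ℂ) * X k t ω) • basisV k - seriesV w F X t ω) 2 P)
      atTop (𝓝 0) := by
  have hM : 0 < 1 + 1 / a₀ := by positivity
  have key : ∀ ε : ℝ, 0 < ε → ∀ᶠ B : Finset Mode in atTop, eLpNorm
      (fun ω => ∑ k ∈ B, ((w k : ℂ) * X k t ω) • basisV k - seriesV w F X t ω) 2 P ≤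
        ENNReal.ofReal ε := by
    intro ε hε
    obtain ⟨B₀, hB₀⟩ := summable_iff_vanishing_norm.mp hw ((ε / (1 + 1 / a₀)) ^ 2) (by positivity)
    refine eventually_atTop.mpr ⟨B₀, fun B hB => ?_⟩
    refine (Lp.eLpNorm_lim_le_liminf_eLpNorm (f := fun J ω =>
      ∑ k ∈ B, ((w k : ℂ) * X k t ω) • basisV k - ∑ k ∈ F J, ((w k : ℂ) * X k t ω) • basisV k)
      (fun J => ?_) _ (ae_of_all _ fun ω => tendsto_const_nhds.sub
        (hR.tendsto_seriesV hF t ω))).trans (liminf_le_of_frequently_le'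
        (Eventually.frequently ?_))
    · refine (Measurable.sub ?_ ?_).aestronglyMeasurable <;>
        exact Finset.measurable_sum _ fun k _ =>
          measurable_smul_basisV ((hX.measurable k t).const_mul _) k
    · have hsub : ∀ᶠ J in atTop, B ⊆ F J := by
        have := tendsto_atTop_finset_of_monotone hF hFc
        exact this.eventually_ge_atTop B
      filter_upwards [hsub] with J hJ
      have e1 : eLpNorm (fun ω => ∑ k ∈ B, ((w k : ℂ) * X k t ω) • basisV k -
          ∑ k ∈ F J, ((w k : ℂ) * X k t ω) • basisV k) 2 P =
          eLpNorm (fun ω => ∑ k ∈ F J \ B, ((w k : ℂ) * X k t ω) • basisV k) 2 P := by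
        refine eLpNorm_congr_norm_ae (ae_of_all _ fun ω => ?_)
        rw [← Finset.sum_sdiff hJ, norm_sub_rev, add_sub_cancel_right]
      have e2 := hX.eLpNorm_sum_basisV_le hH ha₀ ha (F J \ B) w t
      have e3 := hB₀ (F J \ B) (Finset.sdiff_disjoint.mono_right hB)
      rw [Real.norm_of_nonneg (Finset.sum_nonneg fun k _ => sq_nonneg _)] at e3
      rw [e1, ← ENNReal.pow_le_pow_left_iff (n := 2) two_ne_zero, ← ENNReal.ofReal_pow hε.le]
      refine e2.trans (ENNReal.ofReal_le_ofReal ?_)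
      calc (1 + 1 / a₀) ^ 2 * ∑ k ∈ F J \ B, w k ^ 2
          ≤ (1 + 1 / a₀) ^ 2 * (ε / (1 + 1 / a₀)) ^ 2 :=
            mul_le_mul_of_nonneg_left e3.le (sq_nonneg _)
        _ = ε ^ 2 := by rw [← mul_pow, mul_div_cancel₀ _ hM.ne']
  refine ENNReal.tendsto_nhds_zero.mpr fun ε hε => ?_
  obtain ⟨δ, hδ, h1, h2⟩ : ∃ δ : ℝ≥0∞, 0 < δ ∧ δ ≤ ε ∧ δ ≠ ∞ :=
    ⟨min ε 1, lt_min hε one_pos, min_le_left _ _, ((min_le_right _ _).trans_lt (by simp)).ne⟩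
  filter_upwards [key δ.toReal (ENNReal.toReal_pos hδ.ne' h2)] with B hB
  exact hB.trans ((ENNReal.ofReal_toReal h2).le.trans h1)

theorem IsOUModes.isModeSum_seriesV (hX : IsOUModes h a X) (hH : 0 < H ∧ H < 1)
    (ha₀ : 0 < a₀) (ha : ∀ k, a₀ ≤ a k) (hw : Summable fun k => w k ^ 2) (hF : Monotone F)
    (hFc : ∀ k, ∃ j, k ∈ F j) (hR : IsRegularAlong w F m X) (t : ℝ) :
    IsModeSum P (fun k ω => (w k : ℂ) * X k t ω) (seriesV w F X t) := by
  have h1 := hX.tendsto_eLpNorm_seriesV hH ha₀ ha hw hF hFc hR t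
  refine ⟨fun k => (hX.memLp k t).const_mul _, ?_, h1⟩
  obtain ⟨B, hB⟩ := (ENNReal.tendsto_nhds_zero.mp h1 1 one_pos).exists
  have hm : Measurable fun ω => ∑ k ∈ B, ((w k : ℂ) * X k t ω) • basisV k :=
    Finset.measurable_sum _ fun k _ => measurable_smul_basisV ((hX.measurable k t).const_mul _) k
  have h2 : MemLp (fun ω => ∑ k ∈ B, ((w k : ℂ) * X k t ω) • basisV k) 2 P := by
    refine ⟨hm.aestronglyMeasurable, ?_⟩
    have := (hX.eLpNorm_sum_basisV_le hH ha₀ ha B w t).trans_lt ENNReal.ofReal_lt_top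
    exact (ENNReal.pow_lt_top_iff.mp this).resolve_right two_ne_zero
  have h3 : MemLp (fun ω => ∑ k ∈ B, ((w k : ℂ) * X k t ω) • basisV k - seriesV w F X t ω) 2 P :=
    ⟨(hm.sub (hR.measurable_seriesV hF hX.measurable t)).aestronglyMeasurable,
      hB.trans_lt (by simp)⟩
  refine (h2.sub h3).congr_norm
    (hR.measurable_seriesV hF hX.measurable t).aestronglyMeasurable (ae_of_all _ fun ω => ?_)
  simp

theorem IsModeSum.ae_unique {c d : Mode → Ω → ℂ} {Y Z : Ω → VSpace} (hY : IsModeSum P c Y)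
    (hZ : IsModeSum P d Z) (hcd : ∀ k, c k =ᵐ[P] d k) : Y =ᵐ[P] Z := by
  have h1 : ∀ B : Finset Mode, eLpNorm (Y - Z) 2 P ≤
      eLpNorm (fun ω => ∑ k ∈ B, c k ω • basisV k - Y ω) 2 P +
        eLpNorm (fun ω => ∑ k ∈ B, d k ω • basisV k - Z ω) 2 P := by
    intro B
    have hm : ∀ {c : Mode → Ω → ℂ}, (∀ k, MemLp (c k) 2 P) →
        AEStronglyMeasurable (fun ω => ∑ k ∈ B, c k ω • basisV k) P := fun {c} hc => by
      refine Finset.aestronglyMeasurable_fun_sum _ fun k _ => ?_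
      exact (by fun_prop : Continuous fun z : ℂ => z • basisV k).comp_aestronglyMeasurable
        (hc k).aestronglyMeasurable
    rw [add_comm]
    refine le_trans (le_of_eq ?_) (eLpNorm_sub_le ((hm hZ.1).sub hZ.2.1.1) ((hm hY.1).sub hY.2.1.1)
      (by norm_num))
    refine eLpNorm_congr_norm_ae ?_
    filter_upwards [(ae_ball_iff B.countable_toSet).mpr fun k _ => hcd k] with ω hω
    congr 1
    rw [Pi.sub_apply, Pi.sub_apply]
    have : ∑ k ∈ B, c k ω • basisV k = ∑ k ∈ B, d k ω • basisV k :=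
      Finset.sum_congr rfl fun k hk => by rw [hω k hk]
    simp only [this]
    abel
  have h2 : eLpNorm (Y - Z) 2 P ≤ 0 := by
    refine ge_of_tendsto (by simpa using hY.2.2.add hZ.2.2) (Eventually.of_forall h1)
  have h3 := (eLpNorm_eq_zero_iff (hY.2.1.1.sub hZ.2.1.1) (by norm_num)).mp (le_antisymm h2 bot_le)
  filter_upwards [h3] with ω hω
  exact sub_eq_zero.mp hω

end Solution

end

noncomputable section

/-! ### The stationary solution is an adapted mild solution -/

theorem measurable_of_uncurry {Ω E : Type*} [MeasurableSpace Ω] [MeasurableSpace E]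
    {ψ : ℝ → Ω → E} (hψ : Measurable (Function.uncurry ψ)) (T : ℝ) :
    Measurable fun p : Set.Icc (0 : ℝ) T × Ω => ψ p.1 p.2 := by
  have h2 : Measurable fun p : Set.Icc (0 : ℝ) T × Ω => ((p.1 : ℝ), p.2) :=
    (measurable_subtype_coe.comp measurable_fst).prodMk measurable_snd
  exact hψ.comp h2

section Solution

variable {Ω : Type u} [MeasurableSpace Ω] {P : Measure Ω} [IsProbabilityMeasure P] {H : ℝ}
  {β : Mode → ℝ → Ω → ℂ} {w : Mode → ℝ} {F : ℕ → Finset Mode} {m : ℕ}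
  {X : Mode → ℝ → Ω → ℂ} {h : IsFractionalNoise P H β}

theorem IsOUModes.isFourierOUProcess_seriesV {ν c₀ : ℝ} {lam α : Mode → ℝ} (hν : 0 < ν)
    (hc₀ : 0 < c₀) (hα : ∀ k, c₀ ≤ α k)
    (hX : IsOUModes h (fun k => ν * α k) X) (hH : 0 < H ∧ H < 1)
    (hw : Summable fun k => (√(lam k) * ν ^ H) ^ 2) (hF : Monotone F)
    (hFc : ∀ k, ∃ j, k ∈ F j) (hR : IsRegularAlong (fun k => √(lam k) * ν ^ H) F m X) :
    IsFourierOUProcess P H ν lam α β (seriesV (fun k => √(lam k) * ν ^ H) F X) := fun t =>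
  ⟨fun k => X k t, fun k => h.isWienerIntegralIic_exp hH k (mul_pos hν (hc₀.trans_le (hα k))) t
      (hX.ae_eq k t),
    hX.isModeSum_seriesV hH (mul_pos hν hc₀)
      (fun k => mul_le_mul_of_nonneg_left (hα k) hν.le) hw hF hFc hR t⟩

/-- The semigroup damps the coefficients of `ψ(0)`, so `ψ(t) - S(t)ψ(0)` has coefficients `X_k(t) -
exp(-tνα_k) X_k(0)`, which are Wiener integrals over `[0, t]`. Contractivity transports the
convergence of the mode sums. -/
theorem IsOUModes.isMildSolution_seriesV {ν c₀ : ℝ} {lam α : Mode → ℝ} (hν : 0 < ν)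
    (hc₀ : 0 < c₀) (hα : ∀ k, c₀ ≤ α k)
    (hX : IsOUModes h (fun k => ν * α k) X) (hH : 0 < H ∧ H < 1)
    (hw : Summable fun k => (√(lam k) * ν ^ H) ^ 2) (hF : Monotone F)
    (hFc : ∀ k, ∃ j, k ∈ F j) (hR : IsRegularAlong (fun k => √(lam k) * ν ^ H) F m X) (T : ℝ) :
    IsMildSolution P H ν lam α β T (seriesV (fun k => √(lam k) * ν ^ H) F X) := by
  set w : Mode → ℝ := fun k => √(lam k) * ν ^ H with hwdef
  have hmeas := hR.measurable_seriesV hF hX.measurable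
  refine ⟨?_, fun t ht => ?_⟩
  · have h1 : Measurable (Function.uncurry (seriesV w F X)) :=
      measurable_uncurry_of_continuous_of_measurable (hR.continuous_seriesV hX.continuous) hmeas
    exact measurable_of_uncurry h1 T
  · set e : Mode → ℝ := fun k => Real.exp (-(t * (ν * α k))) with he
    have hsum := hX.isModeSum_seriesV hH (mul_pos hν hc₀)
      (fun k => mul_le_mul_of_nonneg_left (hα k) hν.le) hw hF hFc hR
    have hS := continuous_semigroupV hν hα ht.1
    have hSle : ∀ f, ‖semigroupV ν α t f‖ ≤ ‖f‖ := fun f =>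
      (norm_semigroupV_le hν hα ht.1 f).trans (mul_le_of_le_one_left (norm_nonneg _)
        (Real.exp_le_one_iff.mpr (neg_nonpos.mpr (mul_nonneg ht.1 (mul_nonneg hν.le hc₀.le)))))
    refine ⟨fun ω => seriesV w F X t ω - semigroupV ν α t (seriesV w F X 0 ω),
      ⟨fun k ω => X k t ω - (e k : ℂ) * X k 0 ω, fun k => ?_, fun k => ?_, ?_, ?_⟩,
      ae_of_all _ fun ω => (add_sub_cancel _ _).symm⟩
    · refine h.isWienerIntegral_exp hH k (mul_pos hν (hc₀.trans_le (hα k))) ht.1 ?_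
      filter_upwards [hX.ae_eq k t, hX.ae_eq k 0, Lp.coeFn_sub (ouTransform (ν * α k) (h.curve k) t)
        (Real.exp (-((t - 0) * (ν * α k))) • ouTransform (ν * α k) (h.curve k) 0),
        Lp.coeFn_smul (Real.exp (-((t - 0) * (ν * α k)))) (ouTransform (ν * α k) (h.curve k) 0)]
        with ω h1 h2 h3 h4
      rw [h3, Pi.sub_apply, h4, Pi.smul_apply, h1, h2, sub_zero, Complex.real_smul]
    · exact ((hX.memLp k t).sub ((hX.memLp k 0).const_mul _)).const_mul _
    · refine (hsum t).2.1.sub ((hsum 0).2.1.of_le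
        (hS.measurable.comp (hmeas 0)).aestronglyMeasurable (ae_of_all _ fun ω => hSle _))
    · have hlim := (hsum t).2.2.add (hsum 0).2.2
      rw [add_zero] at hlim
      refine tendsto_of_tendsto_of_tendsto_of_le_of_le tendsto_const_nhds hlim
        (fun _ => bot_le) fun B => ?_
      have hm : ∀ t, Measurable fun ω => ∑ k ∈ B, ((w k : ℂ) * X k t ω) • basisV k := fun t =>
        Finset.measurable_sum _ fun k _ =>
          measurable_smul_basisV ((hX.measurable k t).const_mul _) k
      have e1 : ∀ ω, ∑ k ∈ B, ((w k : ℂ) * (X k t ω - (e k : ℂ) * X k 0 ω)) • basisV k -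
          (seriesV w F X t ω - semigroupV ν α t (seriesV w F X 0 ω)) =
          (∑ k ∈ B, ((w k : ℂ) * X k t ω) • basisV k - seriesV w F X t ω) -
          semigroupV ν α t (∑ k ∈ B, ((w k : ℂ) * X k 0 ω) • basisV k - seriesV w F X 0 ω) := by
        intro ω
        rw [semigroupV_sub hν hα ht.1, semigroupV_sum]
        have : ∑ k ∈ B, ((w k : ℂ) * (X k t ω - (e k : ℂ) * X k 0 ω)) • basisV k =
            ∑ k ∈ B, ((w k : ℂ) * X k t ω) • basisV k -
              ∑ k ∈ B, ((e k : ℂ) * ((w k : ℂ) * X k 0 ω)) • basisV k := by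
          rw [← Finset.sum_sub_distrib]
          refine Finset.sum_congr rfl fun k _ => ?_
          rw [← sub_smul]
          congr 1
          ring
        rw [this]
        abel
      refine (eLpNorm_congr_ae (ae_of_all _ e1)).le.trans ?_
      refine (eLpNorm_sub_le ((hm t).sub (hmeas t)).aestronglyMeasurable
        (hS.measurable.comp ((hm 0).sub (hmeas 0))).aestronglyMeasurable (by norm_num)).trans ?_
      exact add_le_add le_rfl (eLpNorm_mono fun ω => hSle _)

theorem noiseSigma_le (h : IsFractionalNoise P H β) (t : ℝ) : noiseSigma β t ≤ ‹MeasurableSpace Ω› :=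
  iSup₂_le fun k u => (h.measurable k u).comap_le

/-- Elements of `L²` measurable with respect to the past form a closed subspace, and the exponential
law charges only `r ≥ 0`, so only times up to `t` are averaged. -/
theorem IsFractionalNoise.aestronglyMeasurable_ouTransform (h : IsFractionalNoise P H β)
    (hH : 0 < H ∧ H < 1) {a : ℝ} (ha : 0 < a) (k : Mode) (t : ℝ) :
    AEStronglyMeasurable[noiseSigma β t] (ouTransform a (h.curve k) t : Lp ℂ 2 P) P := by
  have := isProbabilityMeasure_expMeasure ha
  have hcl : IsClosed (lpMeas ℂ ℝ (noiseSigma β t) 2 P : Set (Lp ℂ 2 P)) :=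
    isClosed_aestronglyMeasurable (noiseSigma_le h t)
  have hmem : ∀ u ≤ t, h.curve k u ∈ lpMeas ℂ ℝ (noiseSigma β t) 2 P := fun u hu => by
    rw [mem_lpMeas_iff_aestronglyMeasurable]
    have h1 : Measurable[noiseSigma β t] (β k u) := by
      refine (comap_measurable (β k u)).mono ?_ le_rfl
      exact le_iSup₂_of_le (f := fun (k : Mode) (u : Set.Iic t) =>
        MeasurableSpace.comap (β k u) inferInstance) k ⟨u, hu⟩ le_rfl
    exact ⟨β k u, h1.stronglyMeasurable, (h.memLp k u).coeFn_toLp⟩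
  rw [← mem_lpMeas_iff_aestronglyMeasurable (𝕜 := ℝ)]
  refine Convex.integral_mem (s := (lpMeas ℂ ℝ (noiseSigma β t) 2 P : Set (Lp ℂ 2 P)))
    (Submodule.convex _) hcl ?_ (((h.hasFBMCov_self k).isHolderCurve hH).integrable_sub ha t)
  filter_upwards [ae_expMeasure_nonneg a] with r hr
  exact Submodule.sub_mem _ (hmem t le_rfl) (hmem (t - r) (by linarith))

theorem IsOUModes.isAdaptedToNoise_seriesV {a : Mode → ℝ} (ha : ∀ k, 0 < a k)
    (hX : IsOUModes h a X) (hH : 0 < H ∧ H < 1) (hF : Monotone F) (hR : IsRegularAlong w F m X) :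
    IsAdaptedToNoise P β (seriesV w F X) := by
  intro t _
  have h1 : ∀ k, AEStronglyMeasurable[noiseSigma β t] (X k t) P := fun k =>
    (h.aestronglyMeasurable_ouTransform hH (ha k) k t).congr (hX.ae_eq k t).symm
  choose g hg hgX using h1
  have h2 : ∀ J, StronglyMeasurable[noiseSigma β t]
      fun ω => ∑ k ∈ F J, ((w k : ℂ) * g k ω) • basisV k := fun J => by
    refine Finset.stronglyMeasurable_fun_sum _ fun k _ => ?_
    exact (by fun_prop : Continuous fun z : ℂ => ((w k : ℂ) * z) • basisV k).comp_stronglyMeasurable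
      (hg k)
  -- Limits of versions measurable for the past; they agree with the process wherever all versions
  -- agree with the modes.
  refine ⟨_, @StronglyMeasurable.limUnder _ _ _ (noiseSigma β t) _ _ atTop _ _ _ _ h2, ?_⟩
  filter_upwards [ae_all_iff.mpr hgX] with ω hω
  have h3 := hR.tendsto_seriesV hF t ω
  simp only [hω] at h3
  exact h3.limUnder_eq.symm

end Solution

end

noncomputable section

/-! ### Characteristic functions and finite-dimensional laws -/

section Law

variable {Ω E ι : Type*} [MeasurableSpace Ω] {P : Measure Ω} [IsProbabilityMeasure P]
  [NormedAddCommGroup E] [NormedSpace ℝ E] [CompleteSpace E] [SecondCountableTopology E]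
  [MeasurableSpace E] [BorelSpace E] [Fintype ι]

theorem integral_exp_sum_eq_of_map_eq {Y Y' : Ω → ι → E} (hY : Measurable Y) (hY' : Measurable Y')
    (h : P.map Y = P.map Y') (L : ι → StrongDual ℝ E) :
    ∫ ω, Complex.exp ((∑ i, L i (Y ω i) : ℝ) * Complex.I) ∂P =
      ∫ ω, Complex.exp ((∑ i, L i (Y' ω i) : ℝ) * Complex.I) ∂P := by
  have hc : Continuous fun y : ι → E => Complex.exp ((∑ i, L i (y i) : ℝ) * Complex.I) := by
    fun_prop
  rw [← integral_map (f := fun y : ι → E => Complex.exp ((∑ i, L i (y i) : ℝ) * Complex.I))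
    hY.aemeasurable hc.aestronglyMeasurable, h,
    integral_map hY'.aemeasurable hc.aestronglyMeasurable]

theorem map_eq_of_integral_exp_sum_eq {Y Y' : Ω → ι → E} (hY : Measurable Y) (hY' : Measurable Y')
    (h : ∀ L : ι → StrongDual ℝ E, ∫ ω, Complex.exp ((∑ i, L i (Y ω i) : ℝ) * Complex.I) ∂P =
      ∫ ω, Complex.exp ((∑ i, L i (Y' ω i) : ℝ) * Complex.I) ∂P) : P.map Y = P.map Y' := by
  classical
  have := Measure.isProbabilityMeasure_map (μ := P) hY.aemeasurable
  have := Measure.isProbabilityMeasure_map (μ := P) hY'.aemeasurable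
  refine Measure.ext_of_charFunDual (funext fun L => ?_)
  have hL : ∀ y : ι → E, L y = ∑ i, L.comp (ContinuousLinearMap.single ℝ (fun _ => E) i) (y i) := by
    intro y
    conv_lhs => rw [← LinearMap.sum_single_apply (fun _ : ι => E) y, map_sum]
    rfl
  have hc : Continuous fun y : ι → E => Complex.exp (L y * Complex.I) := by fun_prop
  rw [charFunDual_apply, charFunDual_apply, integral_map hY.aemeasurable hc.aestronglyMeasurable,
    integral_map hY'.aemeasurable hc.aestronglyMeasurable]
  simp_rw [hL]
  exact h _

theorem map_process_eq_of_finite {T : Type*} {φ ψ : T → Ω → E} (hφ : ∀ t, Measurable (φ t))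
    (hψ : ∀ t, Measurable (ψ t)) (h : ∀ (N : ℕ) (t : Fin N → T),
      P.map (fun ω i => φ (t i) ω) = P.map (fun ω i => ψ (t i) ω)) :
    P.map (fun ω t => φ t ω) = P.map (fun ω t => ψ t ω) := by
  rw [map_eq_iff_forall_finset_map_restrict_eq (measurable_pi_lambda _ hφ).aemeasurable
    (measurable_pi_lambda _ hψ).aemeasurable]
  intro I
  refine map_eq_of_integral_exp_sum_eq (measurable_pi_lambda _ fun t => hφ t)
    (measurable_pi_lambda _ fun t => hψ t) fun L => ?_
  have e := I.equivFin
  have h1 := integral_exp_sum_eq_of_map_eq (measurable_pi_lambda _ fun i => hφ _)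
    (measurable_pi_lambda _ fun i => hψ _) (h _ fun i => (e.symm i : T)) fun i => L (e.symm i)
  have h2 : ∀ (χ : T → Ω → E) ω, ∑ i, L i (I.restrict (fun t => χ t ω) i) =
      ∑ i, L (e.symm i) (χ (e.symm i) ω) := fun χ ω =>
    (Equiv.sum_comp e.symm fun i : I => L i (χ i ω)).symm
  simp_rw [h2]
  exact h1

end Law

/-! ### The Gaussian laws of the stationary solution -/

/-- The coefficients of a real linear functional on real elements of `V`. -/
def dualCoeff (L : StrongDual ℝ VSpace) (k : Mode) : ℂ :=
  (((L (basisV k) : ℂ) - L (Complex.I • basisV k) * Complex.I) +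
    ((L (basisV (-k)) : ℂ) + L (Complex.I • basisV (-k)) * Complex.I)) / 2

theorem norm_dualCoeff_le (L : StrongDual ℝ VSpace) (k : Mode) : ‖dualCoeff L k‖ ≤ 2 * ‖L‖ := by
  have h1 : ∀ k, ‖(L (basisV k) : ℂ)‖ ≤ ‖L‖ := fun k => by
    rw [Complex.norm_real]
    have := L.le_opNorm (basisV k)
    rwa [orthonormal_basisV.1, mul_one] at this
  have h2 : ∀ k, ‖(L (Complex.I • basisV k) : ℂ) * Complex.I‖ ≤ ‖L‖ := fun k => by
    rw [norm_mul, Complex.norm_I, mul_one, Complex.norm_real]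
    have := L.le_opNorm (Complex.I • basisV k)
    rwa [norm_smul, Complex.norm_I, orthonormal_basisV.1, mul_one, mul_one] at this
  rw [dualCoeff, norm_div, Complex.norm_two, div_le_iff₀ two_pos]
  have e1 := (norm_add_le _ _).trans (add_le_add (norm_sub_le _ _) (norm_add_le _ _)) |>.trans
    (add_le_add (add_le_add (h1 k) (h2 k)) (add_le_add (h1 (-k)) (h2 (-k))))
  linarith

theorem dual_smul_basisV (L : StrongDual ℝ VSpace) (z : ℂ) (k : Mode) :
    L (z • basisV k) = (((L (basisV k) : ℂ) - L (Complex.I • basisV k) * Complex.I) * z).re := by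
  have h1 : z • basisV k = z.re • basisV k + z.im • (Complex.I • basisV k) := by
    have e : ∀ (c : ℝ) (v : VSpace), c • v = (c : ℂ) • v := fun c v => SetLike.coe_eq_coe.mp rfl
    rw [e, e, smul_smul, ← add_smul, Complex.re_add_im]
  rw [h1, map_add, map_smul, map_smul]
  simp
  ring

/-- A real functional is only real-linear in the coefficients. On conjugation-symmetric ones,
symmetrizing over `k` and `-k` makes it complex-linear, so `L(ψ)` lies in the complex Gaussian
space. -/
theorem dual_sum_basisV (L : StrongDual ℝ VSpace) {B : Finset Mode} (hB : ∀ k ∈ B, -k ∈ B)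
    {z : Mode → ℂ} (hz : ∀ k, z (-k) = starRingEnd ℂ (z k)) :
    (L (∑ k ∈ B, z k • basisV k) : ℂ) = ∑ k ∈ B, dualCoeff L k * z k := by
  set l : Mode → ℂ := fun k => (L (basisV k) : ℂ) - L (Complex.I • basisV k) * Complex.I with hl
  have hc : ∀ k, dualCoeff L k = (l k + starRingEnd ℂ (l (-k))) / 2 := fun k => by
    simp [dualCoeff, hl]
  have h1 : ∑ k ∈ B, starRingEnd ℂ (l (-k)) * z k = starRingEnd ℂ (∑ k ∈ B, l k * z k) := by
    rw [map_sum]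
    refine Finset.sum_nbij' (fun k => -k) (fun k => -k) hB hB (fun k _ => Mode.neg_neg k)
      (fun k _ => Mode.neg_neg k) fun k _ => ?_
    rw [map_mul, hz, Complex.conj_conj]
  have h2 : ∑ k ∈ B, dualCoeff L k * z k =
      (∑ k ∈ B, l k * z k + starRingEnd ℂ (∑ k ∈ B, l k * z k)) / 2 := by
    rw [← h1, ← Finset.sum_add_distrib, Finset.sum_div]
    exact Finset.sum_congr rfl fun k _ => by rw [hc]; ring
  rw [h2, Complex.add_conj, map_sum, Complex.ofReal_sum, Complex.re_sum]
  push_cast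
  rw [mul_div_cancel_left₀ _ two_ne_zero]
  exact Finset.sum_congr rfl fun k _ => by rw [dual_smul_basisV]

section Solution

variable {Ω : Type u} [MeasurableSpace Ω] {P : Measure Ω} [IsProbabilityMeasure P] {H : ℝ}
  {β : Mode → ℝ → Ω → ℂ} {a : Mode → ℝ} {w : Mode → ℝ} {F : ℕ → Finset Mode} {m : ℕ}
  {X : Mode → ℝ → Ω → ℂ} {h : IsFractionalNoise P H β} {ι : Type*} [Fintype ι]

theorem IsFractionalNoise.inner_ouSum (h : IsFractionalNoise P H β) (hH : 0 < H ∧ H < 1)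
    (ha : ∀ k, 0 < a k) (B : Finset Mode) (c d : Mode → ℂ) (t s : ℝ) :
    inner ℂ (h.ouSum a B c t) (h.ouSum a B d s) =
      ∑ k ∈ B, starRingEnd ℂ (c k) * d k * ouCov H (a k) (a k) (t - s) := by
  rw [ouSum, ouSum, sum_inner]
  refine Finset.sum_congr rfl fun k hk => ?_
  rw [inner_sum, Finset.sum_eq_single_of_mem k hk]
  · have h0 := (h.hasFBMCov_self k).isHolderCurve hH
    have h1 := (h.hasFBMCov_self k).inner_ouTransform h0 h0 (ha k) (ha k) t s
    rw [inner_smul_left, inner_smul_right, ouCurve, ouCurve, h1]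
    ring
  · intro l _ hl
    rw [inner_smul_left, inner_smul_right, h.inner_ouCurve_of_ne hH ha hl.symm, mul_zero, mul_zero]

/-- All covariances depend on time differences. Since norms determine the Gaussian laws, this is
stationarity. -/
theorem IsFractionalNoise.norm_sum_ouSum_add (h : IsFractionalNoise P H β) (hH : 0 < H ∧ H < 1)
    (ha : ∀ k, 0 < a k) (B : Finset Mode) (c : ι → Mode → ℂ) (t : ι → ℝ) (r : ℝ) :
    ‖∑ i, h.ouSum a B (c i) (t i + r)‖ ^ 2 = ‖∑ i, h.ouSum a B (c i) (t i)‖ ^ 2 := by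
  have h1 : inner ℂ (∑ i, h.ouSum a B (c i) (t i + r)) (∑ i, h.ouSum a B (c i) (t i + r)) =
      inner ℂ (∑ i, h.ouSum a B (c i) (t i)) (∑ i, h.ouSum a B (c i) (t i)) := by
    simp_rw [sum_inner, inner_sum, h.inner_ouSum hH ha, add_sub_add_right_eq_sub]
  rw [inner_self_eq_ofReal_norm_sq, inner_self_eq_ofReal_norm_sq] at h1
  exact_mod_cast h1

theorem norm_reL2_eq_of_ae_real {Z : Lp ℂ 2 P} {y : Ω → ℝ} (hy : (Z : Ω → ℂ) =ᵐ[P] fun ω => (y ω : ℂ)) :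
    ‖reL2 Z‖ = ‖Z‖ := by
  rw [Lp.norm_def, Lp.norm_def]
  congr 1
  refine eLpNorm_congr_norm_ae ?_
  filter_upwards [hy, coeFn_reL2 Z] with ω h1 h2
  rw [h2, h1, Complex.ofReal_re, Complex.norm_real]

/-- The exponent is a real-valued element of the Gaussian space, so taking the real part does not
change its norm. -/
theorem IsOUModes.integral_exp_sum (hX : IsOUModes h a X) (hH : 0 < H ∧ H < 1)
    (ha : ∀ k, 0 < a k) {B : Finset Mode} (hB : ∀ k ∈ B, -k ∈ B) (hw : ∀ k, w (-k) = w k)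
    (L : ι → StrongDual ℝ VSpace) (t : ι → ℝ) :
    ∫ ω, Complex.exp ((∑ i, L i (∑ k ∈ B, ((w k : ℂ) * X k (t i) ω) • basisV k) : ℝ) *
      Complex.I) ∂P =
      Complex.exp (-(1 / 2 * ‖∑ i, h.ouSum a B (fun k => dualCoeff (L i) k * w k) (t i)‖ ^ 2 :
        ℝ)) := by
  set Z : Lp ℂ 2 P := ∑ i, h.ouSum a B (fun k => dualCoeff (L i) k * w k) (t i) with hZ
  have h1 : (Z : Ω → ℂ) =ᵐ[P] fun ω =>
      ((∑ i, L i (∑ k ∈ B, ((w k : ℂ) * X k (t i) ω) • basisV k) : ℝ) : ℂ) := by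
    have e1 := ae_all_iff.mpr fun i => IsFractionalNoise.coeFn_ouSum hX B
      (fun k => dualCoeff (L i) k * w k) (t i)
    filter_upwards [e1, Lp.coeFn_finsetSum Finset.univ fun i =>
      h.ouSum a B (fun k => dualCoeff (L i) k * w k) (t i)] with ω e2 e3
    rw [hZ, e3, Finset.sum_apply, Complex.ofReal_sum]
    refine Finset.sum_congr rfl fun i _ => ?_
    rw [e2 i, dual_sum_basisV (L i) hB fun k => ?_]
    · exact Finset.sum_congr rfl fun k _ => mul_assoc _ _ _
    · rw [hw, hX.conj, map_mul, Complex.conj_ofReal]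
  have h2 : IsCenteredGaussianRe Z := h.isCenteredGaussianRe_of_mem
    (Submodule.sum_mem _ fun i _ => h.ouSum_mem hH ha B _ _)
  rw [IsCenteredGaussianRe, norm_reL2_eq_of_ae_real h1] at h2
  rw [← h2]
  refine integral_congr_ae ?_
  filter_upwards [h1] with ω e
  rw [e, Complex.ofReal_re]

theorem IsOUModes.tendsto_integral_exp_sum (hX : IsOUModes h a X) (hH : 0 < H ∧ H < 1)
    (ha : ∀ k, 0 < a k) (hF : Monotone F) (hFs : ∀ j, ∀ k ∈ F j, -k ∈ F j)
    (hw : ∀ k, w (-k) = w k) (hR : IsRegularAlong w F m X)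
    (L : ι → StrongDual ℝ VSpace) (t : ι → ℝ) :
    Tendsto (fun J => Complex.exp
      (-(1 / 2 * ‖∑ i, h.ouSum a (F J) (fun k => dualCoeff (L i) k * w k) (t i)‖ ^ 2 : ℝ))) atTop
      (𝓝 (∫ ω, Complex.exp ((∑ i, L i (seriesV w F X (t i) ω) : ℝ) * Complex.I) ∂P)) := by
  simp_rw [← hX.integral_exp_sum hH ha (hFs _) hw]
  refine tendsto_integral_of_dominated_convergence (fun _ => 1) (fun J => ?_)
    (integrable_const _) (fun J => ae_of_all _ fun ω => ?_) (ae_of_all _ fun ω => ?_)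
  · have h1 : ∀ i, Measurable fun ω => L i (∑ k ∈ F J, ((w k : ℂ) * X k (t i) ω) • basisV k) :=
      fun i => (L i).measurable.comp (Finset.measurable_sum _ fun k _ =>
        measurable_smul_basisV ((hX.measurable k (t i)).const_mul _) k)
    have h2 := Finset.measurable_sum Finset.univ fun i _ => h1 i
    exact (((Complex.measurable_ofReal.comp h2).mul_const _).cexp).aestronglyMeasurable
  · rw [Complex.norm_exp_ofReal_mul_I]
  · have hc : Continuous fun v : ι → VSpace => Complex.exp ((∑ i, L i (v i) : ℝ) * Complex.I) := by
      fun_prop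
    exact (hc.tendsto fun i => seriesV w F X (t i) ω).comp
      (tendsto_pi_nhds.mpr fun i => hR.tendsto_seriesV hF (t i) ω)

theorem IsOUModes.map_add_eq (hX : IsOUModes h a X) (hH : 0 < H ∧ H < 1)
    (ha : ∀ k, 0 < a k) (hF : Monotone F) (hFs : ∀ j, ∀ k ∈ F j, -k ∈ F j)
    (hw : ∀ k, w (-k) = w k) (hR : IsRegularAlong w F m X) (t : ι → ℝ) (r : ℝ) :
    P.map (fun ω i => seriesV w F X (t i + r) ω) = P.map (fun ω i => seriesV w F X (t i) ω) := by
  have hm := hR.measurable_seriesV hF hX.measurable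
  refine map_eq_of_integral_exp_sum_eq (measurable_pi_lambda _ fun i => hm _)
    (measurable_pi_lambda _ fun i => hm _) fun L => ?_
  have h1 := hX.tendsto_integral_exp_sum hH ha hF hFs hw hR L fun i => t i + r
  simp_rw [h.norm_sum_ouSum_add hH ha] at h1
  exact tendsto_nhds_unique h1 (hX.tendsto_integral_exp_sum hH ha hF hFs hw hR L t)

end Solution

end

noncomputable section

/-! ### Ergodicity and uniqueness -/

section Solution

variable {Ω : Type u} [MeasurableSpace Ω] {P : Measure Ω} [IsProbabilityMeasure P] {H : ℝ}
  {β : Mode → ℝ → Ω → ℂ} {a : Mode → ℝ} {a₀ : ℝ} {w : Mode → ℝ} {F : ℕ → Finset Mode} {m : ℕ}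
  {X : Mode → ℝ → Ω → ℂ} {h : IsFractionalNoise P H β}

theorem IsFractionalNoise.abs_ouCov_le (h : IsFractionalNoise P H β) (hH : 0 < H ∧ H < 1)
    (ha₀ : 0 < a₀) (ha : ∀ k, a₀ ≤ a k) (k : Mode) (τ : ℝ) :
    |ouCov H (a k) (a k) τ| ≤ (1 + 1 / a₀) ^ 2 := by
  have h0 := (h.hasFBMCov_self k).isHolderCurve hH
  have ha' := ha₀.trans_le (ha k)
  have h1 := (h.hasFBMCov_self k).inner_ouTransform h0 h0 ha' ha' τ 0
  have h2 := norm_inner_le_norm (𝕜 := ℂ) (h.ouCurve a k τ) (h.ouCurve a k 0)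
  rw [ouCurve, ouCurve, h1, one_mul, sub_zero, Complex.norm_real, Real.norm_eq_abs] at h2
  rw [sq]
  exact h2.trans (mul_le_mul (h.norm_ouCurve_le hH ha₀ ha k τ) (h.norm_ouCurve_le hH ha₀ ha k 0)
    (norm_nonneg _) (by positivity))

theorem dualCoeff_neg (L : StrongDual ℝ VSpace) (k : Mode) : dualCoeff (-L) k = -dualCoeff L k := by
  simp [dualCoeff]
  ring

/-- Let `r` be the covariance function of `L(ψ)`. The difference of two times has characteristic
function `exp(-(r 0 - r j))` at 1 and the squared modulus of the one-time value is `exp(-r 0)`; they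
merge because `r j → 0`, by dominated convergence over the modes. -/
theorem IsOUModes.exists_mixing_rate (hX : IsOUModes h a X) (hH : 0 < H ∧ H < 1) (ha₀ : 0 < a₀)
    (ha : ∀ k, a₀ ≤ a k) (hF : Monotone F) (hFc : ∀ k, ∃ j, k ∈ F j)
    (hFs : ∀ j, ∀ k ∈ F j, -k ∈ F j) (hw : ∀ k, w (-k) = w k) (hws : Summable fun k => w k ^ 2)
    (hR : IsRegularAlong w F m X) (L : StrongDual ℝ VSpace) :
    ∃ c : ℕ → ℝ, Tendsto c atTop (𝓝 0) ∧ ∀ (t : ℝ) (j : ℕ),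
      ‖∫ ω, Complex.exp ((L (seriesV w F X (t + j) ω) - L (seriesV w F X t ω) : ℝ) *
        Complex.I) ∂P -
        (‖∫ ω, Complex.exp (L (seriesV w F X 0 ω) * Complex.I) ∂P‖ : ℂ) ^ 2‖ ≤ c j := by
  have ha' : ∀ k, 0 < a k := fun k => ha₀.trans_le (ha k)
  set d : Mode → ℂ := fun k => dualCoeff L k * w k with hd
  set V : Mode → ℝ → ℝ := fun k => ouCov H (a k) (a k) with hV
  have hq : Summable fun k => ‖d k‖ ^ 2 := by
    refine Summable.of_nonneg_of_le (fun k => sq_nonneg _) (fun k => ?_)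
      (hws.mul_left ((2 * ‖L‖) ^ 2))
    rw [hd, norm_mul, mul_pow, Complex.norm_real, Real.norm_eq_abs, sq_abs]
    gcongr
    exact norm_dualCoeff_le L k
  have hqb : ∀ k τ, ‖‖d k‖ ^ 2 * V k τ‖ ≤ ‖d k‖ ^ 2 * (1 + 1 / a₀) ^ 2 := fun k τ => by
    rw [norm_mul, Real.norm_of_nonneg (sq_nonneg _)]
    exact mul_le_mul_of_nonneg_left (h.abs_ouCov_le hH ha₀ ha k τ) (sq_nonneg _)
  have hqs : ∀ τ, Summable fun k => ‖d k‖ ^ 2 * V k τ := fun τ =>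
    Summable.of_norm_bounded (hq.mul_right _) fun k => hqb k τ
  set r : ℝ → ℝ := fun τ => ∑' k, ‖d k‖ ^ 2 * V k τ with hr
  have hrlim : Tendsto (fun j : ℕ => r j) atTop (𝓝 0) := by
    have := tendsto_tsum_of_dominated_convergence (𝓕 := (atTop : Filter ℕ))
      (f := fun j k => ‖d k‖ ^ 2 * V k j) (g := fun _ => 0) (hq.mul_right ((1 + 1 / a₀) ^ 2))
      (fun k => ?_) (Eventually.of_forall fun j k => hqb k j)
    · simpa using this
    · have := (((h.hasFBMCov_self k).tendsto_ouCov hH (ha' k) (ha' k)).comp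
        tendsto_natCast_atTop_atTop).const_mul (‖d k‖ ^ 2)
      rwa [mul_zero] at this
  have hlim : ∀ τ, Tendsto (fun J => ∑ k ∈ F J, ‖d k‖ ^ 2 * V k τ) atTop (𝓝 (r τ)) := fun τ =>
    (hqs τ).hasSum.comp (tendsto_atTop_finset_of_monotone hF hFc)
  have hone : ∫ ω, Complex.exp (L (seriesV w F X 0 ω) * Complex.I) ∂P =
      Complex.exp (-(1 / 2 * r 0 : ℝ)) := by
    have h1 := hX.tendsto_integral_exp_sum hH ha' hF hFs hw hR (fun _ : Unit => L) fun _ => 0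
    simp only [Finset.univ_unique, Finset.sum_singleton, h.norm_sq_ouSum hH ha',
      IsFractionalNoise.ouCurve,
      (h.hasFBMCov_self _).norm_sq_ouTransform hH (ha' _)] at h1
    refine tendsto_nhds_unique h1 ?_
    have hc : Continuous fun x : ℝ => Complex.exp (-(1 / 2 * x : ℝ)) := by fun_prop
    exact (hc.tendsto _).comp (hlim 0)
  have htwo : ∀ (t : ℝ) (j : ℕ), ∫ ω, Complex.exp ((L (seriesV w F X (t + j) ω) -
      L (seriesV w F X t ω) : ℝ) * Complex.I) ∂P = Complex.exp (-(r 0 - r j : ℝ)) := by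
    intro t j
    -- The increment is handled as the two-time functional with weights `L` and `-L`.
    have h1 := hX.tendsto_integral_exp_sum hH ha' hF hFs hw hR ![L, -L] ![t + j, t]
    have h2 : ∀ J, ‖∑ i, h.ouSum a (F J) (fun k => dualCoeff (![L, -L] i) k * w k)
        (![t + (j : ℝ), t] i)‖ ^ 2 = ∑ k ∈ F J, 2 * (‖d k‖ ^ 2 * V k 0 - ‖d k‖ ^ 2 * V k j) := by
      intro J
      rw [Fin.sum_univ_two]
      simp only [Matrix.cons_val_zero, Matrix.cons_val_one]
      rw [h.norm_sq_ouSum_add hH ha']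
      refine Finset.sum_congr rfl fun k _ => ?_
      rw [dualCoeff_neg, neg_mul, neg_smul, ← sub_eq_add_neg, ← smul_sub, norm_smul, mul_pow,
        IsFractionalNoise.ouCurve, IsFractionalNoise.ouCurve,
        (h.hasFBMCov_self k).norm_sub_sq_ouTransform hH (ha' k), ouIncVar,
        add_sub_cancel_left]
      ring
    simp_rw [h2] at h1
    simp only [Fin.sum_univ_two, Matrix.cons_val_zero, Matrix.cons_val_one,
      neg_apply, ← sub_eq_add_neg] at h1
    refine tendsto_nhds_unique h1 ?_
    have hc : Continuous fun x : ℝ => Complex.exp (-(1 / 2 * x : ℝ)) := by fun_prop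
    have h3 := (hc.tendsto _).comp (((hlim 0).sub (hlim j)).const_mul 2)
    have e : (1 / 2 * (2 * (r 0 - r j)) : ℝ) = r 0 - r j := by ring
    rw [e] at h3
    refine h3.congr fun J => ?_
    simp only [Function.comp_apply]
    rw [← Finset.sum_sub_distrib, Finset.mul_sum]
  refine ⟨fun j => |Real.exp (-(r 0 - r j)) - Real.exp (-r 0)|, ?_, fun t j => ?_⟩
  · have hc : Continuous fun x : ℝ => |Real.exp (-(r 0 - x)) - Real.exp (-r 0)| := by fun_prop
    simpa [Function.comp_def] using (hc.tendsto 0).comp hrlim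
  · rw [htwo, hone, ← Complex.ofReal_neg, ← Complex.ofReal_exp, ← Complex.ofReal_neg,
      ← Complex.ofReal_exp, Complex.norm_real, Real.norm_of_nonneg (Real.exp_pos _).le,
      ← Complex.ofReal_pow, ← Real.exp_nat_mul, ← Complex.ofReal_sub, Complex.norm_real,
      Real.norm_eq_abs]
    refine le_of_eq ?_
    congr 3
    push_cast
    ring

theorem IsOUModes.isErgodicProcess_seriesV (hX : IsOUModes h a X) (hH : 0 < H ∧ H < 1)
    (ha₀ : 0 < a₀) (ha : ∀ k, a₀ ≤ a k) (hF : Monotone F) (hFc : ∀ k, ∃ j, k ∈ F j)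
    (hFs : ∀ j, ∀ k ∈ F j, -k ∈ F j) (hw : ∀ k, w (-k) = w k) (hws : Summable fun k => w k ^ 2)
    (hR : IsRegularAlong w F m X) : IsErgodicProcess P (seriesV w F X) := by
  have ha' : ∀ k, 0 < a k := fun k => ha₀.trans_le (ha k)
  have hm := hR.measurable_seriesV hF hX.measurable
  intro ρ hρ hi
  refine ae_tendsto_timeAverage (hR.continuous_seriesV hX.continuous) hm ?_ (fun t => ?_)
    (fun L => hX.exists_mixing_rate hH ha₀ ha hF hFc hFs hw hws hR L) hρ hi
  · exact map_process_eq_of_finite (fun t => hm (t + 1)) hm fun N t =>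
      hX.map_add_eq hH ha' hF hFs hw hR t 1
  · have h1 := congrArg (Measure.map fun y : Unit → VSpace => y ())
      (hX.map_add_eq hH ha' hF hFs hw hR (fun _ : Unit => 0) t)
    rw [Measure.map_map (measurable_pi_apply _) (measurable_pi_lambda _ fun i => hm _),
      Measure.map_map (measurable_pi_apply _) (measurable_pi_lambda _ fun i => hm _)] at h1
    simp only [zero_add] at h1
    exact h1

theorem IsMildSolution.measurable_of_forall {ν : ℝ} {lam α : Mode → ℝ} {φ : ℝ → Ω → VSpace}
    (hφ : ∀ T > 0, IsMildSolution P H ν lam α β T φ) {t : ℝ} (ht : 0 ≤ t) : Measurable (φ t) := by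
  have h1 := (hφ (t + 1) (by linarith)).1
  have h2 : Measurable fun ω : Ω => ((⟨t, ht, by linarith⟩ : Set.Icc (0 : ℝ) (t + 1)), ω) :=
    measurable_const.prodMk measurable_id
  exact h1.comp h2

/-- The stochastic convolutions agree almost surely by uniqueness of Wiener integrals and of mode
sums, so they cancel. -/
theorem IsMildSolution.ae_sub_eq {ν c₀ : ℝ} {lam α : Mode → ℝ} {φ ψ : ℝ → Ω → VSpace} (hν : 0 < ν)
    (hα : ∀ k, c₀ ≤ α k) (h : IsFractionalNoise P H β)
    (hφ : ∀ T > 0, IsMildSolution P H ν lam α β T φ)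
    (hψ : ∀ T > 0, IsMildSolution P H ν lam α β T ψ) {t : ℝ} (ht : 0 ≤ t) :
    ∀ᵐ ω ∂P, φ t ω - ψ t ω = semigroupV ν α t (φ 0 ω - ψ 0 ω) := by
  obtain ⟨Y, ⟨I, hI, hY⟩, hφY⟩ := (hφ (t + 1) (by linarith)).2 t ⟨ht, by linarith⟩
  obtain ⟨Z, ⟨J, hJ, hZ⟩, hψZ⟩ := (hψ (t + 1) (by linarith)).2 t ⟨ht, by linarith⟩
  have hYZ : Y =ᵐ[P] Z := hY.ae_unique hZ fun k => by
    filter_upwards [(hI k).ae_unique (h.measurable k) ht (hJ k)] with ω hω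
    rw [hω]
  filter_upwards [hφY, hψZ, hYZ] with ω h1 h2 h3
  rw [h1, h2, h3, semigroupV_sub hν hα ht]
  abel

/-- Shifting all times by `n` changes neither characteristic function, while the difference of the
shifted ones tends to zero. A constant sequence with limit zero vanishes. -/
theorem map_eq_of_isStrictlyStationary {φ ψ : ℝ → Ω → VSpace} (hφm : ∀ t ≥ 0, Measurable (φ t))
    (hψm : ∀ t ≥ 0, Measurable (ψ t)) (hφ : IsStrictlyStationary P φ)
    (hψ : IsStrictlyStationary P ψ)
    (hlim : ∀ t : ℝ, 0 ≤ t → ∀ᵐ ω ∂P,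
      Tendsto (fun n : ℕ => φ (t + n) ω - ψ (t + n) ω) atTop (𝓝 0)) :
    P.map (fun ω (t : Set.Ici (0 : ℝ)) => φ t ω) =
      P.map (fun ω (t : Set.Ici (0 : ℝ)) => ψ t ω) := by
  refine map_process_eq_of_finite (φ := fun (t : Set.Ici (0 : ℝ)) ω => φ t ω)
    (ψ := fun (t : Set.Ici (0 : ℝ)) ω => ψ t ω) (fun t => hφm t t.2) (fun t => hψm t t.2)
    fun N t => ?_
  have ht : ∀ i, 0 ≤ (t i : ℝ) := fun i => (t i).2
  have htn : ∀ i (n : ℕ), 0 ≤ (t i : ℝ) + n := fun i n => add_nonneg (ht i) (Nat.cast_nonneg n)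
  refine map_eq_of_integral_exp_sum_eq (measurable_pi_lambda _ fun i => hφm _ (ht i))
    (measurable_pi_lambda _ fun i => hψm _ (ht i)) fun L => ?_
  have hmeas : ∀ {χ : ℝ → Ω → VSpace}, (∀ t ≥ 0, Measurable (χ t)) → ∀ n : ℕ,
      Measurable fun ω => Complex.exp ((∑ i, L i (χ (t i + n) ω) : ℝ) * Complex.I) :=
    fun {χ} hχ n => by
      have h2 := Finset.measurable_sum Finset.univ fun i _ =>
        (L i).measurable.comp (hχ _ (htn i n))
      exact ((Complex.measurable_ofReal.comp h2).mul_const _).cexp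
  have hint : ∀ {χ : ℝ → Ω → VSpace}, (∀ t ≥ 0, Measurable (χ t)) → ∀ n : ℕ,
      Integrable (fun ω => Complex.exp ((∑ i, L i (χ (t i + n) ω) : ℝ) * Complex.I)) P :=
    fun {χ} hχ n => Integrable.of_bound (hmeas hχ n).aestronglyMeasurable 1
      (ae_of_all _ fun ω => (Complex.norm_exp_ofReal_mul_I _).le)
  have hstat : ∀ {χ : ℝ → Ω → VSpace}, (∀ t ≥ 0, Measurable (χ t)) → IsStrictlyStationary P χ →
      ∀ n : ℕ, ∫ ω, Complex.exp ((∑ i, L i (χ (t i + n) ω) : ℝ) * Complex.I) ∂P =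
        ∫ ω, Complex.exp ((∑ i, L i (χ (t i) ω) : ℝ) * Complex.I) ∂P :=
    fun {χ} hχ hs n => integral_exp_sum_eq_of_map_eq
      (measurable_pi_lambda _ fun i => hχ _ (htn i n))
      (measurable_pi_lambda _ fun i => hχ _ (ht i)) (hs N _ ht n (Nat.cast_nonneg n)) L
  have hD : Tendsto (fun n : ℕ => ∫ ω, (Complex.exp ((∑ i, L i (φ (t i + n) ω) : ℝ) * Complex.I) -
      Complex.exp ((∑ i, L i (ψ (t i + n) ω) : ℝ) * Complex.I)) ∂P) atTop (𝓝 (∫ ω, (0 : ℂ) ∂P)) := by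
    refine tendsto_integral_of_dominated_convergence (fun _ => 2)
      (fun n => ((hmeas hφm n).sub (hmeas hψm n)).aestronglyMeasurable)
      (integrable_const _) (fun n => ae_of_all _ fun ω => ?_) ?_
    · refine (norm_sub_le _ _).trans ?_
      rw [Complex.norm_exp_ofReal_mul_I, Complex.norm_exp_ofReal_mul_I]
      norm_num
    · filter_upwards [ae_all_iff.mpr fun i => hlim _ (ht i)] with ω hω
      have h1 : Tendsto (fun n : ℕ => |∑ i, L i (φ (t i + n) ω - ψ (t i + n) ω)|) atTop (𝓝 0) := by
        have hc : Continuous fun v : Fin N → VSpace => |∑ i, L i (v i)| := by fun_prop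
        simpa [Function.comp_def] using (hc.tendsto fun _ => 0).comp (tendsto_pi_nhds.mpr hω)
      refine squeeze_zero_norm (fun n => (norm_exp_mul_I_sub_le _ _).trans (le_of_eq ?_)) h1
      rw [← Finset.sum_sub_distrib]
      simp_rw [map_sub]
  rw [integral_zero] at hD
  have hconst : ∀ n : ℕ, ∫ ω, (Complex.exp ((∑ i, L i (φ (t i + n) ω) : ℝ) * Complex.I) -
      Complex.exp ((∑ i, L i (ψ (t i + n) ω) : ℝ) * Complex.I)) ∂P =
      ∫ ω, Complex.exp ((∑ i, L i (φ (t i) ω) : ℝ) * Complex.I) ∂P -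
        ∫ ω, Complex.exp ((∑ i, L i (ψ (t i) ω) : ℝ) * Complex.I) ∂P := fun n => by
    rw [integral_sub (hint hφm n) (hint hψm n), hstat hφm hφ, hstat hψm hψ]
  simp_rw [hconst] at hD
  exact sub_eq_zero.mp (tendsto_nhds_unique tendsto_const_nhds hD)

theorem IsOUModes.isUniqueErgodicMildSolution_seriesV {ν c₀ : ℝ} {lam α : Mode → ℝ} (hν : 0 < ν)
    (hc₀ : 0 < c₀) (hα : ∀ k, c₀ ≤ α k)
    (hX : IsOUModes h (fun k => ν * α k) X) (hH : 0 < H ∧ H < 1)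
    (hlam : ∀ k, lam (-k) = lam k)
    (hws : Summable fun k => (√(lam k) * ν ^ H) ^ 2) (hF : Monotone F)
    (hFc : ∀ k, ∃ j, k ∈ F j) (hFs : ∀ j, ∀ k ∈ F j, -k ∈ F j)
    (hR : IsRegularAlong (fun k => √(lam k) * ν ^ H) F m X) :
    IsUniqueErgodicMildSolution P H ν lam α β (seriesV (fun k => √(lam k) * ν ^ H) F X) := by
  have ha₀ : 0 < ν * c₀ := mul_pos hν hc₀
  have ha : ∀ k, ν * c₀ ≤ ν * α k := fun k => mul_le_mul_of_nonneg_left (hα k) hν.le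
  have ha' : ∀ k, 0 < ν * α k := fun k => ha₀.trans_le (ha k)
  have hw : ∀ k, √(lam (-k)) * ν ^ H = √(lam k) * ν ^ H := fun k => by rw [hlam]
  have hm := hR.measurable_seriesV hF hX.measurable
  have hmild := hX.isMildSolution_seriesV hν hc₀ hα hH hws hF hFc hR
  have hstat : IsStrictlyStationary P (seriesV (fun k => √(lam k) * ν ^ H) F X) :=
    fun N t _ r _ => hX.map_add_eq hH ha' hF hFs hw hR t r
  refine ⟨⟨fun T _ => hmild T, hstat⟩, hX.isAdaptedToNoise_seriesV ha' hH hF hR,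
    hX.isErgodicProcess_seriesV hH ha₀ ha hF hFc hFs hw hws hR, fun φ hφ _ => ?_⟩
  have hφm : ∀ t ≥ 0, Measurable (φ t) := fun t ht => IsMildSolution.measurable_of_forall hφ.1 ht
  refine map_eq_of_isStrictlyStationary hφm (fun t _ => hm t) hφ.2 hstat fun t ht => ?_
  have h1 := ae_all_iff.mpr fun n : ℕ => IsMildSolution.ae_sub_eq hν hα h hφ.1 (fun T _ => hmild T)
    (add_nonneg ht (Nat.cast_nonneg n))
  filter_upwards [h1] with ω hω
  have h2 : Tendsto (fun n : ℕ => Real.exp (-((t + n) * (ν * c₀))) *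
      ‖φ 0 ω - seriesV (fun k => √(lam k) * ν ^ H) F X 0 ω‖) atTop (𝓝 0) := by
    have e1 : Tendsto (fun n : ℕ => (t + (n : ℝ)) * (ν * c₀)) atTop atTop :=
      (tendsto_atTop_add_const_left _ t tendsto_natCast_atTop_atTop).atTop_mul_const ha₀
    have e2 := (Real.tendsto_exp_neg_atTop_nhds_zero.comp e1).mul_const
      ‖φ 0 ω - seriesV (fun k => √(lam k) * ν ^ H) F X 0 ω‖
    rw [zero_mul] at e2
    exact e2
  refine squeeze_zero_norm (fun n => ?_) h2
  rw [hω n]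
  exact norm_semigroupV_le hν hα (add_nonneg ht (Nat.cast_nonneg n)) _

end Solution

end

noncomputable section

/-! ### Second moments of the velocity field -/

theorem Lp_norm_sq_eq_integral {Ω E : Type*} [MeasurableSpace Ω] [NormedAddCommGroup E]
    {P : Measure Ω} (Z : Lp E 2 P) : ‖Z‖ ^ 2 = ∫ ω, ‖Z ω‖ ^ 2 ∂P := by
  rw [Lp.norm_def, ← ENNReal.toReal_pow, eLpNorm_two_sq,
    integral_eq_lintegral_of_nonneg_ae (ae_of_all _ fun ω => sq_nonneg _)
      ((Lp.aestronglyMeasurable Z).norm.pow 2)]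
  congr 1
  refine lintegral_congr fun ω => ?_
  rw [ENNReal.ofReal_pow (norm_nonneg _), ofReal_norm]

theorem hasFDerivAt_re_trigPoly (B : Finset Mode) (c : Mode → ℂ) (y : Plane) :
    HasFDerivAt (fun x : Plane => (trigPoly B c (toTorus x)).re)
      (Complex.reCLM.comp (∑ k ∈ B, c k • (modeFun k (toTorus y) • phaseCLM k))) y := by
  refine Complex.reCLM.hasFDerivAt.comp y ?_
  simp only [trigPoly, modeFun_toTorus]
  exact HasFDerivAt.fun_sum fun k _ => (hasFDerivAt_exp_phase k y).const_smul (c k)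

/-- The Fourier coefficients at `x` of the derivative in the direction `i`. -/
def gradCoeff (w : Mode → ℝ) (i : Fin 2) (x : Torus2) (k : Mode) : ℂ :=
  (w k : ℂ) * (modeFun k x * ((waveVec k i : ℂ) * Complex.I))

theorem norm_sq_gradCoeff (w : Mode → ℝ) (i : Fin 2) (x : Torus2) (k : Mode) :
    ‖gradCoeff w i x k‖ ^ 2 = w k ^ 2 * waveVec k i ^ 2 := by
  rw [gradCoeff, norm_mul, norm_mul, norm_modeFun, one_mul, norm_mul, Complex.norm_I, mul_one,
    Complex.norm_real, Complex.norm_real, mul_pow, Real.norm_eq_abs, Real.norm_eq_abs, sq_abs,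
    sq_abs]

/-- The point `x` enters only through a factor of modulus 1, so second moments of the velocity are
the same at every point. -/
theorem sum_norm_sq_gradCoeff (w : Mode → ℝ) (x : Torus2) (k : Mode) :
    ∑ i, ‖gradCoeff w i x k‖ ^ 2 = w k ^ 2 * ‖waveVec k‖ ^ 2 := by
  simp_rw [norm_sq_gradCoeff]
  rw [← Finset.mul_sum, EuclideanSpace.norm_sq_eq]
  simp_rw [Real.norm_eq_abs, sq_abs]

theorem gradCoeff_neg {w : Mode → ℝ} (hw : ∀ k, w (-k) = w k) (i : Fin 2) (x : Torus2) (k : Mode) :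
    gradCoeff w i x (-k) = starRingEnd ℂ (gradCoeff w i x k) := by
  rw [gradCoeff, gradCoeff, hw, modeFun_neg, waveVec_neg, PiLp.neg_apply]
  simp

section Solution

variable {Ω : Type u} [MeasurableSpace Ω] {P : Measure Ω} [IsProbabilityMeasure P] {H : ℝ}
  {β : Mode → ℝ → Ω → ℂ} {a : Mode → ℝ} {a₀ : ℝ} {w : Mode → ℝ} {F : ℕ → Finset Mode} {m : ℕ}
  {X : Mode → ℝ → Ω → ℂ} {h : IsFractionalNoise P H β}

theorem IsRegularAlong.differentiable_seriesField (hR : IsRegularAlong w F m X) (hm : 1 ≤ m)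
    (hX : ∀ k ω, Continuous fun t => X k t ω) (t : ℝ) (ω : Ω) :
    Differentiable ℝ fun x : Plane => seriesField w F X t ω (toTorus x) :=
  ((hR.isContinuousIntoCm hX ω).1.1 t).differentiable
    (by exact_mod_cast (by omega : m ≠ 0))

theorem IsRegularAlong.tendsto_torusPartial (hR : IsRegularAlong w F m X) (hm : 1 ≤ m)
    (hF : Monotone F) (hFs : ∀ j, ∀ k ∈ F j, -k ∈ F j) (hw : ∀ k, w (-k) = w k)
    (hX : ∀ k ω, Continuous fun t => X k t ω)
    (hXs : ∀ k t ω, X (-k) t ω = starRingEnd ℂ (X k t ω)) (i : Fin 2) (t : ℝ) (ω : Ω)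
    (x : Torus2) :
    Tendsto (fun J => ∑ k ∈ F J, gradCoeff w i x k * X k t ω) atTop
      (𝓝 (torusPartial i (seriesField w F X t ω) x : ℂ)) := by
  obtain ⟨y, -, rfl⟩ := exists_toTorus_eq x
  rw [torusPartial_toTorus (hR.differentiable_seriesField hm hX t ω y)]
  have h1 := (hR.isContinuousIntoCm hX ω).2 t 1 hm y
  have h2 := (ContinuousMultilinearMap.apply ℝ (fun _ : Fin 1 => Plane) ℝ
    fun _ => EuclideanSpace.single i 1).hasSum h1
  simp only [ContinuousMultilinearMap.apply_apply, iteratedFDeriv_one_apply,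
    (hasFDerivAt_re_trigPoly _ _ y).fderiv] at h2
  have h3 := (Complex.continuous_ofReal.tendsto _).comp
    ((tendsto_add_atTop_iff_nat 1).mpr h2.tendsto_sum_nat)
  have hreal : ∀ J, starRingEnd ℂ (∑ k ∈ F J, gradCoeff w i (toTorus y) k * X k t ω) =
      ∑ k ∈ F J, gradCoeff w i (toTorus y) k * X k t ω := by
    intro J
    rw [map_sum]
    refine Finset.sum_nbij' (fun k => -k) (fun k => -k) (hFs J) (hFs J)
      (fun k _ => Mode.neg_neg k) (fun k _ => Mode.neg_neg k) fun k _ => ?_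
    rw [map_mul, hXs, gradCoeff_neg hw]
  refine h3.congr fun J => ?_
  rw [← Complex.conj_eq_iff_re.mp (hreal J), ← sum_range_block hF, Complex.re_sum]
  simp only [Function.comp_apply]
  congr 1
  refine Finset.sum_congr rfl fun j _ => ?_
  rw [ContinuousLinearMap.comp_apply, Complex.reCLM_apply, sum_apply]
  congr 1
  refine Finset.sum_congr rfl fun k _ => ?_
  rw [smul_apply, smul_apply, phaseCLM_apply, gradCoeff, smul_eq_mul, smul_eq_mul,
    EuclideanSpace.inner_single_right]
  simp
  ring

/-- The orthogonal series converges in `L²`. Its limit is identified with the given pointwise limit,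
and Pythagoras' theorem yields the second moment as an exact sum over modes. -/
theorem IsOUModes.memLp_and_integral_of_tendsto (hX : IsOUModes h a X) (hH : 0 < H ∧ H < 1)
    (ha₀ : 0 < a₀) (ha : ∀ k, a₀ ≤ a k) (hF : Monotone F) (hFc : ∀ k, ∃ j, k ∈ F j)
    {c d : Mode → ℂ} (hc : Summable fun k => ‖c k‖ ^ 2) (hd : Summable fun k => ‖d k‖ ^ 2)
    (t s : ℝ) {y : Ω → ℂ} (hy : ∀ ω, Tendsto (fun J => ∑ k ∈ F J, c k * X k t ω +
      ∑ k ∈ F J, d k * X k s ω) atTop (𝓝 (y ω))) :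
    MemLp y 2 P ∧ HasSum (fun k => ‖c k • h.ouCurve a k t + d k • h.ouCurve a k s‖ ^ 2)
      (∫ ω, ‖y ω‖ ^ 2 ∂P) := by
  have ha' : ∀ k, 0 < a k := fun k => ha₀.trans_le (ha k)
  set f : Mode → Lp ℂ 2 P := fun k => c k • h.ouCurve a k t + d k • h.ouCurve a k s with hf
  have horth := h.pairwise_orthogonal hH ha' (c := c) (d := d) (t := t) (s := s)
  have hsq : Summable fun k => ‖f k‖ ^ 2 := by
    refine Summable.of_nonneg_of_le (fun k => sq_nonneg _) (fun k => ?_)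
      ((hc.add hd).mul_left (2 * (1 + 1 / a₀) ^ 2))
    have e1 : ‖f k‖ ≤ ‖c k‖ * (1 + 1 / a₀) + ‖d k‖ * (1 + 1 / a₀) := by
      refine (norm_add_le _ _).trans (add_le_add ?_ ?_) <;> rw [norm_smul]
      · exact mul_le_mul_of_nonneg_left (h.norm_ouCurve_le hH ha₀ ha k t) (norm_nonneg _)
      · exact mul_le_mul_of_nonneg_left (h.norm_ouCurve_le hH ha₀ ha k s) (norm_nonneg _)
    calc ‖f k‖ ^ 2 ≤ (‖c k‖ * (1 + 1 / a₀) + ‖d k‖ * (1 + 1 / a₀)) ^ 2 :=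
          pow_le_pow_left₀ (norm_nonneg _) e1 2
      _ ≤ 2 * (1 + 1 / a₀) ^ 2 * (‖c k‖ ^ 2 + ‖d k‖ ^ 2) := by
          nlinarith [mul_nonneg (sq_nonneg (‖c k‖ - ‖d k‖)) (sq_nonneg (1 + 1 / a₀))]
  obtain ⟨Z, hZ⟩ := summable_of_orthogonal horth hsq
  have hlim : Tendsto (fun J => ∑ k ∈ F J, f k) atTop (𝓝 Z) :=
    hZ.comp (tendsto_atTop_finset_of_monotone hF hFc)
  have hcoe : ∀ᵐ ω ∂P, ∀ J, ((∑ k ∈ F J, f k : Lp ℂ 2 P) : Ω → ℂ) ω =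
      ∑ k ∈ F J, c k * X k t ω + ∑ k ∈ F J, d k * X k s ω := by
    refine ae_all_iff.mpr fun J => ?_
    have e1 : ∑ k ∈ F J, f k = h.ouSum a (F J) c t + h.ouSum a (F J) d s :=
      Finset.sum_add_distrib
    rw [e1]
    filter_upwards [Lp.coeFn_add (h.ouSum a (F J) c t) (h.ouSum a (F J) d s),
      IsFractionalNoise.coeFn_ouSum hX (F J) c t, IsFractionalNoise.coeFn_ouSum hX (F J) d s]
      with ω e2 e3 e4
    rw [e2, Pi.add_apply, e3, e4]
  -- `L²` convergence gives an almost surely convergent subsequence, to be compared with the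
  -- pointwise limit.
  obtain ⟨ns, hns, hae⟩ := (tendstoInMeasure_of_tendsto_Lp hlim).exists_seq_tendsto_ae
  have hyZ : y =ᵐ[P] Z := by
    filter_upwards [hae, hcoe] with ω e1 e2
    simp only [e2] at e1
    exact tendsto_nhds_unique ((hy ω).comp hns.tendsto_atTop) e1
  refine ⟨(memLp_congr_ae hyZ).mpr (Lp.memLp Z), ?_⟩
  have e1 : ∫ ω, ‖y ω‖ ^ 2 ∂P = ‖Z‖ ^ 2 := by
    rw [Lp_norm_sq_eq_integral]
    refine integral_congr_ae ?_
    filter_upwards [hyZ] with ω hω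
    rw [hω]
  rw [e1]
  have e2 : HasSum (fun k => ‖f k‖ ^ 2) (∑' k, ‖f k‖ ^ 2) := hsq.hasSum
  have e3 : Tendsto (fun B => ∑ k ∈ B, ‖f k‖ ^ 2) atTop (𝓝 (‖Z‖ ^ 2)) := by
    have : Tendsto (fun B => ‖∑ k ∈ B, f k‖ ^ 2) atTop (𝓝 (‖Z‖ ^ 2)) := hZ.norm.pow 2
    refine this.congr fun B => ?_
    exact norm_sq_sum_of_orthogonal horth B
  exact e3

theorem IsOUModes.memLp_perpGrad (hX : IsOUModes h a X) (hH : 0 < H ∧ H < 1)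
    (ha₀ : 0 < a₀) (ha : ∀ k, a₀ ≤ a k) (hF : Monotone F) (hFc : ∀ k, ∃ j, k ∈ F j)
    (hFs : ∀ j, ∀ k ∈ F j, -k ∈ F j) (hw : ∀ k, w (-k) = w k)
    (hws : Summable fun k => w k ^ 2 * ‖waveVec k‖ ^ 2) (hm : 1 ≤ m)
    (hR : IsRegularAlong w F m X) (t : ℝ) (x : Torus2) :
    MemLp (fun ω => perpGrad (seriesField w F X t ω) x) 2 P := by
  have hgs : ∀ i, Summable fun k => ‖gradCoeff w i x k‖ ^ 2 := fun i =>
    Summable.of_nonneg_of_le (fun k => sq_nonneg _) (fun k => by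
      rw [← sum_norm_sq_gradCoeff w x]
      exact Finset.single_le_sum (f := fun i => ‖gradCoeff w i x k‖ ^ 2) (fun _ _ => sq_nonneg _)
        (Finset.mem_univ i)) hws
  have h1 : ∀ i, MemLp (fun ω => torusPartial i (seriesField w F X t ω) x) 2 P := fun i => by
    have h2 := (hX.memLp_and_integral_of_tendsto hH ha₀ ha hF hFc (hgs i)
      (d := 0) (by simp) t t
      (y := fun ω => (torusPartial i (seriesField w F X t ω) x : ℂ)) fun ω => by
        simpa using hR.tendsto_torusPartial hm hF hFs hw hX.continuous hX.conj i t ω x).1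
    exact h2.re
  rw [memLp_piLp_iff]
  intro i
  fin_cases i
  · exact h1 1
  · exact (h1 0).neg

theorem IsOUModes.hasSum_integral_norm_sq_perpGrad_sub (hX : IsOUModes h a X) (hH : 0 < H ∧ H < 1)
    (ha₀ : 0 < a₀) (ha : ∀ k, a₀ ≤ a k) (hF : Monotone F) (hFc : ∀ k, ∃ j, k ∈ F j)
    (hFs : ∀ j, ∀ k ∈ F j, -k ∈ F j) (hw : ∀ k, w (-k) = w k)
    (hws : Summable fun k => w k ^ 2 * ‖waveVec k‖ ^ 2) (hm : 1 ≤ m)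
    (hR : IsRegularAlong w F m X) (t s : ℝ) (x : Torus2) :
    HasSum (fun k => w k ^ 2 * ‖waveVec k‖ ^ 2 * ouIncVar H (a k) (t - s))
      (∫ ω, ‖perpGrad (seriesField w F X t ω) x - perpGrad (seriesField w F X s ω) x‖ ^ 2 ∂P) := by
  have ha' : ∀ k, 0 < a k := fun k => ha₀.trans_le (ha k)
  have hgs : ∀ i, Summable fun k => ‖gradCoeff w i x k‖ ^ 2 := fun i =>
    Summable.of_nonneg_of_le (fun k => sq_nonneg _) (fun k => by
      rw [← sum_norm_sq_gradCoeff w x]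
      exact Finset.single_le_sum (f := fun i => ‖gradCoeff w i x k‖ ^ 2) (fun _ _ => sq_nonneg _)
        (Finset.mem_univ i)) hws
  have h1 := fun i => hX.memLp_and_integral_of_tendsto hH ha₀ ha hF hFc (hgs i)
      (d := fun k => -gradCoeff w i x k) (by simpa using hgs i) t s
      (y := fun ω => ((torusPartial i (seriesField w F X t ω) x -
        torusPartial i (seriesField w F X s ω) x : ℝ) : ℂ)) fun ω => by
    have := (hR.tendsto_torusPartial hm hF hFs hw hX.continuous hX.conj i t ω x).sub
      (hR.tendsto_torusPartial hm hF hFs hw hX.continuous hX.conj i s ω x)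
    simpa [sub_eq_add_neg] using this
  have h2 : ∀ ω, ‖perpGrad (seriesField w F X t ω) x - perpGrad (seriesField w F X s ω) x‖ ^ 2 =
      ∑ i, ‖((torusPartial i (seriesField w F X t ω) x -
        torusPartial i (seriesField w F X s ω) x : ℝ) : ℂ)‖ ^ 2 := by
    intro ω
    rw [EuclideanSpace.norm_sq_eq, Fin.sum_univ_two, Fin.sum_univ_two, add_comm]
    simp only [Complex.norm_real, perpGrad, PiLp.sub_apply]
    congr 1
    rw [← norm_neg]
    congr 2
    simp
    ring
  simp_rw [h2]
  rw [integral_finsetSum _ fun i _ => (memLp_two_iff_integrable_sq_norm (h1 i).1.1).mp (h1 i).1]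
  have h3 := hasSum_sum fun i (_ : i ∈ Finset.univ) => (h1 i).2
  refine h3.congr_fun fun k => ?_
  have h4 : ∀ i, ‖gradCoeff w i x k • h.ouCurve a k t + -gradCoeff w i x k • h.ouCurve a k s‖ ^ 2 =
      ‖gradCoeff w i x k‖ ^ 2 * ouIncVar H (a k) (t - s) := fun i => by
    rw [neg_smul, ← sub_eq_add_neg, ← smul_sub, norm_smul, mul_pow, IsFractionalNoise.ouCurve,
      IsFractionalNoise.ouCurve, (h.hasFBMCov_self k).norm_sub_sq_ouTransform hH (ha' k)]
  simp_rw [h4]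
  rw [← Finset.sum_mul, sum_norm_sq_gradCoeff]

end Solution

end

/-! ### Choice of the constants and assembly of the theorem. -/

theorem mainTheorem7
    (H ν : ℝ) (hH : 0 < H ∧ H < 1) (hν : 0 < ν)
    (lam α : Mode → ℝ)
    (hlam_nonneg : ∀ k, 0 ≤ lam k) (hlam_symm : ∀ k, lam (-k) = lam k)
    (hα_lower : ∃ c₀ > 0, ∀ k, c₀ ≤ α k) (hα_symm : ∀ k, α (-k) = α k)
    (hα_tendsto : Tendsto α cofinite atTop) :
    ∃ C > (0 : ℝ), ∃ c : ℝ → ℝ, (∀ T > 0, 0 < c T) ∧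
      ∀ (m : ℕ) (ε : ℝ), 1 ≤ m → 0 < ε →
      Summable (fun k : Mode => lam k * ‖waveVec k‖ ^ (2 * (m : ℝ) + ε)) →
      ∀ (Ω : Type*) [MeasurableSpace Ω] (P : Measure Ω) [IsProbabilityMeasure P]
        (β : Mode → ℝ → Ω → ℂ), IsFractionalNoise P H β →
      ∃ ψ : ℝ → Ω → VSpace,
        IsUniqueErgodicMildSolution P H ν lam α β ψ ∧
        IsFourierOUProcess P H ν lam α β ψ ∧
        ∃ Ψ : ℝ → Ω → Torus2 → ℝ, IsFieldVersion P ψ Ψ ∧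
          (∀ᵐ ω ∂P, IsContinuousIntoCm m (fun t => Ψ t ω) ∧
            IsContinuousIntoCm (m - 1) (fun t => perpGrad (Ψ t ω))) ∧
          (∀ t x, MemLp (fun ω => perpGrad (Ψ t ω) x) 2 P) ∧
          (∀ t s x, ∫ ω, ‖perpGrad (Ψ t ω) x - perpGrad (Ψ s ω) x‖ ^ 2 ∂P
            ≤ C * |t - s| ^ (2 * H)) ∧
          ((∃ k, lam k ≠ 0) → ∀ T > 0, ∀ t ∈ Set.Icc (-T) T, ∀ s ∈ Set.Icc (-T) T, ∀ x,
            c T * |t - s| ^ (2 * H)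
              ≤ ∫ ω, ‖perpGrad (Ψ t ω) x - perpGrad (Ψ s ω) x‖ ^ 2 ∂P) := by
  obtain ⟨c₀, hc₀, hα⟩ := hα_lower
  have ha₀ : 0 < ν * c₀ := mul_pos hν hc₀
  have ha : ∀ k, ν * c₀ ≤ ν * α k := fun k => mul_le_mul_of_nonneg_left (hα k) hν.le
  set w : Mode → ℝ := fun k => √(lam k) * ν ^ H with hwdef
  have hw : ∀ k, w (-k) = w k := fun k => by simp only [hwdef, hlam_symm]
  have hw2 : ∀ k, w k ^ 2 = lam k * (ν ^ H) ^ 2 := fun k => by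
    rw [hwdef, mul_pow, Real.sq_sqrt (hlam_nonneg k)]
  classical
  -- The constant `c T` must precede `m`, `ε` and the noise, but the proof that one exists uses the
  -- curves of a noise. Hence the property of the parameters is stated here and a constant chosen
  -- from it if it holds, with default 1; it is verified once a noise is given. The range `2 * T`
  -- covers differences of two times in `[-T, T]`.
  let lower : ℝ → Prop := fun T => ∃ c > 0, ∃ k, ∀ τ : ℝ, |τ| ≤ 2 * T →
    c * |τ| ^ (2 * H) ≤ w k ^ 2 * ‖waveVec k‖ ^ 2 * ouIncVar H (ν * α k) τ
  -- The sum is finite under the summability assumption, as `2 ≤ 2m + ε`; the added 1 keeps the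
  -- constant positive when all weights vanish.
  refine ⟨4 * ∑' k, w k ^ 2 * ‖waveVec k‖ ^ 2 + 1, ?_,
    fun T => if hT : lower T then hT.choose else 1, fun T _ => ?_, ?_⟩
  · have : 0 ≤ ∑' k, w k ^ 2 * ‖waveVec k‖ ^ 2 := tsum_nonneg fun k => by positivity
    positivity
  · dsimp only
    split_ifs with hT
    · exact hT.choose_spec.1
    · exact one_pos
  intro m ε hm hε hsum Ω _ P _ β h
  have hwm : Summable fun k : Mode => w k ^ 2 * ‖waveVec k‖ ^ (2 * (m : ℝ) + ε) := by
    refine (hsum.mul_right ((ν ^ H) ^ 2)).congr fun k => ?_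
    rw [hw2]
    ring
  have hws2 : Summable fun k => w k ^ 2 * ‖waveVec k‖ ^ 2 := by
    refine Summable.of_nonneg_of_le (fun k => by positivity) (fun k => ?_) hwm
    refine mul_le_mul_of_nonneg_left ?_ (sq_nonneg _)
    rw [← Real.rpow_two]
    refine Real.rpow_le_rpow_of_exponent_le (one_le_norm_waveVec k) ?_
    have : (1 : ℝ) ≤ m := by exact_mod_cast hm
    linarith
  have hws : Summable fun k => w k ^ 2 := by
    refine Summable.of_nonneg_of_le (fun k => sq_nonneg _) (fun k => ?_) hws2
    exact le_mul_of_one_le_right (sq_nonneg _) (one_le_pow₀ (one_le_norm_waveVec k))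
  obtain ⟨F, X, hF, hFc, hFs, hX, hR⟩ := h.exists_regular_ouModes hH ha₀ ha
    (fun k => by rw [hα_symm]) hε hwm
  have hvar := hX.hasSum_integral_norm_sq_perpGrad_sub hH ha₀ ha hF hFc hFs hw hws2 hm hR
  have hinc0 : ∀ k (t s : ℝ), 0 ≤ ouIncVar H (ν * α k) (t - s) := fun k t s => by
    rw [← (h.hasFBMCov_self k).norm_sub_sq_ouTransform hH (ha₀.trans_le (ha k))]
    exact sq_nonneg _
  refine ⟨seriesV w F X,
    hX.isUniqueErgodicMildSolution_seriesV hν hc₀ hα hH hlam_symm hws hF hFc hFs hR,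
    hX.isFourierOUProcess_seriesV hν hc₀ hα hH hws hF hFc hR, seriesField w F X,
    fun t => ae_of_all _ fun ω => hR.coeFn_seriesV hFs hw hX.conj t ω,
    ae_of_all _ fun ω => ?_, fun t x => hX.memLp_perpGrad hH ha₀ ha hF hFc hFs hw hws2 hm hR t x,
    fun t s x => ?_, fun hex T hT t ht s hs x => ?_⟩
  · have h1 := (hR.isContinuousIntoCm hX.continuous ω).1
    exact ⟨h1, h1.perpGrad hm⟩
  · have h1 := hasSum_le (fun k => ?_) (hvar t s x)
      (hws2.hasSum.mul_right (4 * |t - s| ^ (2 * H)))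
    · refine h1.trans ?_
      have : 0 ≤ |t - s| ^ (2 * H) := by positivity
      nlinarith
    · exact mul_le_mul_of_nonneg_left
        ((h.hasFBMCov_self k).ouIncVar_le hH (ha₀.trans_le (ha k)) _) (by positivity)
  · have hlow : lower T := by
      obtain ⟨k, hk⟩ := hex
      obtain ⟨c, hc, hcτ⟩ :=
        (h.hasFBMCov_self k).exists_le_ouIncVar hH (ha₀.trans_le (ha k)) (2 * T)
      have hpos : 0 < w k ^ 2 * ‖waveVec k‖ ^ 2 := by
        have h1 : 0 < lam k := lt_of_le_of_ne (hlam_nonneg k) (Ne.symm hk)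
        have h2 : 0 < ‖waveVec k‖ := one_pos.trans_le (one_le_norm_waveVec k)
        rw [hw2]
        positivity
      refine ⟨w k ^ 2 * ‖waveVec k‖ ^ 2 * c, mul_pos hpos hc, k, fun τ hτ => ?_⟩
      rw [mul_assoc]
      exact mul_le_mul_of_nonneg_left (hcτ τ hτ) hpos.le
    have hts : |t - s| ≤ 2 * T := by
      rw [abs_le]
      constructor <;> linarith [ht.1, ht.2, hs.1, hs.2]
    dsimp only
    rw [dif_pos hlow]
    -- All terms of the exact variance formula are nonnegative, so one mode bounds the sum from
    -- below.
    obtain ⟨k, hk⟩ := hlow.choose_spec.2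
    exact (hk _ hts).trans (le_hasSum (hvar t s x) k fun l _ =>
      mul_nonneg (by positivity) (hinc0 l t s))
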